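/- Let $d,N\ge 1$ be integers. For $1\le k\le N$: * $\mathcal S_s(\mathbb R^{dk})$ is the space of complex Schwartz functions on $(\mathbb R^d)^k$ that are invariant under permutation of the $k$ variables, and $\mathcal S_s'(\mathbb R^{dk})$ is its strong dual. $\langle f|g\rangle=\int\overline f g$. * $\mathfrak g_k$ is the real vector space of continuous linear $A:\mathcal S_s(\mathbb R^{dk})\to\mathcal S_s(\mathbb R^{dk})$ with $A^*=-A$, with bracket $[A,B]_{\mathfrak g_k}=k(AB-BA)$. * For a tuple $\alpha=(\alpha_1,\dots,\alpha_k)$ of distinct elements of $\{1,\dots,n\}$, $A_{(\alpha)}$ is $A\in\mathfrak g_k$ acting on the variables $x_{\alpha_1},\dots,x_{\alpha_k}$ of a function of $n$ variables. Put $C_{k,N}=1/(N(N-1)\cdots(N-k+1))$ and $\epsilon_{k,N}(A)=C_{k,N}\sum_\alpha A_{(\alpha)}$, the sum over all $k$-tuples of distinct elements of $\{1,\dots,N\}$. * $\mathfrak G_N=\bigoplus_{k=1}^N\mathfrak g_k$, with bracket $([A,B]_{\mathfrak G_N})^{(k)}=\sum_{\min(\ell+j-1,N)=k}\epsilon_{k,N}^{-1}\big([\epsilon_{\ell,N}(A^{(\ell)}),\epsilon_{j,N}(B^{(j)})]_{\mathfrak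 g_N}\big)$, the sum over $1\le\ell,j\le N$. * $\mathfrak G_N^*$ is the space of $\Gamma=(\gamma^{(1)},\dots,\gamma^{(N)})$, where $\gamma^{(k)}:\mathcal S_s'(\mathbb R^{dk})\to\mathcal S_s(\mathbb R^{dk})$ is continuous, linear and self-adjoint, with the product of the topologies of uniform convergence on bounded sets. A continuous linear $\rho:\mathcal S_s'\to\mathcal S_s$ has the Schwartz kernel $\rho(x;x')=(\rho\,\delta_{x'})(x)$; traces and partial traces are integrals of kernels over the diagonal in the traced variables. Put $\mathrm{Tr}(A\cdot\Gamma)=\sum_{k=1}^N\mathrm{Tr}(A^{(k)}\gamma^{(k)})$. * A map between topological vector spaces is smooth if its iterated Gateaux (directional) derivatives of all orders exist and are jointly continuous in the point and the directions. $\mathcal A_{H,N}$ is the real algebra of functions on $\mathfrak G_N^*$ generated by the real-valued smooth functionals $\Gamma\mapsto i\,\mathrm{Tr}(A\cdot\Gamma)$, $A\in\mathfrak G_N$, and the constants. * For $F\in\mathcal A_{H,N}$ the Gateaux derivative at $\Gamma$ is identified with $dF[\Gamma]\in\mathfrak G_N$ through $v\mapsto i\,\mathrm{Tr}(dF[\Gamma]\cdot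 v)$, and $\{F,G\}_{\mathfrak G_N^*}(\Gamma)=i\,\mathrm{Tr}\big([dF[\Gamma],dG[\Gamma]]_{\mathfrak G_N}\cdot\Gamma\big)$. **Claim.** These definitions are meaningful: kernels are integrable on the diagonal; $\epsilon_{k,N}$ maps $\mathfrak g_k$ injectively into $\mathfrak g_N$; $[\epsilon_{\ell,N}(A),\epsilon_{j,N}(B)]_{\mathfrak g_N}$ lies in the range of $\epsilon_{\min(\ell+j-1,N),N}$ for $A\in\mathfrak g_\ell$, $B\in\mathfrak g_j$; every $\Gamma\mapsto i\,\mathrm{Tr}(A\cdot\Gamma)$ is real-valued and belongs to $\mathcal A_{H,N}$; and $dF[\Gamma]$ exists and is unique for every $F\in\mathcal A_{H,N}$ and every $\Gamma$. Moreover $(\mathfrak G_N^*,\mathcal A_{H,N},\{\cdot,\cdot\}_{\mathfrak G_N^*})$ is a weak Poisson manifold, that is: 1. $\mathcal A_{H,N}$ is a unital subalgebra of $C^\infty(\mathfrak G_N^*;\mathbb R)$, and $\{\cdot,\cdot\}_{\mathfrak G_N^*}$ maps $\mathcal A_{H,N}\times\mathcal A_{H,N}$ to $\mathcal A_{H,N}$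 and is bilinear, alternating, satisfies the Jacobi identity and the Leibniz rule $\{F,GH\}=\{F,G\}H+G\{F,H\}$. 2. If $\Gamma,v\in\mathfrak G_N^*$ and $dF[\Gamma](v)=0$ for all $F\in\mathcal A_{H,N}$, then $v=0$. 3. For every $H\in\mathcal A_{H,N}$ there is a smooth vector field $X_H:\mathfrak G_N^*\to\mathfrak G_N^*$ with $dF[\Gamma](X_H(\Gamma))=\{F,H\}_{\mathfrak G_N^*}(\Gamma)$ for all $F\in\mathcal A_{H,N}$ and all $\Gamma$. The field $X_H$ is unique, and for $1\le\ell\le N$ it is given by $$X_H(\Gamma)^{(\ell)}=\sum_{j=1}^N\ \sum_{r=r_0}^{\min(\ell,j)}C'_{\ell jkrN}\ \mathrm{Tr}_{\ell+1,\dots,k}\Big(\Big[\sum_{\alpha\in P_r^\ell}dH[\Gamma]^{(j)}_{(\alpha_1,\dots,\alpha_r,\ell+1,\dots,\ell+j-r)},\ \gamma^{(k)}\Big]\Big),$$ with absolutely convergent partial traces, where $k=\min(\ell+j-1,N)$, $r_0=\max\big(1,\min(\ell,j)-(N-\max(\ell,j))\big)$, $P_r^\ell$ is the set of $r$-tuples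 of distinct elements of $\{1,\dots,\ell\}$, $[\cdot,\cdot]$ is the commutator (operators $A_{(\alpha)}$ being extended to distributions by duality), and $$C'_{\ell jkrN}=\binom jr\,\frac{N\,C_{\ell,N}\,C_{j,N}}{C_{k,N}}\cdot\frac{(N-k)!}{(N-\ell-j+r)!}.$$ -/

import Mathlib

open MeasureTheory Filter Topology
open scoped SchwartzMap

noncomputable section

namespace NBody

/-! ## Calculus on real topological vector spaces (in the sense of Gateaux) -/

section Calculus

variable {X Y : Type*} [AddCommGroup X] [Module ℝ X] [TopologicalSpace X]
  [AddCommGroup Y] [Module ℝ Y] [TopologicalSpace Y]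

/-- `L` is the Gateaux derivative `df[x](v) = lim_{t → 0} (f (x + t v) - f x) / t`. -/
def HasGateauxDeriv (f : X → Y) (x v : X) (L : Y) : Prop :=
  Tendsto (fun t : ℝ => t⁻¹ • (f (x + t • v) - f x)) (𝓝[≠] 0) (𝓝 L)

/-- `f` is `C^∞`: the iterated directional derivatives `D n x (v₁, …, vₙ)` of all orders exist,
and each of them is jointly continuous in `(x, v₁, …, vₙ)`. -/
def GateauxSmooth (f : X → Y) : Prop :=
  ∃ D : (n : ℕ) → X → (Fin n → X) → Y,
    (∀ x v, D 0 x v = f x) ∧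
    (∀ n, Continuous fun p : X × (Fin n → X) => D n p.1 p.2) ∧
    (∀ n x v w, HasGateauxDeriv (fun y => D n y v) x w (D (n + 1) x (Fin.snoc v w)))

end Calculus

/-! ## Weak Poisson structures on a locally convex space

A Hausdorff locally convex space `M` is a smooth manifold with one chart, all of its tangent spaces
are `M`, and a smooth vector field on it is a smooth map `M → M`. -/

section WeakPoisson

variable {M : Type*} [AddCommGroup M] [Module ℝ M] [TopologicalSpace M]

/-- `X` is a Hamiltonian vector field of `H`: it is smooth, and as a derivation it satisfies
`X F = {F, H}` for all `F` in the algebra. -/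
def IsHamiltonianVF (𝒜 : Subalgebra ℝ (M → ℝ)) (br : (M → ℝ) → (M → ℝ) → (M → ℝ))
    (H : M → ℝ) (X : M → M) : Prop :=
  GateauxSmooth X ∧ ∀ F ∈ 𝒜, ∀ m, HasGateauxDeriv F m (X m) (br F H m)

/-- `(M, 𝒜, br)` is a weak Poisson manifold. Only the values of `br` on `𝒜 × 𝒜` matter. -/
structure IsWeakPoisson [IsTopologicalAddGroup M] [ContinuousSMul ℝ M] [LocallyConvexSpace ℝ M]
    [T2Space M] (𝒜 : Subalgebra ℝ (M → ℝ)) (br : (M → ℝ) → (M → ℝ) → (M → ℝ)) : Prop where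
  /-- `𝒜` is a unital subalgebra of `C^∞(M; ℝ)` -/
  smooth : ∀ F ∈ 𝒜, GateauxSmooth F
  /-- the bracket maps `𝒜 × 𝒜` to `𝒜` -/
  closed : ∀ F ∈ 𝒜, ∀ G ∈ 𝒜, br F G ∈ 𝒜
  add_left : ∀ F ∈ 𝒜, ∀ G ∈ 𝒜, ∀ H ∈ 𝒜, br (F + G) H = br F H + br G H
  smul_left : ∀ c : ℝ, ∀ F ∈ 𝒜, ∀ G ∈ 𝒜, br (c • F) G = c • br F G
  add_right : ∀ F ∈ 𝒜, ∀ G ∈ 𝒜, ∀ H ∈ 𝒜, br F (G + H) = br F G + br F H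
  smul_right : ∀ c : ℝ, ∀ F ∈ 𝒜, ∀ G ∈ 𝒜, br F (c • G) = c • br F G
  alternating : ∀ F ∈ 𝒜, br F F = 0
  jacobi : ∀ F ∈ 𝒜, ∀ G ∈ 𝒜, ∀ H ∈ 𝒜,
    br F (br G H) + br G (br H F) + br H (br F G) = 0
  leibniz : ∀ F ∈ 𝒜, ∀ G ∈ 𝒜, ∀ H ∈ 𝒜, br F (G * H) = br F G * H + G * br F H
  /-- a tangent vector that is annihilated by all `dF[m]`, `F ∈ 𝒜`, vanishes -/
  nondegenerate : ∀ m v : M, (∀ F ∈ 𝒜, HasGateauxDeriv F m v 0) → v = 0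
  hamiltonian : ∀ H ∈ 𝒜, ∃ X : M → M, IsHamiltonianVF 𝒜 br H X

end WeakPoisson

/-! ## Bosonic Schwartz functions and bosonic tempered distributions -/

/-- `(ℝ^d)^k`, the configurations of `k` particles, with Lebesgue measure. -/
abbrev Conf (d k : ℕ) : Type := Fin k → EuclideanSpace ℝ (Fin d)

/-- The bosonic Schwartz space `𝒮_s(ℝ^{dk})`, with the topology induced by the Schwartz space. -/
def bosonicSchwartz (d k : ℕ) : Submodule ℂ 𝓢(Conf d k, ℂ) where
  carrier := {f | ∀ (π : Equiv.Perm (Fin k)) (x : Conf d k), f (x ∘ π) = f x}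
  add_mem' := fun hf hg π x => by simp [hf π x, hg π x]
  zero_mem' := fun π x => by simp
  smul_mem' := fun c f hf π x => by simp [hf π x]

abbrev Ss (d k : ℕ) : Type := bosonicSchwartz d k

/-- The bosonic tempered distributions `𝒮_s'(ℝ^{dk})`, as the dual of the bosonic Schwartz space,
with the strong topology (uniform convergence on bounded sets). -/
abbrev SsDual (d k : ℕ) : Type := Ss d k →L[ℂ] ℂ

variable {d k n : ℕ}

/-- The `L²` inner product, complex linear in the second entry. -/
def ip (f g : Ss d k) : ℂ := ∫ x, starRingEnd ℂ (f.1 x) * g.1 x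

/-- Evaluation at `x`, the (symmetrised) Dirac distribution `δ_x`. -/
def delta (x : Conf d k) : SsDual d k where
  toFun f := f.1 x
  map_add' _ _ := rfl
  map_smul' _ _ := rfl
  cont := (BoundedContinuousFunction.evalCLM ℂ x).continuous.comp
    ((SchwartzMap.toBoundedContinuousFunctionCLM ℂ (Conf d k) ℂ).continuous.comp
      continuous_subtype_val)

instance instContinuousSMulRealSs : ContinuousSMul ℝ (Ss d k) where
  continuous_smul := by
    refine Continuous.subtype_mk ?_ _
    exact continuous_fst.smul (continuous_subtype_val.comp continuous_snd)

instance instLocallyConvexSpaceSs : LocallyConvexSpace ℝ (Ss d k) :=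
  LocallyConvexSpace.induced ((bosonicSchwartz d k).subtype.restrictScalars ℝ)

instance instContinuousSMulRealHom : ContinuousSMul ℝ (SsDual d k →L[ℂ] Ss d k) :=
  IsScalarTower.continuousSMul ℂ

instance instHasTemperateGrowthConf : (volume : Measure (Conf d k)).HasTemperateGrowth :=
  Measure.IsAddHaarMeasure.instHasTemperateGrowth

/-- A bosonic Schwartz function `f` as the bosonic tempered distribution `g ↦ ∫ f g`. -/
def toDual (f : Ss d k) : SsDual d k :=
  (SchwartzMap.integralCLM ℂ (volume : Measure (Conf d k))).comp
    ((SchwartzMap.smulLeftCLM ℂ (fun x => f.1 x)).comp (bosonicSchwartz d k).subtypeL)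

theorem toDual_apply (f g : Ss d k) : toDual f g = ∫ x, f.1 x * g.1 x := by
  simp [toDual, SchwartzMap.integralCLM_apply,
    SchwartzMap.smulLeftCLM_apply_apply f.1.hasTemperateGrowth]

/-- Complex conjugation on the bosonic Schwartz space. -/
def conjS (f : Ss d k) : Ss d k :=
  ⟨SchwartzMap.postcompCLM (𝕜 := ℝ) (Complex.conjCLE : ℂ →L[ℝ] ℂ) f.1, fun π x => by
    have h := f.2 π x
    simp [h]⟩

theorem conjS_apply (f : Ss d k) (x : Conf d k) : (conjS f).1 x = starRingEnd ℂ (f.1 x) := by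
  simp [conjS]

theorem continuous_conjS : Continuous (conjS : Ss d k → Ss d k) :=
  Continuous.subtype_mk ((SchwartzMap.postcompCLM (𝕜 := ℝ)
    (Complex.conjCLE : ℂ →L[ℝ] ℂ)).continuous.comp continuous_subtype_val) _

theorem ip_eq_toDual (f g : Ss d k) : ip f g = toDual (conjS f) g := by
  simp [ip, toDual_apply, conjS_apply]

theorem ip_swap (f g : Ss d k) : ip f g = starRingEnd ℂ (ip g f) := by
  simp only [ip]
  rw [← integral_conj]
  congr 1
  ext x
  simp [mul_comm]

theorem ip_add_right (f g h : Ss d k) : ip f (g + h) = ip f g + ip f h := by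
  simp [ip_eq_toDual]

theorem ip_sub_right (f g h : Ss d k) : ip f (g - h) = ip f g - ip f h := by
  simp [ip_eq_toDual]

theorem ip_real_smul_right (c : ℝ) (f g : Ss d k) : ip f (c • g) = c * ip f g := by
  have h : c • g = (c : ℂ) • g := by
    apply Subtype.ext
    ext x
    simp
  rw [h, ip_eq_toDual, ip_eq_toDual]
  simp

theorem ip_add_left (f g h : Ss d k) : ip (f + g) h = ip f h + ip g h := by
  rw [ip_swap, ip_add_right, map_add, ← ip_swap, ← ip_swap]

theorem ip_sub_left (f g h : Ss d k) : ip (f - g) h = ip f h - ip g h := by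
  rw [ip_swap, ip_sub_right, map_sub, ← ip_swap, ← ip_swap]

theorem ip_real_smul_left (c : ℝ) (f g : Ss d k) : ip (c • f) g = c * ip f g := by
  rw [ip_swap, ip_real_smul_right, map_mul, ← ip_swap, Complex.conj_ofReal]

/-! ## Observables and density matrices -/

/-- `𝔤_k`, the `k`-body bosonic observables: the continuous endomorphisms `A` of the bosonic
Schwartz space with `A^* = -A`. -/
def obs (d k : ℕ) : Submodule ℝ (Ss d k →L[ℂ] Ss d k) where
  carrier := {A | ∀ f g, ip f (A g) = -ip (A f) g}
  add_mem' := fun {A B} hA hB f g => by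
    simp only [add_apply, ip_add_right, ip_add_left, hA f g, hB f g]
    ring
  zero_mem' := fun f g => by simp [ip]
  smul_mem' := fun c A hA f g => by
    change ip f (c • A g) = -ip (c • A f) g
    rw [ip_real_smul_right, ip_real_smul_left, hA f g]
    ring

abbrev Obs (d k : ℕ) : Type := obs d k

/-- The self-adjoint continuous linear maps `γ : 𝒮_s' → 𝒮_s` (`γ^* = γ`), with the topology induced
by that of bounded convergence. -/
def dens (d k : ℕ) : Submodule ℝ (SsDual d k →L[ℂ] Ss d k) where
  carrier := {γ | ∀ f g, ip f (γ (toDual g)) = ip (γ (toDual f)) g}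
  add_mem' := fun {A B} hA hB f g => by
    simp only [add_apply, ip_add_right, ip_add_left, hA f g, hB f g]
  zero_mem' := fun f g => by simp [ip]
  smul_mem' := fun c A hA f g => by
    change ip f (c • A (toDual g)) = ip (c • A (toDual f)) g
    rw [ip_real_smul_right, ip_real_smul_left, hA f g]

abbrev Dens (d k : ℕ) : Type := dens d k

instance instAddCommGroupHom : AddCommGroup (SsDual d k →L[ℂ] Ss d k) :=
  ContinuousLinearMap.addCommGroup

instance instModuleHom : Module ℝ (SsDual d k →L[ℂ] Ss d k) := ContinuousLinearMap.module

instance instAddCommGroupDens : AddCommGroup (Dens d k) := (dens d k).addCommGroup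

instance instModuleDens : Module ℝ (Dens d k) := (dens d k).module

instance instAddCommGroupObs : AddCommGroup (Obs d k) := (obs d k).addCommGroup

instance instModuleObs : Module ℝ (Obs d k) := (obs d k).module

/-- The particle numbers `1, …, N`. -/
abbrev Idx (N : ℕ) : Type := Finset.Icc 1 N

/-- `𝔊_N`, the observable `N`-hierarchies. -/
abbrev ObsH (d N : ℕ) : Type := (k : Idx N) → Obs d k

/-- `𝔊_N^*`, the density matrix `N`-hierarchies, with the product topology. -/
abbrev DensH (d N : ℕ) : Type := (k : Idx N) → Dens d k

instance instAddCommGroupDensH (N : ℕ) : AddCommGroup (DensH d N) := Pi.addCommGroup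

instance instModuleDensH (N : ℕ) : Module ℝ (DensH d N) := Pi.module _ _ _

instance instAddCommGroupObsH (N : ℕ) : AddCommGroup (ObsH d N) := Pi.addCommGroup

instance instModuleObsH (N : ℕ) : Module ℝ (ObsH d N) := Pi.module _ _ _

instance instTopologicalSpaceDensH (N : ℕ) : TopologicalSpace (DensH d N) := Pi.topologicalSpace

/-! ## Operators that act on some of the variables -/

theorem extend_comp_perm {E : Type*} (α : Fin k ↪ Fin n) (π : Equiv.Perm (Fin k))
    (y : Fin k → E) (x : Fin n → E) : ∃ σ : Equiv.Perm (Fin n),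
      Function.extend α (y ∘ π) x = Function.extend α y x ∘ σ := by
  refine ⟨π.viaFintypeEmbedding α, ?_⟩
  ext i
  by_cases h : ∃ a, α a = i
  · obtain ⟨a, rfl⟩ := h
    simp [α.injective.extend_apply]
  · have h2 : π.viaFintypeEmbedding α i = i :=
      Equiv.Perm.viaFintypeEmbedding_apply_notMem_range _ _ (by simpa using h)
    simp [Function.extend_apply' _ _ _ h, h2]

theorem extend_hasTemperateGrowth (α : Fin k ↪ Fin n) (x : Conf d n) :
    Function.HasTemperateGrowth fun y : Conf d k => (Function.extend α y x : Conf d n) := by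
  let L : Conf d k →ₗ[ℝ] Conf d n :=
    { toFun := fun y => Function.extend α y 0
      map_add' := fun y z => by
        have := Function.extend_add α y z (0 : Conf d n) 0
        simpa using this
      map_smul' := fun c y => by
        have := Function.extend_smul c α y (0 : Conf d n)
        simpa using this }
  have h : (fun y : Conf d k => (Function.extend α y x : Conf d n)) =
      fun y => LinearMap.toContinuousLinearMap L y + Function.extend α (0 : Conf d k) x := by
    ext1 y
    have := Function.extend_add α y (0 : Conf d k) (0 : Conf d n) x
    simpa [L] using this
  rw [h]
  exact (ContinuousLinearMap.hasTemperateGrowth _).add (Function.HasTemperateGrowth.const _)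

theorem extend_antilipschitz (α : Fin k ↪ Fin n) (x : Conf d n) :
    AntilipschitzWith 1 fun y : Conf d k => (Function.extend α y x : Conf d n) := by
  refine AntilipschitzWith.of_le_mul_dist fun y z => ?_
  rw [NNReal.coe_one, one_mul]
  refine (dist_pi_le_iff dist_nonneg).2 fun a => ?_
  have := dist_le_pi_dist (Function.extend α y x : Conf d n) (Function.extend α z x) (α a)
  simpa [α.injective.extend_apply] using this

/-- Freeze the variables of `f` outside of `α = (α₁, …, α_k)` at their values in `x`: the result is
`f` as a function of the variables `x_{α₁}, …, x_{α_k}`. -/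
def slice (α : Fin k ↪ Fin n) (x : Conf d n) : Ss d n →L[ℂ] Ss d k :=
  ((SchwartzMap.compCLMOfAntilipschitz ℂ (extend_hasTemperateGrowth α x)
    (extend_antilipschitz α x)).comp (bosonicSchwartz d n).subtypeL).codRestrict
    (bosonicSchwartz d k) (fun f π y => by
      obtain ⟨σ, hσ⟩ := extend_comp_perm α π y x
      simpa [hσ] using f.2 σ _)

theorem slice_apply (α : Fin k ↪ Fin n) (x : Conf d n) (f : Ss d n) (y : Conf d k) :
    (slice α x f).1 y = f.1 (Function.extend α y x) := rfl

/-- `(A_{(α₁, …, α_k)} f)(x)`, where `A_{(α₁, …, α_k)}` is the operator `A` acting on the variables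
`x_{α₁}, …, x_{α_k}` of `f`. -/
def actOn (A : Ss d k →L[ℂ] Ss d k) (α : Fin k ↪ Fin n) (f : Ss d n) (x : Conf d n) : ℂ :=
  (A (slice α x f)).1 (x ∘ α)

/-- `C_{k,N} = 1 / (N (N - 1) ⋯ (N - k + 1))`. -/
def cst (k n : ℕ) : ℝ := 1 / (n.descFactorial k : ℝ)

/-- `T = C_{k,n} ∑_α A_{(α₁, …, α_k)}` on the bosonic Schwartz space, where `α` ranges over the
`k`-tuples of distinct elements of `{1, …, n}`. -/
def IsEmb (A : Obs d k) (T : Obs d n) : Prop :=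
  ∀ (f : Ss d n) (x : Conf d n), (T.1 f).1 x = cst k n * ∑ α : Fin k ↪ Fin n, actOn A.1 α f x

open Classical in
/-- The embedding `ε_{k,n} : 𝔤_k → 𝔤_n`, `ε_{k,n}(A) = C_{k,n} ∑_α A_{(α₁, …, α_k)}`. -/
def emb (d k n : ℕ) (A : Obs d k) : Obs d n :=
  if h : ∃ T : Obs d n, IsEmb A T then h.choose else 0

/-- The Lie bracket `[A, B]_{𝔤_k} = k (A B - B A)`. -/
def obsBracket (A B : Obs d k) : Obs d k :=
  (k : ℝ) • ⟨A.1.comp B.1 - B.1.comp A.1, fun f g => by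
    simp only [sub_apply, ContinuousLinearMap.comp_apply, ip_sub_right, ip_sub_left]
    rw [A.2 f, B.2 f, B.2 (A.1 f), A.2 (B.1 f)]
    ring⟩

/-- The Lie bracket of `𝔊_N`: its component `k` is the sum of
`ε_{k,N}⁻¹ [ε_{ℓ,N}(A_ℓ), ε_{j,N}(B_j)]_{𝔤_N}` over `ℓ, j` with `min (ℓ + j - 1) N = k`. -/
def hierBracket {N : ℕ} (A B : ObsH d N) : ObsH d N := fun k =>
  ∑ p : Idx N × Idx N with min ((p.1 : ℕ) + p.2 - 1) N = k,
    Function.invFun (emb d k N) (obsBracket (emb d p.1 N (A p.1)) (emb d p.2 N (B p.2)))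

/-! ## Traces, admissible functionals and the Lie-Poisson bracket -/

/-- The Schwartz kernel `ρ(x; x') = (ρ δ_{x'})(x)` of `ρ : 𝒮_s' → 𝒮_s`. -/
def ker (ρ : SsDual d k →L[ℂ] Ss d k) (x x' : Conf d k) : ℂ := (ρ (delta x')).1 x

/-- The trace of an operator with Schwartz kernel. -/
def trace (ρ : SsDual d k →L[ℂ] Ss d k) : ℂ := ∫ x, ker ρ x x

/-- `Tr(A · Γ) = ∑_k Tr_{1, …, k}(A_k γ_k)`. -/
def hierTrace {N : ℕ} (A : ObsH d N) (Γ : DensH d N) : ℂ :=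
  ∑ k, trace ((A k).1.comp (Γ k).1)

/-- `𝒜_{H,N}`: the algebra generated by the smooth trace functionals and the constants. -/
def functionals (d N : ℕ) : Subalgebra ℝ (DensH d N → ℝ) :=
  Algebra.adjoin ℝ
    ({F | GateauxSmooth F ∧ ∃ A : ObsH d N, ∀ Γ, (F Γ : ℂ) = Complex.I * hierTrace A Γ} ∪
      {F | GateauxSmooth F ∧ ∃ C : ℝ, ∀ Γ, F Γ = C})

/-- `dF[Γ]` is represented by `A` through the trace pairing: `dF[Γ](v) = i Tr(A · v)`. -/
def IsGrad {N : ℕ} (F : DensH d N → ℝ) (Γ : DensH d N) (A : ObsH d N) : Prop :=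
  ∀ v, ∃ c : ℝ, HasGateauxDeriv F Γ v c ∧ (c : ℂ) = Complex.I * hierTrace A v

open Classical in
/-- `dF[Γ]` as an element of `𝔊_N`. -/
def grad {N : ℕ} (F : DensH d N → ℝ) (Γ : DensH d N) : ObsH d N :=
  if h : ∃ A, IsGrad F Γ A then h.choose else fun _ => 0

/-- The Lie-Poisson bracket `{F, G}(Γ) = i Tr([dF[Γ], dG[Γ]] · Γ)` (a real number). -/
def poisson {N : ℕ} (F G : DensH d N → ℝ) : DensH d N → ℝ := fun Γ =>
  (Complex.I * hierTrace (hierBracket (grad F Γ) (grad G Γ)) Γ).re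

/-- The definitions of the Lie bracket, the admissible functionals and the Lie-Poisson bracket are
meaningful: each value that they introduce by a description exists and is unique. -/
structure WellDefined (d N : ℕ) : Prop where
  /-- operators with Schwartz kernel have a trace -/
  trace_integrable : ∀ (k : Idx N) (ρ : SsDual d k →L[ℂ] Ss d k), Integrable fun x => ker ρ x x
  /-- `ε_{k,N}` maps `𝔤_k` to `𝔤_N` -/
  emb_exists : ∀ (k : Idx N) (A : Obs d k), ∃ T : Obs d N, IsEmb A T
  emb_injective : ∀ k : Idx N, Function.Injective (emb d k N)
  /-- the brackets in the definition of `hierBracket` lie in the range of `ε_{k,N}` -/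
  filtration : ∀ (l j k : Idx N), min ((l : ℕ) + j - 1) N = k → ∀ (A : Obs d l) (B : Obs d j),
    ∃ C : Obs d k, emb d k N C = obsBracket (emb d l N A) (emb d j N B)
  /-- each trace functional `i Tr(A · )` is real-valued and admissible -/
  trace_functional : ∀ A : ObsH d N, ∃ F ∈ functionals d N,
    ∀ Γ, (F Γ : ℂ) = Complex.I * hierTrace A Γ
  /-- the derivative of an admissible functional is represented by a unique element of `𝔊_N` -/
  grad_exists : ∀ F ∈ functionals d N, ∀ Γ, ∃! A, IsGrad F Γ A

/-! ## The Hamiltonian vector field -/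

/-- For skew-adjoint `A`, the distribution `A_{(α)} δ_{x'}`: the operator `A_{(α)}` is extended to
distributions by duality, `⟨A_{(α)} u, g⟩ = -⟨u, conj (A_{(α)} (conj g))⟩`. -/
def actOnDelta (A : Ss d k →L[ℂ] Ss d k) (α : Fin k ↪ Fin n) (x' : Conf d n) : SsDual d n where
  toFun g := -starRingEnd ℂ (actOn A α (conjS g) x')
  map_add' g h := by
    have : conjS (g + h) = conjS g + conjS h := by
      apply Subtype.ext
      ext x
      simp [conjS]
    simp only [actOn, this, map_add, Submodule.coe_add, add_apply]
    ring
  map_smul' c g := by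
    have : conjS (c • g) = (starRingEnd ℂ c) • conjS g := by
      apply Subtype.ext
      ext x
      simp [conjS]
    simp [actOn, this]
  cont := by
    refine (Complex.continuous_conj.comp ?_).neg
    exact ((delta (x' ∘ α)).continuous.comp (A.continuous.comp (slice α x').continuous)).comp
      continuous_conjS

/-- The kernel of the commutator `[A_{(α)}, γ] = A_{(α)} γ - γ A_{(α)}`. -/
def commKer (A : Ss d k →L[ℂ] Ss d k) (α : Fin k ↪ Fin n) (γ : SsDual d n →L[ℂ] Ss d n)
    (x x' : Conf d n) : ℂ :=
  actOn A α (γ (delta x')) x - (γ (actOnDelta A α x')).1 x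

/-- The configuration `(x, z)` of `n` particles, for `x` of `k ≤ n` and `z` of `n - k` particles. -/
def glue (x : Conf d k) (z : Conf d (n - k)) : Conf d n := fun i =>
  if h : (i : ℕ) < k then x ⟨i, h⟩ else z ⟨i - k, by omega⟩

/-- The kernel of the partial trace `Tr_{k+1, …, n}` of the operator with kernel `K`. -/
def partialTrace (K : Conf d n → Conf d n → ℂ) (x x' : Conf d k) : ℂ :=
  ∫ z : Conf d (n - k), K (glue x z) (glue x' z)

/-- The tuples `(α₁, …, α_r, ℓ + 1, …, ℓ + j - r)` in `{1, …, k}`, where `α₁, …, α_r` are distinct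
elements of `{1, …, ℓ}` (in the code, indices start at `0`). -/
def tuples (l j k r : ℕ) : Finset (Fin j ↪ Fin k) :=
  {β | (∀ i : Fin j, (i : ℕ) < r → (β i : ℕ) < l) ∧
    ∀ i : Fin j, r ≤ (i : ℕ) → (β i : ℕ) = l + ((i : ℕ) - r)}

/-- `k = min (ℓ + j - 1) N`. -/
def kk {N : ℕ} (l j : Idx N) : Idx N :=
  ⟨min ((l : ℕ) + j - 1) N, by
    have hl := Finset.mem_Icc.1 l.2
    have hj := Finset.mem_Icc.1 j.2
    refine Finset.mem_Icc.2 ⟨le_min ?_ ?_, min_le_right _ _⟩ <;> omega⟩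

/-- `C'_{ℓ j k r N} = binom(j, r) N C_{ℓ,N} C_{j,N} / (C_{k,N} D)`, where `D` is the number of
`(k - s)`-tuples of distinct elements of a set of `N - s` elements, for `s = ℓ + j - r`. -/
def vfCst (l j k r N : ℕ) : ℝ :=
  (j.choose r : ℝ) * (N * cst l N * cst j N) /
    (cst k N * ((N - (l + j - r)).descFactorial (k - (l + j - r)) : ℕ))

/-- `r₀ = max 1 (min ℓ j - (N - max ℓ j))`. -/
def rMin (l j N : ℕ) : ℕ := max 1 (min l j - (N - max l j))

/-- The kernel of component `ℓ` of the Hamiltonian vector field of `H` at `Γ`. -/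
def vfKer {N : ℕ} (H : DensH d N → ℝ) (Γ : DensH d N) (l : Idx N) (x x' : Conf d l) : ℂ :=
  ∑ j : Idx N, ∑ r ∈ Finset.Icc (rMin l j N) (min (l : ℕ) j),
    (vfCst l j (kk l j) r N : ℂ) *
      partialTrace (fun y y' => ∑ β ∈ tuples l j (kk l j) r,
        commKer (grad H Γ j).1 β (Γ (kk l j)).1 y y') x x'

end NBody

end

noncomputable section

namespace NBody

open LineDeriv

/-! ### Continuous linear maps into Schwartz spaces -/

section Construction

variable {E : Type*} [NormedAddCommGroup E] [NormedSpace ℝ E] [FiniteDimensional ℝ E]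

/-! The pairing `Γ ↦ i Tr(A · Γ)` of `𝔊_N` and `𝔊_N^*` consists of continuous real linear
functionals, and `functionals_eq_linAlg` identifies the algebra with the polynomials in them. A
polynomial has a gradient in `𝔊_N` whose coefficients are again polynomials (`exists_hasGrad`).
Hence the theorem is the Lie–Poisson construction, which is formal (`isWeakPoisson_lieBr`) once
three facts are known: the pairing separates points on both sides, `hierBracket` is a Lie bracket,
and every `B` has a coadjoint action, that is, a continuous linear map `field B` of `𝔊_N^*` with
`Tr(A · field B Γ) = Tr([A, B] · Γ)` for all `A` (`pairing_field`). The Hamiltonian field is then `Γ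
↦ field (dH[Γ]) Γ`. The Jacobi identity need only be checked on linear functionals, because a
Jacobiator is a derivation in each argument.

Lie bracket. The map `ε_{k,N}` is injective (`emb_eq_zero`): tested on tensor powers, it is a
triangular system in the number of particles away from a point `p` with `φ p ≠ 0`. A commutator
`[A_{(α)}, B_{(β)}]` vanishes if the tuples are disjoint, and otherwise it involves at most `min (ℓ
+ j - 1) N = k` particles. Counting the `k`-tuples that contain a given set of indices produces an
explicit preimage of the bracket under `ε_{k,N}` (`bracketS`, `emb_bracket`). Jacobi and
antisymmetry are pulled back from `𝔤_N`, since `kk` is compatible with cyclic exchange.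

Vector field. Density matrices are represented by Schwartz kernels that are Hermitian and symmetric
in both groups of variables (`kerMap`, `opMap`, `opMap_kerMap`). Against such a kernel the trace of
`[A_{(α)}, B_{(β)}]` depends on the size of the overlap of `α` and `β` only, so the sum over all
pairs of tuples collapses to `α = (1, …, ℓ)` and the standard `β` with a combinatorial factor
(`sum_commTrace`). Cyclicity of the trace turns each term into the trace of `A` against a partial
trace of a commutator (`commTrace_castLE`), which is the stated formula.

Analysis. Operators that act on some of the variables preserve Schwartz functions
(`exists_partialApply`), and they commute on disjoint variables (`op_comm`). The latter is Fubini's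
theorem for tempered distributions (`app_comm`), proved by approximating distributions by Schwartz
functions uniformly on bounded sets (`exists_integral_approx`). Cyclicity of the trace
(`diagInt_left`) follows because functionals are determined on tensor products
(`functional_eq_zero_of_tensor`). -/

theorem exists_norm_multilinear_le {ι : Type*} [Fintype ι] (b : Module.Basis ι ℝ E) (n : ℕ) :
    ∃ C : ℝ, 0 ≤ C ∧ ∀ M : E [×n]→L[ℝ] ℂ, ‖M‖ ≤ C * ∑ r : Fin n → ι, ‖M (fun a => b (r a))‖ := by
  classical
  let c : ℝ := ∑ i, ‖(LinearMap.toContinuousLinearMap (b.coord i) : E →L[ℝ] ℝ)‖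
  have hc0 : 0 ≤ c := Finset.sum_nonneg fun i _ => norm_nonneg _
  have hc : ∀ i v, ‖b.repr v i‖ ≤ c * ‖v‖ := fun i v => by
    refine ((LinearMap.toContinuousLinearMap (b.coord i) : E →L[ℝ] ℝ).le_opNorm v).trans ?_
    gcongr
    exact Finset.single_le_sum
      (f := fun i => ‖(LinearMap.toContinuousLinearMap (b.coord i) : E →L[ℝ] ℝ)‖)
      (fun i _ => norm_nonneg _) (Finset.mem_univ i)
  refine ⟨c ^ n, by positivity, fun M => ?_⟩
  refine M.opNorm_le_bound (by positivity) fun v => ?_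
  have h1 : M v = ∑ r : Fin n → ι, (∏ a, b.repr (v a) (r a)) • M (fun a => b (r a)) := by
    have hv : v = fun a => ∑ i, b.repr (v a) i • b i := by
      ext1 a
      exact (b.sum_repr (v a)).symm
    conv_lhs => rw [hv, M.map_sum]
    exact Finset.sum_congr rfl fun r _ => M.map_smul_univ _ _
  rw [h1]
  refine (norm_sum_le _ _).trans ?_
  rw [Finset.mul_sum, Finset.sum_mul]
  refine Finset.sum_le_sum fun r _ => ?_
  rw [norm_smul, norm_prod]
  have : ∏ a, ‖b.repr (v a) (r a)‖ ≤ c ^ n * ∏ a, ‖v a‖ := by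
    calc ∏ a, ‖b.repr (v a) (r a)‖ ≤ ∏ a, (c * ‖v a‖) :=
          Finset.prod_le_prod (fun _ _ => norm_nonneg _) fun a _ => hc _ _
      _ = c ^ n * ∏ a, ‖v a‖ := by simp [Finset.prod_mul_distrib]
  calc _ ≤ (c ^ n * ∏ a, ‖v a‖) * ‖M (fun a => b (r a))‖ := by gcongr
    _ = _ := by ring

/-- The seminorms of order `n` are controlled by weighted sup norms of iterated line derivatives. -/
theorem exists_seminorm_le (m n : ℕ) : ∃ C : ℝ, 0 ≤ C ∧ ∀ (f : 𝓢(E, ℂ)) (R : ℝ), 0 ≤ R →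
    (∀ (r : Fin n → Fin (Module.finrank ℝ E)) x,
      ‖x‖ ^ m * ‖(∂^{fun a => Module.finBasis ℝ E (r a)} f : 𝓢(E, ℂ)) x‖ ≤ R) →
    SchwartzMap.seminorm ℂ m n f ≤ C * R := by
  obtain ⟨C, hC, h⟩ := exists_norm_multilinear_le (Module.finBasis ℝ E) n
  refine ⟨C * Fintype.card (Fin n → Fin (Module.finrank ℝ E)), by positivity, fun f R hR hf => ?_⟩
  refine SchwartzMap.seminorm_le_bound ℂ m n f (by positivity) fun x => ?_
  calc ‖x‖ ^ m * ‖iteratedFDeriv ℝ n f x‖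
      ≤ ‖x‖ ^ m * (C * ∑ r : Fin n → Fin (Module.finrank ℝ E),
          ‖iteratedFDeriv ℝ n f x (fun a => Module.finBasis ℝ E (r a))‖) := by gcongr; exact h _
    _ = C * ∑ r : Fin n → Fin (Module.finrank ℝ E),
          ‖x‖ ^ m * ‖(∂^{fun a => Module.finBasis ℝ E (r a)} f : 𝓢(E, ℂ)) x‖ := by
        simp_rw [SchwartzMap.iteratedLineDerivOp_eq_iteratedFDeriv, Finset.mul_sum]
        exact Finset.sum_congr rfl fun r _ => by ring
    _ ≤ C * ∑ r : Fin n → Fin (Module.finrank ℝ E), R := by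
        gcongr with r
        exact hf r x
    _ = _ := by simp; ring

variable {Xs : Type*} [AddCommGroup Xs] [Module ℂ Xs] [TopologicalSpace Xs]
  [IsTopologicalAddGroup Xs] [ContinuousSMul ℂ Xs]
  {ι : Type*}

theorem continuous_of_seminorm_le {F : Type*} [NormedAddCommGroup F] [NormedSpace ℝ F]
    (T : Xs →ₗ[ℂ] 𝓢(F, ℂ))
    (h : ∀ m n, ∃ S ∈ 𝓝 (0 : Xs), ∃ C : ℝ, ∀ f ∈ S, SchwartzMap.seminorm ℂ m n (T f) ≤ C) :
    Continuous T := by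
  refine (schwartz_withSeminorms ℂ F ℂ).continuous_of_continuous_comp T fun ⟨m, n⟩ => ?_
  obtain ⟨S, hS, C, h⟩ := h m n
  refine Seminorm.continuous' (r := C) (mem_of_superset hS fun f hf => ?_)
  simpa [Seminorm.mem_closedBall] using h f hf

/-- A family of linear maps into functions that is closed under directional derivatives and
satisfies weighted sup bounds consists of continuous linear maps into the Schwartz space. -/
theorem exists_clm_of_family (Φ : ι → Xs →ₗ[ℂ] (E → ℂ))
    (hdiff : ∀ i f, Differentiable ℝ (Φ i f))
    (hder : ∀ i v, ∃ i₁ i₂, ∀ f x, fderiv ℝ (Φ i f) x v = Φ i₁ f x + Φ i₂ f x)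
    (hb : ∀ i m, ∃ S ∈ 𝓝 (0 : Xs), ∃ C : ℝ, ∀ f ∈ S, ∀ x, ‖x‖ ^ m * ‖Φ i f x‖ ≤ C) (i : ι) :
    ∃ T : Xs →L[ℂ] 𝓢(E, ℂ), ∀ f x, T f x = Φ i f x := by
  -- The induction runs over all indices at once, because the derivative of a member is a sum of two
  -- other members.
  have hcd : ∀ (n : ℕ) i f, ContDiff ℝ n (Φ i f) := by
    intro n
    induction n with
    | zero => exact fun i f => contDiff_zero.2 (hdiff i f).continuous
    | succ n ih =>
      intro i f
      push_cast
      refine contDiff_succ_iff_fderiv_apply.2 ⟨hdiff i f, by simp, fun v => ?_⟩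
      obtain ⟨i₁, i₂, h⟩ := hder i v
      simp_rw [h f]
      exact (ih i₁ f).add (ih i₂ f)
  -- Indices may repeat in the sums, hence multisets.
  have hiter : ∀ (n : ℕ) (v : Fin n → E) i, ∃ L : Multiset ι, ∀ f x,
      iteratedFDeriv ℝ n (Φ i f) x v = (L.map fun j => Φ j f x).sum := by
    intro n
    induction n with
    | zero => exact fun v i => ⟨{i}, fun f x => by simp⟩
    | succ n ih =>
      intro v i
      obtain ⟨L, hL⟩ := ih (Fin.tail v) i
      choose i₁ i₂ h using fun j => hder j (v 0)
      refine ⟨L.map i₁ + L.map i₂, fun f x => ?_⟩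
      rw [iteratedFDeriv_succ_apply_left, ← fderiv_continuousMultilinear_apply_const_apply
        (((hcd (n + 1) i f).differentiable_iteratedFDeriv (by norm_cast; simp)) x)]
      simp_rw [hL f]
      have : ∀ L : Multiset ι, HasFDerivAt (fun x => (L.map fun j => Φ j f x).sum)
          (L.map fun j => fderiv ℝ (Φ j f) x).sum x := fun L => by
        induction L using Multiset.induction with
        | empty => simpa using hasFDerivAt_const (0 : ℂ) x
        | cons a L ih => 
            simp only [Multiset.map_cons, Multiset.sum_cons]
            exact (hdiff a f x).hasFDerivAt.add ih
      rw [(this L).fderiv]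
      have h2 : ∀ L : Multiset ι, (L.map fun j => fderiv ℝ (Φ j f) x).sum (v 0)
          = ((L.map i₁ + L.map i₂).map fun j => Φ j f x).sum := fun L => by
        induction L using Multiset.induction with
        | empty => simp
        | cons a L ih =>
          simp only [Multiset.map_cons, Multiset.sum_cons, add_apply, ih, h,
            Multiset.map_add, Multiset.sum_add]
          ring
      exact h2 L
  have hbL : ∀ (L : Multiset ι) m, ∃ S ∈ 𝓝 (0 : Xs), ∃ C : ℝ, 0 ≤ C ∧ ∀ f ∈ S, ∀ x,
      ‖x‖ ^ m * ‖(L.map fun j => Φ j f x).sum‖ ≤ C := fun L m => by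
    induction L using Multiset.induction with
    | empty => exact ⟨Set.univ, univ_mem, 0, le_rfl, by simp⟩
    | cons a L ih =>
      obtain ⟨S, hS, C, hC, h⟩ := ih
      obtain ⟨S', hS', C', h'⟩ := hb a m
      refine ⟨S ∩ S', inter_mem hS hS', C + max C' 0, by positivity, fun f hf x => ?_⟩
      simp only [Multiset.map_cons, Multiset.sum_cons]
      calc _ ≤ ‖x‖ ^ m * (‖Φ a f x‖ + ‖(L.map fun j => Φ j f x).sum‖) := by
            gcongr; exact norm_add_le _ _
        _ = ‖x‖ ^ m * ‖Φ a f x‖ + ‖x‖ ^ m * ‖(L.map fun j => Φ j f x).sum‖ := by ring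
        _ ≤ max C' 0 + C := add_le_add ((h' f hf.2 x).trans (le_max_left _ _)) (h f hf.1 x)
        _ = _ := by ring
  have hbD : ∀ m n : ℕ, ∃ S ∈ 𝓝 (0 : Xs), ∃ C : ℝ, 0 ≤ C ∧ ∀ f ∈ S, ∀ x,
      ‖x‖ ^ m * ‖iteratedFDeriv ℝ n (Φ i f) x‖ ≤ C := fun m n => by
    obtain ⟨C, hC, h⟩ := exists_norm_multilinear_le (Module.finBasis ℝ E) n
    choose L hL using fun r : Fin n → Fin (Module.finrank ℝ E) =>
      hiter n (fun a => Module.finBasis ℝ E (r a)) i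
    choose S hS D hD hSD using fun r => hbL (L r) m
    refine ⟨⋂ r, S r, (Filter.iInter_mem).2 hS, C * ∑ r, D r,
      mul_nonneg hC (Finset.sum_nonneg fun r _ => hD r), fun f hf x => ?_⟩
    calc _ ≤ ‖x‖ ^ m * (C * ∑ r : Fin n → Fin (Module.finrank ℝ E),
          ‖iteratedFDeriv ℝ n (Φ i f) x (fun a => Module.finBasis ℝ E (r a))‖) := by
          gcongr; exact h _
      _ = C * ∑ r : Fin n → Fin (Module.finrank ℝ E),
          ‖x‖ ^ m * ‖((L r).map fun j => Φ j f x).sum‖ := by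
        simp_rw [hL, Finset.mul_sum]
        exact Finset.sum_congr rfl fun r _ => by ring
      _ ≤ _ := by
        gcongr with r
        exact hSD r f (Set.mem_iInter.1 hf r) x
  -- The bounds hold on a neighbourhood of zero only; a general `f` is scaled into it by a small `t
  -- ≠ 0`.
  have hdec : ∀ f (m n : ℕ), ∃ C, ∀ x, ‖x‖ ^ m * ‖iteratedFDeriv ℝ n (Φ i f) x‖ ≤ C := by
    intro f m n
    obtain ⟨S, hS, C, hC, h⟩ := hbD m n
    have hten : Tendsto (fun t : ℂ => t • f) (𝓝[≠] 0) (𝓝 0) := by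
      have : Continuous fun t : ℂ => t • f := by fun_prop
      simpa using (this.tendsto 0).mono_left nhdsWithin_le_nhds
    obtain ⟨t, ht, ht0⟩ := ((hten.eventually hS).and self_mem_nhdsWithin).exists
    have ht0 : t ≠ 0 := ht0
    refine ⟨‖t‖⁻¹ * C, fun x => ?_⟩
    have h1 := h _ ht x
    rw [map_smul] at h1
    have h3 : iteratedFDeriv ℝ n (t • Φ i f) x = t • iteratedFDeriv ℝ n (Φ i f) x :=
      iteratedFDeriv_const_smul_apply (hcd n i f).contDiffAt
    rw [h3, norm_smul] at h1
    rw [inv_mul_eq_div, le_div_iff₀ (norm_pos_iff.2 ht0)]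
    linarith
  let T₀ : Xs →ₗ[ℂ] 𝓢(E, ℂ) :=
    { toFun := fun f => ⟨Φ i f, contDiff_infty.2 fun n => hcd n i f, hdec f⟩
      map_add' := fun f g => by ext x; simp; rfl
      map_smul' := fun c f => by ext x; simp; rfl }
  have hT : ∀ f x, T₀ f x = Φ i f x := fun f x => rfl
  exact ⟨⟨T₀, continuous_of_seminorm_le T₀ fun m n => by
    obtain ⟨S, hS, C, hC, h⟩ := hbD m n
    exact ⟨S, hS, C, fun f hf => SchwartzMap.seminorm_le_bound ℂ m n _ hC (h f hf)⟩⟩, hT⟩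

end Construction

/-! ### Second order Taylor estimates for translations in the Schwartz seminorms -/

section Translation

variable {W : Type*} [NormedAddCommGroup W] [NormedSpace ℝ W]

theorem lineDerivOp_comm (f : 𝓢(W, ℂ)) (v w : W) : ∂_{v} (∂_{w} f) = ∂_{w} (∂_{v} f) := by
  ext x
  have h (a b : W) : (∂_{a} (∂_{b} f) : 𝓢(W, ℂ)) x = iteratedFDeriv ℝ 2 f x ![a, b] := by
    rw [← SchwartzMap.iteratedLineDerivOp_eq_iteratedFDeriv]
    rfl
  rw [h, h, iteratedFDeriv_two_apply, iteratedFDeriv_two_apply]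
  exact (((f.smooth 2).contDiffAt).isSymmSndFDerivAt (by simp)) v w

theorem iteratedLineDerivOp_lineDerivOp_comm {n : ℕ} (m : Fin n → W) (f : 𝓢(W, ℂ)) (v : W) :
    ∂^{m} (∂_{v} f) = ∂_{v} (∂^{m} f) := by
  induction n with
  | zero => rfl
  | succ n ih => rw [iteratedLineDerivOp_succ_left, iteratedLineDerivOp_succ_left, ih,
      lineDerivOp_comm]

/-- The translate `f (· + k)`. -/
def shift (k : W) : 𝓢(W, ℂ) →L[ℂ] 𝓢(W, ℂ) := SchwartzMap.compSubConstCLM ℂ (-k)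

@[simp]
theorem shift_apply (k : W) (f : 𝓢(W, ℂ)) (x : W) : shift k f x = f (x + k) := by
  simp [shift]

theorem iteratedLineDerivOp_shift {n : ℕ} (m : Fin n → W) (f : 𝓢(W, ℂ)) (k : W) :
    ∂^{m} (shift k f) = shift k (∂^{m} f) := by
  induction n with
  | zero => rfl
  | succ n ih =>
    rw [iteratedLineDerivOp_succ_left, iteratedLineDerivOp_succ_left, ih]
    ext x
    simp only [SchwartzMap.lineDerivOp_apply_eq_fderiv, shift_apply]
    have : (⇑(shift k (∂^{Fin.tail m} f)) : W → ℂ) = fun x => (∂^{Fin.tail m} f) (x + k) := by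
      ext; simp
    rw [this, fderiv_comp_add_right]

/-- A continuous seminorm that dominates the weighted second derivatives. -/
def secondSeminorm (m : ℕ) : Seminorm ℂ 𝓢(W, ℂ) :=
  (2 ^ m : NNReal) • (Finset.Iic (m, 2)).sup (schwartzSeminormFamily ℂ W ℂ)

theorem continuous_secondSeminorm (m : ℕ) : Continuous (secondSeminorm m : Seminorm ℂ 𝓢(W, ℂ)) := by
  refine Seminorm.continuous_of_le
    (q := (2 ^ m : NNReal) • ∑ i ∈ Finset.Iic (m, 2), schwartzSeminormFamily ℂ W ℂ i) ?_
    fun f => ?_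
  · have : Continuous fun f : 𝓢(W, ℂ) =>
        (2 ^ m : NNReal) • ∑ i ∈ Finset.Iic (m, 2), schwartzSeminormFamily ℂ W ℂ i f :=
      (continuous_finsetSum _ fun i _ =>
        (schwartz_withSeminorms ℂ W ℂ).continuous_seminorm i).const_smul _
    convert this using 2 with f
    rw [smul_apply, sum_apply]
  · simp only [secondSeminorm, smul_apply]
    gcongr
    exact Seminorm.finset_sup_le_sum _ _ f

/-- The mean value inequality is used twice, for the derivative and for `f` minus its linearisation
at `w`. Since `‖k‖ ≤ 1`, a point `y` of the segment satisfies `‖w‖ ≤ 1 + ‖y‖`, so the weight at `w`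
is dominated by `(1 + ‖y‖) ^ m`; this is the origin of the factor `2 ^ m` in `secondSeminorm`. -/
theorem norm_shift_sub_sub_le (f : 𝓢(W, ℂ)) (m : ℕ) (w k : W) (hk : ‖k‖ ≤ 1) :
    ‖w‖ ^ m * ‖f (w + k) - f w - (∂_{k} f : 𝓢(W, ℂ)) w‖ ≤ secondSeminorm m f * ‖k‖ ^ 2 := by
  have hseg : ∀ y ∈ segment ℝ w (w + k), ‖y - w‖ ≤ ‖k‖ := fun y hy => by
    have := norm_sub_le_of_mem_segment hy
    simpa using this
  have hw : ∀ y ∈ segment ℝ w (w + k), ‖w‖ ^ m * ‖iteratedFDeriv ℝ 2 f y‖ ≤ secondSeminorm m f := by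
    intro y hy
    have h1 : ‖w‖ ≤ 1 + ‖y‖ := by
      have := norm_sub_norm_le w y
      rw [norm_sub_rev] at this
      linarith [hseg y hy]
    calc _ ≤ (1 + ‖y‖) ^ m * ‖iteratedFDeriv ℝ 2 f y‖ := by gcongr
      _ ≤ _ := SchwartzMap.one_add_le_sup_seminorm_apply (m := (m, 2)) le_rfl le_rfl f y
  have hd2 : ∀ y, ‖fderiv ℝ (fderiv ℝ f) y‖ = ‖iteratedFDeriv ℝ 2 f y‖ := fun y => by
    rw [show (2 : ℕ) = 1 + 1 from rfl, ← norm_iteratedFDeriv_fderiv, norm_iteratedFDeriv_one]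
  have hdf : Differentiable ℝ (fderiv ℝ f) :=
    ((f.smooth 2).fderiv_right (m := 1) (by norm_num)).differentiable (by norm_num)
  have hz : ∀ z ∈ segment ℝ w (w + k), segment ℝ w z ⊆ segment ℝ w (w + k) := fun z hz =>
    (convex_segment w (w + k)).segment_subset (left_mem_segment ℝ w _) hz
  have h1 : ∀ z ∈ segment ℝ w (w + k),
      ‖w‖ ^ m * ‖fderiv ℝ f z - fderiv ℝ f w‖ ≤ secondSeminorm m f * ‖k‖ := by
    intro z hz'
    have := (convex_segment w z).norm_image_sub_le_of_norm_fderiv_le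
      (f := fun y => (‖w‖ ^ m) • fderiv ℝ f y) (C := secondSeminorm m f) (𝕜 := ℝ)
      (fun y _ => (hdf y).fun_const_smul _) (fun y hy => by
        rw [fderiv_fun_const_smul (hdf y), norm_smul, hd2]
        simpa using hw y (hz z hz' hy)) (left_mem_segment ℝ w z) (right_mem_segment ℝ w z)
    have h0 : ‖w‖ ^ m • fderiv ℝ f z - ‖w‖ ^ m • fderiv ℝ f w
        = ‖w‖ ^ m • (fderiv ℝ f z - fderiv ℝ f w) := (smul_sub _ _ _).symm
    rw [h0, norm_smul] at this
    simp only [norm_pow, norm_norm] at this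
    refine this.trans ?_
    gcongr
    exact hseg z hz'
  have h2 := (convex_segment w (w + k)).norm_image_sub_le_of_norm_fderiv_le
      (f := fun y => (‖w‖ ^ m) • (f y - fderiv ℝ f w y)) (C := secondSeminorm m f * ‖k‖) (𝕜 := ℝ)
      (fun y _ => ((f.differentiable y).fun_sub (fderiv ℝ f w).differentiableAt).fun_const_smul _)
      (fun y hy => by
        rw [fderiv_fun_const_smul ((f.differentiable y).fun_sub (fderiv ℝ f w).differentiableAt),
          fderiv_fun_sub (f.differentiable y) (fderiv ℝ f w).differentiableAt, norm_smul]
        simpa using h1 y hy) (left_mem_segment ℝ w _) (right_mem_segment ℝ w _)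
  rw [← smul_sub, norm_smul] at h2
  simp only [norm_pow, norm_norm, map_add, add_sub_cancel_left] at h2
  have : f (w + k) - f w - (∂_{k} f : 𝓢(W, ℂ)) w
      = f (w + k) - (fderiv ℝ f w w + fderiv ℝ f w k) - (f w - fderiv ℝ f w w) := by
    rw [SchwartzMap.lineDerivOp_apply_eq_fderiv]; ring
  rw [this]
  refine h2.trans_eq ?_
  ring

variable [FiniteDimensional ℝ W]

/-- Line derivatives commute with translations and with each other, so the pointwise estimate
applies to every `∂^{…} f`. -/
theorem seminorm_shift_sub_sub_le (f : 𝓢(W, ℂ)) (m n : ℕ) : ∃ C : ℝ, 0 ≤ C ∧ ∀ k : W, ‖k‖ ≤ 1 →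
    SchwartzMap.seminorm ℂ m n (shift k f - f - ∂_{k} f) ≤ C * ‖k‖ ^ 2 := by
  obtain ⟨C, hC, h⟩ := exists_seminorm_le (E := W) m n
  let D : ℝ := ∑ r : Fin n → Fin (Module.finrank ℝ W),
    secondSeminorm m (∂^{fun a => Module.finBasis ℝ W (r a)} f)
  have hD : 0 ≤ D := Finset.sum_nonneg fun r _ => apply_nonneg _ _
  refine ⟨C * D, by positivity, fun k hk => ?_⟩
  rw [mul_assoc]
  refine h _ _ (by positivity) fun r x => ?_
  have h1 : (∂^{fun a => Module.finBasis ℝ W (r a)} (shift k f - f - ∂_{k} f) : 𝓢(W, ℂ)) x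
      = (∂^{fun a => Module.finBasis ℝ W (r a)} f : 𝓢(W, ℂ)) (x + k)
        - (∂^{fun a => Module.finBasis ℝ W (r a)} f : 𝓢(W, ℂ)) x
        - (∂_{k} (∂^{fun a => Module.finBasis ℝ W (r a)} f) : 𝓢(W, ℂ)) x := by
    rw [sub_eq_add_neg, sub_eq_add_neg, iteratedLineDerivOp_add, iteratedLineDerivOp_add,
      iteratedLineDerivOp_neg, iteratedLineDerivOp_neg, iteratedLineDerivOp_lineDerivOp_comm,
      iteratedLineDerivOp_shift]
    simp [sub_eq_add_neg]
  rw [h1]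
  refine (norm_shift_sub_sub_le _ m x k hk).trans ?_
  gcongr
  exact Finset.single_le_sum (f := fun r : Fin n → Fin (Module.finrank ℝ W) =>
    secondSeminorm m (∂^{fun a => Module.finBasis ℝ W (r a)} f))
    (fun r _ => apply_nonneg _ _) (Finset.mem_univ r)

end Translation

/-! ### Families of operators that depend smoothly on a parameter -/

section SmoothFamily

open Asymptotics

variable {X F : Type*} [NormedAddCommGroup X] [NormedSpace ℝ X] [FiniteDimensional ℝ X]
  [NormedAddCommGroup F] [NormedSpace ℝ F]
  {Xs Z : Type*} [AddCommGroup Xs] [Module ℂ Xs] [TopologicalSpace Xs]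
  [IsTopologicalAddGroup Xs] [ContinuousSMul ℂ Xs]
  [AddCommGroup Z] [Module ℂ Z] [TopologicalSpace Z] {κ : Type*}

/-- If `x ↦ σ x` is differentiable with values in `Z`, then so is `x ↦ L (σ x) (r x)`. -/
theorem hasFDerivAt_eval (r : X →L[ℝ] F) (σ : X → Z) (σ' : X → Z) (x : X)
    (hadd : ∀ v w, σ' (v + w) = σ' v + σ' w) (hsmul : ∀ (c : ℝ) v, σ' (c • v) = (c : ℂ) • σ' v)
    (hσ : ∀ q : Seminorm ℂ Z, Continuous q →
      (fun h => q (σ (x + h) - σ x - σ' h)) =o[𝓝 0] fun h : X => h) (L : Z →L[ℂ] 𝓢(F, ℂ)) :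
    ∃ A : X →L[ℝ] ℂ, HasFDerivAt (fun x => L (σ x) (r x)) A x ∧
      ∀ v, A v = L (σ' v) (r x) + (∂_{r v} (L (σ x)) : 𝓢(F, ℂ)) (r x) := by
  let A₀ : X →ₗ[ℝ] ℂ :=
    { toFun := fun v => L (σ' v) (r x) + (∂_{r v} (L (σ x)) : 𝓢(F, ℂ)) (r x)
      map_add' := fun v w => by
        rw [hadd, map_add, map_add, lineDerivOp_left_add]
        simp only [add_apply]
        ring
      map_smul' := fun c v => by
        rw [hsmul, map_smul, map_smul, lineDerivOp_left_smul]
        simp }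
  refine ⟨LinearMap.toContinuousLinearMap A₀, ?_, fun v => rfl⟩
  rw [hasFDerivAt_iff_isLittleO_nhds_zero]
  -- The error splits into three parts: the remainder of `σ`, controlled at the moving point by a
  -- sup norm; the motion of the evaluation point in the linear term; and the remainder of the fixed
  -- function `L (σ x)`.
  have h1 : (fun h => L (σ (x + h) - σ x - σ' h) (r (x + h))) =o[𝓝 0] fun h : X => h := by
    refine IsBigO.trans_isLittleO (.of_bound 1 (Eventually.of_forall fun h => ?_))
      (hσ ((schwartzSeminormFamily ℂ F ℂ (0, 0)).comp (L : Z →ₗ[ℂ] 𝓢(F, ℂ)))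
        (((schwartz_withSeminorms ℂ F ℂ).continuous_seminorm (0, 0)).comp L.continuous))
    rw [one_mul]
    refine (SchwartzMap.norm_le_seminorm ℂ _ _).trans ?_
    exact Real.le_norm_self _
  -- This is linear in `h` times `o(1)`: in a basis of `X`, only the finitely many functions `L (σ'
  -- (b i))` have to be continuous at `r x`.
  have h2 : (fun h => L (σ' h) (r (x + h)) - L (σ' h) (r x)) =o[𝓝 0] fun h : X => h := by
    let b := Module.finBasis ℝ X
    have : ∀ h, L (σ' h) (r (x + h)) - L (σ' h) (r x)
        = ∑ i, (b.repr h i : ℂ) * (L (σ' (b i)) (r (x + h)) - L (σ' (b i)) (r x)) := by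
      intro h
      have hl : ∀ y, L (σ' h) y = ∑ i, (b.repr h i : ℂ) * L (σ' (b i)) y := fun y => by
        let l : X →ₗ[ℝ] ℂ :=
          { toFun := fun v => L (σ' v) y
            map_add' := fun v w => by rw [hadd, map_add]; rfl
            map_smul' := fun c v => by rw [hsmul, map_smul]; simp }
        have h3 := congrArg l (b.sum_repr h).symm
        rw [map_sum] at h3
        simp_rw [map_smul, Complex.real_smul] at h3
        exact h3
      rw [hl, hl, ← Finset.sum_sub_distrib]
      exact Finset.sum_congr rfl fun i _ => by ring
    simp_rw [this]
    refine IsLittleO.fun_sum fun i _ => ?_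
    have hb : (fun h => (b.repr h i : ℂ)) =O[𝓝 0] fun h : X => h := by
      have := (LinearMap.toContinuousLinearMap (b.coord i) : X →L[ℝ] ℝ).isBigO_id (𝓝 0)
      refine IsBigO.trans (IsBigO.of_bound 1 (Eventually.of_forall fun h => ?_)) this
      simp
    have hc : (fun h => L (σ' (b i)) (r (x + h)) - L (σ' (b i)) (r x)) =o[𝓝 0]
        fun _ : X => (1 : ℝ) := by
      rw [isLittleO_one_iff]
      have : Continuous fun h => L (σ' (b i)) (r (x + h)) - L (σ' (b i)) (r x) :=
        ((L (σ' (b i))).continuous.comp (by fun_prop)).sub continuous_const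
      simpa using this.tendsto 0
    have := hb.norm_right.mul_isLittleO hc
    simp only [mul_one] at this
    exact this.of_norm_right
  have h3 : (fun h => L (σ x) (r x + r h) - L (σ x) (r x) - (∂_{r h} (L (σ x)) : 𝓢(F, ℂ)) (r x))
      =o[𝓝 0] fun h : X => h := by
    have h4 := hasFDerivAt_iff_isLittleO_nhds_zero.1 ((L (σ x)).hasFDerivAt (r x))
    have h5 : Tendsto r (𝓝 0) (𝓝 0) := by simpa using r.continuous.tendsto 0
    exact (h4.comp_tendsto h5).trans_isBigO (r.isBigO_id _)
  refine ((h1.add h2).add h3).congr_left fun h => ?_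
  simp only [LinearMap.coe_toContinuousLinearMap', map_sub, sub_apply, map_add, A₀,
    LinearMap.coe_mk, AddHom.coe_mk]
  ring

/-- Here `δ i v` is the index of the derivative of the family `i` in direction `v`. The functions `L
(σ i f x) (r x)` form a class closed under derivatives once `L` ranges over all operators: a
derivative either falls on `σ` or, through `r`, replaces `L` by `∂_{r v} ∘ L`. -/
theorem exists_clm_of_smooth_family (r : X →L[ℝ] F) (σ : κ → Xs →ₗ[ℂ] (X → Z)) (δ : κ → X → κ)
    (hadd : ∀ i f x v w, σ (δ i (v + w)) f x = σ (δ i v) f x + σ (δ i w) f x)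
    (hsmul : ∀ i f x (c : ℝ) v, σ (δ i (c • v)) f x = (c : ℂ) • σ (δ i v) f x)
    (hσ : ∀ i f x (q : Seminorm ℂ Z), Continuous q →
      (fun h => q (σ i f (x + h) - σ i f x - σ (δ i h) f x)) =o[𝓝 0] fun h : X => h)
    (hb : ∀ i (L : Z →L[ℂ] 𝓢(F, ℂ)) m, ∃ S ∈ 𝓝 (0 : Xs), ∃ C : ℝ, ∀ f ∈ S, ∀ x,
      ‖x‖ ^ m * ‖L (σ i f x) (r x)‖ ≤ C) (i : κ) (L : Z →L[ℂ] 𝓢(F, ℂ)) :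
    ∃ T : Xs →L[ℂ] 𝓢(X, ℂ), ∀ f x, T f x = L (σ i f x) (r x) := by
  let Φ : κ × (Z →L[ℂ] 𝓢(F, ℂ)) → Xs →ₗ[ℂ] (X → ℂ) := fun p =>
    { toFun := fun f x => p.2 (σ p.1 f x) (r x)
      map_add' := fun f g => by ext x; simp
      map_smul' := fun c f => by ext x; simp }
  have key := fun (p : κ × (Z →L[ℂ] 𝓢(F, ℂ))) f x =>
    hasFDerivAt_eval r (σ p.1 f) (fun v => σ (δ p.1 v) f x) x (hadd p.1 f x) (hsmul p.1 f x)
      (hσ p.1 f x) p.2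
  refine exists_clm_of_family Φ (fun p f x => ?_) (fun p v => ?_) (fun p m => hb p.1 p.2 m) (i, L)
  · obtain ⟨A, hA, -⟩ := key p f x
    exact hA.differentiableAt
  · refine ⟨(δ p.1 v, p.2), (p.1, (lineDerivOpCLM ℂ 𝓢(F, ℂ) (r v)).comp p.2), fun f x => ?_⟩
    obtain ⟨A, hA, h⟩ := key p f x
    have : fderiv ℝ (Φ p f) x = A := hA.fderiv
    rw [this, h]
    rfl

end SmoothFamily

/-! ### Operators acting on a part of the variables -/

section Partial

open Asymptotics

variable {E F W X : Type*} [NormedAddCommGroup E] [NormedSpace ℝ E] [NormedAddCommGroup F]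
  [NormedSpace ℝ F] [NormedAddCommGroup W] [NormedSpace ℝ W] [NormedAddCommGroup X]
  [NormedSpace ℝ X]

/-- Restriction of a Schwartz function to the affine subspaces `p E + q x`. -/
def affineSlice (p : E →L[ℝ] W) (q : X →L[ℝ] W) (hp : ∀ x y, ‖y‖ ≤ ‖p y + q x‖) (x : X) :
    𝓢(W, ℂ) →L[ℂ] 𝓢(E, ℂ) :=
  SchwartzMap.compCLMOfAntilipschitz ℂ (g := fun y => p y + q x) (K := 1)
    (p.hasTemperateGrowth.add (Function.HasTemperateGrowth.const _))
    (AntilipschitzWith.of_le_mul_dist fun y z => by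
      have := hp 0 (y - z)
      simpa [dist_eq_norm] using this)

@[simp]
theorem affineSlice_apply (p : E →L[ℝ] W) (q : X →L[ℝ] W) (hp : ∀ x y, ‖y‖ ≤ ‖p y + q x‖) (x : X)
    (f : 𝓢(W, ℂ)) (y : E) : affineSlice p q hp x f y = f (p y + q x) := rfl

theorem iteratedFDeriv_affineSlice (p : E →L[ℝ] W) (q : X →L[ℝ] W)
    (hp : ∀ x y, ‖y‖ ≤ ‖p y + q x‖) (x : X) (f : 𝓢(W, ℂ)) (n : ℕ) (y : E) :
    ‖iteratedFDeriv ℝ n (affineSlice p q hp x f) y‖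
      ≤ ‖p‖ ^ n * ‖iteratedFDeriv ℝ n f (p y + q x)‖ := by
  have h : ⇑(affineSlice p q hp x f) = (fun z => f (z + q x)) ∘ p := by ext; simp
  have hf : ContDiff ℝ n fun z => f (z + q x) := (f.smooth n).comp (by fun_prop)
  rw [h, p.iteratedFDeriv_comp_right hf _ le_rfl, iteratedFDeriv_comp_add_right]
  refine (ContinuousMultilinearMap.norm_compContinuousLinearMap_le _ _).trans ?_
  simp [mul_comm]

theorem seminorm_affineSlice_le (p : E →L[ℝ] W) (q : X →L[ℝ] W)
    (hp : ∀ x y, ‖y‖ ≤ ‖p y + q x‖) (x : X) (f : 𝓢(W, ℂ)) (m n : ℕ) :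
    SchwartzMap.seminorm ℂ m n (affineSlice p q hp x f)
      ≤ ‖p‖ ^ n * SchwartzMap.seminorm ℂ m n f := by
  refine SchwartzMap.seminorm_le_bound ℂ m n _ (by positivity) fun y => ?_
  calc _ ≤ ‖p y + q x‖ ^ m * (‖p‖ ^ n * ‖iteratedFDeriv ℝ n f (p y + q x)‖) := by
        gcongr
        · exact hp x y
        · exact iteratedFDeriv_affineSlice p q hp x f n y
    _ = ‖p‖ ^ n * (‖p y + q x‖ ^ m * ‖iteratedFDeriv ℝ n f (p y + q x)‖) := by ring
    _ ≤ _ := by gcongr; exact SchwartzMap.le_seminorm ℂ m n f _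

/-- The seminorms of slices far away from the origin are small. -/
theorem pow_mul_seminorm_affineSlice_le (p : E →L[ℝ] W) (q : X →L[ℝ] W)
    (hp : ∀ x y, ‖y‖ ≤ ‖p y + q x‖) (x : X) (R : ℝ) (hR : 0 ≤ R) (hx : ∀ y, R ≤ ‖p y + q x‖)
    (f : 𝓢(W, ℂ)) (k m n : ℕ) :
    R ^ k * SchwartzMap.seminorm ℂ m n (affineSlice p q hp x f)
      ≤ ‖p‖ ^ n * SchwartzMap.seminorm ℂ (k + m) n f := by
  have h : SchwartzMap.seminorm ℂ m n ((R ^ k : ℂ) • affineSlice p q hp x f)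
      ≤ ‖p‖ ^ n * SchwartzMap.seminorm ℂ (k + m) n f := by
    refine SchwartzMap.seminorm_le_bound ℂ m n _ (by positivity) fun y => ?_
    have h1 : iteratedFDeriv ℝ n (⇑((R ^ k : ℂ) • affineSlice p q hp x f)) y
        = (R ^ k : ℂ) • iteratedFDeriv ℝ n (affineSlice p q hp x f) y :=
      iteratedFDeriv_const_smul_apply ((affineSlice p q hp x f).smooth n).contDiffAt
    rw [h1, norm_smul]
    calc _ = R ^ k * (‖y‖ ^ m * ‖iteratedFDeriv ℝ n (affineSlice p q hp x f) y‖) := by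
          simp [abs_of_nonneg hR]; ring
      _ ≤ ‖p y + q x‖ ^ k * (‖p y + q x‖ ^ m *
            (‖p‖ ^ n * ‖iteratedFDeriv ℝ n f (p y + q x)‖)) := by
          gcongr
          · exact hx y
          · exact hp x y
          · exact iteratedFDeriv_affineSlice p q hp x f n y
      _ = ‖p‖ ^ n * (‖p y + q x‖ ^ (k + m) * ‖iteratedFDeriv ℝ n f (p y + q x)‖) := by ring
      _ ≤ _ := by gcongr; exact SchwartzMap.le_seminorm ℂ _ n f _
  rw [map_smul_eq_mul] at h
  simpa [abs_of_nonneg hR] using h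

theorem exists_seminorm_le_of_continuous (Q : Seminorm ℂ 𝓢(E, ℂ)) (hQ : Continuous Q) :
    ∃ (s : Finset (ℕ × ℕ)) (C : ℝ), 0 ≤ C ∧ ∀ f, Q f
      ≤ C * ∑ i ∈ s, SchwartzMap.seminorm ℂ i.1 i.2 f := by
  obtain ⟨s, C, -, h⟩ := Seminorm.bound_of_continuous (schwartz_withSeminorms ℂ E ℂ) Q hQ
  refine ⟨s, C, C.2, fun f => (h f).trans ?_⟩
  have := Seminorm.finset_sup_le_sum (schwartzSeminormFamily ℂ E ℂ) s f
  rw [sum_apply] at this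
  exact mul_le_mul_of_nonneg_left this C.2

theorem exists_seminorm_clm_le (L : 𝓢(E, ℂ) →L[ℂ] 𝓢(F, ℂ)) (m n : ℕ) :
    ∃ (s : Finset (ℕ × ℕ)) (C : ℝ), 0 ≤ C ∧ ∀ f, SchwartzMap.seminorm ℂ m n (L f)
      ≤ C * ∑ i ∈ s, SchwartzMap.seminorm ℂ i.1 i.2 f :=
  exists_seminorm_le_of_continuous
    ((schwartzSeminormFamily ℂ F ℂ (m, n)).comp (L : 𝓢(E, ℂ) →ₗ[ℂ] 𝓢(F, ℂ)))
    (((schwartz_withSeminorms ℂ F ℂ).continuous_seminorm (m, n)).comp L.continuous)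

theorem exists_seminorm_functional_le (u : 𝓢(E, ℂ) →L[ℂ] ℂ) :
    ∃ (s : Finset (ℕ × ℕ)) (C : ℝ), 0 ≤ C ∧ ∀ f, ‖u f‖
      ≤ C * ∑ i ∈ s, SchwartzMap.seminorm ℂ i.1 i.2 f :=
  exists_seminorm_le_of_continuous ((normSeminorm ℂ ℂ).comp (u : 𝓢(E, ℂ) →ₗ[ℂ] ℂ))
    u.continuous.norm

theorem exists_nhds_seminorm_le (m n : ℕ) :
    ∃ S ∈ 𝓝 (0 : 𝓢(E, ℂ)), ∀ f ∈ S, SchwartzMap.seminorm ℂ m n f ≤ 1 := by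
  have h := ((schwartz_withSeminorms ℂ E ℂ).continuous_seminorm (m, n)).tendsto 0
  rw [map_zero] at h
  exact ⟨_, h.eventually (ge_mem_nhds zero_lt_one), fun f hf => hf⟩

variable [FiniteDimensional ℝ X] [FiniteDimensional ℝ W]

/-- The operator `L` acting on the variable `y` of `f (p y + q x)`, evaluated at `y = r x`. -/
theorem exists_partialApply (p : E →L[ℝ] W) (q : X →L[ℝ] W) (r : X →L[ℝ] F)
    (hp : ∀ x y, ‖y‖ ≤ ‖p y + q x‖) (hx : ∀ x y, ‖x‖ ≤ ‖r x‖ + ‖p y + q x‖)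
    (L : 𝓢(E, ℂ) →L[ℂ] 𝓢(F, ℂ)) :
    ∃ T : 𝓢(W, ℂ) →L[ℂ] 𝓢(X, ℂ), ∀ f x, T f x = L (affineSlice p q hp x f) (r x) := by
  let σ : (𝓢(W, ℂ) →L[ℂ] 𝓢(W, ℂ)) → 𝓢(W, ℂ) →ₗ[ℂ] (X → 𝓢(E, ℂ)) := fun D =>
    { toFun := fun f x => affineSlice p q hp x (D f)
      map_add' := fun f g => by ext x; simp
      map_smul' := fun c f => by ext x; simp }
  refine exists_clm_of_smooth_family r σ
    (fun D v => (lineDerivOpCLM ℂ 𝓢(W, ℂ) (q v)).comp D) ?_ ?_ ?_ ?_ (.id ℂ _) L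
  · intro D f x v w
    simp [σ, lineDerivOp_left_add]
  · intro D f x c v
    ext y
    simp [σ, lineDerivOp_left_smul]
  · intro D f x Q hQ
    obtain ⟨s, C, hC0, hC⟩ := exists_seminorm_le_of_continuous Q hQ
    choose K hK0 hK using fun i : ℕ × ℕ => seminorm_shift_sub_sub_le (D f) i.1 i.2
    have h1 : ∀ h : X, ‖q h‖ ≤ 1 → Q (σ D f (x + h) - σ D f x -
        σ ((lineDerivOpCLM ℂ 𝓢(W, ℂ) (q h)).comp D) f x)
        ≤ (C * ∑ i ∈ s, ‖p‖ ^ i.2 * K i) * ‖q h‖ ^ 2 := fun h hh => by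
      have : σ D f (x + h) - σ D f x - σ ((lineDerivOpCLM ℂ 𝓢(W, ℂ) (q h)).comp D) f x
          = affineSlice p q hp x (shift (q h) (D f) - D f - ∂_{q h} (D f)) := by
        ext y
        simp [σ, add_assoc]
      rw [this]
      refine (hC _).trans ?_
      rw [mul_assoc, Finset.sum_mul]
      refine mul_le_mul_of_nonneg_left ?_ hC0
      refine Finset.sum_le_sum fun i _ => ?_
      refine (seminorm_affineSlice_le p q hp x _ i.1 i.2).trans ?_
      rw [mul_assoc]
      gcongr
      exact hK i _ hh
    have h2 : (fun h : X => Q (σ D f (x + h) - σ D f x -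
        σ ((lineDerivOpCLM ℂ 𝓢(W, ℂ) (q h)).comp D) f x)) =O[𝓝 0] fun h => ‖q h‖ ^ 2 := by
      refine .of_bound (C * ∑ i ∈ s, ‖p‖ ^ i.2 * K i) ?_
      have h5 : Tendsto (fun h => ‖q h‖) (𝓝 0) (𝓝 0) := by
        simpa using q.continuous.norm.tendsto 0
      filter_upwards [h5.eventually (ge_mem_nhds zero_lt_one)] with h hh
      rw [Real.norm_of_nonneg (apply_nonneg _ _)]
      simpa using h1 h hh
    refine h2.trans_isLittleO ?_
    have h3 : (fun h : X => ‖q h‖ ^ 2) =O[𝓝 0] fun h => ‖h‖ ^ 2 :=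
      (q.isBigO_id (𝓝 0)).norm_norm.pow 2
    exact h3.trans_isLittleO (isLittleO_norm_pow_id one_lt_two)
  · intro D L m
    obtain ⟨s, C, hC, h⟩ := exists_seminorm_clm_le (L.comp (.id ℂ _)) m 0
    obtain ⟨s', C', hC', h'⟩ := exists_seminorm_clm_le L 0 0
    have hS : ∀ i : ℕ × ℕ, ∃ S ∈ 𝓝 (0 : 𝓢(W, ℂ)), ∀ f ∈ S,
        SchwartzMap.seminorm ℂ i.1 i.2 (D f) ≤ 1 := fun i => by
      obtain ⟨S, hS, h⟩ := exists_nhds_seminorm_le (E := W) i.1 i.2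
      refine ⟨D ⁻¹' S, D.continuous.continuousAt.preimage_mem_nhds (by simpa using hS),
        fun f hf => h _ hf⟩
    choose S hS hS1 using hS
    refine ⟨(⋂ i ∈ s, S i) ∩ ⋂ i ∈ s', S (m + i.1, i.2),
      inter_mem ((biInter_finset_mem s).2 fun i _ => hS i)
        ((biInter_finset_mem s').2 fun i _ => hS (m + i.1, i.2)),
      2 ^ m * (C * ∑ i ∈ s, ‖p‖ ^ i.2 + C' * ∑ i ∈ s', ‖p‖ ^ i.2), fun f hf x => ?_⟩
    have ha : ‖r x‖ ^ m * ‖L (σ D f x) (r x)‖ ≤ C * ∑ i ∈ s, ‖p‖ ^ i.2 := by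
      refine (SchwartzMap.norm_pow_mul_le_seminorm ℂ _ m (r x)).trans ((h _).trans ?_)
      gcongr with i hi
      refine (seminorm_affineSlice_le p q hp x _ i.1 i.2).trans ?_
      refine mul_le_of_le_one_right (by positivity) (hS1 i f ?_)
      exact Set.mem_iInter₂.1 hf.1 i hi
    have hn : 0 ≤ C' * ∑ i ∈ s', ‖p‖ ^ i.2 := by positivity
    have hn2 : 0 ≤ C * ∑ i ∈ s, ‖p‖ ^ i.2 := by positivity
    -- Either `r x` is comparable with `x` and the decay of `L (…)` at `r x` suffices, or by `hx`
    -- the whole slice stays at distance at least `‖x‖ / 2` from the origin and its seminorms are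
    -- small.
    by_cases hrx : ‖x‖ ≤ 2 * ‖r x‖
    · calc _ ≤ (2 * ‖r x‖) ^ m * ‖L (σ D f x) (r x)‖ := by gcongr
        _ = 2 ^ m * (‖r x‖ ^ m * ‖L (σ D f x) (r x)‖) := by ring
        _ ≤ _ := by gcongr; linarith
    · have hfar : ∀ y, ‖x‖ / 2 ≤ ‖p y + q x‖ := fun y => by
        have := hx x y
        linarith
      have hb : (‖x‖ / 2) ^ m * ‖L (σ D f x) (r x)‖ ≤ C' * ∑ i ∈ s', ‖p‖ ^ i.2 := by
        calc _ ≤ (‖x‖ / 2) ^ m * (C' * ∑ i ∈ s', SchwartzMap.seminorm ℂ i.1 i.2 (σ D f x)) := by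
              gcongr
              exact (SchwartzMap.norm_le_seminorm ℂ _ (r x)).trans (h' _)
          _ = C' * ∑ i ∈ s', (‖x‖ / 2) ^ m * SchwartzMap.seminorm ℂ i.1 i.2 (σ D f x) := by
              rw [Finset.mul_sum, Finset.mul_sum, Finset.mul_sum]
              exact Finset.sum_congr rfl fun i _ => by ring
          _ ≤ _ := by
              gcongr with i hi
              refine (pow_mul_seminorm_affineSlice_le p q hp x _ (by positivity) hfar _ m _ _).trans ?_
              refine mul_le_of_le_one_right (by positivity) (hS1 (m + i.1, i.2) f ?_)
              exact Set.mem_iInter₂.1 hf.2 i hi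
      calc _ = 2 ^ m * ((‖x‖ / 2) ^ m * ‖L (σ D f x) (r x)‖) := by
            rw [div_pow]; field_simp
        _ ≤ _ := by gcongr; linarith

end Partial

/-! ### Density of Schwartz functions in the tempered distributions -/

section Density

/-- `T` has a formal transpose with respect to the bilinear pairing `∫ f g`. -/
def HasTranspose {W V : Type*} [NormedAddCommGroup W] [NormedSpace ℝ W] [MeasurableSpace W]
    [NormedAddCommGroup V] [NormedSpace ℝ V] [MeasurableSpace V] (μ : Measure W) (ν : Measure V)
    (T : 𝓢(W, ℂ) →L[ℂ] 𝓢(V, ℂ)) : Prop :=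
  ∀ s : 𝓢(V, ℂ), ∃ s' : 𝓢(W, ℂ), ∀ f, ∫ x, T f x * s x ∂ν = ∫ x, f x * s' x ∂μ

variable {W V U : Type*} [NormedAddCommGroup W] [NormedSpace ℝ W] [MeasurableSpace W]
  [NormedAddCommGroup V] [NormedSpace ℝ V] [MeasurableSpace V]
  [NormedAddCommGroup U] [NormedSpace ℝ U] [MeasurableSpace U]

theorem HasTranspose.comp {μ : Measure W} {ν : Measure V} {ξ : Measure U}
    {T : 𝓢(W, ℂ) →L[ℂ] 𝓢(V, ℂ)} {S : 𝓢(V, ℂ) →L[ℂ] 𝓢(U, ℂ)} (hS : HasTranspose ν ξ S)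
    (hT : HasTranspose μ ν T) : HasTranspose μ ξ (S.comp T) := fun s => by
  obtain ⟨s', hs'⟩ := hS s
  obtain ⟨s'', hs''⟩ := hT s'
  exact ⟨s'', fun f => (hs' (T f)).trans (hs'' f)⟩

theorem hasTranspose_smulLeftCLM (μ : Measure W) (g : W → ℂ) :
    HasTranspose μ μ (SchwartzMap.smulLeftCLM ℂ g) := fun s => by
  by_cases hg : g.HasTemperateGrowth
  · refine ⟨SchwartzMap.smulLeftCLM ℂ g s, fun f => ?_⟩
    simp only [SchwartzMap.smulLeftCLM_apply_apply hg, smul_eq_mul]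
    congr 1 with x
    ring
  -- Without temperate growth, `smulLeftCLM` takes its default value zero.
  · refine ⟨0, fun f => ?_⟩
    have : SchwartzMap.smulLeftCLM ℂ g = (0 : 𝓢(W, ℂ) →L[ℂ] 𝓢(W, ℂ)) := by
      simp [SchwartzMap.smulLeftCLM, hg]
    simp [this]

theorem hasTranspose_lineDerivOp [BorelSpace W] [FiniteDimensional ℝ W] (μ : Measure W)
    [μ.IsAddHaarMeasure] (v : W) : HasTranspose μ μ (lineDerivOpCLM ℂ 𝓢(W, ℂ) v) := fun s => by
  refine ⟨-∂_{v} s, fun f => ?_⟩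
  have h := SchwartzMap.integral_bilinear_lineDerivOp_right_eq_neg_left (μ := μ) s f
    (ContinuousLinearMap.mul ℝ ℂ) v
  simp only [ContinuousLinearMap.mul_apply'] at h
  simp only [neg_apply, lineDerivOpCLM_apply, mul_comm _ (s _), mul_comm (f _), neg_mul,
    integral_neg]
  exact h

theorem hasTranspose_iteratedLineDerivOp [BorelSpace W] [FiniteDimensional ℝ W] (μ : Measure W)
    [μ.IsAddHaarMeasure] {n : ℕ} (m : Fin n → W) :
    HasTranspose μ μ (iteratedLineDerivOpCLM ℂ 𝓢(W, ℂ) m) := by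
  induction n with
  | zero =>
    refine fun s => ⟨s, fun f => ?_⟩
    rw [iteratedLineDerivOpCLM_apply, iteratedLineDerivOp_fin_zero]
  | succ n ih =>
    intro s
    obtain ⟨s', hs'⟩ := ((hasTranspose_lineDerivOp μ (m 0)).comp (ih (Fin.tail m))) s
    refine ⟨s', fun f => ?_⟩
    rw [← hs' f, iteratedLineDerivOpCLM_apply, iteratedLineDerivOp_succ_left]
    rfl

theorem hasTranspose_fourier {V : Type*} [NormedAddCommGroup V] [InnerProductSpace ℝ V]
    [MeasurableSpace V] [BorelSpace V] [FiniteDimensional ℝ V] :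
    HasTranspose (volume : Measure V) (volume : Measure V)
      (FourierTransform.fourierCLM ℂ 𝓢(V, ℂ)) := fun s =>
  ⟨FourierTransform.fourier s, fun f => SchwartzMap.integral_fourier_mul_eq f s⟩

theorem hasTranspose_comp_equiv [BorelSpace W] [FiniteDimensional ℝ W] [BorelSpace V]
    [FiniteDimensional ℝ V] (μ : Measure W) [μ.IsAddHaarMeasure] (ν : Measure V)
    [ν.IsAddHaarMeasure] (e : V ≃L[ℝ] W) :
    HasTranspose μ ν (SchwartzMap.compCLMOfContinuousLinearEquiv ℂ e) := fun s => by
  have h : ν.map e = _ := Measure.isAddLeftInvariant_eq_smul (ν.map e) μ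
  set c : NNReal := Measure.addHaarScalarFactor (ν.map e) μ
  refine ⟨(c : ℝ) • SchwartzMap.compCLMOfContinuousLinearEquiv ℂ e.symm s, fun f => ?_⟩
  have h2 := e.toHomeomorph.measurableEmbedding.integral_map (μ := ν)
    (fun w => f w * s (e.symm w))
  have h3 : ν.map e.toHomeomorph = ν.map e := rfl
  rw [h3, h, integral_smul_nnreal_measure] at h2
  simp only [ContinuousLinearEquiv.coe_toHomeomorph, ContinuousLinearEquiv.symm_apply_apply] at h2
  simp only [SchwartzMap.compCLMOfContinuousLinearEquiv_apply, Function.comp_apply, smul_apply]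
  rw [← h2, NNReal.smul_def, ← integral_smul]
  congr 1 with x
  simp
  ring

/-- Linear functionals dominated by the norm of a linear map factor through that map. -/
theorem exists_factor_of_norm_le {S H : Type*} [AddCommGroup S] [Module ℂ S]
    [NormedAddCommGroup H] [NormedSpace ℂ H] (J : S →ₗ[ℂ] H) (u : S →ₗ[ℂ] ℂ) (C : ℝ) (hC : 0 ≤ C)
    (h : ∀ f, ‖u f‖ ≤ C * ‖J f‖) : ∃ F : H →L[ℂ] ℂ, ∀ f, F (J f) = u f := by
  have hker : LinearMap.ker J ≤ LinearMap.ker u := fun f hf => by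
    have := h f
    rw [LinearMap.mem_ker.1 hf, norm_zero, mul_zero] at this
    exact norm_le_zero_iff.1 this
  let g : LinearMap.range J →ₗ[ℂ] ℂ :=
    ((LinearMap.ker J).liftQ u hker) ∘ₗ (J.quotKerEquivRange.symm : _ →ₗ[ℂ] _)
  have hg : ∀ f, g ⟨J f, f, rfl⟩ = u f := fun f => by
    have : J.quotKerEquivRange.symm ⟨J f, f, rfl⟩ = (LinearMap.ker J).mkQ f := by
      rw [LinearEquiv.symm_apply_eq]
      rfl
    simp [g, this]
  obtain ⟨F, hF, -⟩ := Module.Dual.exists_continuous_extension_of_le_seminorm (LinearMap.range J) g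
    (p := C.toNNReal • normSeminorm ℂ H) (continuous_norm.const_smul C.toNNReal) (by
      rintro ⟨_, f, rfl⟩
      rw [hg]
      refine (h f).trans_eq ?_
      change _ = (C.toNNReal : ℝ) * ‖J f‖
      rw [Real.coe_toNNReal C hC])
  exact ⟨F, fun f => (hF ⟨J f, f, rfl⟩).trans (hg f)⟩

/-- A temperate weight with a square integrable inverse. -/
theorem exists_weight (V : Type*) [NormedAddCommGroup V] [InnerProductSpace ℝ V]
    [MeasurableSpace V] [BorelSpace V] [FiniteDimensional ℝ V] :
    ∃ w w' : V → ℝ, MemLp w 2 (volume : Measure V) ∧ (fun x => (w' x : ℂ)).HasTemperateGrowth ∧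
      ∀ x, w x * w' x = 1 := by
  have hs : ((Module.finrank ℝ V : ℕ) : ℝ) < 2 * ((Module.finrank ℝ V : ℝ) + 1) := by
    linarith [(Module.finrank ℝ V).cast_nonneg (α := ℝ)]
  generalize (Module.finrank ℝ V : ℝ) + 1 = s at hs
  refine ⟨fun x => (1 + ‖x‖ ^ 2) ^ (-s / 2), fun x => (1 + ‖x‖ ^ 2) ^ (s / 2), ?_, by fun_prop,
    fun x => ?_⟩
  · constructor
    · have : (fun x : V => (1 + ‖x‖ ^ 2) ^ (-s / 2)).HasTemperateGrowth := by fun_prop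
      exact this.1.continuous.aestronglyMeasurable
    · rw [eLpNorm_lt_top_iff_lintegral_rpow_enorm_lt_top (by norm_num) (by norm_num)]
      suffices h : ∫⁻ a : V, ENNReal.ofReal ‖(1 + ‖a‖ ^ 2) ^ (-s)‖ ∂volume < ⊤ from by
        norm_cast
        simp_rw [ofReal_norm] at h
        simp_rw [← enorm_pow]
        convert h
        rw [← Real.rpow_mul_natCast (by positivity)]
        simp
      apply ((integrable_rpow_neg_one_add_norm_sq hs).congr _).lintegral_lt_top
      filter_upwards with x
      rw [Real.norm_eq_abs, abs_eq_self.mpr (by positivity)]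
      congr
      ring
  · rw [← Real.rpow_add (by positivity)]
    ring_nf
    simp

/-- By Fourier inversion, the values of `h` are integrals of its Fourier transform against phases.
-/
theorem exists_norm_le_toLp_one (V : Type*) [NormedAddCommGroup V] [InnerProductSpace ℝ V]
    [MeasurableSpace V] [BorelSpace V] [FiniteDimensional ℝ V] (h : 𝓢(V, ℂ)) (x : V) :
    ‖h x‖ ≤ (eLpNorm (FourierTransform.fourier h : 𝓢(V, ℂ)) 1 volume).toReal := by
  set k : 𝓢(V, ℂ) := FourierTransform.fourier h with hk
  have : h x = (FourierTransform.fourier k : 𝓢(V, ℂ)) (-x) := by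
    have h2 : h = FourierTransform.fourierInv k := (FourierTransform.fourierInv_fourier_eq h).symm
    rw [h2, SchwartzMap.fourierInv_apply_eq]
    rfl
  rw [this, ← SchwartzMap.norm_toLp]
  exact SchwartzMap.norm_fourier_apply_le_toLp_one k (-x)

/-- Sup norms are controlled by an `L²` norm. -/
theorem exists_norm_le_toLp_two (V : Type*) [NormedAddCommGroup V] [InnerProductSpace ℝ V]
    [MeasurableSpace V] [BorelSpace V] [FiniteDimensional ℝ V] :
    ∃ (T : 𝓢(V, ℂ) →L[ℂ] 𝓢(V, ℂ)) (C : ℝ), 0 ≤ C ∧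
      HasTranspose (volume : Measure V) (volume : Measure V) T ∧
      ∀ h x, ‖h x‖ ≤ C * ‖(T h).toLp 2 (volume : Measure V)‖ := by
  obtain ⟨w, w', hw, hw', hww⟩ := exists_weight V
  refine ⟨(SchwartzMap.smulLeftCLM ℂ fun x => (w' x : ℂ)).comp
    (FourierTransform.fourierCLM ℂ 𝓢(V, ℂ)), (eLpNorm w 2 volume).toReal, ENNReal.toReal_nonneg,
    (hasTranspose_smulLeftCLM _ _).comp hasTranspose_fourier, fun h x => ?_⟩
  refine (exists_norm_le_toLp_one V h x).trans ?_
  set T := (SchwartzMap.smulLeftCLM ℂ fun x => (w' x : ℂ)).comp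
    (FourierTransform.fourierCLM ℂ 𝓢(V, ℂ)) with hT
  have hTh : ∀ x, T h x = w' x * (FourierTransform.fourier h : 𝓢(V, ℂ)) x := fun x => by
    rw [hT, ContinuousLinearMap.comp_apply, SchwartzMap.smulLeftCLM_apply_apply hw']
    rfl
  have h3 : ((FourierTransform.fourier h : 𝓢(V, ℂ)) : V → ℂ) = w • (T h : V → ℂ) := by
    ext x
    rw [Pi.smul_apply', hTh, Complex.real_smul, ← mul_assoc, ← Complex.ofReal_mul, hww]
    simp
  clear_value T
  -- Cauchy–Schwarz: the `L¹` norm of the Fourier transform is at most the product of the `L²` norms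
  -- of `w` and `T h`.
  rw [SchwartzMap.norm_toLp, ← ENNReal.toReal_mul]
  refine ENNReal.toReal_mono (ENNReal.mul_ne_top hw.2.ne ((T h).memLp 2 volume).2.ne) ?_
  rw [h3]
  exact eLpNorm_smul_le_mul_eLpNorm (T h).continuous.aestronglyMeasurable hw.1

variable [BorelSpace W] [FiniteDimensional ℝ W]

theorem exists_toLp_two_bound_pow {V : Type*} [NormedAddCommGroup V] [InnerProductSpace ℝ V]
    [MeasurableSpace V] [BorelSpace V] [FiniteDimensional ℝ V] (μ : Measure W) [μ.IsAddHaarMeasure]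
    (e : W ≃L[ℝ] V) (m : ℕ) :
    ∃ (B : 𝓢(W, ℂ) →L[ℂ] 𝓢(V, ℂ)) (D : ℝ), 0 ≤ D ∧ HasTranspose μ (volume : Measure V) B ∧
      ∀ g x, ‖x‖ ^ m * ‖g x‖ ≤ D * ‖(B g).toLp 2 (volume : Measure V)‖ := by
  obtain ⟨T₀, C₀, hC₀, hT₀, h₀⟩ := exists_norm_le_toLp_two V
  obtain ⟨w, hw, hwm⟩ : ∃ w : V → ℂ, w.HasTemperateGrowth ∧ ∀ v, ‖v‖ ^ m ≤ ‖w v‖ := by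
    refine ⟨fun v => (((1 + ‖v‖ ^ 2) ^ (m : ℝ) : ℝ) : ℂ), by fun_prop, fun v => ?_⟩
    rw [Complex.norm_real, Real.norm_of_nonneg (by positivity), Real.rpow_natCast]
    gcongr
    nlinarith [sq_nonneg (‖v‖ - 1)]
  refine ⟨T₀.comp ((SchwartzMap.smulLeftCLM ℂ w).comp
      (SchwartzMap.compCLMOfContinuousLinearEquiv ℂ e.symm)),
    ‖(e.symm : V →L[ℝ] W)‖ ^ m * C₀, by positivity,
    hT₀.comp ((hasTranspose_smulLeftCLM _ _).comp (hasTranspose_comp_equiv μ volume e.symm)),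
    fun g x => ?_⟩
  have h1 := h₀ (SchwartzMap.smulLeftCLM ℂ w
    (SchwartzMap.compCLMOfContinuousLinearEquiv ℂ e.symm g)) (e x)
  rw [SchwartzMap.smulLeftCLM_apply_apply hw,
    SchwartzMap.compCLMOfContinuousLinearEquiv_apply, Function.comp_apply,
    ContinuousLinearEquiv.symm_apply_apply, norm_smul] at h1
  have h3 : ‖x‖ ≤ ‖(e.symm : V →L[ℝ] W)‖ * ‖e x‖ := by
    simpa using (e.symm : V →L[ℝ] W).le_opNorm (e x)
  calc ‖x‖ ^ m * ‖g x‖ ≤ (‖(e.symm : V →L[ℝ] W)‖ * ‖e x‖) ^ m * ‖g x‖ := by gcongr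
    _ = ‖(e.symm : V →L[ℝ] W)‖ ^ m * (‖e x‖ ^ m * ‖g x‖) := by ring
    _ ≤ ‖(e.symm : V →L[ℝ] W)‖ ^ m * (‖w (e x)‖ * ‖g x‖) := by
        gcongr
        exact hwm _
    _ ≤ ‖(e.symm : V →L[ℝ] W)‖ ^ m * (C₀ * _) := mul_le_mul_of_nonneg_left h1 (by positivity)
    _ = _ := by rw [mul_assoc]; rfl

/-- The seminorms of a Schwartz function are traded for `L²` norms in order to have Hilbert spaces
at hand. Each `T a` is composed of derivatives, multiplications, changes of coordinates and Fourier
transforms, all of which can be moved to the other factor of an integral. -/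
theorem exists_toLp_two_bound {V : Type*} [NormedAddCommGroup V] [InnerProductSpace ℝ V]
    [MeasurableSpace V] [BorelSpace V] [FiniteDimensional ℝ V] (μ : Measure W) [μ.IsAddHaarMeasure]
    (e : W ≃L[ℝ] V) (u : 𝓢(W, ℂ) →L[ℂ] ℂ) :
    ∃ (A : Type) (_ : Fintype A) (T : A → 𝓢(W, ℂ) →L[ℂ] 𝓢(V, ℂ)) (C : ℝ), 0 ≤ C ∧
      (∀ a, HasTranspose μ (volume : Measure V) (T a)) ∧
      ∀ f, ‖u f‖ ≤ C * ∑ a, ‖(T a f).toLp 2 (volume : Measure V)‖ := by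
  obtain ⟨s, C, hC, hu⟩ := exists_seminorm_functional_le u
  choose B D hD0 hB hD using fun m : ℕ => exists_toLp_two_bound_pow μ e m
  choose K hK0 hK using fun i : ℕ × ℕ => exists_seminorm_le (E := W) i.1 i.2
  let bas := Module.finBasis ℝ W
  let T : (Σ i : s, (Fin i.1.2 → Fin (Module.finrank ℝ W))) → 𝓢(W, ℂ) →L[ℂ] 𝓢(V, ℂ) :=
    fun a => (B a.1.1.1).comp (iteratedLineDerivOpCLM ℂ 𝓢(W, ℂ) fun c => bas (a.2 c))
  have hT : ∀ i r f, T ⟨i, r⟩ f = B i.1.1 (∂^{fun c => bas (r c)} f) := fun i r f => rfl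
  refine ⟨_, inferInstance, T, C * ∑ i : s, K i.1 * D i.1.1,
    mul_nonneg hC (Finset.sum_nonneg fun i _ => mul_nonneg (hK0 _) (hD0 _)),
    fun a => (hB _).comp (hasTranspose_iteratedLineDerivOp μ _), fun f => ?_⟩
  clear_value T
  generalize hS : ∑ a, ‖(T a f).toLp 2 (volume : Measure V)‖ = S
  have hS0 : 0 ≤ S := hS ▸ Finset.sum_nonneg fun a _ => norm_nonneg _
  have hsum : ∀ i : s, SchwartzMap.seminorm ℂ i.1.1 i.1.2 f ≤ K i.1 * D i.1.1 * S := fun i => by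
    rw [mul_assoc]
    refine hK i.1 f _ (mul_nonneg (hD0 _) hS0) fun r x => ?_
    refine (hD i.1.1 _ x).trans (mul_le_mul_of_nonneg_left ?_ (hD0 _))
    rw [← hT i r f, ← hS]
    exact Finset.single_le_sum (f := fun a => ‖(T a f).toLp 2 (volume : Measure V)‖)
      (fun a _ => norm_nonneg _) (Finset.mem_univ _)
  refine (hu f).trans ?_
  rw [mul_assoc]
  refine mul_le_mul_of_nonneg_left ?_ hC
  rw [← Finset.sum_coe_sort, Finset.sum_mul]
  exact Finset.sum_le_sum fun i _ => hsum i

/-- Complex conjugation on the Schwartz space. -/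
def conjW (f : 𝓢(V, ℂ)) : 𝓢(V, ℂ) :=
  SchwartzMap.postcompCLM (𝕜 := ℝ) (Complex.conjCLE : ℂ →L[ℝ] ℂ) f

omit [MeasurableSpace V] in
@[simp]
theorem conjW_apply (f : 𝓢(V, ℂ)) (x : V) : conjW f x = starRingEnd ℂ (f x) := by
  simp [conjW]

/-- Continuous functionals on a finite product of Hilbert spaces. -/
theorem exists_inner_of_pi {A H : Type*} [Fintype A] [NormedAddCommGroup H]
    [InnerProductSpace ℂ H] [CompleteSpace H] (F : (A → H) →L[ℂ] ℂ) :
    ∃ g : A → H, ∀ x, F x = ∑ a, inner ℂ (g a) (x a) := by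
  classical
  refine ⟨fun a => (InnerProductSpace.toDual ℂ H).symm
    (F.comp (ContinuousLinearMap.single ℂ (fun _ : A => H) a)), fun x => ?_⟩
  conv_lhs => rw [← Finset.univ_sum_single x]
  rw [map_sum]
  refine Finset.sum_congr rfl fun a _ => ?_
  rw [InnerProductSpace.toDual_symm_apply]
  rfl

theorem exists_schwartz_approx {V : Type*} [NormedAddCommGroup V] [InnerProductSpace ℝ V]
    [MeasurableSpace V] [BorelSpace V] [FiniteDimensional ℝ V]
    (g : Lp ℂ 2 (volume : Measure V)) (ε : ℝ) (hε : 0 < ε) :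
    ∃ s : 𝓢(V, ℂ), ‖g - s.toLp 2 (volume : Measure V)‖ ≤ ε := by
  have hd := SchwartzMap.denseRange_toLpCLM (F := ℂ) (p := 2) (by norm_num)
    (μ := (volume : Measure V))
  obtain ⟨s, hs⟩ := hd.exists_dist_lt g hε
  exact ⟨s, by rw [← dist_eq_norm]; exact hs.le⟩

theorem integral_mul_eq_inner {V : Type*} [NormedAddCommGroup V] [InnerProductSpace ℝ V]
    [MeasurableSpace V] [BorelSpace V] [FiniteDimensional ℝ V] (s t : 𝓢(V, ℂ)) :
    ∫ x, t x * conjW s x =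
      inner ℂ (s.toLp 2 (volume : Measure V)) (t.toLp 2 (volume : Measure V)) := by
  rw [SchwartzMap.inner_toL2_toL2_eq s t (volume : Measure V)]
  congr 1 with x

theorem integrable_mul {W : Type*} [NormedAddCommGroup W] [NormedSpace ℝ W] [MeasurableSpace W]
    [BorelSpace W] [FiniteDimensional ℝ W] (μ : Measure W) [μ.IsAddHaarMeasure]
    (f g : 𝓢(W, ℂ)) : Integrable (fun x => f x * g x) μ := by
  have := (SchwartzMap.smulLeftCLM ℂ g f).integrable (μ := μ)
  refine this.congr (Eventually.of_forall fun x => ?_)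
  simp [SchwartzMap.smulLeftCLM_apply_apply g.hasTemperateGrowth, mul_comm]

/-- By Hahn–Banach and Riesz, `u f = ∑ a, ⟪g a, T a f⟫` with `g a` in `L²`. Replacing `g a` by a
nearby Schwartz function costs little uniformly on `B`, since `T a` maps `B` to a bounded set in
`L²`. The transposes of the `T a` then turn the sum into an integral against a single Schwartz
function. -/
theorem exists_integral_approx_of_equiv {V : Type*} [NormedAddCommGroup V]
    [InnerProductSpace ℝ V] [MeasurableSpace V] [BorelSpace V] [FiniteDimensional ℝ V]
    (e : W ≃L[ℝ] V) (μ : Measure W) [μ.IsAddHaarMeasure] (u : 𝓢(W, ℂ) →L[ℂ] ℂ)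
    (B : Set 𝓢(W, ℂ)) (hB : Bornology.IsVonNBounded ℂ B) (ε : ℝ) (hε : 0 < ε) :
    ∃ g : 𝓢(W, ℂ), ∀ f ∈ B, ‖u f - ∫ x, f x * g x ∂μ‖ ≤ ε := by
  obtain ⟨A, _, T, C, hC, hT, hu⟩ := exists_toLp_two_bound μ e u
  let J : 𝓢(W, ℂ) →ₗ[ℂ] (A → Lp ℂ 2 (volume : Measure V)) :=
    LinearMap.pi fun a => ((SchwartzMap.toLpCLM ℂ ℂ 2 (volume : Measure V)).comp (T a) : _ →ₗ[ℂ] _)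
  have hJ : ∀ f a, J f a = (T a f).toLp 2 (volume : Measure V) := fun f a => rfl
  clear_value J
  obtain ⟨F, hF⟩ := exists_factor_of_norm_le J u (C * Fintype.card A) (by positivity) fun f => by
    refine (hu f).trans ?_
    rw [mul_assoc]
    refine mul_le_mul_of_nonneg_left ?_ hC
    calc _ ≤ ∑ a : A, ‖J f‖ :=
          Finset.sum_le_sum fun a _ => (hJ f a ▸ norm_le_pi_norm (J f) a)
      _ = _ := by simp
  obtain ⟨g, hg⟩ := exists_inner_of_pi F
  have hF' : ∀ f, u f = ∑ a, inner ℂ (g a) ((T a f).toLp 2 (volume : Measure V)) := fun f => by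
    have := hF f
    rw [hg] at this
    simp_rw [hJ] at this
    exact this.symm
  have hM : ∀ a, ∃ M : ℝ, 0 < M ∧ ∀ f ∈ B, ‖(T a f).toLp 2 (volume : Measure V)‖ ≤ M := fun a => by
    have := hB.image ((SchwartzMap.toLpCLM ℂ ℂ 2 (volume : Measure V)).comp (T a))
    obtain ⟨M, hM⟩ := (NormedSpace.isVonNBounded_iff' ℂ).1 this
    exact ⟨max M 1, lt_max_of_lt_right one_pos,
      fun f hf => (hM _ ⟨f, hf, rfl⟩).trans (le_max_left _ _)⟩
  choose M hM0 hM using hM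
  choose s hs using fun a => exists_schwartz_approx (g a) (ε / ((Fintype.card A + 1) * M a))
    (div_pos hε (mul_pos (by positivity) (hM0 a)))
  choose s' hs' using fun a => hT a (conjW (s a))
  refine ⟨∑ a, s' a, fun f hf => ?_⟩
  have h1 : ∫ x, f x * (∑ a, s' a) x ∂μ = ∑ a, inner ℂ ((s a).toLp 2 (volume : Measure V))
      ((T a f).toLp 2 (volume : Measure V)) := by
    simp_rw [sum_apply, Finset.mul_sum]
    rw [integral_finsetSum _ fun a _ => integrable_mul μ f (s' a)]
    refine Finset.sum_congr rfl fun a _ => ?_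
    rw [← hs' a f, integral_mul_eq_inner]
  rw [hF' f, h1, ← Finset.sum_sub_distrib]
  calc _ ≤ ∑ a, _ := norm_sum_le _ _
    _ ≤ ∑ a : A, ε / (Fintype.card A + 1) := by
        refine Finset.sum_le_sum fun a _ => ?_
        rw [← inner_sub_left]
        refine (norm_inner_le_norm _ _).trans ?_
        have h2 : ε / ((Fintype.card A + 1) * M a) * M a = ε / (Fintype.card A + 1) := by
          field_simp [(hM0 a).ne']
        rw [← h2]
        exact mul_le_mul (hs a) (hM a f hf) (norm_nonneg _)
          (div_nonneg hε.le (mul_nonneg (by positivity) (hM0 a).le))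
    _ ≤ ε := by
        simp only [Finset.sum_const, Finset.card_univ, nsmul_eq_mul]
        rw [mul_div_assoc', div_le_iff₀ (by positivity)]
        nlinarith

/-- Schwartz functions are dense in the tempered distributions, in the strong topology. -/
theorem exists_integral_approx (μ : Measure W) [μ.IsAddHaarMeasure] (u : 𝓢(W, ℂ) →L[ℂ] ℂ)
    (B : Set 𝓢(W, ℂ)) (hB : Bornology.IsVonNBounded ℂ B) (ε : ℝ) (hε : 0 < ε) :
    ∃ g : 𝓢(W, ℂ), ∀ f ∈ B, ‖u f - ∫ x, f x * g x ∂μ‖ ≤ ε :=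
  exists_integral_approx_of_equiv toEuclidean μ u B hB ε hε

end Density

/-! ### Functions of two groups of variables and Fubini's theorem for distributions -/

section Tensor

variable {E F E' F' : Type*} [NormedAddCommGroup E] [NormedSpace ℝ E] [FiniteDimensional ℝ E]
  [NormedAddCommGroup F] [NormedSpace ℝ F] [FiniteDimensional ℝ F]
  [NormedAddCommGroup E'] [NormedSpace ℝ E'] [FiniteDimensional ℝ E']
  [NormedAddCommGroup F'] [NormedSpace ℝ F'] [FiniteDimensional ℝ F']

/-- To obtain a class closed under derivatives, the index records an operator applied to `f` and a
function in place of `g`: a derivative in the first variable is composed with the operator, one in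
the second variable changes the function. -/
theorem exists_tensor (f : 𝓢(E, ℂ)) (g : 𝓢(F, ℂ)) :
    ∃ h : 𝓢(E × F, ℂ), ∀ p, h p = f p.1 * g p.2 := by
  let Φ : (𝓢(E, ℂ) →L[ℂ] 𝓢(E, ℂ)) × 𝓢(F, ℂ) → 𝓢(E, ℂ) →ₗ[ℂ] (E × F → ℂ) := fun i =>
    { toFun := fun f p => i.1 f p.1 * i.2 p.2
      map_add' := fun f g => by ext p; simp [add_mul]
      map_smul' := fun c f => by ext p; simp [mul_assoc] }
  have hΦ : ∀ i f (p : E × F), HasFDerivAt (Φ i f)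
      (i.1 f p.1 • (fderiv ℝ i.2 p.2).comp (ContinuousLinearMap.snd ℝ E F) +
        i.2 p.2 • (fderiv ℝ (i.1 f) p.1).comp (ContinuousLinearMap.fst ℝ E F)) p := fun i f p => by
    have h1 : HasFDerivAt (fun p : E × F => i.1 f p.1) _ p :=
      (((i.1 f).differentiableAt).hasFDerivAt).comp p hasFDerivAt_fst
    have h2 : HasFDerivAt (fun p : E × F => i.2 p.2) _ p :=
      ((i.2.differentiableAt).hasFDerivAt).comp p hasFDerivAt_snd
    exact h1.mul h2
  obtain ⟨T, hT⟩ := exists_clm_of_family Φ (fun i f p => (hΦ i f p).differentiableAt)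
    (fun i v => ⟨(i.1, ∂_{v.2} i.2), ((lineDerivOpCLM ℂ 𝓢(E, ℂ) v.1).comp i.1, i.2), fun f x => by
      rw [(hΦ i f x).fderiv]
      simp [Φ, SchwartzMap.lineDerivOp_apply_eq_fderiv, mul_comm]⟩)
    (fun i m => by
      have hS : ∀ n : ℕ, ∃ S ∈ 𝓝 (0 : 𝓢(E, ℂ)), ∀ f ∈ S, SchwartzMap.seminorm ℂ n 0 (i.1 f) ≤ 1 :=
        fun n => by
          obtain ⟨S, hS, h⟩ := exists_nhds_seminorm_le (E := E) n 0
          exact ⟨i.1 ⁻¹' S, i.1.continuous.continuousAt.preimage_mem_nhds (by simpa using hS),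
            fun f hf => h _ hf⟩
      obtain ⟨S', hS', h'⟩ := hS 0
      obtain ⟨S, hS, h⟩ := hS m
      refine ⟨S ∩ S', inter_mem hS hS', SchwartzMap.seminorm ℂ 0 0 i.2 +
        SchwartzMap.seminorm ℂ m 0 i.2, fun f hf p => ?_⟩
      have h1 : ‖p.1‖ ^ m * ‖i.1 f p.1‖ ≤ 1 :=
        (SchwartzMap.norm_pow_mul_le_seminorm ℂ _ m p.1).trans (h f hf.1)
      have h2 : ‖i.1 f p.1‖ ≤ 1 := (SchwartzMap.norm_le_seminorm ℂ _ p.1).trans (h' f hf.2)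
      have h3 : ‖p.2‖ ^ m * ‖i.2 p.2‖ ≤ SchwartzMap.seminorm ℂ m 0 i.2 :=
        SchwartzMap.norm_pow_mul_le_seminorm ℂ _ m p.2
      have h4 : ‖i.2 p.2‖ ≤ SchwartzMap.seminorm ℂ 0 0 i.2 := SchwartzMap.norm_le_seminorm ℂ _ p.2
      have h5 : ‖p‖ ^ m ≤ ‖p.1‖ ^ m + ‖p.2‖ ^ m := by
        rw [Prod.norm_def]
        rcases max_cases ‖p.1‖ ‖p.2‖ with h | h <;> rw [h.1]
        · linarith [pow_nonneg (norm_nonneg p.2) m]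
        · linarith [pow_nonneg (norm_nonneg p.1) m]
      change ‖p‖ ^ m * ‖i.1 f p.1 * i.2 p.2‖ ≤ _
      rw [norm_mul]
      calc _ ≤ (‖p.1‖ ^ m + ‖p.2‖ ^ m) * (‖i.1 f p.1‖ * ‖i.2 p.2‖) := by gcongr
        _ = (‖p.1‖ ^ m * ‖i.1 f p.1‖) * ‖i.2 p.2‖ + ‖i.1 f p.1‖ * (‖p.2‖ ^ m * ‖i.2 p.2‖) := by ring
        _ ≤ 1 * SchwartzMap.seminorm ℂ 0 0 i.2 + 1 * SchwartzMap.seminorm ℂ m 0 i.2 := by gcongr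
        _ = _ := by ring)
    (.id ℂ _, g)
  exact ⟨T f, hT f⟩

/-- The function `(x, y) ↦ f x * g y`. -/
def tensor (f : 𝓢(E, ℂ)) (g : 𝓢(F, ℂ)) : 𝓢(E × F, ℂ) := (exists_tensor f g).choose

@[simp]
theorem tensor_apply (f : 𝓢(E, ℂ)) (g : 𝓢(F, ℂ)) (p : E × F) : tensor f g p = f p.1 * g p.2 :=
  (exists_tensor f g).choose_spec p

omit [FiniteDimensional ℝ E] [FiniteDimensional ℝ F] in
theorem norm_le_inl_add_inr (y : F) (x : E) :
    ‖x‖ ≤ ‖ContinuousLinearMap.inl ℝ E F x + ContinuousLinearMap.inr ℝ E F y‖ := by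
  simp [Prod.norm_def]

omit [FiniteDimensional ℝ E] [FiniteDimensional ℝ F] in
theorem norm_le_inr_add_inl (x : E) (y : F) :
    ‖y‖ ≤ ‖ContinuousLinearMap.inr ℝ E F y + ContinuousLinearMap.inl ℝ E F x‖ := by
  simp [Prod.norm_def]

/-- The function `x ↦ K (x, y)`. -/
def sliceL (y : F) : 𝓢(E × F, ℂ) →L[ℂ] 𝓢(E, ℂ) :=
  affineSlice (.inl ℝ E F) (.inr ℝ E F) norm_le_inl_add_inr y

/-- The function `y ↦ K (x, y)`. -/
def sliceR (x : E) : 𝓢(E × F, ℂ) →L[ℂ] 𝓢(F, ℂ) :=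
  affineSlice (.inr ℝ E F) (.inl ℝ E F) norm_le_inr_add_inl x

omit [FiniteDimensional ℝ E] [FiniteDimensional ℝ F] in
@[simp]
theorem sliceL_apply (y : F) (K : 𝓢(E × F, ℂ)) (x : E) : sliceL y K x = K (x, y) := by
  simp [sliceL]

omit [FiniteDimensional ℝ E] [FiniteDimensional ℝ F] in
@[simp]
theorem sliceR_apply (x : E) (K : 𝓢(E × F, ℂ)) (y : F) : sliceR x K y = K (x, y) := by
  simp [sliceR]

theorem exists_left (T : 𝓢(E, ℂ) →L[ℂ] 𝓢(E', ℂ)) :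
    ∃ S : 𝓢(E × F, ℂ) →L[ℂ] 𝓢(E' × F, ℂ), ∀ K p, S K p = T (sliceL p.2 K) p.1 := by
  have hp : ∀ (x : E' × F) (y : E), ‖y‖ ≤ ‖ContinuousLinearMap.inl ℝ E F y +
      ((ContinuousLinearMap.inr ℝ E F).comp (.snd ℝ E' F)) x‖ := fun x y => by
    simp [Prod.norm_def]
  obtain ⟨S, hS⟩ := exists_partialApply (.inl ℝ E F)
    ((ContinuousLinearMap.inr ℝ E F).comp (.snd ℝ E' F)) (.fst ℝ E' F) hp (fun x y => by
      rw [Prod.norm_def]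
      refine max_le (le_add_of_nonneg_right (norm_nonneg _)) (le_add_of_nonneg_of_le (norm_nonneg _) ?_)
      simp [Prod.norm_def]) T
  refine ⟨S, fun K p => ?_⟩
  rw [hS]
  rfl

theorem exists_right (T : 𝓢(F, ℂ) →L[ℂ] 𝓢(F', ℂ)) :
    ∃ S : 𝓢(E × F, ℂ) →L[ℂ] 𝓢(E × F', ℂ), ∀ K p, S K p = T (sliceR p.1 K) p.2 := by
  have hp : ∀ (x : E × F') (y : F), ‖y‖ ≤ ‖ContinuousLinearMap.inr ℝ E F y +
      ((ContinuousLinearMap.inl ℝ E F).comp (.fst ℝ E F')) x‖ := fun x y => by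
    simp [Prod.norm_def]
  obtain ⟨S, hS⟩ := exists_partialApply (.inr ℝ E F)
    ((ContinuousLinearMap.inl ℝ E F).comp (.fst ℝ E F')) (.snd ℝ E F') hp (fun x y => by
      rw [Prod.norm_def]
      refine max_le (le_add_of_nonneg_of_le (norm_nonneg _) ?_) (le_add_of_nonneg_right (norm_nonneg _))
      simp [Prod.norm_def]) T
  refine ⟨S, fun K p => ?_⟩
  rw [hS]
  rfl

/-- The operator `T` acting on the first variable. -/
def left (T : 𝓢(E, ℂ) →L[ℂ] 𝓢(E', ℂ)) : 𝓢(E × F, ℂ) →L[ℂ] 𝓢(E' × F, ℂ) :=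
  (exists_left T).choose

theorem left_apply (T : 𝓢(E, ℂ) →L[ℂ] 𝓢(E', ℂ)) (K : 𝓢(E × F, ℂ)) (p : E' × F) :
    left T K p = T (sliceL p.2 K) p.1 := (exists_left T).choose_spec K p

/-- The operator `T` acting on the second variable. -/
def right (T : 𝓢(F, ℂ) →L[ℂ] 𝓢(F', ℂ)) : 𝓢(E × F, ℂ) →L[ℂ] 𝓢(E × F', ℂ) :=
  (exists_right T).choose

theorem right_apply (T : 𝓢(F, ℂ) →L[ℂ] 𝓢(F', ℂ)) (K : 𝓢(E × F, ℂ)) (p : E × F') :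
    right T K p = T (sliceR p.1 K) p.2 := (exists_right T).choose_spec K p

theorem sliceL_left (T : 𝓢(E, ℂ) →L[ℂ] 𝓢(E', ℂ)) (K : 𝓢(E × F, ℂ)) (y : F) :
    sliceL y (left T K) = T (sliceL y K) := by
  ext x
  simp [left_apply]

/-- Evaluation at a point. -/
def evalS {V : Type*} [NormedAddCommGroup V] [NormedSpace ℝ V] (x : V) : 𝓢(V, ℂ) →L[ℂ] ℂ :=
  (BoundedContinuousFunction.evalCLM ℂ x).comp (SchwartzMap.toBoundedContinuousFunctionCLM ℂ V ℂ)

@[simp]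
theorem evalS_apply {V : Type*} [NormedAddCommGroup V] [NormedSpace ℝ V] (x : V) (f : 𝓢(V, ℂ)) :
    evalS x f = f x := rfl

/-- The constant function `1` on a point. -/
def onePoint : 𝓢(EuclideanSpace ℝ (Fin 0), ℂ) :=
  (HasCompactSupport.of_compactSpace (fun _ : EuclideanSpace ℝ (Fin 0) => (1 : ℂ))).toSchwartzMap
    contDiff_const

theorem onePoint_apply (x : EuclideanSpace ℝ (Fin 0)) : onePoint x = 1 := rfl

/-- A functional is an operator into the Schwartz functions on a point, so `exists_partialApply`
covers this case as well, with `r = 0`. -/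
theorem exists_app₁ (v : 𝓢(F, ℂ) →L[ℂ] ℂ) :
    ∃ S : 𝓢(E × F, ℂ) →L[ℂ] 𝓢(E, ℂ), ∀ K x, S K x = v (sliceR x K) := by
  obtain ⟨S, hS⟩ := exists_partialApply (.inr ℝ E F) (.inl ℝ E F)
    (0 : E →L[ℝ] EuclideanSpace ℝ (Fin 0)) norm_le_inr_add_inl (fun x y => by
      refine le_add_of_nonneg_of_le (norm_nonneg _) ?_
      simp [Prod.norm_def]) (v.smulRight onePoint)
  refine ⟨S, fun K x => ?_⟩
  rw [hS]
  simp [onePoint_apply, sliceR]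

theorem exists_app₂ (u : 𝓢(E, ℂ) →L[ℂ] ℂ) :
    ∃ S : 𝓢(E × F, ℂ) →L[ℂ] 𝓢(F, ℂ), ∀ K y, S K y = u (sliceL y K) := by
  obtain ⟨S, hS⟩ := exists_partialApply (.inl ℝ E F) (.inr ℝ E F)
    (0 : F →L[ℝ] EuclideanSpace ℝ (Fin 0)) norm_le_inl_add_inr (fun x y => by
      refine le_add_of_nonneg_of_le (norm_nonneg _) ?_
      simp [Prod.norm_def]) (u.smulRight onePoint)
  refine ⟨S, fun K x => ?_⟩
  rw [hS]
  simp [onePoint_apply, sliceL]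

/-- The functional `v` acting on the second variable. -/
def app₁ (v : 𝓢(F, ℂ) →L[ℂ] ℂ) : 𝓢(E × F, ℂ) →L[ℂ] 𝓢(E, ℂ) := (exists_app₁ v).choose

theorem app₁_apply (v : 𝓢(F, ℂ) →L[ℂ] ℂ) (K : 𝓢(E × F, ℂ)) (x : E) :
    app₁ v K x = v (sliceR x K) := (exists_app₁ v).choose_spec K x

/-- The functional `u` acting on the first variable. -/
def app₂ (u : 𝓢(E, ℂ) →L[ℂ] ℂ) : 𝓢(E × F, ℂ) →L[ℂ] 𝓢(F, ℂ) := (exists_app₂ u).choose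

theorem app₂_apply (u : 𝓢(E, ℂ) →L[ℂ] ℂ) (K : 𝓢(E × F, ℂ)) (y : F) :
    app₂ u K y = u (sliceL y K) := (exists_app₂ u).choose_spec K y

/-- Exchange the two variables. -/
def swapCLM : 𝓢(E × F, ℂ) →L[ℂ] 𝓢(F × E, ℂ) :=
  SchwartzMap.compCLMOfContinuousLinearEquiv ℂ (ContinuousLinearEquiv.prodComm ℝ F E)

omit [FiniteDimensional ℝ E] [FiniteDimensional ℝ F] in
@[simp]
theorem swapCLM_apply (K : 𝓢(E × F, ℂ)) (p : F × E) : swapCLM K p = K (p.2, p.1) := rfl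

theorem app₁_eq_app₂_swap (v : 𝓢(F, ℂ) →L[ℂ] ℂ) (K : 𝓢(E × F, ℂ)) :
    app₁ v K = app₂ v (swapCLM K) := by
  ext x
  rw [app₁_apply, app₂_apply]
  congr 1

theorem tendsto_shift_quotient (f : 𝓢(E, ℂ)) (v : E) :
    Tendsto (fun t : ℝ => ((t : ℂ))⁻¹ • (shift (t • v) f - f)) (𝓝[≠] 0) (𝓝 (∂_{v} f)) := by
  refine ((schwartz_withSeminorms ℂ E ℂ).tendsto_nhds _ _).2 fun ⟨m, n⟩ ε hε => ?_
  obtain ⟨C, hC, h⟩ := seminorm_shift_sub_sub_le f m n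
  have h1 : Tendsto (fun t : ℝ => ‖t • v‖) (𝓝[≠] 0) (𝓝 0) := by
    have : Tendsto (fun t : ℝ => ‖t • v‖) (𝓝 0) (𝓝 ‖(0 : ℝ) • v‖) :=
      Continuous.tendsto (by fun_prop) 0
    rw [zero_smul, norm_zero] at this
    exact this.mono_left nhdsWithin_le_nhds
  have h2 : Tendsto (fun t : ℝ => C * ‖v‖ * ‖t • v‖) (𝓝[≠] 0) (𝓝 0) := by
    simpa using h1.const_mul (C * ‖v‖)
  filter_upwards [h1.eventually (ge_mem_nhds zero_lt_one), h2.eventually (gt_mem_nhds hε),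
    self_mem_nhdsWithin] with t ht ht2 ht0
  have ht0 : t ≠ 0 := ht0
  refine lt_of_le_of_lt ?_ ht2
  have h3 : ((t : ℂ))⁻¹ • (shift (t • v) f - f) - ∂_{v} f
      = ((t : ℂ))⁻¹ • (shift (t • v) f - f - ∂_{t • v} f) := by
    ext x
    have : (t : ℂ) ≠ 0 := by exact_mod_cast ht0
    simp [lineDerivOp_left_smul, this, mul_sub]
  rw [h3, map_smul_eq_mul, norm_inv, Complex.norm_real]
  calc _ ≤ ‖t‖⁻¹ * (C * ‖t • v‖ ^ 2) := by gcongr; exact h _ ht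
    _ = C * ‖v‖ * ‖t • v‖ := by
      rw [norm_smul]
      have : ‖t‖ ≠ 0 := norm_ne_zero_iff.2 ht0
      field_simp

/-- `app₂ u` is continuous and intertwines the translations of the second variable, hence also the
limits of difference quotients. -/
theorem lineDerivOp_app₂ (u : 𝓢(E, ℂ) →L[ℂ] ℂ) (K : 𝓢(E × F, ℂ)) (v : F) :
    ∂_{v} (app₂ u K) = app₂ u (∂_{((0, v) : E × F)} K) := by
  have h1 := tendsto_shift_quotient (app₂ u K) v
  have h2 := ((app₂ (F := F) u).continuous.tendsto _).comp (tendsto_shift_quotient K ((0, v) : E × F))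
  refine tendsto_nhds_unique h1 (h2.congr fun t => ?_)
  ext y
  simp only [Function.comp_apply, map_smul, map_sub, smul_apply, sub_apply, shift_apply, app₂_apply]
  congr 3
  ext x
  simp

theorem iteratedLineDerivOp_app₂ (u : 𝓢(E, ℂ) →L[ℂ] ℂ) (K : 𝓢(E × F, ℂ)) {n : ℕ} (m : Fin n → F) :
    ∂^{m} (app₂ u K) = app₂ u (∂^{fun i => ((0, m i) : E × F)} K) := by
  induction n with
  | zero => rfl
  | succ n ih =>
    rw [iteratedLineDerivOp_succ_left, iteratedLineDerivOp_succ_left, ih, lineDerivOp_app₂]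
    rfl

omit [FiniteDimensional ℝ E] [FiniteDimensional ℝ F] in
-- Distant slices of a Schwartz function are small enough to compensate any polynomial weight. A
-- strong bound of `u` on such sets becomes a Schwartz seminorm bound of `app₂ u K`.
theorem isVonNBounded_range_slice (K : 𝓢(E × F, ℂ)) (m : ℕ) :
    Bornology.IsVonNBounded ℂ (Set.range fun y : F => ((‖y‖ ^ m : ℝ) : ℂ) • sliceL y K) := by
  refine ((schwartz_withSeminorms ℂ E ℂ).isVonNBounded_iff_seminorm_bounded).2 fun ⟨a, b⟩ =>
    ⟨‖ContinuousLinearMap.inl ℝ E F‖ ^ b * SchwartzMap.seminorm ℂ (m + a) b K + 1,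
      by positivity, ?_⟩
  rintro _ ⟨y, rfl⟩
  refine lt_of_le_of_lt ?_ (lt_add_one _)
  have := pow_mul_seminorm_affineSlice_le (.inl ℝ E F) (.inr ℝ E F) norm_le_inl_add_inr y ‖y‖
    (norm_nonneg _) (fun x => by simp [Prod.norm_def]) K m a b
  refine le_trans (le_of_eq ?_) this
  simp only [map_smul_eq_mul, Complex.norm_real, norm_pow, norm_norm]
  rfl

theorem norm_pow_mul_iteratedLineDerivOp_app₂ (K : 𝓢(E × F, ℂ)) (u : 𝓢(E, ℂ) →L[ℂ] ℂ) (m : ℕ)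
    {n : ℕ} (r : Fin n → F) (y : F) : ‖y‖ ^ m * ‖(∂^{r} (app₂ u K) : 𝓢(F, ℂ)) y‖ =
      ‖u (((‖y‖ ^ m : ℝ) : ℂ) • sliceL y (∂^{fun a => ((0, r a) : E × F)} K))‖ := by
  rw [map_smul, norm_smul, Complex.norm_real, norm_pow, norm_norm, iteratedLineDerivOp_app₂,
    app₂_apply]

/-- `app₂ u K` is continuous in `u` for the strong topology. -/
theorem exists_bound_seminorm_app₂ (K : 𝓢(E × F, ℂ)) (m n : ℕ) :
    ∃ (B : Set 𝓢(E, ℂ)) (C : ℝ), Bornology.IsVonNBounded ℂ B ∧ 0 ≤ C ∧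
      ∀ (u : 𝓢(E, ℂ) →L[ℂ] ℂ) (M : ℝ), 0 ≤ M → (∀ f ∈ B, ‖u f‖ ≤ M) →
        SchwartzMap.seminorm ℂ m n (app₂ u K) ≤ C * M := by
  obtain ⟨D, hD0, hD⟩ := exists_seminorm_le (E := F) m n
  refine ⟨⋃ r : Fin n → Fin (Module.finrank ℝ F), Set.range fun y : F => ((‖y‖ ^ m : ℝ) : ℂ) •
      sliceL y (∂^{fun a => ((0, Module.finBasis ℝ F (r a)) : E × F)} K), D,
    Bornology.isVonNBounded_iUnion.2 fun r => isVonNBounded_range_slice _ _, hD0,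
    fun u M hM hu => hD _ M hM fun r y => ?_⟩
  rw [norm_pow_mul_iteratedLineDerivOp_app₂]
  exact hu _ (Set.mem_iUnion_of_mem r ⟨y, rfl⟩)

/-- `app₂ u K` is continuous in `K`, uniformly for `u` in an equicontinuous set. -/
theorem exists_seminorm_app₂_le (s : Finset (ℕ × ℕ)) (C : ℝ) (hC : 0 ≤ C) (m n : ℕ) :
    ∃ N : 𝓢(E × F, ℂ) → ℝ, Continuous N ∧ N 0 = 0 ∧ ∀ K (u : 𝓢(E, ℂ) →L[ℂ] ℂ),
      (∀ f, ‖u f‖ ≤ C * ∑ i ∈ s, SchwartzMap.seminorm ℂ i.1 i.2 f) →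
        SchwartzMap.seminorm ℂ m n (app₂ u K) ≤ N K := by
  obtain ⟨D, hD0, hD⟩ := exists_seminorm_le (E := F) m n
  let dK : (Fin n → Fin (Module.finrank ℝ F)) → 𝓢(E × F, ℂ) →L[ℂ] 𝓢(E × F, ℂ) := fun r =>
    iteratedLineDerivOpCLM ℂ 𝓢(E × F, ℂ) fun a => ((0, Module.finBasis ℝ F (r a)) : E × F)
  let N : 𝓢(E × F, ℂ) → ℝ := fun K => ∑ r, C * ∑ i ∈ s, ‖ContinuousLinearMap.inl ℝ E F‖ ^ i.2 *
    SchwartzMap.seminorm ℂ (m + i.1) i.2 (dK r K)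
  have hN : ∀ K r, 0 ≤ C * ∑ i ∈ s, ‖ContinuousLinearMap.inl ℝ E F‖ ^ i.2 *
      SchwartzMap.seminorm ℂ (m + i.1) i.2 (dK r K) := fun K r => by positivity
  refine ⟨fun K => D * N K, ?_, by simp [N], fun K u hu => hD _ _
    (Finset.sum_nonneg fun r _ => hN K r) fun r y => ?_⟩
  · refine continuous_const.mul (continuous_finsetSum _ fun r _ => continuous_const.mul
      (continuous_finsetSum _ fun i _ => continuous_const.mul ?_))
    exact ((schwartz_withSeminorms ℂ (E × F) ℂ).continuous_seminorm (m + i.1, i.2)).comp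
      (dK r).continuous
  · rw [norm_pow_mul_iteratedLineDerivOp_app₂]
    refine (hu _).trans (le_trans ?_ (Finset.single_le_sum (fun r _ => hN K r) (Finset.mem_univ r)))
    refine mul_le_mul_of_nonneg_left (Finset.sum_le_sum fun i _ => ?_) hC
    refine le_trans (le_of_eq ?_) (pow_mul_seminorm_affineSlice_le (.inl ℝ E F) (.inr ℝ E F)
      norm_le_inl_add_inr y ‖y‖ (norm_nonneg _) (fun x => by simp [Prod.norm_def]) (dK r K) m i.1 i.2)
    simp only [map_smul_eq_mul, Complex.norm_real, norm_pow, norm_norm]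
    rfl

/-- `v (app₂ u K)` is continuous in `u` for the strong topology. -/
theorem exists_bound_app₂ (K : 𝓢(E × F, ℂ)) (v : 𝓢(F, ℂ) →L[ℂ] ℂ) :
    ∃ (B : Set 𝓢(E, ℂ)) (C : ℝ), Bornology.IsVonNBounded ℂ B ∧ 0 ≤ C ∧
      ∀ (u : 𝓢(E, ℂ) →L[ℂ] ℂ) (M : ℝ), 0 ≤ M → (∀ f ∈ B, ‖u f‖ ≤ M) → ‖v (app₂ u K)‖ ≤ C * M := by
  obtain ⟨s, C, hC, hv⟩ := exists_seminorm_functional_le v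
  choose B D hB hD0 hD using fun i : ℕ × ℕ => exists_bound_seminorm_app₂ K i.1 i.2
  refine ⟨⋃ i ∈ s, B i, C * ∑ i ∈ s, D i,
    (Bornology.isVonNBounded_biUnion s.finite_toSet).2 fun i _ => hB i,
    mul_nonneg hC (Finset.sum_nonneg fun i _ => hD0 i), fun u M hM hu => (hv _).trans ?_⟩
  rw [mul_assoc, Finset.sum_mul]
  exact mul_le_mul_of_nonneg_left (Finset.sum_le_sum fun i hi => hD i u M hM fun f hf =>
    hu f (Set.mem_biUnion hi hf)) hC

/-- Integration against a Schwartz function. -/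
def integralAgainst {W : Type*} [NormedAddCommGroup W] [NormedSpace ℝ W] [FiniteDimensional ℝ W]
    [MeasurableSpace W] [BorelSpace W] (μ : Measure W) [μ.IsAddHaarMeasure] (g : 𝓢(W, ℂ)) :
    𝓢(W, ℂ) →L[ℂ] ℂ :=
  (SchwartzMap.integralCLM ℂ μ).comp (SchwartzMap.smulLeftCLM ℂ g)

theorem integralAgainst_apply {W : Type*} [NormedAddCommGroup W] [NormedSpace ℝ W]
    [FiniteDimensional ℝ W] [MeasurableSpace W] [BorelSpace W] (μ : Measure W)
    [μ.IsAddHaarMeasure] (f g : 𝓢(W, ℂ)) :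
    integralAgainst μ g f = ∫ x, f x * g x ∂μ := by
  simp [integralAgainst, SchwartzMap.integralCLM_apply,
    SchwartzMap.smulLeftCLM_apply_apply g.hasTemperateGrowth, mul_comm]

theorem integralAgainst_app_comm [MeasurableSpace E] [BorelSpace E] [MeasurableSpace F]
    [BorelSpace F] (μ : Measure E) [μ.IsAddHaarMeasure] (ν : Measure F) [ν.IsAddHaarMeasure]
    (g : 𝓢(E, ℂ)) (h : 𝓢(F, ℂ)) (K : 𝓢(E × F, ℂ)) :
    integralAgainst μ g (app₁ (integralAgainst ν h) K) =
      integralAgainst ν h (app₂ (integralAgainst μ g) K) := by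
  simp only [integralAgainst_apply, app₁_apply, app₂_apply, sliceL_apply, sliceR_apply,
    ← integral_mul_const]
  have := integral_integral_swap (f := fun x y => K (x, y) * h y * g x) (μ := μ) (ν := ν) (by
    refine (integrable_mul (μ.prod ν) K (tensor g h)).congr (Eventually.of_forall fun p => ?_)
    simp only [tensor_apply, Function.uncurry]
    ring)
  rw [this]
  congr 1 with y
  congr 1 with x
  ring

/-- Fubini's theorem for tempered distributions. -/
theorem app_comm (u : 𝓢(E, ℂ) →L[ℂ] ℂ) (v : 𝓢(F, ℂ) →L[ℂ] ℂ) (K : 𝓢(E × F, ℂ)) :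
    u (app₁ v K) = v (app₂ u K) := by
  borelize E
  borelize F
  let μ : Measure E := Measure.addHaar
  let ν : Measure F := Measure.addHaar
  -- The distributions are approximated one after the other. Here `u` is an integral and `v` is
  -- approximated by integrals, for which Fubini's classical theorem holds. The approximation is
  -- needed both on the bounded set that controls `app₁ v K` and at the one function to which `v` is
  -- applied.
  have key : ∀ g : 𝓢(E, ℂ), integralAgainst μ g (app₁ v K) = v (app₂ (integralAgainst μ g) K) := by
    intro g
    obtain ⟨B, C, hB, hC, h⟩ := exists_bound_app₂ (swapCLM K) (integralAgainst μ g)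
    rw [← sub_eq_zero, ← norm_le_zero_iff]
    refine le_of_forall_pos_le_add fun ε hε => ?_
    obtain ⟨w, hw⟩ := exists_integral_approx ν v (B ∪ {app₂ (integralAgainst μ g) K})
      (hB.union (Bornology.isVonNBounded_singleton _)) (ε / (C + 1)) (by positivity)
    simp only [← integralAgainst_apply ν] at hw
    have h1 := h (v - integralAgainst ν w) (ε / (C + 1)) (by positivity) fun f hf => hw f (Or.inl hf)
    have h2 := hw _ (Or.inr rfl)
    rw [← app₁_eq_app₂_swap] at h1
    have h3 : app₁ (v - integralAgainst ν w) K = app₁ v K - app₁ (integralAgainst ν w) K := by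
      ext x
      simp [app₁_apply]
    rw [h3, map_sub, integralAgainst_app_comm μ ν g w K] at h1
    rw [norm_sub_rev] at h2
    have h4 := norm_add_le (integralAgainst μ g (app₁ v K) -
      integralAgainst ν w (app₂ (integralAgainst μ g) K))
      (integralAgainst ν w (app₂ (integralAgainst μ g) K) - v (app₂ (integralAgainst μ g) K))
    rw [sub_add_sub_cancel] at h4
    have h5 : C * (ε / (C + 1)) + ε / (C + 1) = ε := by field_simp
    linarith
  obtain ⟨B, C, hB, hC, h⟩ := exists_bound_app₂ K v
  rw [← sub_eq_zero, ← norm_le_zero_iff]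
  refine le_of_forall_pos_le_add fun ε hε => ?_
  obtain ⟨w, hw⟩ := exists_integral_approx μ u (B ∪ {app₁ v K})
    (hB.union (Bornology.isVonNBounded_singleton _)) (ε / (C + 1)) (by positivity)
  simp only [← integralAgainst_apply μ] at hw
  have h1 := h (u - integralAgainst μ w) (ε / (C + 1)) (by positivity) fun f hf => hw f (Or.inl hf)
  have h2 := hw _ (Or.inr rfl)
  have h3 : app₂ (u - integralAgainst μ w) K = app₂ u K - app₂ (integralAgainst μ w) K := by
    ext x
    simp [app₂_apply]
  rw [h3, map_sub, ← key, norm_sub_rev] at h1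
  have h4 := norm_add_le (u (app₁ v K) - integralAgainst μ w (app₁ v K))
    (integralAgainst μ w (app₁ v K) - v (app₂ u K))
  rw [sub_add_sub_cancel] at h4
  have h5 : C * (ε / (C + 1)) + ε / (C + 1) = ε := by field_simp
  linarith

/-- Operators that act on different variables commute. -/
theorem left_right_comm (T : 𝓢(E, ℂ) →L[ℂ] 𝓢(E', ℂ)) (S : 𝓢(F, ℂ) →L[ℂ] 𝓢(F', ℂ))
    (K : 𝓢(E × F, ℂ)) : left T (right S K) = right S (left T K) := by
  ext p
  have h1 : sliceL p.2 (right S K) = app₁ ((evalS p.2).comp S) K := by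
    ext z
    simp [right_apply, app₁_apply]
  have h2 : sliceR p.1 (left T K) = app₂ ((evalS p.1).comp T) K := by
    ext z
    simp [left_apply, app₂_apply]
  rw [left_apply, right_apply, h1, h2]
  exact app_comm ((evalS p.1).comp T) ((evalS p.2).comp S) K

theorem left_tensor (T : 𝓢(E, ℂ) →L[ℂ] 𝓢(E', ℂ)) (f : 𝓢(E, ℂ)) (g : 𝓢(F, ℂ)) :
    left T (tensor f g) = tensor (T f) g := by
  ext p
  have : sliceL p.2 (tensor f g) = g p.2 • f := by
    ext x
    simp [mul_comm]
  simp [left_apply, this, mul_comm]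

theorem right_tensor (T : 𝓢(F, ℂ) →L[ℂ] 𝓢(F', ℂ)) (f : 𝓢(E, ℂ)) (g : 𝓢(F, ℂ)) :
    right T (tensor f g) = tensor f (T g) := by
  ext p
  have : sliceR p.1 (tensor f g) = f p.1 • g := by
    ext x
    simp
  simp [right_apply, this]

end Tensor

/-! ### Tensor products determine functionals -/

section Separation

variable {E F : Type*} [NormedAddCommGroup E] [NormedSpace ℝ E] [FiniteDimensional ℝ E]
  [NormedAddCommGroup F] [NormedSpace ℝ F] [FiniteDimensional ℝ F]

/-- Nonnegative test functions with small support. -/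
theorem exists_bump (c : E) (r : ℝ) (hr : 0 < r) : ∃ (ρ : 𝓢(E, ℂ)) (f : E → ℝ),
    (∀ x, ρ x = f x) ∧ (∀ x, 0 ≤ f x) ∧ (∀ x, r ≤ dist x c → f x = 0) ∧ f c = 1 ∧
      HasCompactSupport ρ := by
  let b : ContDiffBump c := ⟨r / 2, r, by positivity, by linarith⟩
  have hb : HasCompactSupport fun x => ((b x : ℝ) : ℂ) :=
    b.hasCompactSupport.comp_left (g := fun t : ℝ => (t : ℂ)) (by simp)
  have hd : ContDiff ℝ (⊤ : ℕ∞) fun x => ((b x : ℝ) : ℂ) :=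
    Complex.ofRealCLM.contDiff.comp b.contDiff
  refine ⟨hb.toSchwartzMap hd, b, fun x => rfl, fun x => b.nonneg, fun x hx =>
    b.zero_of_le_dist hx, b.one_of_mem_closedBall ?_, hb⟩
  simp only [Metric.mem_closedBall, dist_self]
  exact b.rIn_pos.le

/-- A Schwartz function vanishes at `c` if its integrals against nonnegative functions that are
concentrated near `c` vanish. -/
theorem apply_eq_zero_of_integral {W : Type*} [NormedAddCommGroup W] [NormedSpace ℝ W]
    [FiniteDimensional ℝ W] [MeasurableSpace W] [BorelSpace W] (μ : Measure W) [μ.IsAddHaarMeasure]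
    (s : 𝓢(W, ℂ)) (c : W) (h : ∀ r > 0, ∃ (b : 𝓢(W, ℂ)) (f : W → ℝ), (∀ x, b x = f x) ∧
      (∀ x, 0 ≤ f x) ∧ (∀ x, r ≤ dist x c → f x = 0) ∧ 0 < f c ∧ ∫ x, s x * b x ∂μ = 0) :
    s c = 0 := by
  by_contra hp
  -- Multiplication by the conjugate of `s c` makes the real part of the integrand nonnegative on a
  -- ball around `c` and positive at `c`.
  have hc : Continuous fun q => (s q * starRingEnd ℂ (s c)).re :=
    Complex.continuous_re.comp (s.continuous.mul continuous_const)
  have h0 : 0 < (s c * starRingEnd ℂ (s c)).re := by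
    rw [Complex.mul_conj]
    simpa using hp
  obtain ⟨r, hr, hball⟩ := Metric.mem_nhds_iff.1
    (hc.continuousAt.eventually (lt_mem_nhds h0))
  obtain ⟨b, f, hb, hf0, hf, hfc, hz⟩ := h r hr
  have hi := integrable_mul μ s b
  have hre : ∀ q, (s q * b q * starRingEnd ℂ (s c)).re = (s q * starRingEnd ℂ (s c)).re * f q :=
    fun q => by
      have : s q * b q * starRingEnd ℂ (s c) = s q * starRingEnd ℂ (s c) * (f q : ℂ) := by
        rw [hb]
        ring
      rw [this, Complex.re_mul_ofReal]
  have hi' : Integrable (fun q => (s q * starRingEnd ℂ (s c)).re * f q) μ :=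
    (hi.mul_const (starRingEnd ℂ (s c))).re.congr (Eventually.of_forall hre)
  have hz' : ∫ q, (s q * starRingEnd ℂ (s c)).re * f q ∂μ = 0 := by
    have h2 : ∫ q, s q * b q * starRingEnd ℂ (s c) ∂μ = 0 := by
      rw [integral_mul_const, hz, zero_mul]
    have h3 := congrArg (RCLike.re : ℂ → ℝ) h2
    rw [← integral_re (hi.mul_const _), map_zero] at h3
    rw [← h3]
    congr 1 with q
    exact (hre q).symm
  have hnn : ∀ q, 0 ≤ (s q * starRingEnd ℂ (s c)).re * f q := fun q => by
    by_cases hq : q ∈ Metric.ball c r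
    · exact mul_nonneg (hball hq).le (hf0 _)
    · rw [hf q (not_lt.1 hq), mul_zero]
  have hfcont : Continuous f := by
    have : f = fun x => (b x).re := by ext x; simp [hb]
    rw [this]
    exact Complex.continuous_re.comp b.continuous
  have h4 := (integral_eq_zero_iff_of_nonneg hnn hi').1 hz'
  have h5 := (Continuous.ae_eq_iff_eq μ (hc.mul hfcont) continuous_zero).1 h4
  exact (mul_pos h0 hfc).ne' (congrFun h5 c)

/-- Schwartz functions are determined by their integrals against tensor products. -/
theorem eq_zero_of_integral_tensor [MeasurableSpace E] [BorelSpace E] [MeasurableSpace F]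
    [BorelSpace F] (μ : Measure E) [μ.IsAddHaarMeasure] (ν : Measure F) [ν.IsAddHaarMeasure]
    (s : 𝓢(E × F, ℂ)) (h : ∀ ρ σ, ∫ p, s p * tensor ρ σ p ∂(μ.prod ν) = 0) : s = 0 := by
  ext p
  refine apply_eq_zero_of_integral (μ.prod ν) s p fun r hr => ?_
  obtain ⟨ρ, f, hρ, hf0, hf, hf1, -⟩ := exists_bump p.1 r hr
  obtain ⟨σ, g, hσ, hg0, hg, hg1, -⟩ := exists_bump p.2 r hr
  refine ⟨tensor ρ σ, fun q => f q.1 * g q.2, fun q => by simp [hρ, hσ],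
    fun q => mul_nonneg (hf0 _) (hg0 _), fun q hq => ?_, by simp [hf1, hg1], h ρ σ⟩
  rw [Prod.dist_eq, le_max_iff] at hq
  rcases hq with hq | hq
  · simp [hf _ hq]
  · simp [hg _ hq]

/-- The change of variables `(z, w) ↦ (z, w - z)`. -/
def shearEquiv (G : Type*) [NormedAddCommGroup G] [NormedSpace ℝ G] : (G × G) ≃L[ℝ] (G × G) where
  toFun p := (p.1, p.2 - p.1)
  invFun p := (p.1, p.2 + p.1)
  map_add' p q := by ext <;> simp; abel
  map_smul' c p := by ext <;> simp [smul_sub]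
  left_inv p := by simp
  right_inv p := by simp
  continuous_toFun := by fun_prop
  continuous_invFun := by fun_prop

/-- Functionals on Schwartz functions of two variables are determined by their values on tensor
products. -/
theorem functional_eq_zero_of_tensor (u : 𝓢(E × F, ℂ) →L[ℂ] ℂ)
    (hu : ∀ f g, u (tensor f g) = 0) : u = 0 := by
  borelize E
  borelize F
  let μ : Measure E := Measure.addHaar
  let ν : Measure F := Measure.addHaar
  -- `M f g (z, w) = f z * g (w - z)`: integration over `z` yields the convolution of `f` and `g`,
  -- while for fixed `z` the slice is a multiple of a translate of `g`.
  let M : 𝓢(E × F, ℂ) → 𝓢(E × F, ℂ) → 𝓢((E × F) × (E × F), ℂ) := fun f g =>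
    SchwartzMap.compCLMOfContinuousLinearEquiv ℂ (shearEquiv (E × F)) (tensor f g)
  have hM : ∀ f g z w, M f g (z, w) = f z * g (w - z) := fun f g z w => by
    simp [M, shearEquiv]
  have hr : ∀ f g z, sliceR z (M f g) = f z • shift (-z) g := fun f g z => by
    ext w
    simp [hM, sub_eq_add_neg]
  let I : 𝓢(E × F, ℂ) →L[ℂ] ℂ := SchwartzMap.integralCLM ℂ (μ.prod ν)
  have hI : ∀ f, I f = ∫ z, f z ∂(μ.prod ν) := fun f => SchwartzMap.integralCLM_apply ℂ f
  have hint : ∀ f g, app₂ I (M f g) = app₂ I (M g f) := fun f g => by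
    ext w
    simp only [app₂_apply, hI, sliceL_apply, hM]
    rw [← integral_sub_left_eq_self _ (μ.prod ν) w]
    congr 1 with z
    rw [sub_sub_cancel, mul_comm]
  -- Convolution is commutative and the integral commutes with `u`, so `K` and `tensor ρ σ` may be
  -- exchanged. Then every slice is a multiple of a translated tensor product, which `u`
  -- annihilates.
  have hvan : ∀ K ρ σ, ∫ z, app₁ u (M (tensor ρ σ) K) z ∂(μ.prod ν) = 0 := fun K ρ σ => by
    rw [← hI, app_comm, hint, ← app_comm, hI]
    refine integral_eq_zero_of_ae (Eventually.of_forall fun z => ?_)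
    have : shift (-z) (tensor ρ σ) = tensor (shift (-z.1) ρ) (shift (-z.2) σ) := by
      ext w
      simp
    simp [app₁_apply, hr, this, hu]
  ext K
  obtain ⟨ρ₀, f, hρ, -, -, hf1, -⟩ := exists_bump (0 : E) 1 one_pos
  obtain ⟨σ₀, g, hσ, -, -, hg1, -⟩ := exists_bump (0 : F) 1 one_pos
  -- The cutoff `tensor ρ₀ σ₀` makes `z ↦ u (K (· - z))` a Schwartz function. It is orthogonal to
  -- all tensor products, and at `z = 0`, where the cutoff is one, its value is `u K`.
  have hs : app₁ u (M (tensor ρ₀ σ₀) K) = 0 := by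
    refine eq_zero_of_integral_tensor μ ν _ fun ρ σ => ?_
    rw [← hvan K (SchwartzMap.smulLeftCLM ℂ ρ ρ₀) (SchwartzMap.smulLeftCLM ℂ σ σ₀)]
    congr 1 with z
    simp only [app₁_apply, hr, map_smul, smul_eq_mul, tensor_apply,
      SchwartzMap.smulLeftCLM_apply_apply ρ.hasTemperateGrowth,
      SchwartzMap.smulLeftCLM_apply_apply σ.hasTemperateGrowth]
    ring
  have h0 := DFunLike.congr_fun hs 0
  have hK : shift (-(0 : E × F)) K = K := by
    ext z
    simp
  rw [app₁_apply, hr, hK, tensor_apply] at h0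
  simpa [hρ, hσ, hf1, hg1] using h0

/-- Functionals on Schwartz functions of two variables are determined by their values on tensor
products. -/
theorem functional_ext_tensor (u v : 𝓢(E × F, ℂ) →L[ℂ] ℂ)
    (h : ∀ f g, u (tensor f g) = v (tensor f g)) : u = v :=
  sub_eq_zero.1 (functional_eq_zero_of_tensor (u - v) fun f g => by simp [h f g])

end Separation

/-! ### Traces as integrals over the diagonal, and cyclicity -/

section Diagonal

variable {E : Type*} [NormedAddCommGroup E] [NormedSpace ℝ E] [FiniteDimensional ℝ E]
  [MeasureSpace E] [BorelSpace E] [(volume : Measure E).IsAddHaarMeasure]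

/-- Restriction to the diagonal. -/
def diagCLM (E : Type*) [NormedAddCommGroup E] [NormedSpace ℝ E] : 𝓢(E × E, ℂ) →L[ℂ] 𝓢(E, ℂ) :=
  SchwartzMap.compCLMOfAntilipschitz ℂ (g := ContinuousLinearMap.prod (.id ℝ E) (.id ℝ E)) (K := 1)
    (ContinuousLinearMap.hasTemperateGrowth _)
    (AntilipschitzWith.of_le_mul_dist fun y z => by simp [Prod.dist_eq])

omit [FiniteDimensional ℝ E] [MeasureSpace E] [BorelSpace E]
  [(volume : Measure E).IsAddHaarMeasure] in
theorem diagCLM_apply (K : 𝓢(E × E, ℂ)) (x : E) : diagCLM E K x = K (x, x) := rfl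

/-- The integral over the diagonal. -/
def diagInt (E : Type*) [NormedAddCommGroup E] [NormedSpace ℝ E] [FiniteDimensional ℝ E]
    [MeasureSpace E] [BorelSpace E] [(volume : Measure E).IsAddHaarMeasure] :
    𝓢(E × E, ℂ) →L[ℂ] ℂ :=
  (SchwartzMap.integralCLM ℂ (volume : Measure E)).comp (diagCLM E)

theorem diagInt_apply (K : 𝓢(E × E, ℂ)) : diagInt E K = ∫ x, K (x, x) := by
  simp [diagInt, SchwartzMap.integralCLM_apply, diagCLM_apply]

/-- Cyclicity of the trace. -/
theorem diagInt_left (T T' : 𝓢(E, ℂ) →L[ℂ] 𝓢(E, ℂ))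
    (h : ∀ f g, ∫ x, T f x * g x = ∫ x, f x * T' g x) (K : 𝓢(E × E, ℂ)) :
    diagInt E (left T K) = diagInt E (right T' K) := by
  have := functional_ext_tensor ((diagInt E).comp (left T)) ((diagInt E).comp (right T'))
    fun f g => by
      simp [diagInt_apply, left_tensor, right_tensor, h]
  exact DFunLike.congr_fun this K

end Diagonal

/-! ### The projection onto bosonic functions -/

section Symmetrization

variable {d n : ℕ}

/-- Permutation of the variables. -/
def permE (d : ℕ) {n : ℕ} (π : Equiv.Perm (Fin n)) : Conf d n ≃L[ℝ] Conf d n :=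
  (LinearEquiv.funCongrLeft ℝ (EuclideanSpace ℝ (Fin d)) π).toContinuousLinearEquiv

/-- Permutation of the variables of a function. -/
def permS (d : ℕ) {n : ℕ} (π : Equiv.Perm (Fin n)) : 𝓢(Conf d n, ℂ) →L[ℂ] 𝓢(Conf d n, ℂ) :=
  SchwartzMap.compCLMOfContinuousLinearEquiv ℂ (permE d π)

@[simp]
theorem permS_apply (π : Equiv.Perm (Fin n)) (f : 𝓢(Conf d n, ℂ)) (x : Conf d n) :
    permS d π f x = f (x ∘ π) := rfl

/-- The projection onto the bosonic Schwartz functions. -/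
def sym (d n : ℕ) : 𝓢(Conf d n, ℂ) →L[ℂ] Ss d n :=
  (((n.factorial : ℂ))⁻¹ • ∑ π : Equiv.Perm (Fin n), permS d π).codRestrict
    (bosonicSchwartz d n) fun f σ x => by
      simp only [smul_apply, sum_apply, permS_apply]
      congr 1
      exact Equiv.sum_comp (Equiv.mulLeft σ) fun π => f (x ∘ π)

theorem sym_apply (f : 𝓢(Conf d n, ℂ)) (x : Conf d n) :
    (sym d n f).1 x = ((n.factorial : ℂ))⁻¹ * ∑ π : Equiv.Perm (Fin n), f (x ∘ π) := by
  change (((n.factorial : ℂ))⁻¹ • ∑ π : Equiv.Perm (Fin n), permS d π : _ →L[ℂ] _) f x = _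
  simp only [smul_apply, sum_apply, permS_apply, smul_eq_mul]

theorem sym_of_symm (f : 𝓢(Conf d n, ℂ)) (hf : ∀ (π : Equiv.Perm (Fin n)) x, f (x ∘ π) = f x) :
    (sym d n f).1 = f := by
  ext x
  rw [sym_apply]
  simp_rw [hf]
  have : (n.factorial : ℂ) ≠ 0 := by exact_mod_cast n.factorial_ne_zero
  simp [Fintype.card_perm, this]

@[simp]
theorem sym_coe (f : Ss d n) : sym d n f.1 = f := Subtype.ext (sym_of_symm f.1 f.2)

theorem integral_comp_perm (π : Equiv.Perm (Fin n)) (f : Conf d n → ℂ) :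
    ∫ x, f (x ∘ π) = ∫ x, f x := by
  have h := volume_measurePreserving_piCongrLeft
    (fun _ : Fin n => EuclideanSpace ℝ (Fin d)) π.symm
  have h2 := h.integral_comp (MeasurableEquiv.measurableEmbedding _) f
  rw [← h2]
  congr 1 with x
  congr 1
  ext i : 1
  have := MeasurableEquiv.piCongrLeft_apply_apply π.symm
    (β := fun _ : Fin n => EuclideanSpace ℝ (Fin d)) x (π i)
  rw [Equiv.symm_apply_apply] at this
  exact this.symm

theorem integral_sym_mul (f g : 𝓢(Conf d n, ℂ)) :
    ∫ x, (sym d n f).1 x * g x = ∫ x, f x * (sym d n g).1 x := by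
  have h1 : ∫ x, (sym d n f).1 x * g x =
      ((n.factorial : ℂ))⁻¹ * ∑ π : Equiv.Perm (Fin n), ∫ x, permS d π f x * g x := by
    rw [← integral_finsetSum _ fun π _ => integrable_mul volume (permS d π f) g,
      ← integral_const_mul]
    simp only [sym_apply, mul_assoc, Finset.sum_mul, permS_apply]
  have h2 : ∫ x, f x * (sym d n g).1 x =
      ((n.factorial : ℂ))⁻¹ * ∑ π : Equiv.Perm (Fin n), ∫ x, f x * permS d π g x := by
    rw [← integral_finsetSum _ fun π _ => integrable_mul volume f (permS d π g),
      ← integral_const_mul]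
    simp only [sym_apply, mul_left_comm (f _), Finset.mul_sum, permS_apply]
  rw [h1, h2, ← Equiv.sum_comp (Equiv.inv _)]
  congr 1
  refine Finset.sum_congr rfl fun π _ => ?_
  rw [← integral_comp_perm π]
  congr 1 with x
  rw [permS_apply, permS_apply]
  congr 2
  ext i : 1
  simp

/-- An operator on bosonic Schwartz functions, extended by zero on the complement. -/
def lift (A : Ss d n →L[ℂ] Ss d n) : 𝓢(Conf d n, ℂ) →L[ℂ] 𝓢(Conf d n, ℂ) :=
  (bosonicSchwartz d n).subtypeL.comp (A.comp (sym d n))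

theorem lift_apply (A : Ss d n →L[ℂ] Ss d n) (f : 𝓢(Conf d n, ℂ)) :
    lift A f = (A (sym d n f)).1 := rfl

@[simp]
theorem lift_coe (A : Ss d n →L[ℂ] Ss d n) (f : Ss d n) : lift A f.1 = (A f).1 := by
  rw [lift_apply, sym_coe]

@[simp]
theorem sym_lift (A : Ss d n →L[ℂ] Ss d n) (f : 𝓢(Conf d n, ℂ)) :
    sym d n (lift A f) = A (sym d n f) := by
  rw [lift_apply, sym_coe]

@[simp]
theorem conjS_coe (f : Ss d n) : (conjS f).1 = conjW f.1 := rfl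

theorem conjS_conjS (f : Ss d n) : conjS (conjS f) = f := by
  apply Subtype.ext
  ext x
  simp

theorem conjS_sym (f : 𝓢(Conf d n, ℂ)) : conjS (sym d n f) = sym d n (conjW f) := by
  apply Subtype.ext
  ext x
  simp [sym_apply]

end Symmetrization

/-! ### Bounded sets and density in the strong dual of the bosonic Schwartz space -/

section StrongDual

variable {d n : ℕ}

theorem isVonNBounded_of_norm_le (U : Set (SsDual d n))
    (h : ∀ B : Set (Ss d n), Bornology.IsVonNBounded ℂ B → ∃ C : ℝ, ∀ u ∈ U, ∀ f ∈ B, ‖u f‖ ≤ C) :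
    Bornology.IsVonNBounded ℂ U := by
  refine ContinuousLinearMap.isVonNBounded_iff.2 fun B hB => ?_
  obtain ⟨C, hC⟩ := h B hB
  refine (NormedSpace.isVonNBounded_iff' ℂ).2 ⟨C, ?_⟩
  rintro _ ⟨u, hu, f, hf, rfl⟩
  exact hC u hu f hf

theorem exists_norm_le_of_isVonNBounded {U : Set (SsDual d n)} (hU : Bornology.IsVonNBounded ℂ U)
    {B : Set (Ss d n)} (hB : Bornology.IsVonNBounded ℂ B) :
    ∃ C : ℝ, ∀ u ∈ U, ∀ f ∈ B, ‖u f‖ ≤ C := by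
  obtain ⟨C, hC⟩ := (NormedSpace.isVonNBounded_iff' ℂ).1
    (ContinuousLinearMap.isVonNBounded_iff.1 hU B hB)
  exact ⟨C, fun u hu f hf => hC _ ⟨u, hu, f, hf, rfl⟩⟩

/-- Continuous seminorms on the strong dual are controlled by suprema over bounded sets. -/
theorem exists_bounded_of_seminorm (Q : Seminorm ℂ (SsDual d n)) (hQ : Continuous Q) :
    ∃ (B : Set (Ss d n)) (C : ℝ), Bornology.IsVonNBounded ℂ B ∧ 0 ≤ C ∧
      ∀ (w : SsDual d n) (M : ℝ), 0 ≤ M → (∀ f ∈ B, ‖w f‖ ≤ M) → Q w ≤ C * M := by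
  have h1 : {w | Q w < 1} ∈ 𝓝 (0 : SsDual d n) := by
    have := hQ.tendsto 0
    rw [map_zero] at this
    exact this.eventually (gt_mem_nhds one_pos)
  obtain ⟨⟨B, V⟩, ⟨hB, hV⟩, hBV⟩ := ContinuousLinearMap.hasBasis_nhds_zero.mem_iff.1 h1
  obtain ⟨ε, hε, hεV⟩ := Metric.mem_nhds_iff.1 hV
  refine ⟨B, 2 / ε, hB, by positivity, fun w M hM hw => ?_⟩
  -- The scaling divides by the bound, and `M` may be zero; so `M + η` is used and `η` tends to
  -- zero.
  have key : ∀ η > 0, Q w ≤ 2 / ε * (M + η) := fun η hη => by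
    have hpos : 0 < ε / (2 * (M + η)) := by positivity
    have h2 : Q (((ε / (2 * (M + η)) : ℝ) : ℂ) • w) < 1 := by
      refine hBV fun f hf => hεV ?_
      rw [mem_ball_zero_iff, smul_apply, norm_smul, Complex.norm_real, Real.norm_of_nonneg hpos.le]
      calc _ ≤ ε / (2 * (M + η)) * M := by gcongr; exact hw f hf
        _ < ε := by
          rw [div_mul_eq_mul_div, div_lt_iff₀ (by positivity)]
          nlinarith
    rw [map_smul_eq_mul, Complex.norm_real, Real.norm_of_nonneg hpos.le] at h2
    have h3 : Q w = 2 / ε * (M + η) * (ε / (2 * (M + η)) * Q w) := by field_simp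
    rw [h3]
    exact mul_le_of_le_one_right (by positivity) h2.le
  have : Tendsto (fun η : ℝ => 2 / ε * (M + η)) (𝓝[>] 0) (𝓝 (2 / ε * (M + 0))) :=
    (Continuous.tendsto (by fun_prop) 0).mono_left nhdsWithin_le_nhds
  rw [add_zero] at this
  exact ge_of_tendsto this (eventually_nhdsWithin_of_forall key)

theorem exists_seminorm_le_of_isVonNBounded {B : Set (Ss d n)} (hB : Bornology.IsVonNBounded ℂ B)
    (Q : Seminorm ℂ 𝓢(Conf d n, ℂ)) (hQ : Continuous Q) (M : Ss d n →L[ℂ] 𝓢(Conf d n, ℂ)) :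
    ∃ C : ℝ, 0 ≤ C ∧ ∀ f ∈ B, Q (M f) ≤ C := by
  have h := hB.image M
  obtain ⟨s, C, hC, hs⟩ := exists_seminorm_le_of_continuous Q hQ
  choose r hr0 hr using ((schwartz_withSeminorms ℂ (Conf d n) ℂ).isVonNBounded_iff_seminorm_bounded).1 h
  refine ⟨C * ∑ i ∈ s, r i, mul_nonneg hC (Finset.sum_nonneg fun i _ => (hr0 i).le),
    fun f hf => (hs _).trans (mul_le_mul_of_nonneg_left
      (Finset.sum_le_sum fun i _ => (hr i _ ⟨f, hf, rfl⟩).le) hC)⟩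

/-- Bounded sets of bosonic distributions are equicontinuous. -/
theorem exists_equicontinuous {U : Set (SsDual d n)} (hU : Bornology.IsVonNBounded ℂ U) :
    ∃ (s : Finset (ℕ × ℕ)) (C : ℝ), 0 ≤ C ∧ ∀ u ∈ U, ∀ f : Ss d n,
      ‖u f‖ ≤ C * ∑ i ∈ s, SchwartzMap.seminorm ℂ i.1 i.2 f.1 := by
  by_contra! hcon
  choose u hu f hf using fun m : ℕ => hcon (Finset.Iic (m, m)) (m + 1) (by positivity)
  -- A uniform boundedness argument: the rescaled functions satisfy `‖u m (g m)‖ = m`, while their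
  -- seminorms of order up to `(m, m)` are at most one. They form a bounded set on which `U` would
  -- be unbounded.
  let g : ℕ → Ss d n := fun m => ((m : ℂ) / (‖u m (f m)‖ : ℂ)) • f m
  have hpos : ∀ m, 0 < ‖u m (f m)‖ := fun m => lt_of_le_of_lt (by positivity) (hf m)
  have hg : ∀ m (i : ℕ × ℕ), i ≤ (m, m) → SchwartzMap.seminorm ℂ i.1 i.2 (g m).1 ≤ 1 := by
    intro m i hi
    have h1 : SchwartzMap.seminorm ℂ i.1 i.2 (f m).1 ≤
        ∑ i ∈ Finset.Iic (m, m), SchwartzMap.seminorm ℂ i.1 i.2 (f m).1 :=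
      Finset.single_le_sum (f := fun i : ℕ × ℕ => SchwartzMap.seminorm ℂ i.1 i.2 (f m).1)
        (fun i _ => apply_nonneg _ _) (Finset.mem_Iic.2 hi)
    have h2 : (m : ℝ) * SchwartzMap.seminorm ℂ i.1 i.2 (f m).1 ≤ ‖u m (f m)‖ := by
      refine le_trans ?_ (hf m).le
      have := apply_nonneg (SchwartzMap.seminorm ℂ i.1 i.2) (f m).1
      nlinarith
    change SchwartzMap.seminorm ℂ i.1 i.2 (((m : ℂ) / (‖u m (f m)‖ : ℂ)) • (f m).1) ≤ 1
    rw [map_smul_eq_mul, norm_div, Complex.norm_natCast, Complex.norm_real, norm_norm,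
      div_mul_eq_mul_div, div_le_one (hpos m)]
    exact h2
  have hgb : Bornology.IsVonNBounded ℂ (Set.range g) := by
    have h1 : Bornology.IsVonNBounded ℂ (Set.range fun m => (g m).1) := by
      refine ((schwartz_withSeminorms ℂ (Conf d n) ℂ).isVonNBounded_iff_seminorm_bounded).2
        fun ⟨a, b⟩ => ⟨1 + ∑ m ∈ Finset.range (max a b), SchwartzMap.seminorm ℂ a b (g m).1 + 1,
          by positivity, ?_⟩
      rintro _ ⟨m, rfl⟩
      refine lt_of_le_of_lt ?_ (lt_add_one _)
      by_cases hm : m < max a b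
      · have := Finset.single_le_sum (f := fun m => SchwartzMap.seminorm ℂ a b (g m).1)
          (fun i _ => apply_nonneg _ _) (Finset.mem_range.2 hm)
        change SchwartzMap.seminorm ℂ a b (g m).1 ≤ _
        linarith
      · have h2 := hg m (a, b) ⟨by have := le_max_left a b; change a ≤ m; omega,
          by have := le_max_right a b; change b ≤ m; omega⟩
        have h3 : 0 ≤ ∑ m ∈ Finset.range (max a b), SchwartzMap.seminorm ℂ a b (g m).1 :=
          Finset.sum_nonneg fun i _ => apply_nonneg _ _
        change SchwartzMap.seminorm ℂ a b (g m).1 ≤ _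
        change SchwartzMap.seminorm ℂ a b (g m).1 ≤ _ at h2
        linarith
    refine (h1.image (sym d n)).subset ?_
    rintro _ ⟨m, rfl⟩
    exact ⟨_, ⟨m, rfl⟩, sym_coe _⟩
  obtain ⟨C, hC⟩ := exists_norm_le_of_isVonNBounded hU hgb
  obtain ⟨m, hm⟩ := exists_nat_gt C
  have h1 := hC _ (hu m) _ ⟨m, rfl⟩
  have h2 : ‖u m (g m)‖ = m := by
    simp only [g, map_smul, norm_smul, norm_div, Complex.norm_natCast, Complex.norm_real, norm_norm]
    exact div_mul_cancel₀ _ (hpos m).ne'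
  linarith

/-- Bosonic Schwartz functions are dense in the bosonic distributions. -/
theorem denseRange_toDual : DenseRange (toDual : Ss d n → SsDual d n) := by
  intro u
  rw [mem_closure_iff_nhds]
  intro t ht
  have h1 : (fun w => u + w) ⁻¹' t ∈ 𝓝 (0 : SsDual d n) := by
    refine ContinuousAt.preimage_mem_nhds (by fun_prop) ?_
    simpa using ht
  obtain ⟨⟨B, V⟩, ⟨hB, hV⟩, hBV⟩ := ContinuousLinearMap.hasBasis_nhds_zero.mem_iff.1 h1
  obtain ⟨ε, hε, hεV⟩ := Metric.mem_nhds_iff.1 hV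
  obtain ⟨g, hg⟩ := exists_integral_approx volume (u.comp (sym d n)) _
    (hB.image (bosonicSchwartz d n).subtypeL) (ε / 2) (by positivity)
  have h2 : u + (toDual (sym d n g) - u) ∈ t := by
    refine hBV fun f hf => hεV ?_
    rw [mem_ball_zero_iff]
    have h3 := hg _ ⟨f, hf, rfl⟩
    simp only [ContinuousLinearMap.comp_apply, Submodule.subtypeL_apply, sym_coe] at h3
    rw [sub_apply, toDual_apply, norm_sub_rev]
    have h4 : ∫ x, (sym d n g).1 x * f.1 x = ∫ x, f.1 x * g x := by
      rw [integral_sym_mul, sym_coe]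
      simp_rw [mul_comm]
    rw [h4]
    linarith
  rw [add_sub_cancel] at h2
  exact ⟨_, h2, _, rfl⟩

/-- Two continuous antilinear-linear forms on distributions that agree on functions agree. -/
theorem dual_induction₂ {Y : Type*} [TopologicalSpace Y] [T2Space Y]
    (a b : SsDual d n → SsDual d n → Y) (ha₁ : ∀ v, Continuous fun w => a w v)
    (hb₁ : ∀ v, Continuous fun w => b w v) (ha₂ : ∀ w, Continuous (a w))
    (hb₂ : ∀ w, Continuous (b w)) (h : ∀ f g : Ss d n, a (toDual f) (toDual g) =
      b (toDual f) (toDual g)) (w v : SsDual d n) : a w v = b w v := by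
  have h1 : ∀ f v, a (toDual f) v = b (toDual f) v := fun f v =>
    congrFun (denseRange_toDual.equalizer (ha₂ _) (hb₂ _) (funext fun g => h f g)) v
  exact congrFun (denseRange_toDual.equalizer (ha₁ v) (hb₁ v) (funext fun f => h1 f v)) w

theorem continuous_eval_dual (f : Ss d n) : Continuous fun w : SsDual d n => w f :=
  continuous_eval_const f

end StrongDual

/-! ### Density matrices and their Schwartz kernels -/

section Kernel

variable {d n : ℕ}

/-- The functional `f ↦ (M f) x` on the bosonic Schwartz space. -/
def evalM (M : Ss d n →L[ℂ] 𝓢(Conf d n, ℂ)) (x : Conf d n) : SsDual d n := (evalS x).comp M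

@[simp]
theorem evalM_apply (M : Ss d n →L[ℂ] 𝓢(Conf d n, ℂ)) (x : Conf d n) (f : Ss d n) :
    evalM M x f = M f x := rfl

/-- For the inclusion `M` these are the distributions `‖x‖ ^ m δ_x`. Their boundedness provides
neighbourhoods of zero, for bounded convergence, on which kernels decay uniformly in the second
variable. -/
theorem isVonNBounded_evalM (M : Ss d n →L[ℂ] 𝓢(Conf d n, ℂ)) (m : ℕ) :
    Bornology.IsVonNBounded ℂ (Set.range fun x : Conf d n => ((‖x‖ ^ m : ℝ) : ℂ) • evalM M x) := by
  refine isVonNBounded_of_norm_le _ fun B hB => ?_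
  obtain ⟨C, -, hC⟩ := exists_seminorm_le_of_isVonNBounded hB (SchwartzMap.seminorm ℂ m 0)
    ((schwartz_withSeminorms ℂ (Conf d n) ℂ).continuous_seminorm (m, 0)) M
  refine ⟨C, ?_⟩
  rintro _ ⟨x, rfl⟩ f hf
  rw [smul_apply, norm_smul, Complex.norm_real, norm_pow, norm_norm, evalM_apply]
  exact (SchwartzMap.norm_pow_mul_le_seminorm ℂ _ m x).trans (hC f hf)

theorem exists_nhds_hom (U : Set (SsDual d n)) (hU : Bornology.IsVonNBounded ℂ U)
    (L : Ss d n →L[ℂ] 𝓢(Conf d n, ℂ)) (m : ℕ) :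
    ∃ S ∈ 𝓝 (0 : SsDual d n →L[ℂ] Ss d n), ∀ γ ∈ S, ∀ u ∈ U,
      SchwartzMap.seminorm ℂ m 0 (L (γ u)) ≤ 1 := by
  obtain ⟨V, hV, h⟩ := exists_nhds_seminorm_le (E := Conf d n) m 0
  have hV' : L ⁻¹' V ∈ 𝓝 (0 : Ss d n) := L.continuous.continuousAt.preimage_mem_nhds (by simpa)
  exact ⟨_, ContinuousLinearMap.hasBasis_nhds_zero.mem_of_mem (i := (U, L ⁻¹' V)) ⟨hU, hV'⟩,
    fun γ hγ u hu => h _ (hγ u hu)⟩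

/-- The kernel is `L (γ (evalM M x')) x` with the inclusions for `L` and `M`. Derivatives in `x` are
composed with `L` and derivatives in `x'` with `M`, so all derivatives of the kernel have the same
form and obey the same kind of bounds. -/
theorem exists_kerMap (d n : ℕ) : ∃ T : (SsDual d n →L[ℂ] Ss d n) →L[ℂ] 𝓢(Conf d n × Conf d n, ℂ),
    ∀ γ p, T γ p = ker γ p.1 p.2 := by
  let σ : (Ss d n →L[ℂ] 𝓢(Conf d n, ℂ)) → (SsDual d n →L[ℂ] Ss d n) →ₗ[ℂ]
      (Conf d n × Conf d n → Ss d n) := fun M =>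
    { toFun := fun γ p => γ (evalM M p.2)
      map_add' := fun _ _ => rfl
      map_smul' := fun _ _ => rfl }
  refine exists_clm_of_smooth_family (ContinuousLinearMap.fst ℝ (Conf d n) (Conf d n)) σ
    (fun M v => (lineDerivOpCLM ℂ 𝓢(Conf d n, ℂ) v.2).comp M) ?_ ?_ ?_ ?_
    (bosonicSchwartz d n).subtypeL (bosonicSchwartz d n).subtypeL
  · intro M γ p v w
    change γ _ = γ _ + γ _
    rw [← map_add]
    congr 1
    ext f
    simp [lineDerivOp_left_add]
  · intro M γ p c v
    change γ _ = (c : ℂ) • γ _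
    rw [← map_smul]
    congr 1
    ext f
    simp [lineDerivOp_left_smul]
  -- Taylor's estimate is uniform over bounded sets of test functions, which makes `x' ↦ δ_{x'}`
  -- differentiable in the strong dual.
  · intro M γ p Q hQ
    obtain ⟨B, C, hB, hC, h⟩ := exists_bounded_of_seminorm
      (Q.comp (γ : SsDual d n →ₗ[ℂ] Ss d n)) (hQ.comp γ.continuous)
    obtain ⟨D, hD0, hD⟩ := exists_seminorm_le_of_isVonNBounded hB (secondSeminorm 0)
      (continuous_secondSeminorm 0) M
    have h1 : ∀ v : Conf d n × Conf d n, ‖v.2‖ ≤ 1 → Q (σ M γ (p + v) - σ M γ p -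
        σ ((lineDerivOpCLM ℂ 𝓢(Conf d n, ℂ) v.2).comp M) γ p) ≤ C * D * ‖v.2‖ ^ 2 := fun v hv => by
      have h2 : σ M γ (p + v) - σ M γ p - σ ((lineDerivOpCLM ℂ 𝓢(Conf d n, ℂ) v.2).comp M) γ p =
          γ (evalM M (p.2 + v.2) - evalM M p.2 -
            evalM ((lineDerivOpCLM ℂ 𝓢(Conf d n, ℂ) v.2).comp M) p.2) := by
        simp only [map_sub]
        rfl
      rw [h2, mul_assoc]
      refine h _ _ (by positivity) fun f hf => ?_
      have h3 := norm_shift_sub_sub_le (M f) 0 p.2 v.2 hv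
      rw [pow_zero, one_mul] at h3
      refine h3.trans ?_
      gcongr
      exact hD f hf
    refine Asymptotics.IsBigO.trans_isLittleO (g := fun v : Conf d n × Conf d n => ‖v‖ ^ 2) ?_
      (Asymptotics.isLittleO_norm_pow_id one_lt_two)
    refine .of_bound (C * D) ?_
    have h5 : Tendsto (fun v : Conf d n × Conf d n => ‖v.2‖) (𝓝 0) (𝓝 0) := by
      have : Continuous fun v : Conf d n × Conf d n => ‖v.2‖ := by fun_prop
      simpa using this.tendsto 0
    filter_upwards [h5.eventually (ge_mem_nhds zero_lt_one)] with v hv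
    rw [Real.norm_of_nonneg (apply_nonneg _ _), norm_pow, norm_norm]
    refine (h1 v hv).trans ?_
    gcongr
    exact norm_snd_le v
  · intro M L m
    obtain ⟨S, hS, h⟩ := exists_nhds_hom _ (isVonNBounded_evalM M 0) L m
    obtain ⟨S', hS', h'⟩ := exists_nhds_hom _ (isVonNBounded_evalM M m) L 0
    refine ⟨S ∩ S', inter_mem hS hS', 2, fun γ hγ p => ?_⟩
    have h1 := (SchwartzMap.norm_pow_mul_le_seminorm ℂ _ m p.1).trans (h γ hγ.1 _ ⟨p.2, rfl⟩)
    have h2 := (SchwartzMap.norm_le_seminorm ℂ _ p.1).trans (h' γ hγ.2 _ ⟨p.2, rfl⟩)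
    simp only [pow_zero, Complex.ofReal_one, one_smul] at h1
    rw [map_smul, map_smul, smul_apply, norm_smul, Complex.norm_real, norm_pow, norm_norm] at h2
    change ‖p‖ ^ m * ‖L (γ (evalM M p.2)) p.1‖ ≤ 2
    have h5 : ‖p‖ ^ m ≤ ‖p.1‖ ^ m + ‖p.2‖ ^ m := by
      rw [Prod.norm_def]
      rcases max_cases ‖p.1‖ ‖p.2‖ with h | h <;> rw [h.1]
      · linarith [pow_nonneg (norm_nonneg p.2) m]
      · linarith [pow_nonneg (norm_nonneg p.1) m]
    calc _ ≤ (‖p.1‖ ^ m + ‖p.2‖ ^ m) * ‖L (γ (evalM M p.2)) p.1‖ := by gcongr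
      _ ≤ 2 := by rw [add_mul]; linarith

/-- The kernel of an operator, as a Schwartz function. -/
def kerMap (d n : ℕ) : (SsDual d n →L[ℂ] Ss d n) →L[ℂ] 𝓢(Conf d n × Conf d n, ℂ) :=
  (exists_kerMap d n).choose

theorem kerMap_apply (γ : SsDual d n →L[ℂ] Ss d n) (p : Conf d n × Conf d n) :
    kerMap d n γ p = ker γ p.1 p.2 := (exists_kerMap d n).choose_spec γ p

/-- The bosonic operator `u ↦ ∫ K (·, x) u x`. -/
theorem exists_opMap (d n : ℕ) : ∃ T : 𝓢(Conf d n × Conf d n, ℂ) →L[ℂ] SsDual d n →L[ℂ] Ss d n,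
    ∀ K u, T K u = sym d n (app₁ (u.comp (sym d n)) K) := by
  have hlin : ∀ K : 𝓢(Conf d n × Conf d n, ℂ), ∃ T : SsDual d n →L[ℂ] 𝓢(Conf d n, ℂ),
      ∀ u, T u = app₁ (u.comp (sym d n)) K := fun K => by
    let T : SsDual d n →ₗ[ℂ] 𝓢(Conf d n, ℂ) :=
      { toFun := fun u => app₁ (u.comp (sym d n)) K
        map_add' := fun u v => by ext; simp [app₁_apply]
        map_smul' := fun c u => by ext; simp [app₁_apply] }
    refine ⟨⟨T, continuous_of_seminorm_le T fun a b => ?_⟩, fun u => rfl⟩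
    obtain ⟨B, C, hB, hC, h⟩ := exists_bound_seminorm_app₂ (swapCLM K) a b
    refine ⟨_, ContinuousLinearMap.hasBasis_nhds_zero.mem_of_mem
      (i := (sym d n '' B, Metric.closedBall (0 : ℂ) 1))
      ⟨hB.image (sym d n), Metric.closedBall_mem_nhds _ one_pos⟩, C * 1, fun u hu => ?_⟩
    change SchwartzMap.seminorm ℂ a b (app₁ (u.comp (sym d n)) K) ≤ _
    rw [app₁_eq_app₂_swap]
    exact h _ 1 zero_le_one fun f hf => by simpa using hu _ ⟨f, hf, rfl⟩
  choose T hT using hlin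
  let S : 𝓢(Conf d n × Conf d n, ℂ) →ₗ[ℂ] SsDual d n →L[ℂ] Ss d n :=
    { toFun := fun K => (sym d n).comp (T K)
      map_add' := fun K L => by
        ext1 u
        simp [hT]
      map_smul' := fun c K => by
        ext1 u
        simp [hT] }
  refine ⟨⟨S, ?_⟩, fun K u => by rw [← hT]; rfl⟩
  refine continuous_of_continuousAt_zero S ?_
  rw [ContinuousAt, map_zero, ContinuousLinearMap.hasBasis_nhds_zero.tendsto_right_iff]
  rintro ⟨U, V⟩ ⟨hU, hV⟩
  have hV' : sym d n ⁻¹' V ∈ 𝓝 (0 : 𝓢(Conf d n, ℂ)) :=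
    (sym d n).continuous.continuousAt.preimage_mem_nhds (by simpa)
  obtain ⟨⟨J, r⟩, hr, hJ⟩ := (schwartz_withSeminorms ℂ (Conf d n) ℂ).hasBasis_zero_ball.mem_iff.1 hV'
  -- Continuity in `K` must be uniform over `u ∈ U`; by equicontinuity, finitely many seminorms
  -- serve all of them at once.
  obtain ⟨s, C, hC, h⟩ := exists_equicontinuous hU
  obtain ⟨s', C', hC', h'⟩ : ∃ (s' : Finset (ℕ × ℕ)) (C' : ℝ), 0 ≤ C' ∧ ∀ u ∈ U, ∀ f,
      ‖(u.comp (sym d n)) f‖ ≤ C' * ∑ i ∈ s', SchwartzMap.seminorm ℂ i.1 i.2 f := by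
    let q : Seminorm ℂ 𝓢(Conf d n, ℂ) := ∑ i ∈ s, (schwartzSeminormFamily ℂ (Conf d n) ℂ i).comp
      (lift (.id ℂ (Ss d n)) : 𝓢(Conf d n, ℂ) →ₗ[ℂ] 𝓢(Conf d n, ℂ))
    have hqa : ∀ f, q f = ∑ i ∈ s, SchwartzMap.seminorm ℂ i.1 i.2 (sym d n f).1 := fun f => by
      simp only [q, sum_apply]
      rfl
    have hq : Continuous q := by
      have : (q : 𝓢(Conf d n, ℂ) → ℝ) = fun f => ∑ i ∈ s,
          SchwartzMap.seminorm ℂ i.1 i.2 (sym d n f).1 := funext hqa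
      rw [this]
      exact continuous_finsetSum _ fun i _ => ((schwartz_withSeminorms ℂ (Conf d n) ℂ).continuous_seminorm
        i).comp (continuous_subtype_val.comp (sym d n).continuous)
    obtain ⟨s', D, hD, hs'⟩ := exists_seminorm_le_of_continuous q hq
    refine ⟨s', C * D, mul_nonneg hC hD, fun u hu f => (h u hu _).trans ?_⟩
    rw [mul_assoc]
    exact mul_le_mul_of_nonneg_left ((hqa f).symm.trans_le (hs' f)) hC
  choose N hNc hN0 hN using fun i : ℕ × ℕ =>
    exists_seminorm_app₂_le (E := Conf d n) (F := Conf d n) s' C' hC' i.1 i.2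
  have h1 : ∀ i ∈ J, ∀ᶠ K in 𝓝 (0 : 𝓢(Conf d n × Conf d n, ℂ)), N i (swapCLM K) < r := fun i _ => by
    have : Continuous fun K : 𝓢(Conf d n × Conf d n, ℂ) => N i (swapCLM K) :=
      (hNc i).comp swapCLM.continuous
    have h2 := this.tendsto 0
    simp only [map_zero, hN0] at h2
    exact h2.eventually (gt_mem_nhds hr)
  filter_upwards [(Filter.eventually_all_finset J).2 h1] with K hK u hu
  change sym d n (T K u) ∈ V
  refine hJ ?_
  rw [Seminorm.mem_ball_zero]
  refine Seminorm.finset_sup_apply_lt hr fun i hi => lt_of_le_of_lt ?_ (hK i hi)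
  rw [hT, app₁_eq_app₂_swap]
  exact hN i _ _ (h' u hu)

/-- The bosonic operator with kernel `K`. -/
def opMap (d n : ℕ) : 𝓢(Conf d n × Conf d n, ℂ) →L[ℂ] SsDual d n →L[ℂ] Ss d n :=
  (exists_opMap d n).choose

theorem opMap_apply (K : 𝓢(Conf d n × Conf d n, ℂ)) (u : SsDual d n) :
    opMap d n K u = sym d n (app₁ (u.comp (sym d n)) K) := (exists_opMap d n).choose_spec K u

/-- Kernels that are symmetric in both groups of variables. -/
def IsSymKernel (K : 𝓢(Conf d n × Conf d n, ℂ)) : Prop :=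
  (∀ (π : Equiv.Perm (Fin n)) x y, K (x ∘ π, y) = K (x, y)) ∧
    ∀ (π : Equiv.Perm (Fin n)) x y, K (x, y ∘ π) = K (x, y)

theorem isSymKernel_kerMap (γ : SsDual d n →L[ℂ] Ss d n) : IsSymKernel (kerMap d n γ) := by
  refine ⟨fun π x y => ?_, fun π x y => ?_⟩
  · simp only [kerMap_apply]
    exact (γ (delta y)).2 π x
  · simp only [kerMap_apply, ker]
    congr 2
    congr 1
    ext f
    exact f.2 π y

theorem opMap_apply_coe {K : 𝓢(Conf d n × Conf d n, ℂ)} (hK : IsSymKernel K) (u : SsDual d n)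
    (x : Conf d n) : (opMap d n K u).1 x = u (sym d n (sliceR x K)) := by
  rw [opMap_apply, sym_of_symm, app₁_apply, ContinuousLinearMap.comp_apply]
  intro π x
  rw [app₁_apply, app₁_apply]
  congr 1
  ext y
  simp [hK.1]

theorem ker_opMap {K : 𝓢(Conf d n × Conf d n, ℂ)} (hK : IsSymKernel K) (x x' : Conf d n) :
    ker (opMap d n K) x x' = K (x, x') := by
  rw [ker, opMap_apply_coe hK]
  change (sym d n (sliceR x K)).1 x' = _
  rw [sym_of_symm _ fun π y => by simp [hK.2], sliceR_apply]

theorem opMap_mem_dens {K : 𝓢(Conf d n × Conf d n, ℂ)} (hK : IsSymKernel K)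
    (hK' : ∀ x y, K (y, x) = starRingEnd ℂ (K (x, y))) : opMap d n K ∈ dens d n := by
  have hop : ∀ (g : Ss d n) x, (opMap d n K (toDual g)).1 x = ∫ y, K (x, y) * g.1 y := fun g x => by
    rw [opMap_apply_coe hK, toDual_apply, sym_of_symm _ fun π y => by simp [hK.2]]
    simp [mul_comm]
  intro f g
  have := integralAgainst_app_comm volume volume (conjW f.1) g.1 K
  simp only [integralAgainst_apply, app₁_apply, app₂_apply, sliceL_apply, sliceR_apply] at this
  simp only [ip, hop]
  calc _ = _ := by simp_rw [mul_comm (starRingEnd ℂ (f.1 _)), ← conjW_apply f.1]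
    _ = _ := this
    _ = _ := by
      congr 1 with x
      congr 1
      rw [← integral_conj]
      congr 1 with y
      simp [hK' y x]

/-- Self-adjointness on distributions. -/
theorem dens_conj (γ : Dens d n) (w v : SsDual d n) :
    starRingEnd ℂ (w (conjS (γ.1 v))) = v (conjS (γ.1 w)) := by
  refine dual_induction₂ (fun w v => starRingEnd ℂ (w (conjS (γ.1 v))))
    (fun w v => v (conjS (γ.1 w))) (fun v => ?_) (fun v => ?_) (fun w => ?_) (fun w => ?_)
    (fun f g => ?_) w v
  · exact Complex.continuous_conj.comp (continuous_eval_dual _)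
  · exact v.continuous.comp (continuous_conjS.comp γ.1.continuous)
  · exact Complex.continuous_conj.comp (w.continuous.comp (continuous_conjS.comp γ.1.continuous))
  · exact continuous_eval_dual _
  · have h := γ.2 f g
    rw [ip_swap (γ.1 (toDual f)) g] at h
    simp only [toDual_apply]
    rw [← integral_conj]
    simp only [ip] at h
    rw [← integral_conj] at h
    simpa using h

/-- This is self-adjointness tested against `δ_x`. It shows that the kernel of `γ` determines `γ` on
all distributions, not only on Dirac measures. -/
theorem dens_apply (γ : Dens d n) (v : SsDual d n) (x : Conf d n) :
    (γ.1 v).1 x = v (conjS (γ.1 (delta x))) := by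
  rw [← dens_conj]
  change _ = starRingEnd ℂ ((conjS (γ.1 v)).1 x)
  simp

theorem ker_hermitian (γ : Dens d n) (x y : Conf d n) :
    ker γ.1 y x = starRingEnd ℂ (ker γ.1 x y) := by
  rw [ker, dens_apply]
  exact conjS_apply _ _

theorem opMap_kerMap (γ : Dens d n) : opMap d n (kerMap d n γ.1) = γ.1 := by
  ext1 u
  apply Subtype.ext
  ext x
  rw [opMap_apply_coe (isSymKernel_kerMap _), dens_apply]
  congr 1
  apply Subtype.ext
  rw [sym_of_symm _ fun π y => by simp [(isSymKernel_kerMap γ.1).2]]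
  ext y
  rw [sliceR_apply, kerMap_apply, conjS_apply]
  exact ker_hermitian γ y x

/-- As a function of its first variable a kernel is bosonic, so `lift A` acts on it as `A` does. The
trace thus becomes a continuous functional of the kernel, to which `diagInt_left` applies. -/
theorem trace_comp (A : Ss d n →L[ℂ] Ss d n) (γ : SsDual d n →L[ℂ] Ss d n) :
    trace (A.comp γ) = diagInt (Conf d n) (left (lift A) (kerMap d n γ)) := by
  rw [diagInt_apply, trace]
  congr 1 with x
  rw [left_apply]
  have : sliceL x (kerMap d n γ) = (γ (delta x)).1 := by
    ext y
    simp [kerMap_apply, ker]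
  dsimp only
  rw [this, lift_coe]
  rfl

theorem integrable_ker_diag (ρ : SsDual d n →L[ℂ] Ss d n) : Integrable fun x => ker ρ x x := by
  refine (diagCLM (Conf d n) (kerMap d n ρ)).integrable.congr (Eventually.of_forall fun x => ?_)
  simp [diagCLM_apply, kerMap_apply]

end Kernel

/-! ### The operators `A_{(α)}` on functions without symmetry -/

section Op

variable {d k l j n : ℕ}

/-- The configuration `y` in the variables `α`, and `0` in the others. -/
def extL (d : ℕ) {k n : ℕ} (α : Fin k ↪ Fin n) : Conf d k →L[ℝ] Conf d n :=
  LinearMap.toContinuousLinearMap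
    { toFun := fun y => Function.extend α y 0
      map_add' := fun y z => by
        have := Function.extend_add α y z (0 : Conf d n) 0
        simpa using this
      map_smul' := fun c y => by
        have := Function.extend_smul c α y (0 : Conf d n)
        simpa using this }

theorem extL_apply (α : Fin k ↪ Fin n) (y : Conf d k) : extL d α y = Function.extend α y 0 := rfl

/-- Restriction to the variables `α`. -/
def resL (d : ℕ) {k n : ℕ} (α : Fin k ↪ Fin n) : Conf d n →L[ℝ] Conf d k :=
  LinearMap.toContinuousLinearMap (LinearMap.funLeft ℝ (EuclideanSpace ℝ (Fin d)) α)

theorem resL_apply (α : Fin k ↪ Fin n) (x : Conf d n) : resL d α x = x ∘ α := rfl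

/-- Setting the variables `α` to `0`. -/
def offL (d : ℕ) {k n : ℕ} (α : Fin k ↪ Fin n) : Conf d n →L[ℝ] Conf d n :=
  .id ℝ _ - (extL d α).comp (resL d α)

theorem extL_add_offL (α : Fin k ↪ Fin n) (y : Conf d k) (x : Conf d n) :
    extL d α y + offL d α x = Function.extend α y x := by
  ext i : 1
  simp only [offL, sub_apply, ContinuousLinearMap.comp_apply, extL_apply, resL_apply,
    ContinuousLinearMap.id_apply, Pi.add_apply, Pi.sub_apply]
  by_cases h : ∃ a, α a = i
  · obtain ⟨a, rfl⟩ := h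
    simp [α.injective.extend_apply]
  · simp [Function.extend_apply' _ _ _ h]

/-- This bound and `norm_le_res_add_extend` are the hypotheses of `exists_partialApply`: each
coordinate of `x` either belongs to `α` or is unchanged in the slice. -/
theorem norm_le_extend (α : Fin k ↪ Fin n) (x : Conf d n) (y : Conf d k) :
    ‖y‖ ≤ ‖extL d α y + offL d α x‖ := by
  rw [extL_add_offL]
  refine (pi_norm_le_iff_of_nonneg (norm_nonneg _)).2 fun a => ?_
  have := norm_le_pi_norm (Function.extend α y x : Conf d n) (α a)
  rwa [α.injective.extend_apply] at this

theorem norm_le_res_add_extend (α : Fin k ↪ Fin n) (x : Conf d n) (y : Conf d k) :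
    ‖x‖ ≤ ‖resL d α x‖ + ‖extL d α y + offL d α x‖ := by
  rw [extL_add_offL]
  refine (pi_norm_le_iff_of_nonneg (by positivity)).2 fun i => ?_
  by_cases h : ∃ a, α a = i
  · obtain ⟨a, rfl⟩ := h
    exact (norm_le_pi_norm (resL d α x) a).trans (le_add_of_nonneg_right (norm_nonneg _))
  · have := norm_le_pi_norm (Function.extend α y x : Conf d n) i
    rw [Function.extend_apply' _ _ _ h] at this
    exact this.trans (le_add_of_nonneg_left (norm_nonneg _))

/-- The restriction of a function to the variables `α`, the others being frozen. -/
def sliceS (α : Fin k ↪ Fin n) (x : Conf d n) : 𝓢(Conf d n, ℂ) →L[ℂ] 𝓢(Conf d k, ℂ) :=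
  affineSlice (extL d α) (offL d α) (norm_le_extend α) x

@[simp]
theorem sliceS_apply (α : Fin k ↪ Fin n) (x : Conf d n) (f : 𝓢(Conf d n, ℂ)) (y : Conf d k) :
    sliceS α x f y = f (Function.extend α y x) := by
  rw [sliceS, affineSlice_apply, extL_add_offL]

theorem exists_op (A : 𝓢(Conf d k, ℂ) →L[ℂ] 𝓢(Conf d k, ℂ)) (α : Fin k ↪ Fin n) :
    ∃ T : 𝓢(Conf d n, ℂ) →L[ℂ] 𝓢(Conf d n, ℂ), ∀ f x, T f x = A (sliceS α x f) (x ∘ α) :=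
  exists_partialApply (extL d α) (offL d α) (resL d α) (norm_le_extend α)
    (norm_le_res_add_extend α) A

/-- The operator `A` acting on the variables `α`. -/
def op (A : 𝓢(Conf d k, ℂ) →L[ℂ] 𝓢(Conf d k, ℂ)) (α : Fin k ↪ Fin n) :
    𝓢(Conf d n, ℂ) →L[ℂ] 𝓢(Conf d n, ℂ) := (exists_op A α).choose

theorem op_apply (A : 𝓢(Conf d k, ℂ) →L[ℂ] 𝓢(Conf d k, ℂ)) (α : Fin k ↪ Fin n)
    (f : 𝓢(Conf d n, ℂ)) (x : Conf d n) : op A α f x = A (sliceS α x f) (x ∘ α) :=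
  (exists_op A α).choose_spec f x

theorem actOn_eq_op (A : Ss d k →L[ℂ] Ss d k) (α : Fin k ↪ Fin n) (f : Ss d n) (x : Conf d n) :
    actOn A α f x = op (lift A) α f.1 x := by
  rw [op_apply, actOn, ← lift_coe]
  congr 2
  ext y
  rw [sliceS_apply, slice_apply]

theorem op_add (A B : 𝓢(Conf d k, ℂ) →L[ℂ] 𝓢(Conf d k, ℂ)) (α : Fin k ↪ Fin n) :
    op (A + B) α = op A α + op B α := by
  ext f x
  simp [op_apply]

theorem op_smul (c : ℂ) (A : 𝓢(Conf d k, ℂ) →L[ℂ] 𝓢(Conf d k, ℂ)) (α : Fin k ↪ Fin n) :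
    op (c • A) α = c • op A α := by
  ext f x
  simp [op_apply]

theorem op_neg (A : 𝓢(Conf d k, ℂ) →L[ℂ] 𝓢(Conf d k, ℂ)) (α : Fin k ↪ Fin n) :
    op (-A) α = -op A α := by
  ext f x
  simp [op_apply]

theorem op_sub (A B : 𝓢(Conf d k, ℂ) →L[ℂ] 𝓢(Conf d k, ℂ)) (α : Fin k ↪ Fin n) :
    op (A - B) α = op A α - op B α := by
  ext f x
  simp [op_apply]

theorem op_sum {ι : Type*} (s : Finset ι) (A : ι → 𝓢(Conf d k, ℂ) →L[ℂ] 𝓢(Conf d k, ℂ))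
    (α : Fin k ↪ Fin n) : op (∑ i ∈ s, A i) α = ∑ i ∈ s, op (A i) α := by
  ext f x
  simp [op_apply, sum_apply]

theorem extend_extend_self {E : Type*} (α : Fin k ↪ Fin n) (y z : Fin k → E) (x : Fin n → E) :
    Function.extend α z (Function.extend α y x) = Function.extend α z x := by
  ext i
  by_cases h : ∃ a, α a = i
  · obtain ⟨a, rfl⟩ := h
    simp [α.injective.extend_apply]
  · simp [Function.extend_apply' _ _ _ h]

theorem extend_comp_self {E : Type*} (α : Fin k ↪ Fin n) (y : Fin k → E) (x : Fin n → E) :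
    Function.extend α y x ∘ α = y := by
  ext a
  simp [α.injective.extend_apply]

theorem sliceS_op (A : 𝓢(Conf d k, ℂ) →L[ℂ] 𝓢(Conf d k, ℂ)) (α : Fin k ↪ Fin n)
    (f : 𝓢(Conf d n, ℂ)) (x : Conf d n) : sliceS α x (op A α f) = A (sliceS α x f) := by
  ext y
  rw [sliceS_apply, op_apply, extend_comp_self]
  congr 2
  ext z
  rw [sliceS_apply, sliceS_apply, extend_extend_self]

theorem op_comp (A B : 𝓢(Conf d k, ℂ) →L[ℂ] 𝓢(Conf d k, ℂ)) (α : Fin k ↪ Fin n) :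
    op (A.comp B) α = (op A α).comp (op B α) := by
  ext f x
  rw [op_apply, ContinuousLinearMap.comp_apply, ContinuousLinearMap.comp_apply, op_apply, sliceS_op]

theorem op_op (A : 𝓢(Conf d k, ℂ) →L[ℂ] 𝓢(Conf d k, ℂ)) (α : Fin k ↪ Fin l) (β : Fin l ↪ Fin n) :
    op (op A α) β = op A (α.trans β) := by
  ext f x
  rw [op_apply, op_apply, op_apply]
  have : sliceS α (x ∘ β) (sliceS β x f) = sliceS (α.trans β) x f := by
    ext y
    simp only [sliceS_apply]
    congr 1
    ext i : 1
    by_cases h : ∃ b, β b = i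
    · obtain ⟨b, rfl⟩ := h
      rw [β.injective.extend_apply]
      by_cases h2 : ∃ a, α a = b
      · obtain ⟨a, rfl⟩ := h2
        rw [α.injective.extend_apply]
        exact ((α.trans β).injective.extend_apply y x a).symm
      · rw [Function.extend_apply' _ _ _ h2, Function.extend_apply']
        · rfl
        · rintro ⟨a, ha⟩
          exact h2 ⟨a, β.injective ha⟩
    · rw [Function.extend_apply' _ _ _ h, Function.extend_apply']
      rintro ⟨a, ha⟩
      exact h ⟨α a, ha⟩
  rw [this]
  rfl

theorem op_perm (A : 𝓢(Conf d k, ℂ) →L[ℂ] 𝓢(Conf d k, ℂ)) (α : Fin k ↪ Fin n)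
    (π : Equiv.Perm (Fin n)) (f : 𝓢(Conf d n, ℂ)) :
    op A (α.trans π.toEmbedding) f = permS d π (op A α (permS d π⁻¹ f)) := by
  ext x
  rw [permS_apply, op_apply, op_apply]
  have : sliceS (α.trans π.toEmbedding) x f = sliceS α (x ∘ π) (permS d π⁻¹ f) := by
    ext y
    simp only [sliceS_apply, permS_apply]
    congr 1
    ext i : 1
    by_cases h : ∃ a, (α.trans π.toEmbedding) a = i
    · obtain ⟨a, rfl⟩ := h
      rw [(α.trans π.toEmbedding).injective.extend_apply]
      simp [α.injective.extend_apply]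
    · rw [Function.extend_apply' _ _ _ h, Function.comp_apply, Function.extend_apply']
      · simp
      · rintro ⟨a, ha⟩
        exact h ⟨a, by simp [ha]⟩
  rw [this]
  rfl

theorem op_id (A : 𝓢(Conf d k, ℂ) →L[ℂ] 𝓢(Conf d k, ℂ)) :
    op A (Function.Embedding.refl (Fin k)) = A := by
  ext f x
  rw [op_apply]
  have : sliceS (Function.Embedding.refl (Fin k)) x f = f := by
    ext y
    rw [sliceS_apply]
    congr 1
    ext i : 1
    exact (Function.Embedding.refl (Fin k)).injective.extend_apply y x i
  rw [this]
  rfl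

theorem sym_permS (π : Equiv.Perm (Fin n)) (f : 𝓢(Conf d n, ℂ)) :
    sym d n (permS d π f) = sym d n f := by
  apply Subtype.ext
  ext x
  simp only [sym_apply, permS_apply]
  congr 1
  exact Equiv.sum_comp (Equiv.mulRight π) fun σ => f (x ∘ σ)

theorem permS_coe (π : Equiv.Perm (Fin n)) (f : Ss d n) : permS d π f.1 = f.1 := by
  ext x
  exact f.2 π x

/-- `lift A` symmetrises its argument and returns a symmetric function, so the order of the
variables in the tuple is irrelevant. -/
theorem op_lift_perm (A : Ss d k →L[ℂ] Ss d k) (σ : Equiv.Perm (Fin k)) (α : Fin k ↪ Fin n) :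
    op (lift A) (σ.toEmbedding.trans α) = op (lift A) α := by
  rw [← op_op]
  congr 1
  ext1 f
  have := op_perm (lift A) (Function.Embedding.refl _) σ f
  rw [op_id] at this
  refine this.trans ?_
  rw [lift_apply, sym_permS, permS_coe, lift_apply]

/-- Operators that act on disjoint sets of variables commute. -/
theorem op_comm (A : 𝓢(Conf d l, ℂ) →L[ℂ] 𝓢(Conf d l, ℂ)) (B : 𝓢(Conf d j, ℂ) →L[ℂ] 𝓢(Conf d j, ℂ))
    (α : Fin l ↪ Fin n) (β : Fin j ↪ Fin n) (h : ∀ a b, α a ≠ β b) (f : 𝓢(Conf d n, ℂ)) :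
    op A α (op B β f) = op B β (op A α f) := by
  ext x
  have hβ : ∀ (y : Conf d l), Function.extend α y x ∘ β = x ∘ β := fun y => by
    ext b : 1
    rw [Function.comp_apply, Function.extend_apply']
    · rfl
    · rintro ⟨a, ha⟩
      exact h a b ha
  have hα : ∀ (z : Conf d j), Function.extend β z x ∘ α = x ∘ α := fun y => by
    ext b : 1
    rw [Function.comp_apply, Function.extend_apply']
    · rfl
    · rintro ⟨a, ha⟩
      exact h b a ha.symm
  have hcomm : ∀ (y : Conf d l) (z : Conf d j),
      Function.extend β z (Function.extend α y x) = Function.extend α y (Function.extend β z x) := by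
    intro y z
    ext i : 1
    by_cases h1 : ∃ a, α a = i
    · obtain ⟨a, rfl⟩ := h1
      rw [α.injective.extend_apply, Function.extend_apply', α.injective.extend_apply]
      rintro ⟨b, hb⟩
      exact h a b hb.symm
    · rw [Function.extend_apply' _ _ _ h1]
      by_cases h2 : ∃ b, β b = i
      · obtain ⟨b, rfl⟩ := h2
        rw [β.injective.extend_apply, β.injective.extend_apply]
      · rw [Function.extend_apply' _ _ _ h2, Function.extend_apply' _ _ _ h2,
          Function.extend_apply' _ _ _ h1]
  -- With all other variables frozen, `f` is a Schwartz function of two separate groups of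
  -- variables, and `left_right_comm` applies.
  obtain ⟨K, hK⟩ : ∃ K : 𝓢(Conf d l × Conf d j, ℂ),
      ∀ y z, K (y, z) = f (Function.extend α y (Function.extend β z x)) := by
    let p : Conf d l × Conf d j →L[ℝ] Conf d n :=
      (extL d α).comp (.fst ℝ _ _) + ((offL d α).comp (extL d β)).comp (.snd ℝ _ _)
    have hp : ∀ x (y : Conf d l × Conf d j), p y + ((offL d α).comp (offL d β)) x =
        Function.extend α y.1 (Function.extend β y.2 x) := fun x y => by
      rw [← extL_add_offL, ← extL_add_offL β, map_add, ← add_assoc]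
      rfl
    refine ⟨affineSlice p ((offL d α).comp (offL d β)) (fun x y => ?_) x f, fun y z => ?_⟩
    · rw [hp, Prod.norm_def]
      refine max_le ?_ ?_
      · refine (pi_norm_le_iff_of_nonneg (norm_nonneg _)).2 fun a => ?_
        have := norm_le_pi_norm
          (Function.extend α y.1 (Function.extend β y.2 x) : Conf d n) (α a)
        rwa [α.injective.extend_apply] at this
      · refine (pi_norm_le_iff_of_nonneg (norm_nonneg _)).2 fun b => ?_
        have := norm_le_pi_norm
          (Function.extend α y.1 (Function.extend β y.2 x) : Conf d n) (β b)
        rwa [Function.extend_apply' _ _ _ (fun ⟨a, ha⟩ => h a b ha),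
          β.injective.extend_apply] at this
    · rw [affineSlice_apply, hp]
  have h1 : sliceS α x (op B β f) = sliceL (x ∘ β) (right B K) := by
    ext y
    rw [sliceS_apply, op_apply, sliceL_apply, right_apply, hβ]
    congr 2
    ext z
    rw [sliceS_apply, sliceR_apply, hK, hcomm]
  have h2 : sliceS β x (op A α f) = sliceR (x ∘ α) (left A K) := by
    ext z
    rw [sliceS_apply, op_apply, sliceR_apply, left_apply, hα]
    congr 2
    ext y
    rw [sliceS_apply, sliceL_apply, hK]
  rw [op_apply, h1, op_apply B, h2]
  have h3 := left_apply A (right B K) (x ∘ α, x ∘ β)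
  have h4 := right_apply B (left A K) (x ∘ α, x ∘ β)
  dsimp only at h3 h4
  rw [← h3, ← h4, left_right_comm]

end Op

/-! ### Splitting configurations into two groups of particles -/

section Glue

variable {d k n : ℕ}

theorem glue_comp_castLE (h : k ≤ n) (x : Conf d k) (z : Conf d (n - k)) :
    glue x z ∘ Fin.castLEEmb h = x := by
  ext i : 1
  simp [glue]

theorem glue_natAdd (h : k ≤ n) (x : Conf d k) (z : Conf d (n - k)) (i : Fin (n - k)) :
    glue x z ⟨k + i, by omega⟩ = z i := by
  simp [glue]

theorem extend_glue (h : k ≤ n) (x y : Conf d k) (z : Conf d (n - k)) :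
    Function.extend (Fin.castLEEmb h) y (glue x z) = glue y z := by
  ext i : 1
  by_cases hi : (i : ℕ) < k
  · have : i = Fin.castLEEmb h ⟨i, hi⟩ := rfl
    rw [this, (Fin.castLEEmb h).injective.extend_apply]
    simp [glue, hi]
  · rw [Function.extend_apply']
    · simp [glue, hi]
    · rintro ⟨a, rfl⟩
      exact hi a.2

/-- Splitting a configuration into its first `k` particles and the remaining ones. -/
def glueL (d : ℕ) {k n : ℕ} (h : k ≤ n) : (Conf d k × Conf d (n - k)) ≃L[ℝ] Conf d n :=
  LinearEquiv.toContinuousLinearEquiv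
    { toFun := fun p => glue p.1 p.2
      invFun := fun x => (x ∘ Fin.castLEEmb h, fun i => x ⟨k + i, by omega⟩)
      map_add' := fun p q => by
        ext i : 1
        by_cases hi : (i : ℕ) < k <;> simp [glue, hi]
      map_smul' := fun c p => by
        ext i : 1
        by_cases hi : (i : ℕ) < k <;> simp [glue, hi]
      left_inv := fun p => by
        refine Prod.ext (glue_comp_castLE h _ _) ?_
        ext i : 1
        exact glue_natAdd h _ _ i
      right_inv := fun x => by
        ext i : 1
        by_cases hi : (i : ℕ) < k
        · simp [glue, hi]
        · simp only [glue, hi, dif_neg, not_false_iff]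
          congr 1
          ext
          simp
          omega }

theorem glueL_apply (h : k ≤ n) (p : Conf d k × Conf d (n - k)) : glueL d h p = glue p.1 p.2 := rfl

theorem measurePreserving_glueL (d : ℕ) (h : k ≤ n) : MeasurePreserving (glueL d h) := by
  let e : Fin k ⊕ Fin (n - k) ≃ Fin n := finSumFinEquiv.trans (finCongr (by omega))
  have h1 := volume_measurePreserving_sumPiEquivProdPi_symm
    (fun _ : Fin k ⊕ Fin (n - k) => EuclideanSpace ℝ (Fin d))
  have h2 := volume_measurePreserving_piCongrLeft (fun _ : Fin n => EuclideanSpace ℝ (Fin d)) e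
  have h3 := h2.comp h1
  refine (funext fun p => ?_ : (glueL d h : Conf d k × Conf d (n - k) → Conf d n) = _) ▸ h3
  ext i : 1
  obtain ⟨i, rfl⟩ := e.surjective i
  have := MeasurableEquiv.piCongrLeft_apply_apply e
    (β := fun _ : Fin n => EuclideanSpace ℝ (Fin d))
    ((MeasurableEquiv.sumPiEquivProdPi fun _ : Fin k ⊕ Fin (n - k) =>
      EuclideanSpace ℝ (Fin d)).symm p) i
  refine Eq.trans ?_ this.symm
  rcases i with i | i
  · simp [glueL_apply, glue, e, MeasurableEquiv.coe_sumPiEquivProdPi_symm,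
      Equiv.sumPiEquivProdPi]
  · simp [glueL_apply, glue, e, MeasurableEquiv.coe_sumPiEquivProdPi_symm,
      Equiv.sumPiEquivProdPi]

theorem integrable_glue (h : k ≤ n) {F : Conf d n → ℂ} (hF : Integrable F) :
    Integrable (fun p : Conf d k × Conf d (n - k) => F (glue p.1 p.2)) :=
  ((measurePreserving_glueL d h).integrable_comp_emb
    (glueL d h).toHomeomorph.measurableEmbedding).2 hF

theorem integral_glue (h : k ≤ n) {F : Conf d n → ℂ} (hF : Integrable F) :
    ∫ x, F x = ∫ y : Conf d k, ∫ z : Conf d (n - k), F (glue y z) := by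
  rw [← (measurePreserving_glueL d h).integral_comp
    (glueL d h).toHomeomorph.measurableEmbedding F]
  exact integral_prod _ (integrable_glue h hF)

theorem integral_glue_symm (h : k ≤ n) {F : Conf d n → ℂ} (hF : Integrable F) :
    ∫ x, F x = ∫ z : Conf d (n - k), ∫ y : Conf d k, F (glue y z) := by
  rw [← (measurePreserving_glueL d h).integral_comp
    (glueL d h).toHomeomorph.measurableEmbedding F]
  exact integral_prod_symm _ (integrable_glue h hF)

/-- Every tuple is the image of the first variables under a permutation. -/
theorem exists_perm_castLE (h : k ≤ n) (α : Fin k ↪ Fin n) :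
    ∃ π : Equiv.Perm (Fin n), (Fin.castLEEmb h).trans π.toEmbedding = α := by
  have := Equiv.Perm.isMultiplyPretransitive (Fin n) k
  obtain ⟨π, hπ⟩ := MulAction.exists_smul_eq (Equiv.Perm (Fin n)) (Fin.castLEEmb h) α
  refine ⟨π, ?_⟩
  rw [← hπ]
  rfl

end Glue

/-! ### Transposes of operators and skew-adjointness -/

section Transpose

variable {d k n : ℕ}

/-- `T'` is the transpose of `T`. -/
def IsTr (T T' : 𝓢(Conf d n, ℂ) →L[ℂ] 𝓢(Conf d n, ℂ)) : Prop :=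
  ∀ f g, ∫ x, T f x * g x = ∫ x, f x * T' g x

/-- For the first `k` variables, Fubini's theorem reduces the identity to the slices in which the
other particles are frozen. A permutation of the integration variables carries it over to every
tuple. -/
theorem IsTr.op {A A' : 𝓢(Conf d k, ℂ) →L[ℂ] 𝓢(Conf d k, ℂ)} (hA : IsTr A A')
    (α : Fin k ↪ Fin n) : IsTr (op A α) (op A' α) := by
  have h : k ≤ n := by simpa using Fintype.card_le_of_embedding α
  have key : IsTr (NBody.op A (Fin.castLEEmb h)) (NBody.op A' (Fin.castLEEmb h)) := fun f g => by
    rw [integral_glue_symm h (integrable_mul volume _ g),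
      integral_glue_symm h (integrable_mul volume f _)]
    congr 1 with z
    have hs : ∀ (f : 𝓢(Conf d n, ℂ)) y, sliceS (Fin.castLEEmb h) (glue y z) f =
        sliceS (Fin.castLEEmb h) (glue 0 z) f := fun f y => by
      ext w
      rw [sliceS_apply, sliceS_apply, extend_glue, extend_glue]
    have hs' : ∀ (f : 𝓢(Conf d n, ℂ)) y, f (glue y z) =
        sliceS (Fin.castLEEmb h) (glue 0 z) f y := fun f y => by
      rw [sliceS_apply, extend_glue]
    simp only [op_apply, glue_comp_castLE, hs]
    simp only [hs']
    exact hA _ _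
  obtain ⟨π, rfl⟩ := exists_perm_castLE h α
  intro f g
  have hc : ∀ (x : Conf d n), (x ∘ ⇑π⁻¹) ∘ ⇑π = x := fun x => by
    ext i : 1
    simp
  simp only [op_perm, permS_apply]
  rw [← integral_comp_perm π⁻¹, ← integral_comp_perm π⁻¹ fun x => f x * _]
  simp only [hc]
  exact key (permS d π⁻¹ f) (permS d π⁻¹ g)

/-- The complex conjugate of an operator. -/
def conjOp (T : 𝓢(Conf d n, ℂ) →L[ℂ] 𝓢(Conf d n, ℂ)) : 𝓢(Conf d n, ℂ) →L[ℂ] 𝓢(Conf d n, ℂ) where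
  toFun f := conjW (T (conjW f))
  map_add' f g := by
    have : conjW (f + g) = conjW f + conjW g := by ext; simp
    ext x
    simp [this]
  map_smul' c f := by
    have : conjW (c • f) = starRingEnd ℂ c • conjW f := by ext; simp
    ext x
    simp [this]
  cont := by
    have : Continuous (conjW : 𝓢(Conf d n, ℂ) → 𝓢(Conf d n, ℂ)) :=
      (SchwartzMap.postcompCLM (𝕜 := ℝ) (Complex.conjCLE : ℂ →L[ℝ] ℂ)).continuous
    exact this.comp (T.continuous.comp this)

theorem conjOp_apply (T : 𝓢(Conf d n, ℂ) →L[ℂ] 𝓢(Conf d n, ℂ)) (f : 𝓢(Conf d n, ℂ)) :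
    conjOp T f = conjW (T (conjW f)) := rfl

theorem op_conjOp (A : 𝓢(Conf d k, ℂ) →L[ℂ] 𝓢(Conf d k, ℂ)) (α : Fin k ↪ Fin n) :
    op (conjOp A) α = conjOp (op A α) := by
  ext f x
  simp only [op_apply, conjOp_apply, conjW_apply]
  congr 3

/-- The transpose of a skew-adjoint operator. -/
theorem isTr_lift (A : Obs d n) : IsTr (lift A.1) (-conjOp (lift A.1)) := fun f g => by
  -- Skew-adjointness refers to the sesquilinear form and to bosonic functions, while `IsTr` is
  -- bilinear and without symmetry; hence the conjugation and the symmetrisation of both functions.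
  have h := A.2 (conjS (sym d n g)) (sym d n f)
  rw [ip_eq_toDual, toDual_apply, conjS_conjS, ip_eq_toDual, toDual_apply] at h
  have h1 := integral_sym_mul (lift A.1 f) g
  rw [sym_lift] at h1
  have h2 := integral_sym_mul f (conjS (A.1 (conjS (sym d n g)))).1
  rw [sym_coe] at h2
  calc _ = ∫ x, lift A.1 f x * (sym d n g).1 x := h1
    _ = ∫ x, (sym d n g).1 x * (A.1 (sym d n f)).1 x := by
      congr 1 with x
      exact mul_comm _ _
    _ = -∫ x, (sym d n f).1 x * (conjS (A.1 (conjS (sym d n g)))).1 x := by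
      rw [h]
      congr 2 with x
      exact mul_comm _ _
    _ = _ := by
      rw [h2, ← integral_neg]
      congr 1 with x
      rw [conjS_sym, ← mul_neg]
      rfl

theorem IsTr.smul {T T' : 𝓢(Conf d n, ℂ) →L[ℂ] 𝓢(Conf d n, ℂ)} (h : IsTr T T') (c : ℂ) :
    IsTr (c • T) (c • T') := fun f g => by
  simp only [smul_apply, smul_eq_mul, mul_assoc, mul_left_comm _ c, integral_const_mul]
  rw [h]

theorem IsTr.comp {S S' T T' : 𝓢(Conf d n, ℂ) →L[ℂ] 𝓢(Conf d n, ℂ)} (hS : IsTr S S')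
    (hT : IsTr T T') : IsTr (S.comp T) (T'.comp S') := fun f g =>
  (hS (T f) g).trans (hT f (S' g))

theorem IsTr.sum {ι : Type*} (s : Finset ι) {T T' : ι → 𝓢(Conf d n, ℂ) →L[ℂ] 𝓢(Conf d n, ℂ)}
    (h : ∀ i ∈ s, IsTr (T i) (T' i)) : IsTr (∑ i ∈ s, T i) (∑ i ∈ s, T' i) := fun f g => by
  simp only [sum_apply, Finset.sum_mul, Finset.mul_sum]
  rw [integral_finsetSum _ fun i _ => integrable_mul volume _ _,
    integral_finsetSum _ fun i _ => integrable_mul volume _ _]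
  exact Finset.sum_congr rfl fun i hi => h i hi f g

/-- Operators on the bosonic Schwartz space with skew transpose are observables. -/
theorem mem_obs_of_isTr {A : Ss d n →L[ℂ] Ss d n} {T : 𝓢(Conf d n, ℂ) →L[ℂ] 𝓢(Conf d n, ℂ)}
    (hA : ∀ f, T f.1 = (A f).1) (hT : IsTr T (-conjOp T)) : A ∈ obs d n := fun f g => by
  have h := hT g.1 (conjW f.1)
  simp only [ip]
  calc _ = ∫ x, T g.1 x * conjW f.1 x := by
        rw [hA]
        congr 1 with x
        rw [conjW_apply, mul_comm]
    _ = _ := by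
      rw [h, ← integral_neg]
      congr 1 with x
      have : conjW (conjW f.1) = f.1 := by ext; simp
      rw [neg_apply, neg_apply, conjOp_apply, this, hA, conjW_apply]
      ring

end Transpose

/-! ### Partial traces on the level of kernels -/

section PartialTrace

variable {d l k n : ℕ}

/-- The change of variables `((x, x'), z) ↦ ((x, z), (x', z))`. -/
def doubleGlue (d : ℕ) {l k : ℕ} (h : l ≤ k) :
    (Conf d l × Conf d l) × Conf d (k - l) →L[ℝ] Conf d k × Conf d k :=
  ((glueL d h : Conf d l × Conf d (k - l) →L[ℝ] Conf d k).comp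
    (((ContinuousLinearMap.fst ℝ (Conf d l) (Conf d l)).comp (.fst ℝ _ _)).prod (.snd ℝ _ _))).prod
  ((glueL d h : Conf d l × Conf d (k - l) →L[ℝ] Conf d k).comp
    (((ContinuousLinearMap.snd ℝ (Conf d l) (Conf d l)).comp (.fst ℝ _ _)).prod (.snd ℝ _ _)))

theorem doubleGlue_apply (h : l ≤ k) (p : (Conf d l × Conf d l) × Conf d (k - l)) :
    doubleGlue d h p = (glue p.1.1 p.2, glue p.1.2 p.2) := rfl

theorem norm_le_glue (h : l ≤ k) (x : Conf d l) (z : Conf d (k - l)) :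
    ‖x‖ ≤ ‖(glue x z : Conf d k)‖ := by
  refine (pi_norm_le_iff_of_nonneg (norm_nonneg _)).2 fun a => ?_
  have := norm_le_pi_norm (glue x z : Conf d k) (Fin.castLEEmb h a)
  rwa [← Function.comp_apply (f := (glue x z : Conf d k)), glue_comp_castLE] at this

theorem norm_le_glue_right (h : l ≤ k) (x : Conf d l) (z : Conf d (k - l)) :
    ‖z‖ ≤ ‖(glue x z : Conf d k)‖ := by
  refine (pi_norm_le_iff_of_nonneg (norm_nonneg _)).2 fun a => ?_
  have := norm_le_pi_norm (glue x z : Conf d k) ⟨l + a, by omega⟩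
  rwa [glue_natAdd h] at this

/-- The kernel `K` as a function of `((x, x'), z)`. -/
def glueCLM (d : ℕ) {l k : ℕ} (h : l ≤ k) :
    𝓢(Conf d k × Conf d k, ℂ) →L[ℂ] 𝓢((Conf d l × Conf d l) × Conf d (k - l), ℂ) :=
  SchwartzMap.compCLMOfAntilipschitz ℂ (g := doubleGlue d h) (K := 1)
    (ContinuousLinearMap.hasTemperateGrowth _)
    (AntilipschitzWith.of_le_mul_dist fun p q => by
      rw [dist_eq_norm, dist_eq_norm, ← map_sub, doubleGlue_apply, Prod.norm_def, Prod.norm_def,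
        Prod.norm_def, NNReal.coe_one, one_mul]
      exact max_le (max_le_max (norm_le_glue h _ _) (norm_le_glue h _ _))
        (le_max_of_le_left (norm_le_glue_right h _ _)))

theorem glueCLM_apply (h : l ≤ k) (K : 𝓢(Conf d k × Conf d k, ℂ))
    (p : (Conf d l × Conf d l) × Conf d (k - l)) :
    glueCLM d h K p = K (glue p.1.1 p.2, glue p.1.2 p.2) := rfl

/-- The integral. -/
def intS (d n : ℕ) : 𝓢(Conf d n, ℂ) →L[ℂ] ℂ := SchwartzMap.integralCLM ℂ volume

theorem intS_apply (f : 𝓢(Conf d n, ℂ)) : intS d n f = ∫ x, f x :=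
  SchwartzMap.integralCLM_apply ℂ f

/-- The partial trace over all but the first `l` variables. -/
def ptrace (d : ℕ) {l k : ℕ} (h : l ≤ k) :
    𝓢(Conf d k × Conf d k, ℂ) →L[ℂ] 𝓢(Conf d l × Conf d l, ℂ) :=
  (app₁ (intS d (k - l))).comp (glueCLM d h)

theorem ptrace_apply (h : l ≤ k) (K : 𝓢(Conf d k × Conf d k, ℂ)) (p : Conf d l × Conf d l) :
    ptrace d h K p = partialTrace (fun x y => K (x, y)) p.1 p.2 := by
  simp only [ptrace, ContinuousLinearMap.comp_apply, app₁_apply, intS_apply, sliceR_apply,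
    glueCLM_apply]
  rfl

theorem integrable_glue_kernel (h : l ≤ k) (K : 𝓢(Conf d k × Conf d k, ℂ)) (x x' : Conf d l) :
    Integrable fun z : Conf d (k - l) => K (glue x z, glue x' z) := by
  refine (sliceR (x, x') (glueCLM d h K)).integrable.congr (Eventually.of_forall fun z => ?_)
  simp [glueCLM_apply]

/-- The trace of an operator on the first variables composed with a kernel. -/
theorem diagInt_left_op (h : l ≤ k) (A : 𝓢(Conf d l, ℂ) →L[ℂ] 𝓢(Conf d l, ℂ))
    (K : 𝓢(Conf d k × Conf d k, ℂ)) :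
    diagInt (Conf d k) (left (op A (Fin.castLEEmb h)) K) =
      diagInt (Conf d l) (left A (ptrace d h K)) := by
  have hint : Integrable fun x => left (op A (Fin.castLEEmb h)) K (x, x) :=
    (diagCLM (Conf d k) (left (op A (Fin.castLEEmb h)) K)).integrable
  rw [diagInt_apply, diagInt_apply, integral_glue h hint]
  congr 1 with y
  obtain ⟨M, hM⟩ : ∃ M : 𝓢(Conf d l × Conf d (k - l), ℂ),
      ∀ y' z, M (y', z) = K (glue y' z, glue y z) := by
    let p : Conf d l × Conf d (k - l) →L[ℝ] (Conf d l × Conf d l) × Conf d (k - l) :=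
      ((ContinuousLinearMap.inl ℝ (Conf d l) (Conf d l)).comp (.fst ℝ _ _)).prod (.snd ℝ _ _)
    let q : Conf d l →L[ℝ] (Conf d l × Conf d l) × Conf d (k - l) :=
      (ContinuousLinearMap.inl ℝ _ _).comp (.inr ℝ _ _)
    refine ⟨affineSlice p q (fun x y => ?_) y (glueCLM d h K), fun y' z => ?_⟩
    · rcases le_total ‖y.2‖ ‖y.1‖ with hy | hy <;> simp [p, q, Prod.norm_def, hy]
    · simp [p, q, glueCLM_apply]
  -- `A` acts on the retained particles while the others are integrated out; Fubini's theorem for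
  -- distributions exchanges the two.
  have hfub := app_comm ((evalS y).comp A) (intS d (k - l)) M
  have h1 : sliceL y (ptrace d h K) = app₁ (intS d (k - l)) M := by
    ext y'
    rw [sliceL_apply, ptrace_apply, app₁_apply, intS_apply]
    simp only [partialTrace, sliceR_apply, hM]
  rw [left_apply]
  dsimp only
  rw [h1]
  refine Eq.trans ?_ hfub.symm
  rw [intS_apply]
  congr 1 with z
  rw [left_apply, app₂_apply]
  dsimp only
  rw [op_apply, glue_comp_castLE, ContinuousLinearMap.comp_apply, evalS_apply]
  congr 2
  ext y'
  rw [sliceS_apply, sliceL_apply, sliceL_apply, extend_glue, hM]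

end PartialTrace

/-! ### The embeddings `ε_{k,N}` as linear maps between observables -/

section Embedding

variable {d k n : ℕ}

/-- `C_{k,n} ∑_α A_{(α)}` on the Schwartz space. -/
def embS (d : ℕ) {k : ℕ} (n : ℕ) (A : 𝓢(Conf d k, ℂ) →L[ℂ] 𝓢(Conf d k, ℂ)) :
    𝓢(Conf d n, ℂ) →L[ℂ] 𝓢(Conf d n, ℂ) :=
  (cst k n : ℂ) • ∑ α : Fin k ↪ Fin n, op A α

theorem permS_permS_inv (π : Equiv.Perm (Fin n)) (f : 𝓢(Conf d n, ℂ)) :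
    permS d π⁻¹ (permS d π f) = f := by
  ext x
  simp only [permS_apply]
  congr 1
  ext i : 1
  simp

/-- Sums over all tuples commute with permutations. -/
theorem permS_embS (A : 𝓢(Conf d k, ℂ) →L[ℂ] 𝓢(Conf d k, ℂ)) (π : Equiv.Perm (Fin n))
    (f : 𝓢(Conf d n, ℂ)) : permS d π (embS d n A f) = embS d n A (permS d π f) := by
  simp only [embS, smul_apply, sum_apply, map_smul, map_sum]
  congr 1
  let e : (Fin k ↪ Fin n) ≃ (Fin k ↪ Fin n) :=
    { toFun := fun α => α.trans π.toEmbedding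
      invFun := fun α => α.trans (π⁻¹).toEmbedding
      left_inv := fun α => by ext; simp
      right_inv := fun α => by ext; simp }
  rw [← Equiv.sum_comp e fun α => op A α (permS d π f)]
  refine Finset.sum_congr rfl fun α _ => ?_
  change _ = op A (α.trans π.toEmbedding) _
  rw [op_perm, permS_permS_inv]

theorem isTr_embS (A : Obs d k) : IsTr (embS d n (lift A.1)) (-conjOp (embS d n (lift A.1))) := by
  have h : -conjOp (embS d n (lift A.1)) =
      (cst k n : ℂ) • ∑ α : Fin k ↪ Fin n, op (-conjOp (lift A.1)) α := by
    ext f x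
    simp only [neg_apply, conjOp_apply, conjW_apply, embS, smul_apply, sum_apply, op_neg, op_conjOp,
      smul_eq_mul, map_mul, map_sum, Complex.conj_ofReal, Finset.sum_neg_distrib, mul_neg]
  rw [h]
  exact (IsTr.sum _ fun α _ => (isTr_lift A).op α).smul _

/-- The sum over all tuples commutes with permutations, hence preserves bosonic functions, and each
of its terms has a skew transpose. -/
theorem exists_isEmb (n : ℕ) (A : Obs d k) :
    ∃ T : Obs d n, IsEmb A T ∧ ∀ f, (T.1 f).1 = embS d n (lift A.1) f.1 := by
  let T : Ss d n →L[ℂ] Ss d n :=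
    ((embS d n (lift A.1)).comp (bosonicSchwartz d n).subtypeL).codRestrict (bosonicSchwartz d n)
      fun f π x => by
        have := permS_embS (lift A.1) π f.1
        rw [permS_coe] at this
        exact DFunLike.congr_fun this x
  refine ⟨⟨T, mem_obs_of_isTr (fun f => rfl) (isTr_embS A)⟩, fun f x => ?_, fun f => rfl⟩
  change embS d n (lift A.1) f.1 x = _
  simp only [embS, smul_apply, sum_apply, actOn_eq_op, smul_eq_mul]

theorem isEmb_emb (n : ℕ) (A : Obs d k) : IsEmb A (emb d k n A) := by
  have h : ∃ T : Obs d n, IsEmb A T := (exists_isEmb n A).imp fun T h => h.1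
  rw [emb, dif_pos h]
  exact h.choose_spec

theorem emb_apply (A : Obs d k) (f : Ss d n) :
    ((emb d k n A).1 f).1 = embS d n (lift A.1) f.1 := by
  ext x
  rw [isEmb_emb n A f x]
  simp only [embS, smul_apply, sum_apply, actOn_eq_op, smul_eq_mul]

theorem obs_ext {A B : Obs d n} (h : ∀ f, (A.1 f).1 = (B.1 f).1) : A = B :=
  Subtype.ext (ContinuousLinearMap.ext fun f => Subtype.ext (h f))

theorem lift_add (A B : Ss d n →L[ℂ] Ss d n) : lift (A + B) = lift A + lift B := rfl

theorem lift_real_smul (c : ℝ) (A : Ss d n →L[ℂ] Ss d n) : lift (c • A) = (c : ℂ) • lift A := by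
  ext f x
  simp [lift_apply]

theorem embS_add (A B : 𝓢(Conf d k, ℂ) →L[ℂ] 𝓢(Conf d k, ℂ)) :
    embS d n (A + B) = embS d n A + embS d n B := by
  simp [embS, op_add, Finset.sum_add_distrib]

theorem embS_smul (c : ℂ) (A : 𝓢(Conf d k, ℂ) →L[ℂ] 𝓢(Conf d k, ℂ)) :
    embS d n (c • A) = c • embS d n A := by
  simp only [embS, op_smul, ← Finset.smul_sum, smul_comm c]

theorem emb_add (A B : Obs d k) : emb d k n (A + B) = emb d k n A + emb d k n B :=
  obs_ext fun f => by
    rw [emb_apply, Submodule.coe_add, lift_add, embS_add, add_apply, ← emb_apply, ← emb_apply]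
    rfl

theorem emb_smul (c : ℝ) (A : Obs d k) : emb d k n (c • A) = c • emb d k n A :=
  obs_ext fun f => by
    rw [emb_apply, Submodule.coe_smul, lift_real_smul, embS_smul, smul_apply, ← emb_apply]
    ext x
    simp

/-- `ε_{k,n}` as a linear map. -/
def embL (d k n : ℕ) : Obs d k →ₗ[ℝ] Obs d n where
  toFun := emb d k n
  map_add' := emb_add
  map_smul' := emb_smul

theorem embL_apply (A : Obs d k) : embL d k n A = emb d k n A := rfl

end Embedding

/-! ### Bosonic functions are determined by tensor powers -/

section Products

variable {d n k : ℕ}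

/-- Polarization of a product. -/
theorem polarization (a : Fin n → Fin n → ℂ) :
    ∑ t : Finset (Fin n), (-1) ^ t.card * ∏ i, ∑ j ∈ tᶜ, a j i =
      ∑ σ : Equiv.Perm (Fin n), ∏ i, a (σ i) i := by
  classical
  have h1 : ∀ t : Finset (Fin n), (-1 : ℂ) ^ t.card * ∏ i, ∑ j ∈ tᶜ, a j i =
      ∑ τ : Fin n → Fin n, if ∀ i, τ i ∉ t then (-1) ^ t.card * ∏ i, a (τ i) i else 0 := fun t => by
    rw [Finset.prod_univ_sum, Finset.mul_sum, ← Finset.sum_filter]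
    refine Finset.sum_congr ?_ fun _ _ => rfl
    ext τ
    simp [Fintype.mem_piFinset]
  -- Inclusion–exclusion: the signs of the sets `t` that avoid the image of `τ` cancel unless `τ` is
  -- surjective.
  have h2 : ∀ τ : Fin n → Fin n, (∑ t : Finset (Fin n),
      if ∀ i, τ i ∉ t then (-1 : ℂ) ^ t.card * ∏ i, a (τ i) i else 0) =
        if Function.Bijective τ then ∏ i, a (τ i) i else 0 := fun τ => by
    have h3 : (∑ t : Finset (Fin n), if ∀ i, τ i ∉ t then (-1 : ℂ) ^ t.card * ∏ i, a (τ i) i else 0)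
        = (∑ t ∈ (Finset.univ.image τ)ᶜ.powerset, (-1 : ℂ) ^ t.card) * ∏ i, a (τ i) i := by
      rw [← Finset.sum_filter, Finset.sum_mul]
      refine Finset.sum_congr ?_ fun _ _ => rfl
      ext t
      simp only [Finset.mem_filter, Finset.mem_univ, true_and, Finset.mem_powerset]
      constructor
      · intro h b hb
        simp only [Finset.mem_compl, Finset.mem_image, Finset.mem_univ, true_and, not_exists]
        exact fun i hi => h i (hi ▸ hb)
      · intro h i hi
        have := h hi
        simp at this
    have h4 : (∑ t ∈ (Finset.univ.image τ)ᶜ.powerset, (-1 : ℂ) ^ t.card) =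
        if (Finset.univ.image τ)ᶜ = ∅ then 1 else 0 := by
      have := Finset.sum_powerset_neg_one_pow_card (x := (Finset.univ.image τ)ᶜ)
      have h5 := congrArg (Int.cast : ℤ → ℂ) this
      push_cast at h5
      exact h5
    have h5 : (Finset.univ.image τ)ᶜ = ∅ ↔ Function.Bijective τ := by
      rw [Finset.compl_eq_empty_iff, ← Finite.surjective_iff_bijective,
        Finset.eq_univ_iff_forall]
      simp [Function.Surjective]
    rw [h3, h4]
    simp only [h5]
    split_ifs <;> simp
  rw [Finset.sum_congr rfl fun t _ => h1 t, Finset.sum_comm, Finset.sum_congr rfl fun τ _ => h2 τ,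
    ← Finset.sum_filter]
  refine Finset.sum_bij' (fun τ h => Equiv.ofBijective τ (Finset.mem_filter.1 h).2)
    (fun σ _ => σ) ?_ ?_ ?_ ?_ ?_
  · exact fun _ _ => Finset.mem_univ _
  · exact fun σ _ => Finset.mem_filter.2 ⟨Finset.mem_univ _, σ.bijective⟩
  · intro τ _
    rfl
  · intro σ _
    ext
    rfl
  · intro τ _
    rfl

theorem exists_prodS (φ : Fin n → 𝓢(EuclideanSpace ℝ (Fin d), ℂ))
    (hφ : ∀ i, HasCompactSupport (φ i)) :
    ∃ f : 𝓢(Conf d n, ℂ), ∀ x, f x = ∏ i, φ i (x i) := by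
  have hc : HasCompactSupport fun x : Conf d n => ∏ i, φ i (x i) := by
    refine HasCompactSupport.intro (K := Set.pi Set.univ fun i => tsupport (φ i))
      (isCompact_univ_pi fun i => hφ i) fun x hx => ?_
    simp only [Set.mem_pi, Set.mem_univ, true_imp_iff, not_forall] at hx
    obtain ⟨i, hi⟩ := hx
    exact Finset.prod_eq_zero (Finset.mem_univ i) (image_eq_zero_of_notMem_tsupport hi)
  have hd : ContDiff ℝ (⊤ : ℕ∞) fun x : Conf d n => ∏ i, φ i (x i) :=
    contDiff_prod fun i _ => ((φ i).smooth ⊤).comp (contDiff_apply ℝ _ i)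
  exact ⟨hc.toSchwartzMap hd, fun x => rfl⟩

theorem exists_powS (φ : 𝓢(EuclideanSpace ℝ (Fin d), ℂ)) (hφ : HasCompactSupport φ) (n : ℕ) :
    ∃ f : Ss d n, ∀ x, f.1 x = ∏ i, φ (x i) := by
  obtain ⟨f, hf⟩ := exists_prodS (fun _ : Fin n => φ) fun _ => hφ
  refine ⟨⟨f, fun π x => ?_⟩, hf⟩
  rw [hf, hf]
  exact Equiv.prod_comp π fun i => φ (x i)

theorem hasCompactSupport_sum (φ : Fin n → 𝓢(EuclideanSpace ℝ (Fin d), ℂ))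
    (hφ : ∀ i, HasCompactSupport (φ i)) (t : Finset (Fin n)) :
    HasCompactSupport (∑ j ∈ t, φ j : 𝓢(EuclideanSpace ℝ (Fin d), ℂ)) := by
  classical
  induction t using Finset.induction_on with
  | empty => exact HasCompactSupport.zero
  | insert a s ha ih =>
    rw [Finset.sum_insert ha]
    exact (hφ a).add ih

/-- Polarization expresses the sum of the products over all orders of the factors by tensor powers,
and the symmetric `H` has the same integral against each order. -/
theorem integral_prod_eq_zero (H : Ss d n) (h : ∀ (φ : 𝓢(EuclideanSpace ℝ (Fin d), ℂ)),
    HasCompactSupport φ → ∫ x : Conf d n, H.1 x * ∏ i, φ (x i) = 0)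
    (φ : Fin n → 𝓢(EuclideanSpace ℝ (Fin d), ℂ)) (hφ : ∀ i, HasCompactSupport (φ i)) :
    ∫ x : Conf d n, H.1 x * ∏ i, φ i (x i) = 0 := by
  have hex : ∀ t : Finset (Fin n), ∃ f : 𝓢(Conf d n, ℂ),
      ∀ x, f x = ∏ i, ∑ j ∈ tᶜ, φ j (x i) := fun t => by
    obtain ⟨f, hf⟩ := exists_prodS (fun _ : Fin n => ∑ j ∈ tᶜ, φ j)
      fun _ => hasCompactSupport_sum φ hφ tᶜ
    exact ⟨f, fun x => by rw [hf]; simp only [sum_apply]⟩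
  choose f hf using hex
  have hf0 : ∀ t, ∫ x, H.1 x * f t x = 0 := fun t => by
    have h3 := h (∑ j ∈ tᶜ, φ j) (hasCompactSupport_sum φ hφ tᶜ)
    simp only [sum_apply] at h3
    simp only [hf]
    exact h3
  have hex' : ∀ σ : Equiv.Perm (Fin n), ∃ f : 𝓢(Conf d n, ℂ), ∀ x, f x = ∏ i, φ (σ i) (x i) :=
    fun σ => exists_prodS (fun i => φ (σ i)) fun i => hφ _
  choose g hg using hex'
  have hpol : ∀ x : Conf d n, ∑ t : Finset (Fin n), (-1 : ℂ) ^ t.card * (H.1 x * f t x) =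
      ∑ σ, H.1 x * g σ x := fun x => by
    rw [← Finset.mul_sum, Finset.sum_congr rfl fun σ _ => hg σ x, ← polarization fun j i => φ j (x i),
      Finset.mul_sum]
    refine Finset.sum_congr rfl fun t _ => ?_
    rw [hf]
    ring
  have h1 : ∫ x : Conf d n, ∑ σ, H.1 x * g σ x = 0 := by
    rw [← funext hpol, integral_finsetSum _ fun t _ =>
      (integrable_mul volume H.1 (f t)).const_mul _]
    refine Finset.sum_eq_zero fun t _ => ?_
    rw [integral_const_mul, hf0, mul_zero]
  rw [integral_finsetSum _ fun σ _ => integrable_mul volume H.1 (g σ)] at h1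
  have h6 : ∀ σ, ∫ x, H.1 x * g σ x = ∫ x : Conf d n, H.1 x * ∏ i, φ i (x i) := fun σ => by
    rw [← integral_comp_perm σ]
    congr 1 with x
    rw [H.2 σ x, hg]
    congr 1
    exact Equiv.prod_comp σ fun i => φ i (x i)
  rw [Finset.sum_congr rfl fun σ _ => h6 σ, Finset.sum_const, nsmul_eq_mul] at h1
  refine (mul_eq_zero.1 h1).resolve_left ?_
  simp [Fintype.card_perm, n.factorial_ne_zero]

/-- A bosonic function is determined by its integrals against powers of test functions. -/
theorem eq_zero_of_integral_pow (H : Ss d n) (h : ∀ (φ : 𝓢(EuclideanSpace ℝ (Fin d), ℂ)),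
    HasCompactSupport φ → ∫ x : Conf d n, H.1 x * ∏ i, φ (x i) = 0) : H = 0 := by
  apply Subtype.ext
  ext c
  refine apply_eq_zero_of_integral volume H.1 c fun r hr => ?_
  choose ρ f hρ hf0 hf hf1 hc using fun i => exists_bump (c i) r hr
  obtain ⟨b, hb⟩ := exists_prodS ρ hc
  refine ⟨b, fun x => ∏ i, f i (x i), fun x => by simp [hb, hρ],
    fun x => Finset.prod_nonneg fun i _ => hf0 _ _, fun x hx => ?_, by simp [hf1], ?_⟩
  · have : ¬ dist x c < r := not_lt.2 hx
    rw [dist_pi_lt_iff hr] at this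
    push Not at this
    obtain ⟨i, hi⟩ := this
    exact Finset.prod_eq_zero (Finset.mem_univ i) (hf i _ hi)
  · simp_rw [hb]
    exact integral_prod_eq_zero H h ρ hc

end Products

/-! ### Injectivity of the embeddings -/

section Injectivity

variable {d n k : ℕ}

open Classical in
-- Freezing variables of a tensor power leaves a scalar times a lower tensor power. On such
-- functions the sum over tuples becomes the finite system of equations solved in
-- `eq_zero_of_sum_embedding`.
theorem actOn_pow (A : Ss d k →L[ℂ] Ss d k) (φ : 𝓢(EuclideanSpace ℝ (Fin d), ℂ)) (α : Fin k ↪ Fin n)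
    (f : Ss d n) (hf : ∀ x, f.1 x = ∏ i, φ (x i)) (g : Ss d k) (hg : ∀ x, g.1 x = ∏ i, φ (x i))
    (x : Conf d n) :
    actOn A α f x = (∏ i ∈ Finset.univ.filter (fun i => i ∉ Set.range α), φ (x i)) *
      (A g).1 (x ∘ α) := by
  have h : slice α x f = (∏ i ∈ Finset.univ.filter (fun i => i ∉ Set.range α), φ (x i)) • g := by
    apply Subtype.ext
    ext y
    rw [slice_apply, hf]
    change _ = (∏ i ∈ Finset.univ.filter (fun i => i ∉ Set.range α), φ (x i)) * g.1 y
    rw [hg, ← Finset.prod_filter_mul_prod_filter_not _ (fun i => i ∉ Set.range α)]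
    congr 1
    · refine Finset.prod_congr rfl fun i hi => ?_
      rw [Function.extend_apply']
      simpa using hi
    · have : Finset.univ.filter (fun i => ¬ i ∉ Set.range α) = Finset.univ.map α := by
        ext i
        simp
      rw [this, Finset.prod_map]
      simp [α.injective.extend_apply]
  rw [actOn, h, map_smul]
  rfl

/-- Rearranging a configuration that contains all the particles away from `p`. -/
theorem exists_perm_of_range {E : Type*} (h : k ≤ n) (y : Fin k → E) (p : E) (x : Fin n → E)
    (hx : x = Function.extend (Fin.castLEEmb h) y fun _ => p) (α : Fin k ↪ Fin n)
    (hα : ∀ i, x i ≠ p → i ∈ Set.range α) : ∃ σ : Equiv.Perm (Fin k), x ∘ α = y ∘ σ := by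
  classical
  have hxy : ∀ a, x (Fin.castLEEmb h a) = y a := fun a => by
    rw [hx, (Fin.castLEEmb h).injective.extend_apply]
  have hxp : ∀ i, x i ≠ p → ∃ b, Fin.castLEEmb h b = i := fun i hi => by
    by_contra hb
    rw [hx, Function.extend_apply' _ _ _ hb] at hi
    exact hi rfl
  choose g hg using fun a : {a // x (α a) ≠ p} => hxp _ a.2
  have hgy : ∀ a, y (g a) = x (α a) := fun a => by rw [← hxy, hg]
  let e : {a // x (α a) ≠ p} ≃ {b // y b ≠ p} := Equiv.ofBijective
    (fun a => ⟨g a, by rw [hgy]; exact a.2⟩) (by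
      constructor
      · intro a b hab
        have : g a = g b := congrArg Subtype.val hab
        have h2 := hg a
        rw [this, hg b] at h2
        exact Subtype.ext (α.injective h2).symm
      · rintro ⟨b, hb⟩
        rw [← hxy] at hb
        obtain ⟨a, ha⟩ := hα _ hb
        refine ⟨⟨a, by rwa [ha]⟩, Subtype.ext ?_⟩
        apply (Fin.castLEEmb h).injective
        rw [hg]
        exact ha)
  refine ⟨e.extendSubtype, funext fun a => ?_⟩
  by_cases ha : x (α a) ≠ p
  · rw [Function.comp_apply, Function.comp_apply, e.extendSubtype_apply_of_mem a ha]
    exact (hgy ⟨a, ha⟩).symm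
  · have h2 := e.extendSubtype_not_mem a ha
    rw [Function.comp_apply, Function.comp_apply, not_not.1 ha, not_not.1 h2]

/-- The sum over all tuples determines the summand. -/
theorem eq_zero_of_sum_embedding {E : Type*} [DecidableEq E] (h : k ≤ n) (φ : E → ℂ) (p : E)
    (hp : φ p ≠ 0) (f : (Fin k → E) → ℂ) (hf : ∀ (σ : Equiv.Perm (Fin k)) y, f (y ∘ σ) = f y)
    (hsum : ∀ x : Fin n → E, ∑ α : Fin k ↪ Fin n,
      (∏ i ∈ Finset.univ.filter (fun i => i ∉ Set.range α), φ (x i)) * f (x ∘ α) = 0) (y : Fin k → E) :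
    f y = 0 := by
  classical
  -- Induction on the number of entries of `y` that differ from `p`. Let `x` be `y` padded with
  -- copies of `p`. A tuple that misses one of these entries selects fewer of them, and its term
  -- vanishes by induction; every other tuple selects a permutation of `y`. So a positive multiple
  -- of `φ p ^ (n - k) * f y` is zero.
  induction hm : (Finset.univ.filter fun i => y i ≠ p).card using Nat.strong_induction_on
    generalizing y with
  | _ m ih =>
  set x : Fin n → E := Function.extend (Fin.castLEEmb h) y fun _ => p with hx
  have hxy : ∀ a, x (Fin.castLEEmb h a) = y a := fun a => by
    rw [hx, (Fin.castLEEmb h).injective.extend_apply]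
  have hxp : ∀ i, i ∉ Set.range (Fin.castLEEmb h) → x i = p := fun i hi => by
    rw [hx, Function.extend_apply' _ _ _ hi]
  have hcard : (Finset.univ.filter fun i => x i ≠ p).card = m := by
    rw [← hm]
    have : (Finset.univ.filter fun i => x i ≠ p) =
        (Finset.univ.filter fun a => y a ≠ p).map (Fin.castLEEmb h) := by
      ext i
      simp only [Finset.mem_filter, Finset.mem_univ, true_and, Finset.mem_map]
      constructor
      · intro hi
        by_cases hr : i ∈ Set.range (Fin.castLEEmb h)
        · obtain ⟨a, rfl⟩ := hr
          exact ⟨a, by rwa [hxy] at hi, rfl⟩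
        · exact absurd (hxp i hr) hi
      · rintro ⟨a, ha, rfl⟩
        rwa [hxy]
    rw [this, Finset.card_map]
  have hterm : ∀ α : Fin k ↪ Fin n,
      (∏ i ∈ Finset.univ.filter (fun i => i ∉ Set.range α), φ (x i)) * f (x ∘ α) =
        if ∀ i, x i ≠ p → i ∈ Set.range α then φ p ^ (n - k) * f y else 0 := fun α => by
    split_ifs with hα
    · obtain ⟨σ, hσ⟩ := exists_perm_of_range h y p x hx α hα
      rw [hσ, hf, Finset.prod_congr rfl fun i hi => ?_, Finset.prod_const]
      · congr 2
        have : Finset.univ.filter (fun i => i ∉ Set.range α) = (Finset.univ.map α)ᶜ := by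
          ext i
          simp
        rw [this, Finset.card_compl, Finset.card_map]
        simp
      · by_contra hne
        have h2 : x i ≠ p := fun h3 => hne (by rw [h3])
        exact (Finset.mem_filter.1 hi).2 (hα i h2)
    · push Not at hα
      obtain ⟨i, hi, hiα⟩ := hα
      rw [ih _ _ (x ∘ α) rfl, mul_zero]
      rw [← hcard, ← Finset.card_map α]
      refine Finset.card_lt_card (Finset.ssubset_iff_of_subset ?_ |>.2 ⟨i, ?_, ?_⟩)
      · intro b hb
        simp only [Finset.mem_map, Finset.mem_filter, Finset.mem_univ, true_and] at hb ⊢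
        obtain ⟨a, ha, rfl⟩ := hb
        exact ha
      · simpa using hi
      · simp only [Finset.mem_map, not_exists, not_and]
        rintro a - ha
        exact hiα ⟨a, ha⟩
  have h1 := hsum x
  rw [Finset.sum_congr rfl fun α _ => hterm α, ← Finset.sum_filter, Finset.sum_const,
    nsmul_eq_mul] at h1
  have h2 : ((Finset.univ.filter fun α : Fin k ↪ Fin n =>
      ∀ i, x i ≠ p → i ∈ Set.range α).card : ℂ) ≠ 0 := by
    rw [Nat.cast_ne_zero]
    refine Finset.card_ne_zero_of_mem (a := Fin.castLEEmb h) ?_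
    simp only [Finset.mem_filter, Finset.mem_univ, true_and]
    intro i hi
    by_contra hr
    exact hi (hxp i hr)
  exact (mul_eq_zero.1 ((mul_eq_zero.1 h1).resolve_left h2)).resolve_left (pow_ne_zero _ hp)

/-- `A` annihilates the tensor powers of compactly supported functions by
`eq_zero_of_sum_embedding`. Skew-adjointness then makes every `A f` orthogonal to these powers, so
their span need not be shown to be dense in the Schwartz topology. -/
theorem emb_eq_zero (h1 : 1 ≤ k) (h : k ≤ n) (A : Obs d k) (hA : emb d k n A = 0) : A = 0 := by
  classical
  have hpow : ∀ (φ : 𝓢(EuclideanSpace ℝ (Fin d), ℂ)), HasCompactSupport φ → ∀ g : Ss d k,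
      (∀ x, g.1 x = ∏ i, φ (x i)) → A.1 g = 0 := fun φ hφ g hg => by
    by_cases h0 : ∃ p, φ p ≠ 0
    · obtain ⟨p, hp⟩ := h0
      obtain ⟨f, hf⟩ := exists_powS φ hφ n
      apply Subtype.ext
      ext y
      refine eq_zero_of_sum_embedding h φ p hp (A.1 g).1 (fun σ y => (A.1 g).2 σ y) (fun x => ?_) y
      have h2 := isEmb_emb n A f x
      rw [hA, Finset.sum_congr rfl fun α _ => actOn_pow A.1 φ α f hf g hg x] at h2
      have h3 : (cst k n : ℂ) ≠ 0 := by
        rw [cst, Complex.ofReal_ne_zero]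
        have : n.descFactorial k ≠ 0 := (Nat.descFactorial_pos.2 h).ne'
        positivity
      have h4 : (((0 : Obs d n).1 f).1 : 𝓢(Conf d n, ℂ)) x = 0 := rfl
      rw [h4] at h2
      have h5 := (mul_eq_zero.1 h2.symm).resolve_left h3
      convert h5 using 2
    -- If `φ` vanishes identically, its tensor power is zero because `1 ≤ k`.
    · push Not at h0
      have : g = 0 := by
        apply Subtype.ext
        ext x
        rw [hg]
        exact Finset.prod_eq_zero (Finset.mem_univ ⟨0, h1⟩) (h0 _)
      rw [this, map_zero]
  refine obs_ext fun f => ?_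
  have h2 : conjS (A.1 f) = 0 := by
    refine eq_zero_of_integral_pow _ fun φ hφ => ?_
    obtain ⟨g, hg⟩ := exists_powS φ hφ k
    have h3 := A.2 f g
    rw [hpow φ hφ g hg] at h3
    have h4 : ip f (0 : Ss d k) = 0 := by simp [ip_eq_toDual]
    rw [h4, zero_eq_neg, ip_eq_toDual, toDual_apply] at h3
    simp_rw [← hg]
    exact h3
  rw [← conjS_conjS (A.1 f), h2]
  ext x
  simp

theorem emb_injective (h1 : 1 ≤ k) (h : k ≤ n) : Function.Injective (emb d k n) := by
  intro A B hAB
  rw [← sub_eq_zero]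
  refine emb_eq_zero h1 h _ ?_
  rw [← embL_apply, map_sub, embL_apply, embL_apply, hAB, sub_self]

end Injectivity

/-! ### Counting tuples by their joint indices and overlaps -/

section Combinatorics

variable {l j k n : ℕ}

/-- The indices that occur in one of two tuples. -/
def joint (α : Fin l ↪ Fin n) (β : Fin j ↪ Fin n) : Finset (Fin n) :=
  Finset.univ.map α ∪ Finset.univ.map β

/-- The number of indices that occur in both of two tuples. -/
def overlap (α : Fin l ↪ Fin n) (β : Fin j ↪ Fin n) : ℕ :=
  (Finset.univ.filter fun i => β i ∈ Set.range α).card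

theorem overlap_eq_card_inter (α : Fin l ↪ Fin n) (β : Fin j ↪ Fin n) :
    overlap α β = (Finset.univ.map α ∩ Finset.univ.map β).card := by
  rw [overlap, ← Finset.card_map β]
  congr 1
  ext i
  simp only [Finset.mem_map, Finset.mem_filter, Finset.mem_univ, true_and, Finset.mem_inter,
    Set.mem_range]
  constructor
  · rintro ⟨a, ⟨b, hb⟩, rfl⟩
    exact ⟨⟨b, hb⟩, a, rfl⟩
  · rintro ⟨⟨b, hb⟩, a, rfl⟩
    exact ⟨a, ⟨b, hb⟩, rfl⟩

theorem card_joint_add_overlap (α : Fin l ↪ Fin n) (β : Fin j ↪ Fin n) :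
    (joint α β).card + overlap α β = l + j := by
  rw [overlap_eq_card_inter, joint, Finset.card_union_add_card_inter]
  simp

theorem joint_trans (α : Fin l ↪ Fin k) (β : Fin j ↪ Fin k) (γ : Fin k ↪ Fin n) :
    joint (α.trans γ) (β.trans γ) = (joint α β).map γ := by
  simp [joint, Finset.map_union, Finset.map_map]

theorem card_joint_le (α : Fin l ↪ Fin n) (β : Fin j ↪ Fin n) : (joint α β).card ≤ n := by
  simpa using Finset.card_le_univ (joint α β)

theorem overlap_eq_zero {α : Fin l ↪ Fin n} {β : Fin j ↪ Fin n} (h : overlap α β = 0) (a : Fin l)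
    (b : Fin j) : α a ≠ β b := fun hab => by
  rw [overlap, Finset.card_eq_zero, Finset.filter_eq_empty_iff] at h
  exact h (Finset.mem_univ b) ⟨a, hab⟩

theorem overlap_le (α : Fin l ↪ Fin n) (β : Fin j ↪ Fin n) : overlap α β ≤ j :=
  (Finset.card_le_univ _).trans_eq (Fintype.card_fin j)

theorem overlap_le' (α : Fin l ↪ Fin n) (β : Fin j ↪ Fin n) : overlap α β ≤ l := by
  have h1 := card_joint_add_overlap α β
  have h2 : (Finset.univ.map β).card ≤ (joint α β).card :=
    Finset.card_le_card Finset.subset_union_right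
  rw [Finset.card_map, Finset.card_univ, Fintype.card_fin] at h2
  omega

theorem exists_perm_trans (ι ι' : Fin k ↪ Fin n) :
    ∃ π : Equiv.Perm (Fin n), ι.trans π.toEmbedding = ι' := by
  have := Equiv.Perm.isMultiplyPretransitive (Fin n) k
  obtain ⟨π, hπ⟩ := MulAction.exists_smul_eq (Equiv.Perm (Fin n)) ι ι'
  refine ⟨π, ?_⟩
  rw [← hπ]
  rfl

theorem exists_trans_of_range_subset (ι : Fin l ↪ Fin n) (γ : Fin k ↪ Fin n)
    (h : Finset.univ.map ι ⊆ Finset.univ.map γ) : ∃ δ : Fin l ↪ Fin k, δ.trans γ = ι := by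
  have h1 : ∀ i, ∃ a, γ a = ι i := fun i => by
    simpa using h (Finset.mem_map_of_mem ι (Finset.mem_univ i))
  choose f hf using h1
  refine ⟨⟨f, fun a b hab => ι.injective ?_⟩, ?_⟩
  · rw [← hf, ← hf, hab]
  · exact Function.Embedding.ext hf

theorem exists_perm_of_range_eq (ι ι' : Fin k ↪ Fin n)
    (h : Finset.univ.map ι = Finset.univ.map ι') :
    ∃ π : Equiv.Perm (Fin k), π.toEmbedding.trans ι' = ι := by
  obtain ⟨δ, hδ⟩ := exists_trans_of_range_subset ι ι' h.subset
  exact ⟨Equiv.ofBijective δ (Finite.injective_iff_bijective.1 δ.injective), by rw [← hδ]; rfl⟩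

theorem trans_right_injective (γ : Fin k ↪ Fin n) :
    Function.Injective fun δ : Fin l ↪ Fin k => δ.trans γ := fun δ δ' h => by
  ext i
  have := DFunLike.congr_fun h i
  simp only [Function.Embedding.trans_apply] at this
  rw [γ.injective this]

/-- Double counting of pairs of a `k`-tuple `γ` and a tuple `ι` of length `S.card` with entries in
the range of `γ`. Permutations of `Fin n` show that the number of `γ` is the same for every `ι`. -/
theorem card_filter_subset_map (S : Finset (Fin n)) :
    (Finset.univ.filter fun γ : Fin k ↪ Fin n => S ⊆ Finset.univ.map γ).card *
      n.descFactorial S.card = n.descFactorial k * k.descFactorial S.card := by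
  classical
  have hperm : ∀ ι ι' : Fin S.card ↪ Fin n,
      (Finset.univ.filter fun γ : Fin k ↪ Fin n => Finset.univ.map ι ⊆ Finset.univ.map γ).card =
      (Finset.univ.filter fun γ : Fin k ↪ Fin n => Finset.univ.map ι' ⊆ Finset.univ.map γ).card := by
    intro ι ι'
    obtain ⟨π, hπ⟩ := exists_perm_trans ι ι'
    have h2 : Function.Injective fun γ : Fin k ↪ Fin n => γ.trans π.toEmbedding :=
      trans_right_injective _
    rw [← Finset.card_map ⟨_, h2⟩]
    congr 1
    ext γ
    simp only [Finset.mem_map, Finset.mem_filter, Finset.mem_univ, true_and,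
      Function.Embedding.coeFn_mk]
    constructor
    · rintro ⟨γ', hγ', rfl⟩
      rw [← hπ, ← Finset.map_map, ← Finset.map_map]
      exact Finset.map_subset_map.2 hγ'
    · intro h
      have h3 : (γ.trans (π⁻¹).toEmbedding).trans π.toEmbedding = γ := by
        ext
        simp
      refine ⟨γ.trans (π⁻¹).toEmbedding, ?_, h3⟩
      rw [← Finset.map_subset_map (f := π.toEmbedding), Finset.map_map, Finset.map_map, h3, hπ]
      exact h
  let ι₀ : Fin S.card ↪ Fin n := (S.orderEmbOfFin rfl).toEmbedding
  have h0 : Finset.univ.map ι₀ = S := by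
    ext i
    have := S.range_orderEmbOfFin rfl
    rw [← Finset.mem_coe (s := S), ← this]
    simp [ι₀]
  have h1 : ∑ ι : Fin S.card ↪ Fin n,
      (Finset.univ.filter fun γ : Fin k ↪ Fin n => Finset.univ.map ι ⊆ Finset.univ.map γ).card =
      (Finset.univ.filter fun γ : Fin k ↪ Fin n => S ⊆ Finset.univ.map γ).card *
      n.descFactorial S.card := by
    rw [Finset.sum_congr rfl fun ι _ => hperm ι ι₀, h0, Finset.sum_const, mul_comm]
    simp [Fintype.card_embedding_eq]
  have h2 : ∑ ι : Fin S.card ↪ Fin n,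
      (Finset.univ.filter fun γ : Fin k ↪ Fin n => Finset.univ.map ι ⊆ Finset.univ.map γ).card =
      ∑ γ : Fin k ↪ Fin n,
      (Finset.univ.filter fun ι : Fin S.card ↪ Fin n => Finset.univ.map ι ⊆ Finset.univ.map γ).card := by
    simp only [Finset.card_filter]
    exact Finset.sum_comm
  have h3 : ∀ γ : Fin k ↪ Fin n, (Finset.univ.filter fun ι : Fin S.card ↪ Fin n =>
      Finset.univ.map ι ⊆ Finset.univ.map γ).card = k.descFactorial S.card := fun γ => by
    have h4 : (Finset.univ.filter fun ι : Fin S.card ↪ Fin n =>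
        Finset.univ.map ι ⊆ Finset.univ.map γ) =
        Finset.univ.map ⟨_, trans_right_injective (l := S.card) γ⟩ := by
      ext ι
      simp only [Finset.mem_filter, Finset.mem_univ, true_and, Finset.mem_map,
        Function.Embedding.coeFn_mk]
      constructor
      · exact exists_trans_of_range_subset ι γ
      · rintro ⟨δ, rfl⟩
        rw [← Finset.map_map]
        exact Finset.map_subset_map.2 (Finset.subset_univ _)
    rw [h4, Finset.card_map]
    simp [Fintype.card_embedding_eq]
  rw [← h1, h2, Finset.sum_congr rfl fun γ _ => h3 γ]
  simp [Fintype.card_embedding_eq]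

/-- A pair of tuples factors through `γ` if and only if `γ` covers its joint index set, and then in
a unique way; exchanging the sums leaves the number of such `γ`. -/
theorem sum_joint_trans {V : Type*} [AddCommGroup V] [Module ℂ V]
    (T : (Fin l ↪ Fin n) → (Fin j ↪ Fin n) → V) (w : ℕ → ℂ) :
    ∑ γ : Fin k ↪ Fin n, ∑ p : (Fin l ↪ Fin k) × (Fin j ↪ Fin k),
      w (joint p.1 p.2).card • T (p.1.trans γ) (p.2.trans γ) =
    ∑ q : (Fin l ↪ Fin n) × (Fin j ↪ Fin n),
      ((Finset.univ.filter fun γ : Fin k ↪ Fin n => joint q.1 q.2 ⊆ Finset.univ.map γ).card *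
        w (joint q.1 q.2).card) • T q.1 q.2 := by
  classical
  have h1 : ∀ γ : Fin k ↪ Fin n, ∑ p : (Fin l ↪ Fin k) × (Fin j ↪ Fin k),
      w (joint p.1 p.2).card • T (p.1.trans γ) (p.2.trans γ) =
      ∑ q : (Fin l ↪ Fin n) × (Fin j ↪ Fin n), if joint q.1 q.2 ⊆ Finset.univ.map γ then
        w (joint q.1 q.2).card • T q.1 q.2 else 0 := fun γ => by
    let e : (Fin l ↪ Fin k) × (Fin j ↪ Fin k) ↪ (Fin l ↪ Fin n) × (Fin j ↪ Fin n) :=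
      ⟨_, (trans_right_injective (l := l) γ).prodMap (trans_right_injective (l := j) γ)⟩
    rw [← Finset.sum_filter]
    have h2 : (Finset.univ.filter fun q : (Fin l ↪ Fin n) × (Fin j ↪ Fin n) =>
        joint q.1 q.2 ⊆ Finset.univ.map γ) = Finset.univ.map e := by
      ext ⟨α, β⟩
      simp only [Finset.mem_filter, Finset.mem_univ, true_and, Finset.mem_map]
      constructor
      · intro h
        obtain ⟨δ, hδ⟩ := exists_trans_of_range_subset α γ (Finset.subset_union_left.trans h)
        obtain ⟨δ', hδ'⟩ := exists_trans_of_range_subset β γ (Finset.subset_union_right.trans h)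
        exact ⟨(δ, δ'), Prod.ext hδ hδ'⟩
      · rintro ⟨⟨δ, δ'⟩, h⟩
        obtain ⟨rfl, rfl⟩ := Prod.ext_iff.1 h
        change joint (δ.trans γ) (δ'.trans γ) ⊆ _
        rw [joint_trans]
        exact Finset.map_subset_map.2 (Finset.subset_univ _)
    rw [h2, Finset.sum_map]
    refine Finset.sum_congr rfl fun p _ => ?_
    change _ = w (joint (p.1.trans γ) (p.2.trans γ)).card • T (p.1.trans γ) (p.2.trans γ)
    rw [joint_trans, Finset.card_map]
  rw [Finset.sum_congr rfl fun γ _ => h1 γ, Finset.sum_comm]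
  refine Finset.sum_congr rfl fun q _ => ?_
  rw [← Finset.sum_filter, Finset.sum_const, mul_smul, Nat.cast_smul_eq_nsmul]

/-- The four classes of indices given by membership in `A` and in `B` have the same sizes as those
for `A` and `B'`; `σ` is a bijection class by class. -/
theorem exists_perm_map_eq (A B B' : Finset (Fin n)) (h1 : B.card = B'.card)
    (h2 : (A ∩ B).card = (A ∩ B').card) :
    ∃ σ : Equiv.Perm (Fin n), A.map σ.toEmbedding = A ∧ B.map σ.toEmbedding = B' := by
  have key : ∀ x : Bool × Bool,
      Fintype.card {i // (decide (i ∈ A), decide (i ∈ B)) = x} =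
      Fintype.card {i // (decide (i ∈ A), decide (i ∈ B')) = x} := by
    have h3 : ∀ C : Finset (Fin n), ∀ x : Bool × Bool,
        Fintype.card {i // (decide (i ∈ A), decide (i ∈ C)) = x} =
        match x with
        | (true, true) => (A ∩ C).card
        | (true, false) => (A \ C).card
        | (false, true) => (C \ A).card
        | (false, false) => ((A ∪ C)ᶜ).card := by
      rintro C ⟨_ | _, _ | _⟩ <;> rw [Fintype.card_subtype] <;> dsimp only <;> congr 1 <;> ext i <;>
        simp [and_comm]
    intro x
    rw [h3, h3]
    have e1 := Finset.card_inter_add_card_sdiff A B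
    have e2 := Finset.card_inter_add_card_sdiff A B'
    have e3 := Finset.card_inter_add_card_sdiff B A
    have e4 := Finset.card_inter_add_card_sdiff B' A
    have e5 := Finset.card_union_add_card_inter A B
    have e6 := Finset.card_union_add_card_inter A B'
    rw [Finset.inter_comm] at e3 e4
    obtain ⟨_ | _, _ | _⟩ := x
    · dsimp only
      rw [Finset.card_compl, Finset.card_compl]
      omega
    · dsimp only
      omega
    · dsimp only
      omega
    · exact h2
  let σ : Equiv.Perm (Fin n) := Equiv.ofFiberEquiv (f := fun i => (decide (i ∈ A), decide (i ∈ B)))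
    (g := fun i => (decide (i ∈ A), decide (i ∈ B'))) fun x => Fintype.equivOfCardEq (key x)
  have hσ : ∀ i, (decide (σ i ∈ A), decide (σ i ∈ B')) = (decide (i ∈ A), decide (i ∈ B)) :=
    fun i => Equiv.ofFiberEquiv_map (f := fun i => (decide (i ∈ A), decide (i ∈ B)))
      (g := fun i => (decide (i ∈ A), decide (i ∈ B'))) _ i
  refine ⟨σ, ?_, ?_⟩
  · ext i
    have h4 := (Prod.ext_iff.1 (hσ (σ.symm i))).1
    simp only [Equiv.apply_symm_apply, decide_eq_decide] at h4
    rw [Finset.mem_map_equiv, h4]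
  · ext i
    have h4 := (Prod.ext_iff.1 (hσ (σ.symm i))).2
    simp only [Equiv.apply_symm_apply, decide_eq_decide] at h4
    rw [Finset.mem_map_equiv, h4]

/-- Two pairs of tuples with the same overlap differ by permutations. -/
theorem exists_perm_of_overlap_eq (α : Fin l ↪ Fin n) (β β' : Fin j ↪ Fin n)
    (h : overlap α β = overlap α β') : ∃ (σ : Equiv.Perm (Fin n)) (π : Equiv.Perm (Fin l))
      (π' : Equiv.Perm (Fin j)), α.trans σ.toEmbedding = π.toEmbedding.trans α ∧
        β.trans σ.toEmbedding = π'.toEmbedding.trans β' := by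
  rw [overlap_eq_card_inter, overlap_eq_card_inter] at h
  obtain ⟨σ, h1, h2⟩ := exists_perm_map_eq (Finset.univ.map α) (Finset.univ.map β)
    (Finset.univ.map β') (by simp) h
  rw [Finset.map_map] at h1 h2
  obtain ⟨π, hπ⟩ := exists_perm_of_range_eq _ _ h1
  obtain ⟨π', hπ'⟩ := exists_perm_of_range_eq _ _ h2
  exact ⟨σ, π, π', hπ.symm, hπ'.symm⟩

/-- The number of tuples with prescribed positions of the entries in `Fin l`. -/
theorem card_embedding_split (R : Finset (Fin j)) (S : Finset (Fin n)) :
    (Finset.univ.filter fun β : Fin j ↪ Fin n => ∀ i, i ∈ R ↔ β i ∈ S).card =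
      S.card.descFactorial R.card * (n - S.card).descFactorial (j - R.card) := by
  classical
  let e : {β : Fin j ↪ Fin n // ∀ i, i ∈ R ↔ β i ∈ S} ≃
      ({i // i ∈ R} ↪ {a // a ∈ S}) × ({i // i ∉ R} ↪ {a // a ∉ S}) :=
    { toFun := fun β =>
        (⟨fun i => ⟨β.1 i, (β.2 i).1 i.2⟩, fun a b hab =>
          Subtype.ext (β.1.injective (congrArg Subtype.val hab))⟩,
         ⟨fun i => ⟨β.1 i, fun h => i.2 ((β.2 i).2 h)⟩, fun a b hab =>
          Subtype.ext (β.1.injective (congrArg Subtype.val hab))⟩)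
      invFun := fun p => ⟨⟨fun i => if h : i ∈ R then (p.1 ⟨i, h⟩ : Fin n) else p.2 ⟨i, h⟩, by
          intro a b hab
          dsimp only at hab
          split_ifs at hab with h1 h2 h2
          · exact congrArg Subtype.val (p.1.injective (Subtype.ext hab))
          · exact absurd (hab ▸ (p.1 ⟨a, h1⟩).2) (p.2 ⟨b, h2⟩).2
          · exact absurd (hab ▸ (p.1 ⟨b, h2⟩).2) (p.2 ⟨a, h1⟩).2
          · exact congrArg Subtype.val (p.2.injective (Subtype.ext hab))⟩, by
        intro i
        by_cases h : i ∈ R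
        · refine iff_of_true h ?_
          change dite (i ∈ R) (fun h => (p.1 ⟨i, h⟩ : Fin n)) (fun h => p.2 ⟨i, h⟩) ∈ S
          rw [dif_pos h]
          exact (p.1 ⟨i, h⟩).2
        · refine iff_of_false h ?_
          change ¬ dite (i ∈ R) (fun h => (p.1 ⟨i, h⟩ : Fin n)) (fun h => p.2 ⟨i, h⟩) ∈ S
          rw [dif_neg h]
          exact (p.2 ⟨i, h⟩).2⟩
      left_inv := fun β => by
        refine Subtype.ext (Function.Embedding.ext fun i => ?_)
        by_cases h : i ∈ R
        · exact dif_pos h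
        · exact dif_neg h
      right_inv := fun p => by
        refine Prod.ext (Function.Embedding.ext fun i => Subtype.ext ?_)
          (Function.Embedding.ext fun i => Subtype.ext ?_)
        · exact dif_pos i.2
        · exact dif_neg i.2 }
  rw [← Fintype.card_subtype, Fintype.card_congr e, Fintype.card_prod, Fintype.card_embedding_eq,
    Fintype.card_embedding_eq]
  simp [Fintype.card_subtype_compl]

/-- The tuples are sorted by the set of the `r` positions whose entries lie in the range of `α`. -/
theorem card_overlap (α : Fin l ↪ Fin n) (r : ℕ) :
    (Finset.univ.filter fun β : Fin j ↪ Fin n => overlap α β = r).card =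
      j.choose r * (l.descFactorial r * (n - l).descFactorial (j - r)) := by
  classical
  have h1 : (Finset.univ.filter fun β : Fin j ↪ Fin n => overlap α β = r) =
      (Finset.univ.powersetCard r : Finset (Finset (Fin j))).biUnion fun R =>
        Finset.univ.filter fun β : Fin j ↪ Fin n => ∀ i, i ∈ R ↔ β i ∈ Finset.univ.map α := by
    ext β
    simp only [Finset.mem_filter, Finset.mem_univ, true_and, Finset.mem_biUnion,
      Finset.mem_powersetCard, Finset.subset_univ]
    constructor
    · intro h
      exact ⟨_, h, fun i => by simp⟩
    · rintro ⟨R, hR, h⟩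
      rw [← hR, overlap]
      congr 1
      ext i
      simp [h]
  rw [h1, Finset.card_biUnion]
  · rw [Finset.sum_congr rfl fun R hR => by
      rw [card_embedding_split, (Finset.mem_powersetCard.1 hR).2, Finset.card_map, Finset.card_univ,
        Fintype.card_fin]]
    simp
  · intro R _ R' _ hne
    rw [Function.onFun, Finset.disjoint_left]
    intro β hβ hβ'
    refine hne (Finset.ext fun i => ?_)
    rw [(Finset.mem_filter.1 hβ).2, (Finset.mem_filter.1 hβ').2]

theorem overlap_of_mem_tuples (h : l ≤ k) {r : ℕ} (hr : r ≤ j) {β : Fin j ↪ Fin k}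
    (hβ : β ∈ tuples l j k r) : overlap (Fin.castLEEmb h) β = r := by
  have h2 := (Finset.mem_filter.1 hβ).2
  have h3 : (Finset.univ.filter fun i : Fin j => β i ∈ Set.range (Fin.castLEEmb h)) =
      Finset.univ.filter fun i : Fin j => (i : ℕ) < r := by
    ext i
    simp only [Finset.mem_filter, Finset.mem_univ, true_and, Set.mem_range]
    constructor
    · rintro ⟨a, ha⟩
      by_contra hi
      have h4 := h2.2 i (not_lt.1 hi)
      rw [← ha] at h4
      have := a.2
      simp at h4
      omega
    · intro hi
      exact ⟨⟨β i, h2.1 i hi⟩, Fin.ext rfl⟩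
  rw [overlap, h3, Fin.card_filter_val_lt]
  omega

/-- Only the first `r` entries are free; `hk` says that the prescribed entries fit into `Fin k`. -/
theorem card_tuples (h : l ≤ k) {r : ℕ} (hr : r ≤ j) (hk : l + j - r ≤ k) :
    (tuples l j k r).card = l.descFactorial r := by
  let e : (Fin r ↪ Fin l) ≃ {β // β ∈ tuples l j k r} :=
    { toFun := fun δ => ⟨⟨fun i => if hi : (i : ℕ) < r then ⟨δ ⟨i, hi⟩, by omega⟩ else
          ⟨l + (i - r), by omega⟩, by
          intro a b hab
          dsimp only at hab
          split_ifs at hab with h1 h2 h2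
          · have h3 : (δ ⟨a, h1⟩ : ℕ) = δ ⟨b, h2⟩ := by
              have h4 := Fin.ext_iff.1 hab
              exact h4
            have h4 := Fin.ext_iff.1 (δ.injective (Fin.ext h3))
            exact Fin.ext h4
          · have := Fin.ext_iff.1 hab
            have h3 := (δ ⟨a, h1⟩).2
            simp only at this
            omega
          · have := Fin.ext_iff.1 hab
            have h3 := (δ ⟨b, h2⟩).2
            simp only at this
            omega
          · have := Fin.ext_iff.1 hab
            simp only at this
            exact Fin.ext (by omega)⟩, by
          refine Finset.mem_filter.2 ⟨Finset.mem_univ _, fun i hi => ?_, fun i hi => ?_⟩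
          · exact (congrArg Fin.val (dif_pos hi)).trans_lt (δ ⟨i, hi⟩).2
          · exact congrArg Fin.val (dif_neg (not_lt.2 hi))⟩
      invFun := fun β => ⟨fun i => ⟨β.1 ⟨i, by omega⟩,
          (Finset.mem_filter.1 β.2).2.1 ⟨i, by omega⟩ i.2⟩, fun a b hab => by
          have h3 : (β.1 ⟨a, by omega⟩ : ℕ) = β.1 ⟨b, by omega⟩ := by
            have h4 := Fin.ext_iff.1 hab
            exact h4
          have h4 := Fin.ext_iff.1 (β.1.injective (Fin.ext h3))
          exact Fin.ext h4⟩
      left_inv := fun δ => by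
        refine Function.Embedding.ext fun i => Fin.ext ?_
        have h4 := congrArg Fin.val (dif_pos (c := (i : ℕ) < r) (h := inferInstance)
          (t := fun hi => (⟨δ ⟨i, hi⟩, by omega⟩ : Fin k))
          (e := fun hi => ⟨l + (i - r), (hi i.2).elim⟩) i.2)
        exact h4
      right_inv := fun β => by
        refine Subtype.ext (Function.Embedding.ext fun i => Fin.ext ?_)
        by_cases hi : (i : ℕ) < r
        · exact congrArg Fin.val (dif_pos hi)
        · rw [(Finset.mem_filter.1 β.2).2.2 i (not_lt.1 hi)]
          exact congrArg Fin.val (dif_neg hi) }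
  rw [← Fintype.card_coe, ← Fintype.card_congr e, Fintype.card_embedding_eq]
  simp

end Combinatorics

/-! ### The bracket of embedded observables is itself embedded -/

section Bracket

variable {d l j k n N : ℕ}

/-- The commutator of `A_{(α)}` and `B_{(β)}`. -/
def commOp (A : 𝓢(Conf d l, ℂ) →L[ℂ] 𝓢(Conf d l, ℂ)) (B : 𝓢(Conf d j, ℂ) →L[ℂ] 𝓢(Conf d j, ℂ))
    (α : Fin l ↪ Fin n) (β : Fin j ↪ Fin n) : 𝓢(Conf d n, ℂ) →L[ℂ] 𝓢(Conf d n, ℂ) :=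
  (op A α).comp (op B β) - (op B β).comp (op A α)

theorem commOp_apply (A : 𝓢(Conf d l, ℂ) →L[ℂ] 𝓢(Conf d l, ℂ))
    (B : 𝓢(Conf d j, ℂ) →L[ℂ] 𝓢(Conf d j, ℂ)) (α : Fin l ↪ Fin n) (β : Fin j ↪ Fin n)
    (f : 𝓢(Conf d n, ℂ)) :
    commOp A B α β f = op A α (op B β f) - op B β (op A α f) := rfl

theorem commOp_eq_zero (A : 𝓢(Conf d l, ℂ) →L[ℂ] 𝓢(Conf d l, ℂ))
    (B : 𝓢(Conf d j, ℂ) →L[ℂ] 𝓢(Conf d j, ℂ)) {α : Fin l ↪ Fin n} {β : Fin j ↪ Fin n}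
    (h : overlap α β = 0) : commOp A B α β = 0 := by
  ext1 f
  rw [commOp_apply, op_comm A B α β (overlap_eq_zero h), sub_self]
  rfl

theorem op_commOp (A : 𝓢(Conf d l, ℂ) →L[ℂ] 𝓢(Conf d l, ℂ))
    (B : 𝓢(Conf d j, ℂ) →L[ℂ] 𝓢(Conf d j, ℂ)) (α : Fin l ↪ Fin k) (β : Fin j ↪ Fin k)
    (γ : Fin k ↪ Fin n) : op (commOp A B α β) γ = commOp A B (α.trans γ) (β.trans γ) := by
  rw [commOp, op_sub, op_comp, op_comp, op_op, op_op, commOp]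

theorem commOp_perm (A : 𝓢(Conf d l, ℂ) →L[ℂ] 𝓢(Conf d l, ℂ))
    (B : 𝓢(Conf d j, ℂ) →L[ℂ] 𝓢(Conf d j, ℂ)) (α : Fin l ↪ Fin n) (β : Fin j ↪ Fin n)
    (π : Equiv.Perm (Fin n)) (f : 𝓢(Conf d n, ℂ)) :
    commOp A B (α.trans π.toEmbedding) (β.trans π.toEmbedding) f =
      permS d π (commOp A B α β (permS d π⁻¹ f)) := by
  simp only [commOp_apply, op_perm, permS_permS_inv, map_sub]

theorem IsTr.sub {T T' S S' : 𝓢(Conf d n, ℂ) →L[ℂ] 𝓢(Conf d n, ℂ)} (h : IsTr T T')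
    (h' : IsTr S S') : IsTr (T - S) (T' - S') := fun f g => by
  simp only [sub_apply, sub_mul, mul_sub]
  rw [integral_sub (integrable_mul volume _ _) (integrable_mul volume _ _),
    integral_sub (integrable_mul volume _ _) (integrable_mul volume _ _), h, h']

theorem conjW_conjW (f : 𝓢(Conf d n, ℂ)) : conjW (conjW f) = f := by
  ext
  simp

theorem isTr_op_lift (A : Obs d l) (α : Fin l ↪ Fin n) :
    IsTr (op (lift A.1) α) (-conjOp (op (lift A.1) α)) := by
  have := (isTr_lift A).op α
  rwa [op_neg, op_conjOp] at this

theorem isTr_commOp (A : Obs d l) (B : Obs d j) (α : Fin l ↪ Fin n) (β : Fin j ↪ Fin n) :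
    IsTr (commOp (lift A.1) (lift B.1) α β) (-conjOp (commOp (lift A.1) (lift B.1) α β)) := by
  have h := ((isTr_op_lift A α).comp (isTr_op_lift B β)).sub
    ((isTr_op_lift B β).comp (isTr_op_lift A α))
  have h2 : -conjOp (commOp (lift A.1) (lift B.1) α β) =
      (-conjOp (op (lift B.1) β)).comp (-conjOp (op (lift A.1) α)) -
        (-conjOp (op (lift A.1) α)).comp (-conjOp (op (lift B.1) β)) := by
    ext f x
    simp only [commOp, neg_apply, sub_apply, ContinuousLinearMap.comp_apply, conjOp_apply,
      map_neg, neg_neg, conjW_conjW, conjW_apply, map_sub]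
    ring
  rw [h2]
  exact h

/-- The weights of the commutators in the bracket. -/
def brCst (l j k N s : ℕ) : ℝ :=
  N * cst l N * cst j N * (N.descFactorial s / k.descFactorial s)

/-- The operator that `ε_{k,N}` maps to the bracket of `ε_{ℓ,N}(A)` and `ε_{j,N}(B)`. -/
def bracketS (k N : ℕ) (A : 𝓢(Conf d l, ℂ) →L[ℂ] 𝓢(Conf d l, ℂ))
    (B : 𝓢(Conf d j, ℂ) →L[ℂ] 𝓢(Conf d j, ℂ)) : 𝓢(Conf d k, ℂ) →L[ℂ] 𝓢(Conf d k, ℂ) :=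
  ∑ p : (Fin l ↪ Fin k) × (Fin j ↪ Fin k),
    (brCst l j k N (joint p.1 p.2).card : ℂ) • commOp A B p.1 p.2

/-- Permutations act on tuples. -/
def embeddingPerm (π : Equiv.Perm (Fin n)) : (Fin k ↪ Fin n) ≃ (Fin k ↪ Fin n) where
  toFun α := α.trans π.toEmbedding
  invFun α := α.trans (π⁻¹).toEmbedding
  left_inv α := by ext; simp
  right_inv α := by ext; simp

theorem joint_perm (α : Fin l ↪ Fin n) (β : Fin j ↪ Fin n) (π : Equiv.Perm (Fin n)) :
    (joint (α.trans π.toEmbedding) (β.trans π.toEmbedding)).card = (joint α β).card := by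
  rw [joint_trans, Finset.card_map]

theorem permS_bracketS (A : 𝓢(Conf d l, ℂ) →L[ℂ] 𝓢(Conf d l, ℂ))
    (B : 𝓢(Conf d j, ℂ) →L[ℂ] 𝓢(Conf d j, ℂ)) (π : Equiv.Perm (Fin k)) (f : 𝓢(Conf d k, ℂ)) :
    permS d π (bracketS k N A B f) = bracketS k N A B (permS d π f) := by
  simp only [bracketS, smul_apply, sum_apply, map_smul, map_sum]
  rw [← Equiv.sum_comp ((embeddingPerm π).prodCongr (embeddingPerm π)) fun p =>
    (brCst l j k N (joint p.1 p.2).card : ℂ) • commOp A B p.1 p.2 (permS d π f)]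
  refine Finset.sum_congr rfl fun p _ => ?_
  change _ = (brCst l j k N (joint (p.1.trans π.toEmbedding) (p.2.trans π.toEmbedding)).card : ℂ) •
    commOp A B (p.1.trans π.toEmbedding) (p.2.trans π.toEmbedding) (permS d π f)
  rw [joint_perm, commOp_perm, permS_permS_inv]

theorem isTr_bracketS (A : Obs d l) (B : Obs d j) :
    IsTr (bracketS k N (lift A.1) (lift B.1)) (-conjOp (bracketS k N (lift A.1) (lift B.1))) := by
  have h : -conjOp (bracketS k N (lift A.1) (lift B.1)) =
      ∑ p : (Fin l ↪ Fin k) × (Fin j ↪ Fin k), (brCst l j k N (joint p.1 p.2).card : ℂ) •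
        -conjOp (commOp (lift A.1) (lift B.1) p.1 p.2) := by
    ext f x
    simp only [neg_apply, conjOp_apply, conjW_apply, bracketS, smul_apply, sum_apply,
      smul_eq_mul, map_mul, map_sum, Complex.conj_ofReal, Finset.sum_neg_distrib, mul_neg]
  rw [h]
  exact IsTr.sum _ fun p _ => (isTr_commOp A B p.1 p.2).smul _

theorem exists_bracket (k N : ℕ) (A : Obs d l) (B : Obs d j) :
    ∃ C : Obs d k, ∀ f, (C.1 f).1 = bracketS k N (lift A.1) (lift B.1) f.1 := by
  let T : Ss d k →L[ℂ] Ss d k :=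
    ((bracketS k N (lift A.1) (lift B.1)).comp (bosonicSchwartz d k).subtypeL).codRestrict
      (bosonicSchwartz d k) fun f π x => by
        have := permS_bracketS (N := N) (lift A.1) (lift B.1) π f.1
        rw [permS_coe] at this
        exact DFunLike.congr_fun this x
  exact ⟨⟨T, mem_obs_of_isTr (fun f => rfl) (isTr_bracketS A B)⟩, fun f => rfl⟩

theorem op_lift_coe (C : Ss d k →L[ℂ] Ss d k) (T : 𝓢(Conf d k, ℂ) →L[ℂ] 𝓢(Conf d k, ℂ))
    (h : ∀ f, (C f).1 = T f.1) (γ : Fin k ↪ Fin n) (f : Ss d n) :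
    op (lift C) γ f.1 = op T γ f.1 := by
  ext x
  have hs : sliceS γ x f.1 = (slice γ x f).1 := by
    ext y
    rw [sliceS_apply, slice_apply]
  rw [op_apply, op_apply, hs, lift_coe, h]

/-- Commutators of disjoint tuples vanish. Otherwise the joint index set has `s ≤ k` elements, and
each commutator reappears in `ε_{k,N}` once for every `k`-tuple that covers this set. The weights
`brCst` divide out this multiplicity together with `C_{k,N}`, so that every commutator receives the
coefficient `N C_{ℓ,N} C_{j,N}`. -/
theorem emb_bracket (hl : 1 ≤ l) (hj : 1 ≤ j) (hk : min (l + j - 1) N = k) (A : Obs d l)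
    (B : Obs d j) (C : Obs d k)
    (hC : ∀ f, (C.1 f).1 = bracketS k N (lift A.1) (lift B.1) f.1) :
    emb d k N C = obsBracket (emb d l N A) (emb d j N B) := by
  refine obs_ext fun f => ?_
  have h1 : ((emb d k N C).1 f).1 = (cst k N : ℂ) • ∑ γ : Fin k ↪ Fin N,
      ∑ p : (Fin l ↪ Fin k) × (Fin j ↪ Fin k), (brCst l j k N (joint p.1 p.2).card : ℂ) •
        commOp (lift A.1) (lift B.1) (p.1.trans γ) (p.2.trans γ) f.1 := by
    rw [emb_apply, embS, smul_apply, sum_apply]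
    congr 1
    refine Finset.sum_congr rfl fun γ _ => ?_
    rw [op_lift_coe C.1 _ hC, bracketS, op_sum, sum_apply]
    refine Finset.sum_congr rfl fun p _ => ?_
    rw [op_smul, op_commOp, smul_apply]
  have h2 : ((obsBracket (emb d l N A) (emb d j N B)).1 f).1 =
      ((N * cst l N * cst j N : ℝ) : ℂ) • ∑ q : (Fin l ↪ Fin N) × (Fin j ↪ Fin N),
        commOp (lift A.1) (lift B.1) q.1 q.2 f.1 := by
    have h3 : ((obsBracket (emb d l N A) (emb d j N B)).1 f).1 =
        (N : ℝ) • (((emb d l N A).1 ((emb d j N B).1 f)).1 -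
          ((emb d j N B).1 ((emb d l N A).1 f)).1) := rfl
    rw [h3, emb_apply, emb_apply, emb_apply, emb_apply]
    have h4 : ∑ q : (Fin l ↪ Fin N) × (Fin j ↪ Fin N),
        commOp (lift A.1) (lift B.1) q.1 q.2 f.1 =
        (∑ α, op (lift A.1) α) ((∑ β, op (lift B.1) β) f.1) -
          (∑ β, op (lift B.1) β) ((∑ α, op (lift A.1) α) f.1) := by
      simp only [Fintype.sum_prod_type, commOp_apply, Finset.sum_sub_distrib, sum_apply, map_sum]
      congr 1
      exact Finset.sum_comm
    rw [h4]
    ext x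
    simp only [embS, smul_apply, map_smul, sub_apply, smul_eq_mul, Complex.real_smul]
    push_cast
    ring
  rw [h1, h2]
  refine (congrArg _ (sum_joint_trans (k := k) (fun α β => commOp (lift A.1) (lift B.1) α β f.1)
    fun s => (brCst l j k N s : ℂ))).trans ?_
  rw [Finset.smul_sum, Finset.smul_sum]
  refine Finset.sum_congr rfl fun q _ => ?_
  by_cases h0 : overlap q.1 q.2 = 0
  · rw [commOp_eq_zero _ _ h0]
    simp
  · rw [smul_smul]
    congr 1
    -- A nonempty overlap gives at most `ℓ + j - 1` joint indices, and there are only `N` indices in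
    -- all.
    have hs : (joint q.1 q.2).card ≤ k := by
      have h4 := card_joint_add_overlap q.1 q.2
      have h5 := card_joint_le q.1 q.2
      omega
    have h6 := card_filter_subset_map (k := k) (joint q.1 q.2)
    have hkN : k ≤ N := by omega
    have h7 : (N.descFactorial (joint q.1 q.2).card : ℝ) ≠ 0 :=
      Nat.cast_ne_zero.2 (Nat.descFactorial_pos.2 (hs.trans hkN)).ne'
    have h8 : (k.descFactorial (joint q.1 q.2).card : ℝ) ≠ 0 :=
      Nat.cast_ne_zero.2 (Nat.descFactorial_pos.2 hs).ne'
    have h9 : (N.descFactorial k : ℝ) ≠ 0 :=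
      Nat.cast_ne_zero.2 (Nat.descFactorial_pos.2 hkN).ne'
    have h10 : ((Finset.univ.filter fun γ : Fin k ↪ Fin N =>
        joint q.1 q.2 ⊆ Finset.univ.map γ).card : ℝ) =
        N.descFactorial k * k.descFactorial (joint q.1 q.2).card /
          N.descFactorial (joint q.1 q.2).card := by
      rw [eq_div_iff h7]
      exact_mod_cast h6
    have h11 : cst k N * (((Finset.univ.filter fun γ : Fin k ↪ Fin N =>
        joint q.1 q.2 ⊆ Finset.univ.map γ).card : ℝ) * brCst l j k N (joint q.1 q.2).card) =
        N * cst l N * cst j N := by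
      rw [h10, brCst, cst]
      field_simp
    exact_mod_cast congrArg (Complex.ofReal) h11

end Bracket

/-! ### Traces of commutators against symmetric kernels -/

section Pairing

variable {d l j k N : ℕ}

/-- The trace of the commutator of `A_{(α)}` and `B_{(β)}` against a kernel. -/
def commTrace (A : 𝓢(Conf d l, ℂ) →L[ℂ] 𝓢(Conf d l, ℂ))
    (B : 𝓢(Conf d j, ℂ) →L[ℂ] 𝓢(Conf d j, ℂ)) (K : 𝓢(Conf d k × Conf d k, ℂ))
    (α : Fin l ↪ Fin k) (β : Fin j ↪ Fin k) : ℂ :=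
  diagInt (Conf d k) (left (commOp A B α β) K)

/-- Conjugation by `σ` is absorbed by the symmetry of the kernel and a change of variables on the
diagonal. -/
theorem commTrace_perm (A : 𝓢(Conf d l, ℂ) →L[ℂ] 𝓢(Conf d l, ℂ))
    (B : 𝓢(Conf d j, ℂ) →L[ℂ] 𝓢(Conf d j, ℂ)) {K : 𝓢(Conf d k × Conf d k, ℂ)}
    (hK : IsSymKernel K) (σ : Equiv.Perm (Fin k)) (α : Fin l ↪ Fin k) (β : Fin j ↪ Fin k) :
    commTrace A B K (α.trans σ.toEmbedding) (β.trans σ.toEmbedding) = commTrace A B K α β := by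
  simp only [commTrace, diagInt_apply, left_apply, commOp_perm, permS_apply]
  rw [← integral_comp_perm σ fun x => commOp A B α β (sliceL x K) x]
  congr 1 with x
  congr 2
  have : ∀ y, permS d σ⁻¹ (sliceL y K) = sliceL y K := fun y => by
    ext z
    simp [hK.1]
  rw [this]
  ext z
  simp [hK.2]

theorem commTrace_lift_perm (A : Ss d l →L[ℂ] Ss d l) (B : Ss d j →L[ℂ] Ss d j)
    (K : 𝓢(Conf d k × Conf d k, ℂ)) (π : Equiv.Perm (Fin l)) (π' : Equiv.Perm (Fin j))
    (α : Fin l ↪ Fin k) (β : Fin j ↪ Fin k) :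
    commTrace (lift A) (lift B) K (π.toEmbedding.trans α) (π'.toEmbedding.trans β) =
      commTrace (lift A) (lift B) K α β := by
  simp only [commTrace, commOp, op_lift_perm]

/-- Pairs with the same overlap differ by a permutation of the particles and by reorderings within
the tuples, and neither changes the trace. -/
theorem commTrace_eq_of_overlap (A : Ss d l →L[ℂ] Ss d l) (B : Ss d j →L[ℂ] Ss d j)
    {K : 𝓢(Conf d k × Conf d k, ℂ)} (hK : IsSymKernel K) (α : Fin l ↪ Fin k)
    (β β' : Fin j ↪ Fin k) (h : overlap α β = overlap α β') :
    commTrace (lift A) (lift B) K α β = commTrace (lift A) (lift B) K α β' := by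
  obtain ⟨σ, π, π', h1, h2⟩ := exists_perm_of_overlap_eq α β β' h
  rw [← commTrace_perm _ _ hK σ α β, h1, h2, commTrace_lift_perm]

theorem trace_bracket (A : Obs d l) (B : Obs d j) (C : Obs d k)
    (hC : ∀ f, (C.1 f).1 = bracketS k N (lift A.1) (lift B.1) f.1)
    (γ : SsDual d k →L[ℂ] Ss d k) :
    trace (C.1.comp γ) = ∑ p : (Fin l ↪ Fin k) × (Fin j ↪ Fin k),
      (brCst l j k N (joint p.1 p.2).card : ℂ) *
        commTrace (lift A.1) (lift B.1) (kerMap d k γ) p.1 p.2 := by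
  rw [trace_comp]
  have h : left (lift C.1) (kerMap d k γ) = ∑ p : (Fin l ↪ Fin k) × (Fin j ↪ Fin k),
      (brCst l j k N (joint p.1 p.2).card : ℂ) •
        left (commOp (lift A.1) (lift B.1) p.1 p.2) (kerMap d k γ) := by
    ext q
    have hs : sliceL q.2 (kerMap d k γ) = (γ (delta q.2)).1 := by
      ext y
      simp [kerMap_apply, ker]
    rw [left_apply, hs, lift_coe, hC, bracketS]
    simp only [sum_apply, smul_apply, left_apply, hs]
  rw [h, map_sum]
  simp only [map_smul, smul_eq_mul, commTrace]

/-- The sum over all pairs of tuples, in terms of the standard tuples. -/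
theorem sum_commTrace (hl : 1 ≤ l) (hj : 1 ≤ j) (hlN : l ≤ N) (hjN : j ≤ N)
    (hk : min (l + j - 1) N = k) (hlk : l ≤ k) (A : Ss d l →L[ℂ] Ss d l) (B : Ss d j →L[ℂ] Ss d j)
    {K : 𝓢(Conf d k × Conf d k, ℂ)} (hK : IsSymKernel K) :
    ∑ p : (Fin l ↪ Fin k) × (Fin j ↪ Fin k), (brCst l j k N (joint p.1 p.2).card : ℂ) *
        commTrace (lift A) (lift B) K p.1 p.2 =
      ∑ r ∈ Finset.Icc (rMin l j N) (min l j), (vfCst l j k r N : ℂ) *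
        ∑ β ∈ tuples l j k r, commTrace (lift A) (lift B) K (Fin.castLEEmb hlk) β := by
  set ι := Fin.castLEEmb hlk
  -- By symmetry the first tuple may be taken to be `(1, …, ℓ)`; the sum over it then produces the
  -- factor `k.descFactorial l`.
  have h1 : ∀ α : Fin l ↪ Fin k, ∑ β : Fin j ↪ Fin k, (brCst l j k N (joint α β).card : ℂ) *
      commTrace (lift A) (lift B) K α β = ∑ β : Fin j ↪ Fin k,
        (brCst l j k N (joint ι β).card : ℂ) * commTrace (lift A) (lift B) K ι β := fun α => by
    obtain ⟨σ, hσ⟩ := exists_perm_castLE hlk α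
    rw [← Equiv.sum_comp (embeddingPerm σ)]
    refine Finset.sum_congr rfl fun β _ => ?_
    change (brCst l j k N (joint α (β.trans σ.toEmbedding)).card : ℂ) *
      commTrace (lift A) (lift B) K α (β.trans σ.toEmbedding) = _
    rw [← hσ, joint_perm, commTrace_perm _ _ hK]
  rw [Fintype.sum_prod_type, Finset.sum_congr rfl fun α _ => h1 α, Finset.sum_const,
    Finset.card_univ, Fintype.card_embedding_eq, Fintype.card_fin, Fintype.card_fin, nsmul_eq_mul]
  -- The joint index set has at most `k ≤ N` elements, so the overlap is at least `ℓ + j - N`. A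
  -- positive overlap is therefore in the range, and a zero overlap contributes nothing.
  have h2 : ∀ β : Fin j ↪ Fin k, overlap ι β ∉ Finset.Icc (rMin l j N) (min l j) →
      commTrace (lift A) (lift B) K ι β = 0 := fun β hβ => by
    have h3 : overlap ι β = 0 := by
      by_contra h4
      have h5 := overlap_le ι β
      have h6 := overlap_le' ι β
      have h7 := card_joint_add_overlap ι β
      have h8 := card_joint_le ι β
      rw [Finset.mem_Icc, rMin] at hβ
      omega
    rw [commTrace, commOp_eq_zero _ _ h3, diagInt_apply]
    simp [left_apply]
  have h3 : ∑ β : Fin j ↪ Fin k, (brCst l j k N (joint ι β).card : ℂ) *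
      commTrace (lift A) (lift B) K ι β = ∑ r ∈ Finset.Icc (rMin l j N) (min l j),
        ∑ β : Fin j ↪ Fin k with overlap ι β = r, (brCst l j k N (joint ι β).card : ℂ) *
          commTrace (lift A) (lift B) K ι β := by
    rw [Finset.sum_fiberwise_eq_sum_filter]
    refine (Finset.sum_subset (Finset.filter_subset _ _) fun β _ hβ => ?_).symm
    rw [h2 β fun h => hβ (Finset.mem_filter.2 ⟨Finset.mem_univ _, h⟩), mul_zero]
  rw [h3, Finset.mul_sum]
  refine Finset.sum_congr rfl fun r hr => ?_
  rw [Finset.mem_Icc, rMin] at hr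
  have hrj : r ≤ j := by omega
  have hrk : l + j - r ≤ k := by omega
  have hkN : k ≤ N := by omega
  have hne : (tuples l j k r).Nonempty := by
    rw [← Finset.card_pos, card_tuples hlk hrj hrk]
    exact Nat.descFactorial_pos.2 (by omega)
  obtain ⟨β₀, hβ₀⟩ := hne
  have ho := overlap_of_mem_tuples hlk hrj hβ₀
  have h4 : ∀ β ∈ tuples l j k r, commTrace (lift A) (lift B) K ι β =
      commTrace (lift A) (lift B) K ι β₀ := fun β hβ =>
    commTrace_eq_of_overlap A B hK ι β β₀ ((overlap_of_mem_tuples hlk hrj hβ).trans ho.symm)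
  have h5 : ∀ β ∈ Finset.univ.filter (fun β : Fin j ↪ Fin k => overlap ι β = r),
      (brCst l j k N (joint ι β).card : ℂ) * commTrace (lift A) (lift B) K ι β =
      (brCst l j k N (l + j - r) : ℂ) * commTrace (lift A) (lift B) K ι β₀ := fun β hβ => by
    have h6 := (Finset.mem_filter.1 hβ).2
    have h7 := card_joint_add_overlap ι β
    rw [commTrace_eq_of_overlap A B hK ι β β₀ (h6.trans ho.symm)]
    congr 4
    omega
  rw [Finset.sum_congr rfl h5, Finset.sum_congr rfl h4, Finset.sum_const, Finset.sum_const,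
    card_tuples hlk hrj hrk, card_overlap, nsmul_eq_mul, nsmul_eq_mul]
  -- On the left is the number of pairs with overlap `r` times their weight, on the right the
  -- constant times the number of standard tuples. The falling factorials cancel by `e1` and `e2`.
  have h9 : (k.descFactorial l : ℝ) * ((j.choose r * (l.descFactorial r *
      (k - l).descFactorial (j - r)) : ℕ) * brCst l j k N (l + j - r)) =
      vfCst l j k r N * l.descFactorial r := by
    have e1 : k.descFactorial (l + j - r) = k.descFactorial l * (k - l).descFactorial (j - r) := by
      have := Nat.descFactorial_mul_descFactorial (n := k) (show l ≤ l + j - r by omega)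
      rw [← this, mul_comm]
      congr 2
      omega
    have e2 : N.descFactorial k =
        N.descFactorial (l + j - r) * (N - (l + j - r)).descFactorial (k - (l + j - r)) := by
      rw [mul_comm, Nat.descFactorial_mul_descFactorial hrk]
    have p1 : (k.descFactorial l : ℝ) ≠ 0 := Nat.cast_ne_zero.2 (Nat.descFactorial_pos.2 hlk).ne'
    have p2 : ((k - l).descFactorial (j - r) : ℝ) ≠ 0 :=
      Nat.cast_ne_zero.2 (Nat.descFactorial_pos.2 (by omega)).ne'
    have p3 : (N.descFactorial (l + j - r) : ℝ) ≠ 0 :=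
      Nat.cast_ne_zero.2 (Nat.descFactorial_pos.2 (by omega)).ne'
    have p4 : ((N - (l + j - r)).descFactorial (k - (l + j - r)) : ℝ) ≠ 0 :=
      Nat.cast_ne_zero.2 (Nat.descFactorial_pos.2 (by omega)).ne'
    rw [brCst, vfCst, cst, cst, cst, e1, e2]
    push_cast
    field_simp
  have h10 := congrArg Complex.ofReal h9
  push_cast at h10 ⊢
  linear_combination (commTrace (lift A) (lift B) K ι β₀) * h10

/-- The commutator trace as a pairing with a partial trace. -/
theorem commTrace_castLE (hlk : l ≤ k) (A : 𝓢(Conf d l, ℂ) →L[ℂ] 𝓢(Conf d l, ℂ)) (B : Obs d j)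
    (K : 𝓢(Conf d k × Conf d k, ℂ)) (β : Fin j ↪ Fin k) :
    commTrace A (lift B.1) K (Fin.castLEEmb hlk) β = diagInt (Conf d l) (left A (ptrace d hlk
      (left (op (lift B.1) β) K - right (-conjOp (op (lift B.1) β)) K))) := by
  have h1 : left (commOp A (lift B.1) (Fin.castLEEmb hlk) β) K =
      left (op A (Fin.castLEEmb hlk)) (left (op (lift B.1) β) K) -
      left (op (lift B.1) β) (left (op A (Fin.castLEEmb hlk)) K) := by
    ext p
    rw [sub_apply, left_apply, left_apply, left_apply, sliceL_left, sliceL_left]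
    rfl
  -- In the second term, cyclicity moves `B_{(β)}` to the second variable, where it commutes with
  -- `A`. In both terms `A` is then outermost and acts on the first `ℓ` particles, so the others can
  -- be traced out.
  rw [commTrace, h1, map_sub, diagInt_left _ _ (isTr_op_lift B β), ← left_right_comm, ← map_sub,
    ← map_sub, diagInt_left_op]

end Pairing

/-! ### Rules for directional derivatives and smooth maps -/

section GateauxCalculus

variable {X Y : Type*} [AddCommGroup X] [Module ℝ X] [TopologicalSpace X]
  [AddCommGroup Y] [Module ℝ Y] [TopologicalSpace Y]

omit [TopologicalSpace X] in
theorem HasGateauxDeriv.unique [T2Space Y] {f : X → Y} {x v : X} {L L' : Y}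
    (h : HasGateauxDeriv f x v L) (h' : HasGateauxDeriv f x v L') : L = L' :=
  tendsto_nhds_unique h h'

omit [TopologicalSpace X] in
theorem HasGateauxDeriv.add [IsTopologicalAddGroup Y] {f g : X → Y} {x v : X} {L L' : Y}
    (h : HasGateauxDeriv f x v L) (h' : HasGateauxDeriv g x v L') :
    HasGateauxDeriv (fun y => f y + g y) x v (L + L') := by
  refine (Tendsto.add h h').congr fun t => ?_
  rw [← smul_add, sub_add_sub_comm]

omit [TopologicalSpace X] in
theorem hasGateauxDeriv_const (c : Y) (x v : X) : HasGateauxDeriv (fun _ : X => c) x v 0 := by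
  refine tendsto_const_nhds.congr fun t => ?_
  rw [sub_self, smul_zero]

theorem hasGateauxDeriv_clm (L : X →L[ℝ] Y) (x v : X) : HasGateauxDeriv L x v (L v) := by
  refine tendsto_const_nhds.congr' ?_
  filter_upwards [self_mem_nhdsWithin] with t ht
  rw [map_add, add_sub_cancel_left, map_smul, inv_smul_smul₀ ht]

omit [TopologicalSpace X] in
theorem HasGateauxDeriv.tendsto {f : X → ℝ} {x v : X} {L : ℝ} (h : HasGateauxDeriv f x v L) :
    Tendsto (fun t : ℝ => f (x + t • v)) (𝓝[≠] 0) (𝓝 (f x)) := by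
  have h1 : Tendsto (fun t : ℝ => f x + t * (t⁻¹ • (f (x + t • v) - f x))) (𝓝[≠] 0)
      (𝓝 (f x + 0 * L)) :=
    tendsto_const_nhds.add ((tendsto_id.mono_left nhdsWithin_le_nhds).mul h)
  rw [zero_mul, add_zero] at h1
  refine h1.congr' ?_
  filter_upwards [self_mem_nhdsWithin] with t ht
  have ht : t ≠ 0 := ht
  rw [smul_eq_mul]
  field_simp
  ring

omit [TopologicalSpace X] in
theorem HasGateauxDeriv.smul [IsTopologicalAddGroup Y] [ContinuousSMul ℝ Y] {f : X → ℝ} {g : X → Y}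
    {x v : X} {a : ℝ} {L : Y} (hf : HasGateauxDeriv f x v a) (hg : HasGateauxDeriv g x v L) :
    HasGateauxDeriv (fun y => f y • g y) x v (a • g x + f x • L) := by
  refine ((hf.smul_const (g x)).add (hf.tendsto.smul hg)).congr fun t => ?_
  rw [smul_eq_mul, mul_smul, smul_comm (f (x + t • v)) t⁻¹, ← smul_add, sub_smul, smul_sub]
  congr 1
  abel

theorem GateauxSmooth.add [IsTopologicalAddGroup Y] {f g : X → Y} (hf : GateauxSmooth f)
    (hg : GateauxSmooth g) : GateauxSmooth fun x => f x + g x := by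
  obtain ⟨D, h0, h1, h2⟩ := hf
  obtain ⟨E, k0, k1, k2⟩ := hg
  exact ⟨fun n x v => D n x v + E n x v, fun x v => congrArg₂ _ (h0 x v) (k0 x v),
    fun n => (h1 n).add (k1 n),
    fun n x v w => (h2 n x v w).add (k2 n x v w)⟩

theorem gateauxSmooth_const (c : Y) : GateauxSmooth fun _ : X => c := by
  refine ⟨fun n _ _ => if n = 0 then c else 0, fun x v => by simp, fun n => continuous_const,
    fun n x v w => ?_⟩
  simpa using hasGateauxDeriv_const _ x w

theorem gateauxSmooth_clm (L : X →L[ℝ] Y) : GateauxSmooth L := by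
  let D : (n : ℕ) → X → (Fin n → X) → Y := fun n => match n with
    | 0 => fun x _ => L x
    | 1 => fun _ v => L (v 0)
    | _ + 2 => fun _ _ => 0
  refine ⟨D, fun x v => rfl, fun n => ?_, fun n x v w => ?_⟩
  · match n with
    | 0 => exact L.continuous.comp continuous_fst
    | 1 => exact L.continuous.comp ((continuous_apply 0).comp continuous_snd)
    | _ + 2 => exact continuous_const
  · match n with
    | 0 => exact hasGateauxDeriv_clm L x w
    | 1 => exact hasGateauxDeriv_const _ x w
    | _ + 2 => exact hasGateauxDeriv_const _ x w

/-- The iterated directional derivatives of a product, of which some have already been distributed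
to the two factors. -/
def leibnizDeriv (D : (n : ℕ) → X → (Fin n → X) → ℝ) (E : (n : ℕ) → X → (Fin n → X) → Y) :
    (n a b : ℕ) → X → (Fin a → X) → (Fin b → X) → (Fin n → X) → Y
  | 0, a, b, x, u, v, _ => D a x u • E b x v
  | n + 1, a, b, x, u, v, w =>
    leibnizDeriv D E n (a + 1) b x (Fin.snoc u (w 0)) v (Fin.tail w) +
      leibnizDeriv D E n a (b + 1) x u (Fin.snoc v (w 0)) (Fin.tail w)

omit [AddCommGroup X] [Module ℝ X] in
theorem continuous_leibnizDeriv [IsTopologicalAddGroup Y] [ContinuousSMul ℝ Y]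
    {D : (n : ℕ) → X → (Fin n → X) → ℝ} {E : (n : ℕ) → X → (Fin n → X) → Y}
    (hD : ∀ n, Continuous fun p : X × (Fin n → X) => D n p.1 p.2)
    (hE : ∀ n, Continuous fun p : X × (Fin n → X) => E n p.1 p.2) {T : Type*} [TopologicalSpace T]
    (n : ℕ) : ∀ (a b : ℕ) (x : T → X) (u : T → Fin a → X) (v : T → Fin b → X) (w : T → Fin n → X),
      Continuous x → Continuous u → Continuous v → Continuous w →
        Continuous fun t => leibnizDeriv D E n a b (x t) (u t) (v t) (w t) := by
  induction n with
  | zero =>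
    intro a b x u v w hx hu hv _
    exact ((hD a).comp (hx.prodMk hu)).smul ((hE b).comp (hx.prodMk hv))
  | succ n ih =>
    intro a b x u v w hx hu hv hw
    have h0 : Continuous fun t => w t 0 := (continuous_apply 0).comp hw
    have ht : Continuous fun t => Fin.tail (w t) :=
      continuous_pi fun i => (continuous_apply i.succ).comp hw
    have hs : ∀ {m : ℕ} {u : T → Fin m → X}, Continuous u →
        Continuous fun t => (Fin.snoc (u t) (w t 0) : Fin (m + 1) → X) := fun hu =>
      hu.finSnoc h0
    exact (ih _ _ _ _ _ _ hx (hs hu) hv ht).add (ih _ _ _ _ _ _ hx hu (hs hv) ht)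

omit [TopologicalSpace X] in
theorem hasGateauxDeriv_leibnizDeriv [IsTopologicalAddGroup Y] [ContinuousSMul ℝ Y]
    {D : (n : ℕ) → X → (Fin n → X) → ℝ} {E : (n : ℕ) → X → (Fin n → X) → Y}
    (hD : ∀ n x v w, HasGateauxDeriv (fun y => D n y v) x w (D (n + 1) x (Fin.snoc v w)))
    (hE : ∀ n x v w, HasGateauxDeriv (fun y => E n y v) x w (E (n + 1) x (Fin.snoc v w)))
    (n : ℕ) : ∀ (a b : ℕ) (x : X) (u : Fin a → X) (v : Fin b → X) (w : Fin n → X) (z : X),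
      HasGateauxDeriv (fun y => leibnizDeriv D E n a b y u v w) x z
        (leibnizDeriv D E (n + 1) a b x u v (Fin.snoc w z)) := by
  induction n with
  | zero => exact fun a b x u v w z => (hD a x u z).smul (hE b x v z)
  | succ n ih =>
    intro a b x u v w z
    have h0 : (Fin.snoc w z : Fin (n + 2) → X) 0 = w 0 := rfl
    -- `leibnizDeriv` consumes directions from the front, while differentiation appends a direction
    -- at the end.
    have h1 : Fin.tail (Fin.snoc w z : Fin (n + 2) → X) = Fin.snoc (Fin.tail w) z := by
      funext i
      induction i using Fin.lastCases with
      | last => rw [Fin.tail, Fin.succ_last, Fin.snoc_last, Fin.snoc_last]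
      | cast i => rw [Fin.tail, Fin.succ_castSucc, Fin.snoc_castSucc, Fin.snoc_castSucc, Fin.tail]
    rw [leibnizDeriv, h0, h1]
    exact (ih _ _ _ _ _ _ _).add (ih _ _ _ _ _ _ _)

theorem GateauxSmooth.smul [IsTopologicalAddGroup Y] [ContinuousSMul ℝ Y] {f : X → ℝ} {g : X → Y}
    (hf : GateauxSmooth f) (hg : GateauxSmooth g) : GateauxSmooth fun x => f x • g x := by
  obtain ⟨D, h0, h1, h2⟩ := hf
  obtain ⟨E, k0, k1, k2⟩ := hg
  refine ⟨fun n x w => leibnizDeriv D E n 0 0 x Fin.elim0 Fin.elim0 w, fun x v => ?_, fun n => ?_,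
    fun n x v w => hasGateauxDeriv_leibnizDeriv h2 k2 n 0 0 x _ _ v w⟩
  · change D 0 x _ • E 0 x _ = _
    rw [h0, k0]
  · exact continuous_leibnizDeriv h1 k1 n 0 0 _ _ _ _ continuous_fst continuous_const
      continuous_const continuous_snd

theorem GateauxSmooth.sum [IsTopologicalAddGroup Y] {ι : Type*} (s : Finset ι) {f : ι → X → Y}
    (h : ∀ i ∈ s, GateauxSmooth (f i)) : GateauxSmooth fun x => ∑ i ∈ s, f i x := by
  classical
  induction s using Finset.induction_on with
  | empty => simpa using gateauxSmooth_const (X := X) (0 : Y)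
  | insert a s ha ih =>
    simp only [Finset.sum_insert ha]
    exact (h a (Finset.mem_insert_self a s)).add (ih fun i hi => h i (Finset.mem_insert_of_mem hi))

end GateauxCalculus

/-! ### Biderivations and the Jacobi identity on generators -/

section PoissonAlgebra

variable {R : Type*} [CommRing R] [Algebra ℝ R]

/-- The Jacobiator of a bracket. -/
def jacobiator (br : R → R → R) (x y z : R) : R :=
  br x (br y z) + br y (br z x) + br z (br x y)

omit [Algebra ℝ R] in
theorem jacobiator_rotate (br : R → R → R) (x y z : R) :
    jacobiator br x y z = jacobiator br y z x := by
  simp only [jacobiator]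
  ring

/-- A bilinear alternating biderivation on a subalgebra. -/
structure IsBiderivation (𝒜 : Subalgebra ℝ R) (br : R → R → R) : Prop where
  closed : ∀ x ∈ 𝒜, ∀ y ∈ 𝒜, br x y ∈ 𝒜
  add_left : ∀ x ∈ 𝒜, ∀ y ∈ 𝒜, ∀ z ∈ 𝒜, br (x + y) z = br x z + br y z
  add_right : ∀ x ∈ 𝒜, ∀ y ∈ 𝒜, ∀ z ∈ 𝒜, br x (y + z) = br x y + br x z
  smul_right : ∀ c : ℝ, ∀ x ∈ 𝒜, ∀ y ∈ 𝒜, br x (c • y) = c • br x y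
  alternating : ∀ x ∈ 𝒜, br x x = 0
  leibniz : ∀ x ∈ 𝒜, ∀ y ∈ 𝒜, ∀ z ∈ 𝒜, br x (y * z) = br x y * z + y * br x z

namespace IsBiderivation

variable {𝒜 : Subalgebra ℝ R} {br : R → R → R} (h : IsBiderivation 𝒜 br)

include h

theorem antisymm {x y : R} (hx : x ∈ 𝒜) (hy : y ∈ 𝒜) : br x y = -br y x := by
  have h1 := h.alternating _ (𝒜.add_mem hx hy)
  rw [h.add_left x hx y hy _ (𝒜.add_mem hx hy), h.add_right x hx x hx y hy,
    h.add_right y hy x hx y hy, h.alternating x hx, h.alternating y hy] at h1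
  linear_combination h1

theorem algebraMap_right {x : R} (hx : x ∈ 𝒜) (c : ℝ) : br x (algebraMap ℝ R c) = 0 := by
  have h1 := h.leibniz x hx 1 𝒜.one_mem 1 𝒜.one_mem
  rw [mul_one, mul_one, one_mul, left_eq_add] at h1
  rw [Algebra.algebraMap_eq_smul_one, h.smul_right c x hx 1 𝒜.one_mem, h1, smul_zero]

theorem algebraMap_left {x : R} (hx : x ∈ 𝒜) (c : ℝ) : br (algebraMap ℝ R c) x = 0 := by
  rw [h.antisymm (𝒜.algebraMap_mem c) hx, h.algebraMap_right hx, neg_zero]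

theorem leibniz_left {x y z : R} (hx : x ∈ 𝒜) (hy : y ∈ 𝒜) (hz : z ∈ 𝒜) :
    br (x * y) z = br x z * y + x * br y z := by
  rw [h.antisymm (𝒜.mul_mem hx hy) hz, h.leibniz z hz x hx y hy, h.antisymm hx hz,
    h.antisymm hy hz]
  ring

theorem jacobiator_add {x y z w : R} (hx : x ∈ 𝒜) (hy : y ∈ 𝒜) (hz : z ∈ 𝒜) (hw : w ∈ 𝒜) :
    jacobiator br x y (z + w) = jacobiator br x y z + jacobiator br x y w := by
  simp only [jacobiator]
  rw [h.add_right y hy z hz w hw, h.add_left z hz w hw x hx,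
    h.add_left z hz w hw _ (h.closed x hx y hy),
    h.add_right x hx _ (h.closed y hy z hz) _ (h.closed y hy w hw),
    h.add_right y hy _ (h.closed z hz x hx) _ (h.closed w hw x hx)]
  ring

/-- By antisymmetry, the mixed products of two brackets cancel. The Jacobiator is thus a derivation
in its last argument, and its vanishing propagates from generators to the algebra. -/
theorem jacobiator_mul {x y z w : R} (hx : x ∈ 𝒜) (hy : y ∈ 𝒜) (hz : z ∈ 𝒜) (hw : w ∈ 𝒜) :
    jacobiator br x y (z * w) = jacobiator br x y z * w + z * jacobiator br x y w := by
  have c := h.closed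
  have m := fun {a b : R} (ha : a ∈ 𝒜) (hb : b ∈ 𝒜) => 𝒜.mul_mem ha hb
  simp only [jacobiator]
  rw [h.leibniz y hy z hz w hw, h.leibniz_left hz hw hx, h.leibniz_left hz hw (c x hx y hy),
    h.add_right x hx _ (m (c y hy z hz) hw) _ (m hz (c y hy w hw)),
    h.add_right y hy _ (m (c z hz x hx) hw) _ (m hz (c w hw x hx)),
    h.leibniz x hx _ (c y hy z hz) w hw, h.leibniz x hx z hz _ (c y hy w hw),
    h.leibniz y hy _ (c z hz x hx) w hw, h.leibniz y hy z hz _ (c w hw x hx),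
    h.antisymm hx hz, h.antisymm hx hw]
  ring

theorem jacobiator_eq_zero_of_generators {S : Set R} (hS : 𝒜 = Algebra.adjoin ℝ S) {x y : R}
    (hx : x ∈ 𝒜) (hy : y ∈ 𝒜) (h0 : ∀ s ∈ S, jacobiator br x y s = 0) {z : R} (hz : z ∈ 𝒜) :
    jacobiator br x y z = 0 := by
  have hz' : z ∈ Algebra.adjoin ℝ S := hS ▸ hz
  induction hz' using Algebra.adjoin_induction with
  | mem s hs => exact h0 s hs
  | algebraMap c =>
    have e1 := h.algebraMap_right hy c
    have e2 := h.algebraMap_left hx c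
    have e3 := h.algebraMap_left (h.closed x hx y hy) c
    have e4 : ∀ {a : R}, a ∈ 𝒜 → br a 0 = 0 := fun ha => by
      simpa using h.algebraMap_right ha 0
    rw [jacobiator, e1, e2, e3, e4 hx, e4 hy]
    ring
  | add a b ha hb iha ihb =>
    rw [← hS] at ha hb
    rw [h.jacobiator_add hx hy ha hb, iha ha, ihb hb, add_zero]
  | mul a b ha hb iha ihb =>
    rw [← hS] at ha hb
    rw [h.jacobiator_mul hx hy ha hb, iha ha, ihb hb]
    ring

/-- The Jacobi identity has to be checked on generators only. -/
theorem jacobi {S : Set R} (hS : 𝒜 = Algebra.adjoin ℝ S)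
    (h0 : ∀ x ∈ S, ∀ y ∈ S, ∀ z ∈ S, jacobiator br x y z = 0) {x y z : R} (hx : x ∈ 𝒜) (hy : y ∈ 𝒜)
    (hz : z ∈ 𝒜) : jacobiator br x y z = 0 := by
  have hS' : ∀ s ∈ S, s ∈ 𝒜 := fun s hs => hS ▸ Algebra.subset_adjoin hs
  refine h.jacobiator_eq_zero_of_generators hS hx hy (fun s hs => ?_) hz
  -- Rotation brings each argument in turn to the last place, where it is reduced to generators.
  rw [jacobiator_rotate, jacobiator_rotate]
  refine h.jacobiator_eq_zero_of_generators hS (hS' s hs) hx (fun s' hs' => ?_) hy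
  rw [jacobiator_rotate, jacobiator_rotate]
  refine h.jacobiator_eq_zero_of_generators hS (hS' s' hs') (hS' s hs) (fun s'' hs'' => ?_) hx
  exact h0 _ hs' _ hs _ hs''

end IsBiderivation

end PoissonAlgebra

/-! ### The Lie–Poisson bracket on polynomials in linear functionals -/

section Gradients

variable {M G : Type*} [AddCommGroup M] [Module ℝ M] [TopologicalSpace M]
  [AddCommGroup G] [Module ℝ G]

/-- The algebra of functions that is generated by continuous linear functionals. -/
def linAlg (Λ : G →ₗ[ℝ] M →L[ℝ] ℝ) : Subalgebra ℝ (M → ℝ) :=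
  Algebra.adjoin ℝ (Set.range fun A => ⇑(Λ A))

variable {Λ : G →ₗ[ℝ] M →L[ℝ] ℝ}

theorem mem_linAlg (A : G) : ⇑(Λ A) ∈ linAlg Λ := Algebra.subset_adjoin ⟨A, rfl⟩

theorem gateauxSmooth_of_mem_linAlg {F : M → ℝ} (hF : F ∈ linAlg Λ) : GateauxSmooth F := by
  induction hF using Algebra.adjoin_induction with
  | mem F hF =>
    obtain ⟨A, rfl⟩ := hF
    exact gateauxSmooth_clm _
  | algebraMap c => exact gateauxSmooth_const c
  | add F G _ _ hF hG => exact hF.add hG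
  | mul F G _ _ hF hG => exact hF.smul hG

/-- `g` is the gradient of `F` with respect to the pairing `Λ`. -/
def HasGrad (Λ : G →ₗ[ℝ] M →L[ℝ] ℝ) (F : M → ℝ) (g : M → G) : Prop :=
  ∀ m v, HasGateauxDeriv F m v (Λ (g m) v)

theorem hasGrad_lin (A : G) : HasGrad Λ (Λ A) fun _ => A := fun m v => hasGateauxDeriv_clm _ m v

theorem hasGrad_const (c : ℝ) : HasGrad Λ (fun _ => c) fun _ => 0 := fun m v => by
  simpa using hasGateauxDeriv_const c m v

theorem HasGrad.add {F F' : M → ℝ} {g g' : M → G} (h : HasGrad Λ F g) (h' : HasGrad Λ F' g') :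
    HasGrad Λ (F + F') fun m => g m + g' m := fun m v => by
  rw [map_add, add_apply]
  exact (h m v).add (h' m v)

theorem HasGrad.mul {F F' : M → ℝ} {g g' : M → G} (h : HasGrad Λ F g) (h' : HasGrad Λ F' g') :
    HasGrad Λ (F * F') fun m => F m • g' m + F' m • g m := fun m v => by
  have := (h m v).smul (h' m v)
  have e : Λ (F m • g' m + F' m • g m) v = Λ (g m) v • F' m + F m • Λ (g' m) v := by
    simp
    ring
  rw [e]
  exact this

theorem HasGrad.smul {F : M → ℝ} {g : M → G} (h : HasGrad Λ F g) (c : ℝ) :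
    HasGrad Λ (c • F) fun m => c • g m := fun m v => by
  have := (hasGateauxDeriv_const c m v).smul (h m v)
  rw [zero_smul, zero_add] at this
  rw [map_smul, smul_apply]
  exact this

/-- Functions of the algebra have gradients, with coefficients in the algebra. -/
theorem exists_hasGrad {F : M → ℝ} (hF : F ∈ linAlg Λ) : ∃ g : M → G, HasGrad Λ F g ∧
    ∃ (ι : Type) (_ : Fintype ι) (P : ι → M → ℝ) (A : ι → G), (∀ i, P i ∈ linAlg Λ) ∧
      ∀ m, g m = ∑ i, P i m • A i := by
  induction hF using Algebra.adjoin_induction with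
  | mem F hF =>
    obtain ⟨A, rfl⟩ := hF
    exact ⟨_, hasGrad_lin A, Unit, inferInstance, fun _ => 1, fun _ => A,
      fun _ => (linAlg Λ).one_mem, fun m => by simp⟩
  | algebraMap c =>
    exact ⟨_, hasGrad_const c, Empty, inferInstance, fun _ => 1, fun _ => 0,
      fun _ => (linAlg Λ).one_mem, fun m => by simp⟩
  | add F F' _ _ hF hF' =>
    obtain ⟨g, hg, ι, _, P, A, hP, hA⟩ := hF
    obtain ⟨g', hg', ι', _, P', A', hP', hA'⟩ := hF'
    refine ⟨_, hg.add hg', ι ⊕ ι', inferInstance, Sum.elim P P', Sum.elim A A', ?_, fun m => ?_⟩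
    · rintro (i | i)
      exacts [hP i, hP' i]
    · simp [hA, hA']
  | mul F F' hFm hFm' hF hF' =>
    obtain ⟨g, hg, ι, _, P, A, hP, hA⟩ := hF
    obtain ⟨g', hg', ι', _, P', A', hP', hA'⟩ := hF'
    refine ⟨_, hg.mul hg', ι' ⊕ ι, inferInstance, Sum.elim (fun i => F * P' i) fun i => F' * P i,
      Sum.elim A' A, ?_, fun m => ?_⟩
    · rintro (i | i)
      exacts [(linAlg Λ).mul_mem hFm (hP' i), (linAlg Λ).mul_mem hFm' (hP i)]
    · simp [hA, hA', Finset.smul_sum, mul_smul]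

theorem HasGrad.unique (hΛ : Function.Injective Λ) {F : M → ℝ} {g g' : M → G} (h : HasGrad Λ F g)
    (h' : HasGrad Λ F g') : g = g' := by
  ext m
  apply hΛ
  ext v
  exact (h m v).unique (h' m v)

/-- The Lie-Poisson bracket of functions with given gradients. -/
def lieBr (Λ : G →ₗ[ℝ] M →L[ℝ] ℝ) (b : G →ₗ[ℝ] G →ₗ[ℝ] G) (gr : (M → ℝ) → M → G)
    (F F' : M → ℝ) : M → ℝ :=
  fun m => Λ (b (gr F m) (gr F' m)) m

variable {b : G →ₗ[ℝ] G →ₗ[ℝ] G} {gr : (M → ℝ) → M → G}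

/-- Gradients are unique, so any formula for them may replace the chosen `gr` in computations. -/
theorem lieBr_eq (hΛ : Function.Injective Λ) (hgr : ∀ F ∈ linAlg Λ, HasGrad Λ F (gr F))
    {F F' : M → ℝ} {g g' : M → G} (hF : F ∈ linAlg Λ) (hF' : F' ∈ linAlg Λ) (hg : HasGrad Λ F g)
    (hg' : HasGrad Λ F' g') : lieBr Λ b gr F F' = fun m => Λ (b (g m) (g' m)) m := by
  rw [(hg.unique hΛ (hgr F hF)), (hg'.unique hΛ (hgr F' hF'))]
  rfl

theorem lieBr_lin (hΛ : Function.Injective Λ) (hgr : ∀ F ∈ linAlg Λ, HasGrad Λ F (gr F)) (A B : G) :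
    lieBr Λ b gr (Λ A) (Λ B) = Λ (b A B) :=
  lieBr_eq hΛ hgr (mem_linAlg A) (mem_linAlg B) (hasGrad_lin A) (hasGrad_lin B)

theorem lieBr_smul_left (hΛ : Function.Injective Λ) (hgr : ∀ F ∈ linAlg Λ, HasGrad Λ F (gr F))
    (c : ℝ) {F F' : M → ℝ} (hF : F ∈ linAlg Λ) (hF' : F' ∈ linAlg Λ) :
    lieBr Λ b gr (c • F) F' = c • lieBr Λ b gr F F' := by
  rw [lieBr_eq hΛ hgr ((linAlg Λ).smul_mem hF c) hF' ((hgr F hF).smul c) (hgr F' hF')]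
  ext m
  simp [lieBr]

theorem isBiderivation_lieBr (hΛ : Function.Injective Λ)
    (hgr : ∀ F ∈ linAlg Λ, HasGrad Λ F (gr F)) (hb : ∀ A, b A A = 0) :
    IsBiderivation (linAlg Λ) (lieBr Λ b gr) := by
  have hadd_left : ∀ F ∈ linAlg Λ, ∀ F' ∈ linAlg Λ, ∀ H ∈ linAlg Λ,
      lieBr Λ b gr (F + F') H = lieBr Λ b gr F H + lieBr Λ b gr F' H := fun F hF F' hF' H hH => by
    rw [lieBr_eq hΛ hgr ((linAlg Λ).add_mem hF hF') hH ((hgr F hF).add (hgr F' hF')) (hgr H hH)]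
    ext m
    simp [lieBr]
  have hmul_left : ∀ F ∈ linAlg Λ, ∀ F' ∈ linAlg Λ, ∀ H ∈ linAlg Λ,
      lieBr Λ b gr (F * F') H = F * lieBr Λ b gr F' H + F' * lieBr Λ b gr F H :=
    fun F hF F' hF' H hH => by
    rw [lieBr_eq hΛ hgr ((linAlg Λ).mul_mem hF hF') hH ((hgr F hF).mul (hgr F' hF')) (hgr H hH)]
    ext m
    simp [lieBr]
  have hadd_right : ∀ F ∈ linAlg Λ, ∀ F' ∈ linAlg Λ, ∀ H ∈ linAlg Λ,
      lieBr Λ b gr F (F' + H) = lieBr Λ b gr F F' + lieBr Λ b gr F H := fun F hF F' hF' H hH => by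
    rw [lieBr_eq hΛ hgr hF ((linAlg Λ).add_mem hF' hH) (hgr F hF) ((hgr F' hF').add (hgr H hH))]
    ext m
    simp [lieBr]
  have hmul_right : ∀ F ∈ linAlg Λ, ∀ F' ∈ linAlg Λ, ∀ H ∈ linAlg Λ,
      lieBr Λ b gr F (F' * H) = lieBr Λ b gr F F' * H + F' * lieBr Λ b gr F H :=
    fun F hF F' hF' H hH => by
    rw [lieBr_eq hΛ hgr hF ((linAlg Λ).mul_mem hF' hH) (hgr F hF) ((hgr F' hF').mul (hgr H hH))]
    ext m
    simp [lieBr]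
    ring
  have hconst_left : ∀ (c : ℝ), ∀ H ∈ linAlg Λ,
      lieBr Λ b gr (algebraMap ℝ (M → ℝ) c) H = 0 := fun c H hH => by
    rw [lieBr_eq hΛ hgr ((linAlg Λ).algebraMap_mem c) hH (hasGrad_const c) (hgr H hH)]
    ext m
    simp
  have hconst_right : ∀ (c : ℝ), ∀ H ∈ linAlg Λ,
      lieBr Λ b gr H (algebraMap ℝ (M → ℝ) c) = 0 := fun c H hH => by
    rw [lieBr_eq hΛ hgr hH ((linAlg Λ).algebraMap_mem c) (hgr H hH) (hasGrad_const c)]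
    ext m
    simp
  refine ⟨fun F hF F' hF' => ?_, hadd_left, hadd_right, fun c F hF F' hF' => ?_, fun F hF => ?_,
    hmul_right⟩
  -- The bracket of linear functionals is linear; the Leibniz rule extends this to polynomials, in
  -- the second argument and afterwards in the first.
  · have h1 : ∀ A : G, lieBr Λ b gr (Λ A) F' ∈ linAlg Λ := fun A => by
      have hF'' := hF'
      induction hF' using Algebra.adjoin_induction with
      | mem F hF =>
        obtain ⟨B, rfl⟩ := hF
        rw [lieBr_lin hΛ hgr]
        exact mem_linAlg _
      | algebraMap c =>
        rw [hconst_right c _ (mem_linAlg A)]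
        exact (linAlg Λ).zero_mem
      | add P Q hP hQ ihP ihQ =>
        rw [hadd_right _ (mem_linAlg A) P hP Q hQ]
        exact (linAlg Λ).add_mem (ihP hP) (ihQ hQ)
      | mul P Q hP hQ ihP ihQ =>
        rw [hmul_right _ (mem_linAlg A) P hP Q hQ]
        exact (linAlg Λ).add_mem ((linAlg Λ).mul_mem (ihP hP) hQ) ((linAlg Λ).mul_mem hP (ihQ hQ))
    induction hF using Algebra.adjoin_induction with
    | mem F hF =>
      obtain ⟨A, rfl⟩ := hF
      exact h1 A
    | algebraMap c =>
      rw [hconst_left c _ hF']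
      exact (linAlg Λ).zero_mem
    | add P Q hP hQ ihP ihQ =>
      rw [hadd_left P hP Q hQ F' hF']
      exact (linAlg Λ).add_mem ihP ihQ
    | mul P Q hP hQ ihP ihQ =>
      rw [hmul_left P hP Q hQ F' hF']
      exact (linAlg Λ).add_mem ((linAlg Λ).mul_mem hP ihQ) ((linAlg Λ).mul_mem hQ ihP)
  · rw [lieBr_eq hΛ hgr hF ((linAlg Λ).smul_mem hF' c) (hgr F hF) ((hgr F' hF').smul c)]
    ext m
    simp [lieBr]
  · ext m
    simp [lieBr, hb]

theorem jacobi_lieBr (hΛ : Function.Injective Λ)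
    (hgr : ∀ F ∈ linAlg Λ, HasGrad Λ F (gr F)) (hb : ∀ A, b A A = 0)
    (hJ : ∀ A B C, b A (b B C) + b B (b C A) + b C (b A B) = 0) {F F' F'' : M → ℝ}
    (hF : F ∈ linAlg Λ) (hF' : F' ∈ linAlg Λ) (hF'' : F'' ∈ linAlg Λ) :
    jacobiator (lieBr Λ b gr) F F' F'' = 0 := by
  refine (isBiderivation_lieBr hΛ hgr hb).jacobi rfl ?_ hF hF' hF''
  rintro _ ⟨A, rfl⟩ _ ⟨B, rfl⟩ _ ⟨C, rfl⟩
  simp only [jacobiator, lieBr_lin hΛ hgr]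
  have := hJ A B C
  ext m
  have h2 := congrArg (fun Z => Λ Z m) this
  simpa using h2

end Gradients

/-! ### Rank one operators and nondegeneracy of the trace -/

section InnerProduct

variable {d k : ℕ}

theorem ip_smul_right (c : ℂ) (f g : Ss d k) : ip f (c • g) = c * ip f g := by
  rw [ip_eq_toDual, map_smul, ip_eq_toDual, smul_eq_mul]

theorem ip_smul_left (c : ℂ) (f g : Ss d k) : ip (c • f) g = starRingEnd ℂ c * ip f g := by
  rw [ip_swap, ip_smul_right, map_mul, ← ip_swap]

theorem eq_zero_of_ip_self (f : Ss d k) (h : ip f f = 0) : f = 0 := by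
  have h1 : ∫ x, ‖f.1 x‖ ^ 2 = 0 := by
    have h2 : ((∫ x, ‖f.1 x‖ ^ 2 : ℝ) : ℂ) = 0 := by
      rw [← h, ip, ← integral_complex_ofReal]
      congr 1 with x
      rw [mul_comm, Complex.mul_conj']
      push_cast
      rfl
    exact_mod_cast h2
  have hint : Integrable fun x => ‖f.1 x‖ ^ 2 := by
    refine (integrable_mul volume f.1 (conjW f.1)).norm.congr (Eventually.of_forall fun x => ?_)
    simp [sq]
  rw [integral_eq_zero_iff_of_nonneg (fun x => by positivity) hint] at h1
  have h3 := (Continuous.ae_eq_iff_eq volume (f.1.continuous.norm.pow 2) continuous_const).1 h1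
  apply Subtype.ext
  ext x
  exact norm_eq_zero.1 (pow_eq_zero_iff two_ne_zero |>.1 (congrFun h3 x))

/-- Polarization of a quadratic form. -/
theorem eq_zero_of_ip_apply_self (T : Ss d k →ₗ[ℂ] Ss d k) (h : ∀ f, ip f (T f) = 0) : T = 0 := by
  have key : ∀ (c : ℂ) (f g : Ss d k),
      c * ip f (T g) + starRingEnd ℂ c * ip g (T f) = 0 := fun c f g => by
    have h1 := h (f + c • g)
    rw [map_add, map_smul, ip_add_right, ip_add_left, ip_add_left, ip_smul_right, ip_smul_right,
      ip_smul_left, ip_smul_left, h, h] at h1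
    linear_combination h1
  ext1 g
  refine eq_zero_of_ip_self _ ?_
  have h1 := key 1 (T g) g
  have h2 := key Complex.I (T g) g
  rw [map_one] at h1
  rw [Complex.conj_I] at h2
  have h3 : 2 * ip (T g) (T g) = 0 := by
    linear_combination h1 - Complex.I * h2 + (ip (T g) (T g) - ip g (T (T g))) * Complex.I_sq
  simpa using h3

theorem toDual_add (f g : Ss d k) : toDual (f + g) = toDual f + toDual g := by
  ext h
  have e : ∀ u v : Ss d k, toDual u v = toDual v u := fun u v => by
    rw [toDual_apply, toDual_apply]
    congr 1 with x
    exact mul_comm _ _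
  rw [add_apply, e, e f, e g, map_add]

theorem toDual_smul (c : ℂ) (f : Ss d k) : toDual (c • f) = c • toDual f := by
  ext h
  have e : ∀ u v : Ss d k, toDual u v = toDual v u := fun u v => by
    rw [toDual_apply, toDual_apply]
    congr 1 with x
    exact mul_comm _ _
  rw [smul_apply, e, e f, map_smul]

/-- The observable `i |f⟩⟨f|`. -/
def obsRank (f : Ss d k) : Obs d k :=
  ⟨Complex.I • (toDual (conjS f)).smulRight f, fun g h => by
    have e : ∀ h, (Complex.I • (toDual (conjS f)).smulRight f : Ss d k →L[ℂ] Ss d k) h =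
        (Complex.I * ip f h) • f := fun h => by
      rw [smul_apply, ContinuousLinearMap.smulRight_apply, ← ip_eq_toDual, smul_smul]
    rw [e, e, ip_smul_right, ip_smul_left, map_mul, Complex.conj_I, ← ip_swap]
    ring⟩

theorem obsRank_apply (f h : Ss d k) : (obsRank f).1 h = (Complex.I * ip f h) • f := by
  change (Complex.I • (toDual (conjS f)).smulRight f : Ss d k →L[ℂ] Ss d k) h = _
  rw [smul_apply, ContinuousLinearMap.smulRight_apply, ← ip_eq_toDual, smul_smul]

/-- Evaluation at a bosonic Schwartz function. -/
def evalDual (f : Ss d k) : SsDual d k →L[ℂ] ℂ where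
  toFun u := u f
  map_add' _ _ := rfl
  map_smul' _ _ := rfl
  cont := continuous_eval_dual f

/-- The density matrix `|f⟩⟨f|`. -/
def densRank (f : Ss d k) : Dens d k :=
  ⟨(evalDual (conjS f)).smulRight f, fun g h => by
    have e : ∀ h, ((evalDual (conjS f)).smulRight f : SsDual d k →L[ℂ] Ss d k) (toDual h) =
        ip f h • f := fun h => by
      rw [ContinuousLinearMap.smulRight_apply, ip_eq_toDual, toDual_apply]
      change toDual h (conjS f) • f = _
      rw [toDual_apply]
      congr 2 with x
      exact mul_comm _ _
    rw [e, e, ip_smul_right, ip_smul_left, ← ip_swap]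
    ring⟩

theorem trace_comp_densRank (A : Ss d k →L[ℂ] Ss d k) (f : Ss d k) :
    trace (A.comp (densRank f).1) = ip f (A f) := by
  rw [trace, ip]
  congr 1 with x
  have h : (densRank f).1 (delta x) = starRingEnd ℂ (f.1 x) • f := by
    rw [← conjS_apply]
    rfl
  rw [ker, ContinuousLinearMap.comp_apply, h, map_smul]
  rfl

theorem trace_obsRank_comp (f : Ss d k) (v : Dens d k) :
    trace ((obsRank f).1.comp v.1) = Complex.I * ip (v.1 (toDual f)) f := by
  rw [trace, ip, ← integral_const_mul]
  congr 1 with x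
  have h : ip f (v.1 (delta x)) = starRingEnd ℂ ((v.1 (toDual f)).1 x) := by
    rw [dens_apply, ip_swap, ip_eq_toDual, toDual_apply, toDual_apply]
    congr 2 with y
    exact mul_comm _ _
  rw [ker, ContinuousLinearMap.comp_apply, obsRank_apply, h, ← mul_assoc]
  rfl

/-- The density matrices `|f⟩⟨f|` yield the quadratic form of `A`, which determines `A` over `ℂ`. -/
theorem obs_eq_zero_of_trace (A : Obs d k) (h : ∀ v : Dens d k, trace (A.1.comp v.1) = 0) :
    A = 0 := by
  have h1 := eq_zero_of_ip_apply_self (A.1 : Ss d k →ₗ[ℂ] Ss d k) fun f => by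
    have := h (densRank f)
    rwa [trace_comp_densRank] at this
  exact obs_ext fun f => congrArg Subtype.val (DFunLike.congr_fun h1 f)

/-- The observables `i |f⟩⟨f|` yield the quadratic form of `v` on functions, and functions are dense
in the distributions. -/
theorem dens_eq_zero_of_trace (v : Dens d k) (h : ∀ A : Obs d k, trace (A.1.comp v.1) = 0) :
    v = 0 := by
  let T : Ss d k →ₗ[ℂ] Ss d k :=
    { toFun := fun f => v.1 (toDual f)
      map_add' := fun f g => by rw [toDual_add, map_add]
      map_smul' := fun c f => by rw [toDual_smul, map_smul, RingHom.id_apply] }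
  have h1 : T = 0 := eq_zero_of_ip_apply_self T fun f => by
    have h2 := h (obsRank f)
    rw [trace_obsRank_comp, mul_eq_zero] at h2
    exact (v.2 f f).trans (h2.resolve_left Complex.I_ne_zero)
  apply Subtype.ext
  ext1 u
  have h2 : (fun u => v.1 u) = fun _ => 0 :=
    denseRange_toDual.equalizer v.1.continuous continuous_const
      (funext fun f => DFunLike.congr_fun h1 f)
  exact congrFun h2 u

end InnerProduct

/-! ### Vector space structure and topology of the hierarchies -/

section Instances

variable {d : ℕ} (N : ℕ)
scoped instance instAddCommMonoidDensH : AddCommMonoid (DensH d N) :=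
  (instAddCommGroupDensH N).toAddCommMonoid

scoped instance instAddDensH : Add (DensH d N) := (instAddCommMonoidDensH N).toAdd

scoped instance instSMulDensH : SMul ℝ (DensH d N) := (instModuleDensH N).toSMul

scoped instance instAddCommMonoidObsH : AddCommMonoid (ObsH d N) :=
  (instAddCommGroupObsH N).toAddCommMonoid

scoped instance instAddObsH : Add (ObsH d N) := (instAddCommMonoidObsH N).toAdd

scoped instance instZeroDensH : Zero (DensH d N) := (instAddCommMonoidDensH N).toZero

scoped instance instZeroObsH : Zero (ObsH d N) := (instAddCommMonoidObsH N).toZero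

scoped instance instSMulObsH : SMul ℝ (ObsH d N) := (instModuleObsH N).toSMul

set_option synthInstance.maxHeartbeats 200000 in
scoped instance instIsTopologicalAddGroupDensH : IsTopologicalAddGroup (DensH d N) := inferInstance

set_option synthInstance.maxHeartbeats 200000 in
scoped instance instContinuousSMulDensH : ContinuousSMul ℝ (DensH d N) := inferInstance

end Instances

/-! ### The trace pairing, the algebra of functionals and their gradients -/

section Pairing

set_option synthInstance.maxHeartbeats 200000

variable {d k N : ℕ}

/-- The trace against an operator. -/
def traceL (A : Ss d k →L[ℂ] Ss d k) : (SsDual d k →L[ℂ] Ss d k) →L[ℂ] ℂ :=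
  (diagInt (Conf d k)).comp ((left (lift A)).comp (kerMap d k))

theorem traceL_apply (A : Ss d k →L[ℂ] Ss d k) (γ : SsDual d k →L[ℂ] Ss d k) :
    traceL A γ = trace (A.comp γ) := (trace_comp A γ).symm

theorem trace_add_comp (A B : Ss d k →L[ℂ] Ss d k) (γ : SsDual d k →L[ℂ] Ss d k) :
    trace ((A + B).comp γ) = trace (A.comp γ) + trace (B.comp γ) := by
  rw [trace, trace, trace, ← integral_add (integrable_ker_diag _) (integrable_ker_diag _)]
  rfl

theorem trace_real_smul_comp (c : ℝ) (A : Ss d k →L[ℂ] Ss d k) (γ : SsDual d k →L[ℂ] Ss d k) :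
    trace ((c • A).comp γ) = c * trace (A.comp γ) := by
  rw [trace, trace, ← integral_const_mul]
  rfl

theorem traceL_real_smul (A : Ss d k →L[ℂ] Ss d k) (c : ℝ) (γ : SsDual d k →L[ℂ] Ss d k) :
    traceL A (c • γ) = c * traceL A γ := by
  have : c • γ = (c : ℂ) • γ := by
    ext u x
    simp
  rw [this, map_smul, smul_eq_mul]

/-- Hermitian symmetry of the kernel moves the conjugate of `A` to the second variable, and
cyclicity with the skew transpose moves it back with a minus sign. This makes `i Tr(A γ)` real. -/
theorem conj_trace (A : Obs d k) (γ : Dens d k) :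
    starRingEnd ℂ (trace (A.1.comp γ.1)) = -trace (A.1.comp γ.1) := by
  have h : starRingEnd ℂ (trace (A.1.comp γ.1)) =
      diagInt (Conf d k) (right (conjOp (lift A.1)) (kerMap d k γ.1)) := by
    rw [trace_comp, diagInt_apply, diagInt_apply, ← integral_conj]
    congr 1 with x
    rw [left_apply, right_apply, conjOp_apply, conjW_apply]
    congr 3
    ext y
    simp only [sliceL_apply, sliceR_apply, conjW_apply, kerMap_apply]
    rw [ker_hermitian]
  have h2 : right (conjOp (lift A.1)) (kerMap d k γ.1) =
      -right (-conjOp (lift A.1)) (kerMap d k γ.1) := by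
    ext p
    rw [neg_apply, right_apply, right_apply, neg_apply, neg_apply, neg_neg]
  rw [h, h2, map_neg, ← diagInt_left _ _ (isTr_lift A), ← trace_comp]

/-- The functional `Γ ↦ i Tr(A · Γ)`. -/
def pairingL (A : ObsH d N) : DensH d N →L[ℝ] ℝ where
  toFun Γ := (Complex.I * hierTrace A Γ).re
  map_add' Γ Γ' := by
    have : hierTrace A (Γ + Γ') = hierTrace A Γ + hierTrace A Γ' := by
      simp only [hierTrace, ← traceL_apply, ← Finset.sum_add_distrib]
      exact Finset.sum_congr rfl fun k _ => map_add (traceL (A k).1) (Γ k).1 (Γ' k).1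
    rw [this, mul_add, Complex.add_re]
  map_smul' c Γ := by
    have : hierTrace A (c • Γ) = c * hierTrace A Γ := by
      simp only [hierTrace, ← traceL_apply, Finset.mul_sum]
      exact Finset.sum_congr rfl fun k _ => traceL_real_smul (A k).1 c (Γ k).1
    rw [this, mul_left_comm, Complex.re_ofReal_mul]
    rfl
  cont := by
    refine Complex.continuous_re.comp (continuous_const.mul ?_)
    change Continuous fun Γ : DensH d N => ∑ k, trace ((A k).1.comp (Γ k).1)
    simp only [← traceL_apply]
    exact continuous_finsetSum _ fun k _ =>
      (traceL (A k).1).continuous.comp (continuous_subtype_val.comp (continuous_apply k))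

theorem pairingL_apply (A : ObsH d N) (Γ : DensH d N) :
    (pairingL A Γ : ℂ) = Complex.I * hierTrace A Γ := by
  change ((Complex.I * hierTrace A Γ).re : ℂ) = _
  rw [← Complex.conj_eq_iff_re, map_mul, Complex.conj_I, hierTrace, map_sum,
    Finset.sum_congr rfl fun k _ => conj_trace (A k) (Γ k), Finset.sum_neg_distrib]
  ring

theorem hierTrace_add_left (A B : ObsH d N) (Γ : DensH d N) :
    hierTrace (A + B) Γ = hierTrace A Γ + hierTrace B Γ := by
  rw [hierTrace, hierTrace, hierTrace, ← Finset.sum_add_distrib]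
  exact Finset.sum_congr rfl fun k _ => trace_add_comp (A k).1 (B k).1 (Γ k).1

theorem hierTrace_smul_left (c : ℝ) (A : ObsH d N) (Γ : DensH d N) :
    hierTrace (c • A) Γ = c * hierTrace A Γ := by
  rw [hierTrace, hierTrace, Finset.mul_sum]
  exact Finset.sum_congr rfl fun k _ => trace_real_smul_comp c (A k).1 (Γ k).1

/-- The pairing of observable hierarchies and density matrix hierarchies. -/
def pairing (d N : ℕ) : ObsH d N →ₗ[ℝ] DensH d N →L[ℝ] ℝ where
  toFun := pairingL
  map_add' A B := by
    ext Γ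
    have h : (pairingL (A + B) Γ : ℂ) = ((pairingL A + pairingL B) Γ : ℝ) := by
      rw [add_apply, Complex.ofReal_add]
      simp only [pairingL_apply, hierTrace_add_left]
      ring
    exact_mod_cast h
  map_smul' c A := by
    ext Γ
    have h : (pairingL (c • A) Γ : ℂ) = ((c • pairingL A) Γ : ℝ) := by
      rw [smul_apply, smul_eq_mul, Complex.ofReal_mul]
      simp only [pairingL_apply, hierTrace_smul_left]
      ring
    exact_mod_cast h

theorem pairing_apply (A : ObsH d N) (Γ : DensH d N) :
    (pairing d N A Γ : ℂ) = Complex.I * hierTrace A Γ := pairingL_apply A Γ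

theorem hierTrace_eq_zero_of_pairing {A : ObsH d N} {Γ : DensH d N} (h : pairing d N A Γ = 0) :
    hierTrace A Γ = 0 := by
  have h1 := pairing_apply A Γ
  rw [h, Complex.ofReal_zero, zero_eq_mul] at h1
  exact h1.resolve_left Complex.I_ne_zero

theorem hierTrace_single_right (A : ObsH d N) (k : Idx N) (v : Dens d k) :
    hierTrace A (Pi.single k v) = trace ((A k).1.comp v.1) := by
  rw [hierTrace, Finset.sum_eq_single k, Pi.single_eq_same]
  · intro j _ hj
    rw [Pi.single_eq_of_ne hj, ← traceL_apply]
    exact map_zero (traceL (A j).1)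
  · exact fun h => absurd (Finset.mem_univ k) h

theorem hierTrace_single_left (k : Idx N) (A : Obs d k) (Γ : DensH d N) :
    hierTrace (Pi.single k A) Γ = trace (A.1.comp (Γ k).1) := by
  rw [hierTrace, Finset.sum_eq_single k, Pi.single_eq_same]
  · intro j _ hj
    rw [Pi.single_eq_of_ne hj]
    have := trace_real_smul_comp 0 (0 : Obs d j).1 (Γ j).1
    rw [Complex.ofReal_zero, zero_mul] at this
    rw [← this]
    congr 2
    exact (zero_smul ℝ (0 : Ss d j →L[ℂ] Ss d j)).symm
  · exact fun h => absurd (Finset.mem_univ k) h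

theorem pairing_injective (d N : ℕ) : Function.Injective (pairing d N) := by
  rw [injective_iff_map_eq_zero]
  intro A hA
  funext k
  refine obs_eq_zero_of_trace (A k) fun v => ?_
  rw [← hierTrace_single_right]
  exact hierTrace_eq_zero_of_pairing (by rw [hA]; rfl)

theorem eq_zero_of_pairing (v : DensH d N) (h : ∀ A, pairing d N A v = 0) : v = 0 := by
  funext k
  refine dens_eq_zero_of_trace (v k) fun A => ?_
  rw [← hierTrace_single_left]
  exact hierTrace_eq_zero_of_pairing (h _)

/-- Trace functionals are continuous and linear, hence smooth, so the smoothness required of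
generators excludes none of them; constants lie in every unital subalgebra. -/
theorem functionals_eq_linAlg (d N : ℕ) : functionals d N = linAlg (pairing d N) := by
  refine le_antisymm (Algebra.adjoin_le ?_) (Algebra.adjoin_le ?_)
  · rintro F (⟨_, A, hF⟩ | ⟨_, c, hF⟩)
    · have : F = pairing d N A := by
        funext Γ
        have := (hF Γ).trans (pairing_apply A Γ).symm
        exact_mod_cast this
      rw [this]
      exact mem_linAlg A
    · have : F = algebraMap ℝ (DensH d N → ℝ) c := funext hF
      rw [this]
      exact Subalgebra.algebraMap_mem _ c
  · rintro _ ⟨A, rfl⟩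
    exact Algebra.subset_adjoin (Or.inl ⟨gateauxSmooth_clm _, A, pairing_apply A⟩)

theorem isGrad_iff {F : DensH d N → ℝ} {Γ : DensH d N} {A : ObsH d N} :
    IsGrad F Γ A ↔ ∀ v, HasGateauxDeriv F Γ v (pairing d N A v) := by
  refine forall_congr' fun v => ⟨?_, fun h => ⟨_, h, pairing_apply A v⟩⟩
  rintro ⟨c, hc, h⟩
  rw [← pairing_apply, Complex.ofReal_inj] at h
  rwa [← h]

theorem existsUnique_isGrad {F : DensH d N → ℝ} (hF : F ∈ functionals d N) (Γ : DensH d N) :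
    ∃! A, IsGrad F Γ A := by
  rw [functionals_eq_linAlg] at hF
  obtain ⟨g, hg, -⟩ := exists_hasGrad hF
  refine ⟨g Γ, isGrad_iff.2 (hg Γ), fun B hB => pairing_injective d N ?_⟩
  ext v
  exact (isGrad_iff.1 hB v).unique (hg Γ v)

theorem hasGrad_grad {F : DensH d N → ℝ} (hF : F ∈ linAlg (pairing d N)) :
    HasGrad (pairing d N) F (grad F) := fun Γ => by
  rw [← functionals_eq_linAlg] at hF
  have h : ∃ A, IsGrad F Γ A := (existsUnique_isGrad hF Γ).exists
  rw [grad, dif_pos h]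
  exact isGrad_iff.1 h.choose_spec

end Pairing

/-! ### Lie brackets pulled back along injective maps of homogeneous components -/

section GradedBracket

variable {ι W : Type*} [Fintype ι] [DecidableEq ι] {V : ι → Type*} [∀ i, AddCommGroup (V i)]
  [∀ i, Module ℝ (V i)] [AddCommGroup W] [Module ℝ W] {e : ∀ i, V i →ₗ[ℝ] W}
  {b : W →ₗ[ℝ] W →ₗ[ℝ] W} {q : ι → ι → ι} {h : (∀ i, V i) → (∀ i, V i) → ∀ i, V i}

omit [Fintype ι] [DecidableEq ι] in
theorem graded_ext (he : ∀ i, Function.Injective (e i)) {A B : ∀ i, V i}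
    (hAB : ∀ k, e k (A k) = e k (B k)) : A = B :=
  funext fun k => he k (hAB k)

/-- The bracket that is induced on a graded space by a bracket of its homogeneous components. -/
def gradedBracket (he : ∀ i, Function.Injective (e i)) (hh : ∀ A B k, e k (h A B k) =
    ∑ p : ι × ι, if q p.1 p.2 = k then b (e p.1 (A p.1)) (e p.2 (B p.2)) else 0) :
    (∀ i, V i) →ₗ[ℝ] (∀ i, V i) →ₗ[ℝ] ∀ i, V i :=
  LinearMap.mk₂ ℝ h
    (fun A B C => graded_ext he fun k => by
      simp only [hh, Pi.add_apply, map_add, LinearMap.add_apply, ite_add_zero,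
        Finset.sum_add_distrib])
    (fun c A B => graded_ext he fun k => by
      simp only [hh, Pi.smul_apply, map_smul, LinearMap.smul_apply, Finset.smul_sum, smul_ite,
        smul_zero])
    (fun A B C => graded_ext he fun k => by
      simp only [hh, Pi.add_apply, map_add, ite_add_zero, Finset.sum_add_distrib])
    (fun c A B => graded_ext he fun k => by
      simp only [hh, Pi.smul_apply, map_smul, Finset.smul_sum, smul_ite, smul_zero])

/-- The pairs `(i, j)` and `(j, i)` contribute to the same degree with opposite signs, so the sum
equals its own negative. -/
theorem gradedBracket_self (he : ∀ i, Function.Injective (e i)) (hh : ∀ A B k, e k (h A B k) =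
    ∑ p : ι × ι, if q p.1 p.2 = k then b (e p.1 (A p.1)) (e p.2 (B p.2)) else 0)
    (hq : ∀ i j, q i j = q j i) (hb : ∀ x, b x x = 0) (A : ∀ i, V i) : h A A = 0 :=
  graded_ext he fun k => by
    have hanti : ∀ x y, b x y = -b y x := fun x y => by
      have h1 := hb (x + y)
      simp only [map_add, LinearMap.add_apply, hb, zero_add, add_zero] at h1
      exact eq_neg_of_add_eq_zero_right h1
    have h1 : ∑ p : ι × ι, (if q p.1 p.2 = k then b (e p.1 (A p.1)) (e p.2 (A p.2)) else 0) =
        -∑ p : ι × ι, if q p.1 p.2 = k then b (e p.1 (A p.1)) (e p.2 (A p.2)) else 0 := by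
      conv_lhs => rw [← Equiv.sum_comp (Equiv.prodComm ι ι)]
      rw [← Finset.sum_neg_distrib]
      refine Finset.sum_congr rfl fun p _ => ?_
      change (if q p.2 p.1 = k then b (e p.2 (A p.2)) (e p.1 (A p.1)) else 0) = _
      rw [hq, hanti]
      split_ifs
      · rfl
      · rw [neg_zero]
    rw [hh, Pi.zero_apply, map_zero]
    exact (smul_eq_zero.1 ((two_smul ℝ _).trans (eq_neg_iff_add_eq_zero.1 h1))).resolve_left
      two_ne_zero

theorem gradedBracket_apply₂ (hh : ∀ A B k, e k (h A B k) =
    ∑ p : ι × ι, if q p.1 p.2 = k then b (e p.1 (A p.1)) (e p.2 (B p.2)) else 0)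
    (A B C : ∀ i, V i) (k : ι) : e k (h A (h B C) k) = ∑ l, ∑ j, ∑ m,
      if q l (q j m) = k then b (e l (A l)) (b (e j (B j)) (e m (C m))) else 0 := by
  rw [hh, Fintype.sum_prod_type]
  refine Finset.sum_congr rfl fun l _ => ?_
  have h1 : ∀ i, (if q l i = k then b (e l (A l)) (e i (h B C i)) else 0) =
      ∑ p : ι × ι, if q p.1 p.2 = i then
        if q l i = k then b (e l (A l)) (b (e p.1 (B p.1)) (e p.2 (C p.2))) else 0 else 0 :=
    fun i => by
      rw [hh, map_sum]
      split_ifs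
      · refine Finset.sum_congr rfl fun p _ => ?_
        split_ifs
        · rfl
        · rw [map_zero]
      · simp
  rw [Finset.sum_congr rfl fun i _ => h1 i, Finset.sum_comm, Fintype.sum_prod_type]
  simp only [Finset.sum_ite_eq, Finset.mem_univ, if_true]

/-- By `hq`, the three double brackets of components `l, j, m` land in the same degree, where the
Jacobi identity of `W` applies to each triple. -/
theorem gradedBracket_jacobi (he : ∀ i, Function.Injective (e i)) (hh : ∀ A B k, e k (h A B k) =
    ∑ p : ι × ι, if q p.1 p.2 = k then b (e p.1 (A p.1)) (e p.2 (B p.2)) else 0)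
    (hq : ∀ l j m, q l (q j m) = q j (q m l))
    (hb : ∀ x y z, b x (b y z) + b y (b z x) + b z (b x y) = 0) (A B C : ∀ i, V i) :
    h A (h B C) + h B (h C A) + h C (h A B) = 0 := graded_ext he fun k => by
  rw [Pi.add_apply, Pi.add_apply, map_add, map_add, Pi.zero_apply, map_zero,
    gradedBracket_apply₂ hh, gradedBracket_apply₂ hh, gradedBracket_apply₂ hh]
  have h2 : ∀ F : ι → ι → ι → W, ∑ j, ∑ m, ∑ l, F j m l = ∑ l, ∑ j, ∑ m, F j m l := fun F =>
    (Finset.sum_congr rfl fun j _ => Finset.sum_comm).trans Finset.sum_comm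
  rw [h2 fun j m l => if q j (q m l) = k then b (e j (B j)) (b (e m (C m)) (e l (A l))) else 0,
    h2 fun m l j => if q m (q l j) = k then b (e m (C m)) (b (e l (A l)) (e j (B j))) else 0,
    h2 fun j m l => if q m (q l j) = k then b (e m (C m)) (b (e l (A l)) (e j (B j))) else 0,
    ← Finset.sum_add_distrib, ← Finset.sum_add_distrib]
  refine Finset.sum_eq_zero fun l _ => ?_
  rw [← Finset.sum_add_distrib, ← Finset.sum_add_distrib]
  refine Finset.sum_eq_zero fun j _ => ?_
  rw [← Finset.sum_add_distrib, ← Finset.sum_add_distrib]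
  refine Finset.sum_eq_zero fun m _ => ?_
  rw [← hq j m l, ← hq l j m]
  split_ifs
  · exact hb _ _ _
  · rw [add_zero, add_zero]

end GradedBracket

/-! ### `𝔤_N` and `𝔊_N` as Lie algebras -/

section LieAlgebra

variable {d n N : ℕ}

theorem obsBracket_apply (A B : Obs d n) (f : Ss d n) :
    (obsBracket A B).1 f = (n : ℝ) • (A.1 (B.1 f) - B.1 (A.1 f)) := rfl

theorem map_real_smul (A : Ss d n →L[ℂ] Ss d n) (c : ℝ) (f : Ss d n) : A (c • f) = c • A f := by
  have h : ∀ g : Ss d n, c • g = (c : ℂ) • g := fun g => by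
    apply Subtype.ext
    ext x
    simp
  rw [h, h, map_smul]

theorem obs_add_apply (A B : Obs d n) (f : Ss d n) : (A + B).1 f = A.1 f + B.1 f := rfl

theorem obs_smul_apply (c : ℝ) (A : Obs d n) (f : Ss d n) : (c • A).1 f = c • A.1 f := rfl

/-- The bracket of `n`-body observables is bilinear. -/
def obsBracketL (d n : ℕ) : Obs d n →ₗ[ℝ] Obs d n →ₗ[ℝ] Obs d n :=
  LinearMap.mk₂ ℝ obsBracket
    (fun A B C => obs_ext fun f => congrArg Subtype.val (by
      simp only [obsBracket_apply, obs_add_apply, map_add]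
      module))
    (fun c A B => obs_ext fun f => congrArg Subtype.val (by
      simp only [obsBracket_apply, obs_smul_apply, map_real_smul]
      module))
    (fun A B C => obs_ext fun f => congrArg Subtype.val (by
      simp only [obsBracket_apply, obs_add_apply, map_add]
      module))
    (fun c A B => obs_ext fun f => congrArg Subtype.val (by
      simp only [obsBracket_apply, obs_smul_apply, map_real_smul]
      module))

theorem obsBracketL_apply (A B : Obs d n) : obsBracketL d n A B = obsBracket A B := rfl

theorem obsBracketL_self (A : Obs d n) : obsBracketL d n A A = 0 :=
  obs_ext fun f => congrArg Subtype.val (by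
    rw [obsBracketL_apply, obsBracket_apply, sub_self, smul_zero]
    rfl)

theorem obsBracketL_jacobi (A B C : Obs d n) :
    obsBracketL d n A (obsBracketL d n B C) + obsBracketL d n B (obsBracketL d n C A) +
      obsBracketL d n C (obsBracketL d n A B) = 0 :=
  obs_ext fun f => congrArg Subtype.val (by
    simp only [obsBracketL_apply, obsBracket_apply, obs_add_apply, map_real_smul, map_sub]
    change _ = (0 : Ss d n)
    module)

theorem exists_compBracket (l j : Idx N) (A : Obs d l) (B : Obs d j) : ∃ C : Obs d (kk l j),
    ∀ f, (C.1 f).1 = bracketS (kk l j) N (lift A.1) (lift B.1) f.1 := exists_bracket _ N A B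

/-- The component of the bracket of hierarchies that comes from `ℓ`- and `j`-body observables. -/
def compBracket (l j : Idx N) (A : Obs d l) (B : Obs d j) : Obs d (kk l j) :=
  (exists_compBracket l j A B).choose

theorem compBracket_apply (l j : Idx N) (A : Obs d l) (B : Obs d j) (f : Ss d (kk l j)) :
    ((compBracket l j A B).1 f).1 = bracketS (kk l j) N (lift A.1) (lift B.1) f.1 :=
  (exists_compBracket l j A B).choose_spec f

theorem emb_compBracket (l j : Idx N) (A : Obs d l) (B : Obs d j) :
    emb d (kk l j) N (compBracket l j A B) = obsBracket (emb d l N A) (emb d j N B) :=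
  emb_bracket (Finset.mem_Icc.1 l.2).1 (Finset.mem_Icc.1 j.2).1 rfl A B _
    (compBracket_apply l j A B)

theorem emb_injective_idx (k : Idx N) : Function.Injective (emb d k N) :=
  emb_injective (Finset.mem_Icc.1 k.2).1 (Finset.mem_Icc.1 k.2).2

/-- The bracket lies in the range of an injective map, so `Function.invFun` returns the preimage and
not its default value. -/
theorem invFun_emb (l j : Idx N) (A : Obs d l) (B : Obs d j) :
    Function.invFun (emb d (kk l j) N) (obsBracket (emb d l N A) (emb d j N B)) =
      compBracket l j A B := by
  rw [← emb_compBracket]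
  exact Function.leftInverse_invFun (emb_injective_idx _) _

theorem hierBracket_apply (A B : ObsH d N) (k : Idx N) : hierBracket A B k =
    ∑ p : Idx N × Idx N, if kk p.1 p.2 = k then
      Function.invFun (emb d k N) (obsBracket (emb d p.1 N (A p.1)) (emb d p.2 N (B p.2))) else 0 := by
  rw [hierBracket, ← Finset.sum_filter]
  refine Finset.sum_congr ?_ fun _ _ => rfl
  ext p
  simp only [Finset.mem_filter, Finset.mem_univ, true_and, Subtype.ext_iff]
  rfl

theorem embL_hierBracket (A B : ObsH d N) (k : Idx N) : embL d k N (hierBracket A B k) =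
    ∑ p : Idx N × Idx N, if kk p.1 p.2 = k then
      obsBracketL d N (embL d p.1 N (A p.1)) (embL d p.2 N (B p.2)) else 0 := by
  rw [hierBracket_apply, map_sum]
  refine Finset.sum_congr rfl fun p _ => ?_
  by_cases h : kk p.1 p.2 = k
  · subst h
    rw [if_pos rfl, if_pos rfl, invFun_emb, embL_apply, emb_compBracket]
    rfl
  · rw [if_neg h, if_neg h, map_zero]

theorem kk_comm (l j : Idx N) : kk l j = kk j l :=
  Subtype.ext (by simp only [kk]; omega)

/-- Both sides equal `min (ℓ + j + m - 2) N`, because all three indices are at least one. -/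
theorem kk_assoc (l j m : Idx N) : kk l (kk j m) = kk j (kk m l) := by
  have h1 := Finset.mem_Icc.1 l.2
  have h2 := Finset.mem_Icc.1 j.2
  have h3 := Finset.mem_Icc.1 m.2
  exact Subtype.ext (by simp only [kk]; omega)

theorem embL_injective (k : Idx N) : Function.Injective (embL d k N) := emb_injective_idx k

/-- The bracket of hierarchies is bilinear. -/
def hierBracketL (d N : ℕ) : ObsH d N →ₗ[ℝ] ObsH d N →ₗ[ℝ] ObsH d N :=
  gradedBracket (V := fun k : Idx N => Obs d k) (e := fun k => embL d k N)
    (b := obsBracketL d N) (q := kk) embL_injective embL_hierBracket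

theorem hierBracketL_apply (A B : ObsH d N) : hierBracketL d N A B = hierBracket A B := rfl

theorem hierBracketL_self (A : ObsH d N) : hierBracketL d N A A = 0 :=
  gradedBracket_self (V := fun k : Idx N => Obs d k) (e := fun k => embL d k N)
    (b := obsBracketL d N) (q := kk) embL_injective embL_hierBracket kk_comm obsBracketL_self A

theorem hierBracketL_jacobi (A B C : ObsH d N) :
    hierBracketL d N A (hierBracketL d N B C) + hierBracketL d N B (hierBracketL d N C A) +
      hierBracketL d N C (hierBracketL d N A B) = 0 :=
  gradedBracket_jacobi (V := fun k : Idx N => Obs d k) (e := fun k => embL d k N)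
    (b := obsBracketL d N) (q := kk) embL_injective embL_hierBracket kk_assoc obsBracketL_jacobi
    A B C

theorem hierTrace_hierBracket (A B : ObsH d N) (Γ : DensH d N) : hierTrace (hierBracket A B) Γ =
    ∑ l : Idx N, ∑ j : Idx N, trace ((compBracket l j (A l) (B j)).1.comp (Γ (kk l j)).1) := by
  have h : ∀ k : Idx N, trace ((hierBracket A B k).1.comp (Γ k).1) =
      ∑ p : Idx N × Idx N, if kk p.1 p.2 = k then trace ((Function.invFun (emb d k N)
        (obsBracket (emb d p.1 N (A p.1)) (emb d p.2 N (B p.2)))).1.comp (Γ k).1) else 0 := fun k => by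
    let T : Obs d k →ₗ[ℝ] ℂ :=
      { toFun := fun A => trace (A.1.comp (Γ k).1)
        map_add' := fun A B => trace_add_comp A.1 B.1 _
        map_smul' := fun c A => by
          rw [RingHom.id_apply, Complex.real_smul]
          exact trace_real_smul_comp c A.1 _ }
    change T (hierBracket A B k) = ∑ p : Idx N × Idx N, if kk p.1 p.2 = k then
      T (Function.invFun (emb d k N) (obsBracket (emb d p.1 N (A p.1)) (emb d p.2 N (B p.2)))) else 0
    rw [hierBracket_apply, map_sum]
    refine Finset.sum_congr rfl fun p _ => ?_
    split_ifs <;> simp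
  rw [hierTrace, Finset.sum_congr rfl fun k _ => h k, Finset.sum_comm, Fintype.sum_prod_type]
  refine Finset.sum_congr rfl fun l _ => Finset.sum_congr rfl fun j _ => ?_
  rw [Finset.sum_ite_eq, if_pos (Finset.mem_univ _), invFun_emb]

end LieAlgebra

/-! ### Commutators and the coadjoint action on kernels -/

section Commutator

variable {d l j k : ℕ}

/-- The commutator of `B_{(β)}` with the operator with a given kernel, on the level of kernels. -/
def commK (B : 𝓢(Conf d j, ℂ) →L[ℂ] 𝓢(Conf d j, ℂ)) (β : Fin j ↪ Fin k) :
    𝓢(Conf d k × Conf d k, ℂ) →L[ℂ] 𝓢(Conf d k × Conf d k, ℂ) :=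
  left (op B β) - right (-conjOp (op B β))

theorem commK_apply (B : 𝓢(Conf d j, ℂ) →L[ℂ] 𝓢(Conf d j, ℂ)) (β : Fin j ↪ Fin k)
    (K : 𝓢(Conf d k × Conf d k, ℂ)) (p : Conf d k × Conf d k) :
    commK B β K p = op B β (sliceL p.2 K) p.1 +
      starRingEnd ℂ (op B β (conjW (sliceR p.1 K)) p.2) := by
  rw [commK, sub_apply, sub_apply, left_apply, right_apply, neg_apply, neg_apply, conjOp_apply,
    conjW_apply, sub_neg_eq_add]

/-- A density matrix acts on a distribution by pairing it with the second variable of the kernel.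
For `actOnDelta` this turns the extension of `B_{(β)}` by duality into `-conjOp` acting on that
variable. -/
theorem commKer_eq (B : Ss d j →L[ℂ] Ss d j) (β : Fin j ↪ Fin k) (γ : Dens d k)
    (y y' : Conf d k) : commKer B β γ.1 y y' = commK (lift B) β (kerMap d k γ.1) (y, y') := by
  have hs : sliceL y' (kerMap d k γ.1) = (γ.1 (delta y')).1 := by
    ext x
    simp [kerMap_apply, ker]
  have hK := isSymKernel_kerMap γ.1
  have hr : (sym d k (sliceR y (kerMap d k γ.1))).1 = sliceR y (kerMap d k γ.1) :=
    sym_of_symm _ fun π x => by simp [hK.2]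
  have h2 : (γ.1 (actOnDelta B β y')).1 y =
      -starRingEnd ℂ (op (lift B) β (conjW (sliceR y (kerMap d k γ.1))) y') := by
    rw [← opMap_kerMap γ, opMap_apply_coe (isSymKernel_kerMap _), opMap_kerMap]
    change -starRingEnd ℂ (actOn B β (conjS _) y') = _
    rw [actOn_eq_op, conjS_coe, hr]
  rw [commKer, actOn_eq_op, h2, commK_apply, hs, sub_neg_eq_add]

/-- Hermitian kernels. -/
def IsHermKernel {V : Type*} [NormedAddCommGroup V] [NormedSpace ℝ V] (K : 𝓢(V × V, ℂ)) : Prop :=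
  ∀ x y, K (y, x) = starRingEnd ℂ (K (x, y))

theorem IsHermKernel.commK {K : 𝓢(Conf d k × Conf d k, ℂ)} (hK : IsHermKernel K)
    (B : 𝓢(Conf d j, ℂ) →L[ℂ] 𝓢(Conf d j, ℂ)) (β : Fin j ↪ Fin k) :
    IsHermKernel (commK B β K) := fun x y => by
  have h : ∀ x, sliceL x K = conjW (sliceR x K) := fun x => by
    ext y
    rw [sliceL_apply, conjW_apply, sliceR_apply, hK]
  rw [commK_apply, commK_apply, map_add, h, h, Complex.conj_conj, add_comm]

theorem IsHermKernel.sum {V ι : Type*} [NormedAddCommGroup V] [NormedSpace ℝ V] (s : Finset ι)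
    {K : ι → 𝓢(V × V, ℂ)} (hK : ∀ i ∈ s, IsHermKernel (K i)) :
    IsHermKernel (∑ i ∈ s, K i) := fun x y => by
  simp only [sum_apply, map_sum]
  exact Finset.sum_congr rfl fun i hi => hK i hi x y

theorem IsHermKernel.smul {V : Type*} [NormedAddCommGroup V] [NormedSpace ℝ V] (c : ℝ)
    {K : 𝓢(V × V, ℂ)} (hK : IsHermKernel K) : IsHermKernel ((c : ℂ) • K) := fun x y => by
  rw [smul_apply, smul_apply, smul_eq_mul, smul_eq_mul, map_mul, Complex.conj_ofReal, hK]

theorem IsHermKernel.ptrace (h : l ≤ k) {K : 𝓢(Conf d k × Conf d k, ℂ)} (hK : IsHermKernel K) :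
    IsHermKernel (ptrace d h K) := fun x y => by
  rw [ptrace_apply, ptrace_apply, partialTrace, partialTrace, ← integral_conj]
  simp only [hK (glue x _)]

/-- A permutation of the first particles. -/
theorem glue_comp_perm (h : l ≤ k) (π : Equiv.Perm (Fin l)) (x : Conf d l) (z : Conf d (k - l)) :
    (glue (x ∘ π) z : Conf d k) =
      glue x z ∘ π.viaFintypeEmbedding (Fin.castLEEmb h) := by
  ext1 i
  by_cases hi : (i : ℕ) < l
  · have : i = Fin.castLEEmb h ⟨i, hi⟩ := rfl
    rw [this, Function.comp_apply, Equiv.Perm.viaFintypeEmbedding_apply_image]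
    simp [glue, hi]
  · rw [Function.comp_apply, Equiv.Perm.viaFintypeEmbedding_apply_notMem_range]
    · simp [glue, hi]
    · rintro ⟨a, rfl⟩
      exact hi a.2

/-- The permutation moves only the first `ℓ` indices and so leaves the prescribed entries from `ℓ +
1` on alone. -/
theorem trans_mem_tuples (h : l ≤ k) (r : ℕ) (π : Equiv.Perm (Fin l)) {β : Fin j ↪ Fin k}
    (hβ : β ∈ tuples l j k r) :
    β.trans (π.viaFintypeEmbedding (Fin.castLEEmb h)).toEmbedding ∈ tuples l j k r := by
  rw [tuples, Finset.mem_filter] at hβ ⊢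
  refine ⟨Finset.mem_univ _, fun i hi => ?_, fun i hi => ?_⟩
  · have : β i = Fin.castLEEmb h ⟨β i, hβ.2.1 i hi⟩ := rfl
    change ((π.viaFintypeEmbedding (Fin.castLEEmb h) (β i) : Fin k) : ℕ) < l
    rw [this, Equiv.Perm.viaFintypeEmbedding_apply_image]
    exact (π _).2
  · change ((π.viaFintypeEmbedding (Fin.castLEEmb h) (β i) : Fin k) : ℕ) = _
    rw [Equiv.Perm.viaFintypeEmbedding_apply_notMem_range, hβ.2.2 i hi]
    rintro ⟨a, ha⟩
    have h1 := hβ.2.2 i hi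
    rw [← ha] at h1
    have h2 : ((Fin.castLEEmb h a : Fin k) : ℕ) < l := a.2
    omega

theorem sum_tuples_perm {V : Type*} [AddCommMonoid V] (h : l ≤ k) (r : ℕ)
    (π : Equiv.Perm (Fin l)) (F : (Fin j ↪ Fin k) → V) :
    ∑ β ∈ tuples l j k r, F (β.trans (π.viaFintypeEmbedding (Fin.castLEEmb h)).toEmbedding) =
      ∑ β ∈ tuples l j k r, F β := by
  let e := embeddingPerm (k := j) (π.viaFintypeEmbedding (Fin.castLEEmb h))
  have hinj : Set.InjOn e (tuples l j k r) := e.injective.injOn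
  have himg : (tuples l j k r).image e = tuples l j k r := by
    refine Finset.eq_of_subset_of_card_le (fun γ hγ => ?_) ?_
    · obtain ⟨β, hβ, rfl⟩ := Finset.mem_image.1 hγ
      exact trans_mem_tuples h r π hβ
    · rw [Finset.card_image_of_injOn hinj]
  conv_rhs => rw [← himg, Finset.sum_image hinj]
  rfl

theorem commK_comp_perm {K : 𝓢(Conf d k × Conf d k, ℂ)} (hK : IsSymKernel K)
    (B : 𝓢(Conf d j, ℂ) →L[ℂ] 𝓢(Conf d j, ℂ)) (β : Fin j ↪ Fin k) (σ : Equiv.Perm (Fin k))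
    (y y' : Conf d k) : commK B β K (y ∘ σ, y') =
      op B (β.trans σ.toEmbedding) (sliceL y' K) y +
        starRingEnd ℂ (op B β (conjW (sliceR y K)) y') := by
  have h1 : permS d σ⁻¹ (sliceL y' K) = sliceL y' K := by
    ext z
    simp [hK.1]
  have h2 : sliceR (y ∘ σ) K = sliceR y K := by
    ext z
    simp [hK.1]
  rw [commK_apply, op_perm, permS_apply, h1, h2]

/-- A single tuple need not give a symmetric kernel. A permutation of the first `ℓ` particles
permutes the tuples in the term where `B` acts on the left and leaves the other term unchanged, so
the sum is invariant. -/
theorem ptrace_commK_comp_perm (h : l ≤ k) (r : ℕ) {K : 𝓢(Conf d k × Conf d k, ℂ)}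
    (hK : IsSymKernel K) (B : 𝓢(Conf d j, ℂ) →L[ℂ] 𝓢(Conf d j, ℂ)) (π : Equiv.Perm (Fin l))
    (x x' : Conf d l) :
    ptrace d h (∑ β ∈ tuples l j k r, commK B β K) (x ∘ π, x') =
      ptrace d h (∑ β ∈ tuples l j k r, commK B β K) (x, x') := by
  rw [ptrace_apply, ptrace_apply, partialTrace, partialTrace]
  congr 1 with z
  simp only [sum_apply, glue_comp_perm h, commK_comp_perm hK]
  simp only [commK_apply, Finset.sum_add_distrib]
  congr 1
  exact sum_tuples_perm h r π fun β => op B β (sliceL (glue x' z) K) (glue x z)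

/-- The contribution to the `ℓ`-body component of a Hamiltonian vector field that comes from a
`j`-body observable, as a kernel. -/
def fieldK (N : ℕ) (h : l ≤ k) (B : 𝓢(Conf d j, ℂ) →L[ℂ] 𝓢(Conf d j, ℂ)) :
    𝓢(Conf d k × Conf d k, ℂ) →L[ℂ] 𝓢(Conf d l × Conf d l, ℂ) :=
  ∑ r ∈ Finset.Icc (rMin l j N) (min l j), (vfCst l j k r N : ℂ) •
    (ptrace d h).comp (∑ β ∈ tuples l j k r, commK B β)

theorem fieldK_apply (N : ℕ) (h : l ≤ k) (B : 𝓢(Conf d j, ℂ) →L[ℂ] 𝓢(Conf d j, ℂ))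
    (K : 𝓢(Conf d k × Conf d k, ℂ)) : fieldK N h B K =
      ∑ r ∈ Finset.Icc (rMin l j N) (min l j), (vfCst l j k r N : ℂ) •
        ptrace d h (∑ β ∈ tuples l j k r, commK B β K) := by
  simp only [fieldK, sum_apply, smul_apply, ContinuousLinearMap.comp_apply]

theorem IsHermKernel.fieldK (N : ℕ) (h : l ≤ k) {K : 𝓢(Conf d k × Conf d k, ℂ)}
    (hK : IsHermKernel K) (B : 𝓢(Conf d j, ℂ) →L[ℂ] 𝓢(Conf d j, ℂ)) :
    IsHermKernel (fieldK N h B K) := by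
  rw [fieldK_apply]
  exact .sum _ fun r _ => .smul _ (.ptrace h (.sum _ fun β _ => hK.commK B β))

theorem fieldK_comp_perm (N : ℕ) (h : l ≤ k) {K : 𝓢(Conf d k × Conf d k, ℂ)}
    (hK : IsSymKernel K) (B : 𝓢(Conf d j, ℂ) →L[ℂ] 𝓢(Conf d j, ℂ)) (π : Equiv.Perm (Fin l))
    (x x' : Conf d l) : fieldK N h B K (x ∘ π, x') = fieldK N h B K (x, x') := by
  simp only [fieldK_apply, sum_apply, smul_apply, ptrace_commK_comp_perm h _ hK]

/-- This is the duality between the coadjoint action and the bracket in a single pair of degrees: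
the constants come from `sum_commTrace`, the partial traces from `commTrace_castLE`. -/
theorem diagInt_left_fieldK {N : ℕ} (hl : 1 ≤ l) (hj : 1 ≤ j) (hlN : l ≤ N) (hjN : j ≤ N)
    (hk : min (l + j - 1) N = k) (hlk : l ≤ k) (A : Obs d l) (B : Obs d j) (C : Obs d k)
    (hC : ∀ f, (C.1 f).1 = bracketS k N (lift A.1) (lift B.1) f.1)
    (γ : SsDual d k →L[ℂ] Ss d k) :
    diagInt (Conf d l) (left (lift A.1) (fieldK N hlk (lift B.1) (kerMap d k γ))) =
      trace (C.1.comp γ) := by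
  rw [trace_bracket A B C hC, sum_commTrace hl hj hlN hjN hk hlk _ _ (isSymKernel_kerMap γ),
    fieldK_apply]
  simp only [map_sum, map_smul, smul_eq_mul]
  refine Finset.sum_congr rfl fun r _ => ?_
  congr 1
  refine Finset.sum_congr rfl fun β _ => ?_
  rw [commTrace_castLE]
  rfl

end Commutator

/-! ### The linear vector fields generated by observables -/

section Field

set_option synthInstance.maxHeartbeats 200000

variable {d N : ℕ}

theorem le_kk (l j : Idx N) : (l : ℕ) ≤ kk l j := by
  have h1 := Finset.mem_Icc.1 l.2
  have h2 := Finset.mem_Icc.1 j.2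
  simp only [kk]
  omega

/-- The kernel of the `ℓ`-body component of the vector field that is generated by `B`. -/
def fieldKernel (B : ObsH d N) (l : Idx N) (Γ : DensH d N) : 𝓢(Conf d l × Conf d l, ℂ) :=
  ∑ j : Idx N, fieldK N (le_kk l j) (lift (B j).1) (kerMap d (kk l j) (Γ (kk l j)).1)

theorem isHermKernel_fieldKernel (B : ObsH d N) (l : Idx N) (Γ : DensH d N) :
    IsHermKernel (fieldKernel B l Γ) :=
  .sum _ fun j _ => .fieldK N _ (fun x y => by
    rw [kerMap_apply, kerMap_apply]
    exact ker_hermitian _ _ _) _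

theorem isSymKernel_fieldKernel (B : ObsH d N) (l : Idx N) (Γ : DensH d N) :
    IsSymKernel (fieldKernel B l Γ) := by
  have h : ∀ (π : Equiv.Perm (Fin l)) x y,
      fieldKernel B l Γ (x ∘ π, y) = fieldKernel B l Γ (x, y) := fun π x y => by
    simp only [fieldKernel, sum_apply, fieldK_comp_perm N _ (isSymKernel_kerMap _)]
  refine ⟨h, fun π x y => ?_⟩
  -- Hermitian symmetry transports the permutation invariance from the first group of variables to
  -- the second.
  rw [isHermKernel_fieldKernel, h, ← isHermKernel_fieldKernel]

/-- The vector field that is generated by `B`. -/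
def field (B : ObsH d N) (Γ : DensH d N) : DensH d N := fun l =>
  ⟨opMap d l (fieldKernel B l Γ),
    opMap_mem_dens (isSymKernel_fieldKernel B l Γ) (isHermKernel_fieldKernel B l Γ)⟩

theorem continuous_field (B : ObsH d N) : Continuous (field B) := by
  refine continuous_pi fun l => Continuous.subtype_mk ((opMap d l).continuous.comp ?_) _
  exact continuous_finsetSum _ fun j _ => (fieldK N (le_kk l j) (lift (B j).1)).continuous.comp
    ((kerMap d (kk l j)).continuous.comp (continuous_subtype_val.comp (continuous_apply _)))

theorem ker_field (B : ObsH d N) (Γ : DensH d N) (l : Idx N) (x x' : Conf d l) :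
    ker (field B Γ l).1 x x' = fieldKernel B l Γ (x, x') :=
  ker_opMap (isSymKernel_fieldKernel B l Γ) x x'

theorem kerMap_field (B : ObsH d N) (Γ : DensH d N) (l : Idx N) :
    kerMap d l (field B Γ l).1 = fieldKernel B l Γ := by
  ext p
  rw [kerMap_apply, ker_field]

/-- This is the coadjoint identity for hierarchies, the input from which the Hamiltonian fields are
built. Both sides are sums over pairs `ℓ, j` whose terms agree by `diagInt_left_fieldK`. -/
theorem pairing_field (A B : ObsH d N) (Γ : DensH d N) :
    pairing d N A (field B Γ) = pairing d N (hierBracketL d N A B) Γ := by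
  have h : hierTrace A (field B Γ) = hierTrace (hierBracket A B) Γ := by
    rw [hierTrace_hierBracket, hierTrace]
    refine Finset.sum_congr rfl fun l _ => ?_
    have hl := Finset.mem_Icc.1 l.2
    rw [trace_comp, kerMap_field, fieldKernel, map_sum, map_sum]
    refine Finset.sum_congr rfl fun j _ => ?_
    have hj := Finset.mem_Icc.1 j.2
    exact diagInt_left_fieldK hl.1 hj.1 hl.2 hj.2 rfl _ (A l) (B j) _
      (compBracket_apply l j (A l) (B j)) _
  have h2 := pairing_apply A (field B Γ)
  rw [h, ← hierBracketL_apply, ← pairing_apply] at h2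
  exact_mod_cast h2

theorem commKer_integrable (B : ObsH d N) (Γ : DensH d N) (l j : Idx N)
    (β : Fin j ↪ Fin (kk l j)) (x x' : Conf d l) :
    Integrable fun z : Conf d (kk l j - l) =>
      commKer (B j).1 β (Γ (kk l j)).1 (glue x z) (glue x' z) := by
  simp only [commKer_eq]
  exact integrable_glue_kernel (le_kk l j) _ x x'

theorem ker_field_eq_vfKer (H : DensH d N → ℝ) (Γ : DensH d N) (l : Idx N) (x x' : Conf d l) :
    ker (field (grad H Γ) Γ l).1 x x' = vfKer H Γ l x x' := by
  rw [ker_field, fieldKernel, vfKer, sum_apply]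
  refine Finset.sum_congr rfl fun j _ => ?_
  rw [fieldK_apply, sum_apply]
  refine Finset.sum_congr rfl fun r _ => ?_
  simp only [smul_apply, smul_eq_mul, ptrace_apply, commKer_eq, sum_apply]

theorem eq_of_pairing {v w : DensH d N} (h : ∀ A, pairing d N A v = pairing d N A w) : v = w :=
  sub_eq_zero.1 (eq_zero_of_pairing _ fun A => by rw [map_sub, h, sub_self])

/-- `field B` as a continuous linear map. -/
def fieldL (B : ObsH d N) : DensH d N →L[ℝ] DensH d N where
  toFun := field B
  -- Linearity in `Γ` is inherited from the linear functional on the other side of the duality,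
  -- because the pairing is nondegenerate.
  map_add' Γ Γ' := eq_of_pairing fun A => by
    rw [map_add, pairing_field, pairing_field, pairing_field, map_add]
  map_smul' c Γ := eq_of_pairing fun A => by
    rw [RingHom.id_apply, map_smul, pairing_field, pairing_field, map_smul]
  cont := continuous_field B

end Field

/-! ### From linear Hamiltonian fields to a weak Poisson structure -/

section HamiltonianFields

variable {M G : Type*} [AddCommGroup M] [Module ℝ M] [TopologicalSpace M]
  [AddCommGroup G] [Module ℝ G] {Λ : G →ₗ[ℝ] M →L[ℝ] ℝ} {b : G →ₗ[ℝ] G →ₗ[ℝ] G}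
  {gr : (M → ℝ) → M → G} {X : G → M →L[ℝ] M}

/-- Linear Hamiltonian vector fields of the generators yield the Hamiltonian vector fields of all
functions of the algebra. -/
theorem isHamiltonianVF_of_linear [IsTopologicalAddGroup M] [ContinuousSMul ℝ M]
    (hΛ : Function.Injective Λ) (hgr : ∀ F ∈ linAlg Λ, HasGrad Λ F (gr F))
    (hsep : ∀ v, (∀ A, Λ A v = 0) → v = 0) (hX : ∀ A B m, Λ A (X B m) = Λ (b A B) m)
    {H : M → ℝ} (hH : H ∈ linAlg Λ) :
    IsHamiltonianVF (linAlg Λ) (lieBr Λ b gr) H fun m => X (gr H m) m := by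
  refine ⟨?_, fun F hF m => ?_⟩
  · obtain ⟨g, hg, ι, _, P, A, hP, hA⟩ := exists_hasGrad hH
    -- The gradient is expanded in fixed elements of `G` with coefficients in the algebra, so the
    -- field is a sum of smooth functions times continuous linear fields. `X` is not assumed linear
    -- in its index; the pairing makes up for this.
    have h : (fun m => X (gr H m) m) = fun m => ∑ i, P i m • X (A i) m := by
      funext m
      refine sub_eq_zero.1 (hsep _ fun B => ?_)
      rw [(hgr H hH).unique hΛ hg, hA, map_sub, hX, map_sum, map_sum, map_sum, sum_apply,
        sub_eq_zero]
      refine Finset.sum_congr rfl fun i _ => ?_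
      rw [map_smul, map_smul, map_smul, smul_apply, hX]
    rw [h]
    exact GateauxSmooth.sum _ fun i _ =>
      (gateauxSmooth_of_mem_linAlg (hP i)).smul (gateauxSmooth_clm _)
  · have := hgr F hF m (X (gr H m) m)
    rwa [hX] at this

/-- The linear functionals in the algebra already determine the value of the field at each point. -/
theorem IsHamiltonianVF.unique (hsep : ∀ v, (∀ A, Λ A v = 0) → v = 0)
    {br : (M → ℝ) → (M → ℝ) → M → ℝ} {H : M → ℝ} {Y Z : M → M}
    (hY : IsHamiltonianVF (linAlg Λ) br H Y) (hZ : IsHamiltonianVF (linAlg Λ) br H Z) : Y = Z := by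
  funext m
  refine sub_eq_zero.1 (hsep _ fun A => ?_)
  have h1 := (hasGateauxDeriv_clm (Λ A) m (Y m)).unique (hY.2 _ (mem_linAlg A) m)
  have h2 := (hasGateauxDeriv_clm (Λ A) m (Z m)).unique (hZ.2 _ (mem_linAlg A) m)
  rw [map_sub, h1, h2, sub_self]

theorem isWeakPoisson_lieBr [IsTopologicalAddGroup M] [ContinuousSMul ℝ M]
    [LocallyConvexSpace ℝ M] [T2Space M]
    (hΛ : Function.Injective Λ) (hgr : ∀ F ∈ linAlg Λ, HasGrad Λ F (gr F))
    (hsep : ∀ v, (∀ A, Λ A v = 0) → v = 0) (hX : ∀ A B m, Λ A (X B m) = Λ (b A B) m)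
    (hb : ∀ A, b A A = 0) (hJ : ∀ A B C, b A (b B C) + b B (b C A) + b C (b A B) = 0) :
    IsWeakPoisson (linAlg Λ) (lieBr Λ b gr) := by
  have h := isBiderivation_lieBr hΛ hgr hb
  refine ⟨fun F hF => gateauxSmooth_of_mem_linAlg hF, h.closed, h.add_left,
    fun c F hF F' hF' => lieBr_smul_left hΛ hgr c hF hF', h.add_right, h.smul_right, h.alternating,
    fun F hF F' hF' F'' hF'' => jacobi_lieBr hΛ hgr hb hJ hF hF' hF'', h.leibniz,
    fun m v hv => hsep v fun A => ?_, fun H hH => ⟨_, isHamiltonianVF_of_linear hΛ hgr hsep hX hH⟩⟩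
  exact (hasGateauxDeriv_clm (Λ A) m v).unique (hv _ (mem_linAlg A))

end HamiltonianFields

/-! ### The weak Poisson structure on density matrix hierarchies -/

section NBodyPoisson

set_option synthInstance.maxHeartbeats 200000

variable {d N : ℕ}

theorem wellDefined (d N : ℕ) : WellDefined d N where
  trace_integrable _ ρ := integrable_ker_diag ρ
  emb_exists _ A := ⟨_, isEmb_emb N A⟩
  emb_injective := emb_injective_idx
  filtration l j k h A B := by
    obtain rfl : kk l j = k := Subtype.ext h
    exact ⟨_, emb_compBracket l j A B⟩
  trace_functional A := ⟨pairing d N A, by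
    rw [functionals_eq_linAlg]
    exact mem_linAlg A, pairing_apply A⟩
  grad_exists _ hF Γ := existsUnique_isGrad hF Γ

theorem isHamiltonianVF_field {H : DensH d N → ℝ} (hH : H ∈ functionals d N) :
    IsHamiltonianVF (functionals d N) poisson H fun Γ => field (grad H Γ) Γ := by
  rw [functionals_eq_linAlg] at hH ⊢
  exact isHamiltonianVF_of_linear (X := fieldL) (b := hierBracketL d N) (pairing_injective d N)
    (fun F hF => hasGrad_grad hF) eq_zero_of_pairing pairing_field hH

theorem isWeakPoisson_poisson (d N : ℕ) :
    IsWeakPoisson (functionals d N) (poisson (d := d) (N := N)) := by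
  have h := isWeakPoisson_lieBr (Λ := pairing d N) (gr := grad) (X := fieldL)
    (b := hierBracketL d N) (pairing_injective d N) (fun F hF => hasGrad_grad hF)
    eq_zero_of_pairing pairing_field hierBracketL_self hierBracketL_jacobi
  rw [← functionals_eq_linAlg] at h
  exact h

theorem eq_field_of_isHamiltonianVF {H : DensH d N → ℝ} (hH : H ∈ functionals d N)
    {Y : DensH d N → DensH d N} (hY : IsHamiltonianVF (functionals d N) poisson H Y) :
    Y = fun Γ => field (grad H Γ) Γ := by
  have h := isHamiltonianVF_field hH
  rw [functionals_eq_linAlg] at h hY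
  exact hY.unique eq_zero_of_pairing h

end NBodyPoisson

end NBody

end

theorem proposition2p2 (d N : ℕ) (hd : 1 ≤ d) (hN : 1 ≤ N) :
    NBody.WellDefined d N ∧
    NBody.IsWeakPoisson (NBody.functionals d N) (NBody.poisson (d := d) (N := N)) ∧
    ∀ H ∈ NBody.functionals d N, ∃ X : NBody.DensH d N → NBody.DensH d N,
      NBody.IsHamiltonianVF (NBody.functionals d N) NBody.poisson H X ∧
      (∀ Y, NBody.IsHamiltonianVF (NBody.functionals d N) NBody.poisson H Y → Y = X) ∧
      (∀ (Γ : NBody.DensH d N) (l j : NBody.Idx N) (r : ℕ),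
        ∀ β ∈ NBody.tuples l j (NBody.kk l j) r, ∀ x x' : NBody.Conf d l,
          MeasureTheory.Integrable fun z : NBody.Conf d (NBody.kk l j - l) =>
            NBody.commKer (NBody.grad H Γ j).1 β (Γ (NBody.kk l j)).1
              (NBody.glue x z) (NBody.glue x' z)) ∧
      ∀ (Γ : NBody.DensH d N) (l : NBody.Idx N) (x x' : NBody.Conf d l),
        NBody.ker (X Γ l).1 x x' = NBody.vfKer H Γ l x x' := by
  exact ⟨NBody.wellDefined d N, NBody.isWeakPoisson_poisson d N, fun H hH =>
    ⟨_, NBody.isHamiltonianVF_field hH, fun Y hY => NBody.eq_field_of_isHamiltonianVF hH hY,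
      fun Γ l j r β _ x x' => NBody.commKer_integrable _ Γ l j β x x',
      NBody.ker_field_eq_vfKer H⟩⟩
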